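/- Let $n\ge 3$ and let $M=G/K$ be one of the compact homogeneous spaces $$SU(nk)/S(U(k)^n)\ (k\ge 1),\qquad Sp(nk)/Sp(k)^n\ (k\ge 1),\qquad SO(nk)/S(O(k)^n)\ (k\ge 3),$$ where $K$ is the group of all block diagonal elements of $G$ ($n$ diagonal blocks of size $k$). Let $\mathfrak g=\mathfrak k\oplus\mathfrak p$ be the orthogonal decomposition for the Killing form $B$ of $\mathfrak g$, and let $g_B$ be the standard metric, i.e. the $G$-invariant Riemannian metric on $M$ given by $-B|_{\mathfrak p}$ at the base point. Definitions. Let $\mathcal M^G_1$ be the manifold of the $G$-invariant Riemannian metrics on $M$ of the same volume as $g_B$, and $\mathrm{Sc}:\mathcal M_1^G\to\mathbb R$ the scalar curvature. For a $G$-invariant Einstein metric $g\in\mathcal M_1^G$ (a critical point of $\mathrm{Sc}$), $\mathrm{Aut}(G/K)$ is the group of Lie group automorphisms of $G$ taking $K$ onto $K$, acting on $G$-invariant metrics by pullback; $W_g$ is the space of the $G$-invariant symmetric 2-tensors on $M$ that are $g$-orthogonal to $g$ and to the tangent space at $g$ of the orbit $\mathrm{Aut}(G/K)\cdot g$; and $\mathrm{Sc}''_g$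 is the Hessian of $\mathrm{Sc}|_{\mathcal M_1^G}$ at $g$, restricted to $W_g$. The metric $g$ is $G$-unstable if $\mathrm{Sc}''_g(T,T)>0$ for some $T\in W_g$; its coindex is the maximal dimension of a subspace of $W_g$ on which $\mathrm{Sc}''_g$ is positive definite; it is $G$-non-degenerate if $\mathrm{Sc}''_g$ is non-degenerate on $W_g$, and otherwise $G$-degenerate; it is $G$-rigid if every $G$-invariant Einstein metric sufficiently close to $g$ belongs to $\mathrm{Aut}(G/K)\cdot g$ up to scaling. A Riemannian metric $g$ on $M$ is Ricci flow dynamically unstable if there is a non-constant solution $(g_t)_{t\in(-\infty,0]}$ of the volume-normalized Ricci flow on $M$ that converges to $g$ modulo diffeomorphisms in the $C^\infty$ topology as $t\to-\infty$. Statement. The metric $g_B$ is Einstein, $G$-unstable and Ricci flow dynamically unstable. As a critical point of $\mathrm{Sc}:\mathcal M_1^G\to\mathbb R$ it has the following type and coindex: - $SU(nk)/S(U(k)^n)$: $n=3$: local minimum, coindex $2$; $n=4$: $G$-degenerate, coindex $3$; $n\ge5$: saddle point, coindex $n-1$. - $Sp(nk)/Sp(k)^n$: $n=3$: local minimum, coindex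 $2$; $n=4$: local minimum, coindex $5$; $(n,k)=(5,1)$: local minimum, coindex $9$; $(n,k)=(5,2)$: $G$-degenerate, coindex $4$; $(n,k)=(6,1)$: $G$-degenerate, coindex $5$; all other $(n,k)$ with $n\ge5$: saddle point, coindex $n-1$. - $SO(nk)/S(O(k)^n)$, $k\ge3$: $n=3$: local minimum, coindex $2$; $n\ge4$: saddle point, coindex $n-1$. Here a saddle point is a critical point that is neither a local minimum nor a local maximum. The metric $g_B$ is $G$-non-degenerate, and hence $G$-rigid, in all cases except $SU(4k)/S(U(k)^4)$ ($k\ge1$), $Sp(10)/Sp(2)^5$ and $Sp(6)/Sp(1)^6$, where it is $G$-degenerate. -/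

import Mathlib

open scoped ContDiff Topology

noncomputable section

namespace BlockSpace

/-! ### Riemannian geometry in a chart

A metric on (an open piece of) a finite-dimensional vector space `E` is a function
`γ : E → E → E → ℝ`, where `γ x v w` is the inner product of `v` and `w` at the point `x`.
Its curvature is given by the classical index formulas in a basis of `E`. -/

section Chart

variable {E : Type*} [AddCommGroup E] [Module ℝ E] {d : ℕ}

/-- The partial derivative of `f` in the direction of the `i`-th basis vector. -/
def pd (b : Module.Basis (Fin d) ℝ E) (i : Fin d) (f : E → ℝ) (x : E) : ℝ :=
  deriv (fun t : ℝ => f (x + t • b i)) 0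

/-- The matrix `γ_{ij}` of the metric at the point `x`. -/
def gram (γ : E → E → E → ℝ) (b : Module.Basis (Fin d) ℝ E) (x : E) : Matrix (Fin d) (Fin d) ℝ :=
  Matrix.of fun i j => γ x (b i) (b j)

/-- The Christoffel symbols `Γ^l_{ij}` of the Levi-Civita connection. -/
def christoffel (γ : E → E → E → ℝ) (b : Module.Basis (Fin d) ℝ E) (l i j : Fin d) (x : E) : ℝ :=
  (1 / 2) * ∑ m, (gram γ b x)⁻¹ l m *
    (pd b i (fun y => gram γ b y j m) x + pd b j (fun y => gram γ b y i m) x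
      - pd b m (fun y => gram γ b y i j) x)

/-- The components `R_{ij} = ∂_l Γ^l_{ij} - ∂_j Γ^l_{il} + Γ^l_{lm} Γ^m_{ij} - Γ^l_{jm} Γ^m_{il}`
of the Ricci tensor. -/
def ricciCoord (γ : E → E → E → ℝ) (b : Module.Basis (Fin d) ℝ E) (x : E) (i j : Fin d) : ℝ :=
  (∑ l, (pd b l (christoffel γ b l i j) x - pd b j (christoffel γ b l i l) x)) +
    ∑ l, ∑ m, (christoffel γ b l l m x * christoffel γ b m i j x
      - christoffel γ b l j m x * christoffel γ b m i l x)

end Chart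

/-! ### The block decomposition -/

/-- Square matrices of size `n k` with entries in `𝕜`, divided into `n × n` blocks of size `k`:
the row or column `(i, a)` is the `a`-th one of the `i`-th block. -/
abbrev Mat (𝕜 : Type*) (n k : ℕ) : Type _ := Matrix (Fin n × Fin k) (Fin n × Fin k) 𝕜

attribute [local instance] LieRing.ofAssociativeRing

instance : StarModule ℝ (Quaternion ℝ) := ⟨fun r a => by simp [Quaternion.star_smul]⟩

variable {𝕜 : Type*} [NormedDivisionRing 𝕜] [NormedAlgebra ℝ 𝕜] [FiniteDimensional ℝ 𝕜]
  [StarRing 𝕜] [StarModule ℝ 𝕜] {n k : ℕ}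

/-- `X` is block diagonal. -/
def IsBlockDiag (X : Mat 𝕜 n k) : Prop :=
  ∀ p q, p.1 ≠ q.1 → X p q = 0

variable (𝕜 n k) in
/-- The space `𝔭 = 𝔭₁₂ ⊕ ⋯ ⊕ 𝔭₍ₙ₋₁₎ₙ` of the skew-Hermitian matrices (skew-symmetric ones for
`𝕜 = ℝ`) whose diagonal blocks vanish. -/
def offDiag : Submodule ℝ (Mat 𝕜 n k) where
  carrier := {X | star X = -X ∧ ∀ i a b, X (i, a) (i, b) = 0}
  add_mem' := by
    rintro X Y ⟨hX, hX'⟩ ⟨hY, hY'⟩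
    exact ⟨by rw [star_add, hX, hY]; abel, fun i a b => by simp [hX', hY']⟩
  zero_mem' := by simp
  smul_mem' := by
    rintro c X ⟨hX, hX'⟩
    exact ⟨by rw [star_smul, hX]; simp, fun i a b => by simp [hX']⟩

/-- The off-diagonal part of the skew-Hermitian part of a matrix. On a Lie algebra `𝔤 = 𝔨 ⊕ 𝔭` of
skew-Hermitian matrices (`𝔨` the block diagonal ones) it is the projection onto `𝔭` along `𝔨`. -/
def projP : Mat 𝕜 n k →ₗ[ℝ] offDiag 𝕜 n k where
  toFun X := ⟨Matrix.of fun p q => if p.1 = q.1 then 0 else (1 / 2 : ℝ) • (X p q - star (X q p)), by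
    refine ⟨?_, fun i a b => by simp⟩
    ext p q
    by_cases h : p.1 = q.1
    · simp [Matrix.star_apply, h]
    · have h' : ¬ q.1 = p.1 := fun e => h e.symm
      simp only [Matrix.star_apply, Matrix.of_apply, h, h', if_false, Matrix.neg_apply, star_smul,
        star_sub, star_star, star_trivial]
      rw [← smul_neg, neg_sub]⟩
  map_add' X Y := by
    ext p q
    by_cases h : p.1 = q.1
    · simp [h]
    · simp only [Matrix.of_apply, h, if_false, Submodule.coe_add, Matrix.add_apply, star_add,
        ← smul_add]
      congr 1
      abel
  map_smul' c X := by
    ext p q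
    by_cases h : p.1 = q.1
    · simp [h]
    · simp only [Matrix.of_apply, h, if_false, Submodule.coe_smul, Matrix.smul_apply, star_smul,
        star_trivial, RingHom.id_apply, ← smul_sub]
      rw [smul_comm]

/-- A group `G` of matrices together with its Lie algebra `𝔤`. With `K` the group of block diagonal
elements of `G`, it presents the homogeneous space `M = G / K`. -/
structure Space (𝕜 : Type*) [NormedDivisionRing 𝕜] [NormedAlgebra ℝ 𝕜] [StarRing 𝕜]
    [StarModule ℝ 𝕜] (n k : ℕ) where
  /-- the group `G`, in the cases below a group of unitary matrices -/
  G : Submonoid (Mat 𝕜 n k)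
  /-- the Lie algebra of `G` -/
  lie : LieSubalgebra ℝ (Mat 𝕜 n k)
  offDiag_le : offDiag 𝕜 n k ≤ lie.toSubmodule

variable (𝕜 n k) in
/-- The Lie algebra of all skew-Hermitian matrices. -/
def skewLie : LieSubalgebra ℝ (Mat 𝕜 n k) where
  carrier := {X | star X = -X}
  add_mem' := by
    intro X Y hX hY
    simp only [Set.mem_ofPred_eq] at *
    rw [star_add, hX, hY]; abel
  zero_mem' := by simp
  smul_mem' := by
    intro c X hX
    simp only [Set.mem_ofPred_eq] at *
    rw [star_smul, hX]; simp
  lie_mem' := by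
    intro X Y hX hY
    simp only [Set.mem_ofPred_eq, LieRing.of_associative_ring_bracket] at *
    change star (X * Y - Y * X) = _
    rw [star_sub, star_mul, star_mul, hX, hY]
    noncomm_ring

variable (n k) in
/-- The Lie algebra `𝔰𝔲(nk)`. -/
def suLie : LieSubalgebra ℝ (Mat ℂ n k) where
  carrier := {X | star X = -X ∧ X.trace = 0}
  add_mem' := by
    rintro X Y ⟨hX, hX'⟩ ⟨hY, hY'⟩
    exact ⟨(skewLie ℂ n k).add_mem hX hY, by simp [hX', hY']⟩
  zero_mem' := by simp
  smul_mem' := by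
    rintro c X ⟨hX, hX'⟩
    exact ⟨(skewLie ℂ n k).smul_mem c hX, by simp [hX']⟩
  lie_mem' := by
    rintro X Y ⟨hX, hX'⟩ ⟨hY, hY'⟩
    refine ⟨(skewLie ℂ n k).lie_mem hX hY, ?_⟩
    change (X * Y - Y * X).trace = 0
    rw [Matrix.trace_sub, Matrix.trace_mul_comm, sub_self]

variable (n k) in
/-- `SU(nk) / S(U(k) × ⋯ × U(k))`. -/
def suSpace : Space ℂ n k where
  G := Matrix.specialUnitaryGroup (Fin n × Fin k) ℂ
  lie := suLie n k
  offDiag_le := fun X hX => ⟨hX.1, by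
    simp only [Matrix.trace, Matrix.diag]
    exact Finset.sum_eq_zero fun p _ => hX.2 p.1 p.2 p.2⟩

variable (n k) in
/-- `Sp(nk) / Sp(k) × ⋯ × Sp(k)`, where `Sp(N)` is the group of unitary quaternionic matrices. -/
def spSpace : Space (Quaternion ℝ) n k where
  G := unitary (Mat (Quaternion ℝ) n k)
  lie := skewLie (Quaternion ℝ) n k
  offDiag_le := fun _ hX => hX.1

variable (n k) in
/-- `SO(nk) / S(O(k) × ⋯ × O(k))`. -/
def soSpace : Space ℝ n k where
  G := Matrix.specialOrthogonalGroup (Fin n × Fin k) ℝ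
  lie := skewLie ℝ n k
  offDiag_le := fun _ hX => hX.1

/-! ### Riemannian metrics on `M = G / K` and their curvature

The tangent bundle of `M` is `G ×_K 𝔭`: the element `v` of `𝔭` at the point `a` of `G` represents
the velocity of the curve `t ↦ a exp(t v) K` of `M`, and `v` at `a c` (`c ∈ K`) represents the same
tangent vector as `Ad(c) v` at `a`. A field of bilinear forms on `M` is therefore a function from
`G` to the bilinear forms on `𝔭` that is equivariant under `K`. Such functions are written as
functions of a matrix, of which only the values on `G` play a role. The `G`-invariant fields are
the constant ones. -/

variable (𝕜 n k) in
/-- Bilinear forms on `𝔭`, the tangent space of `M` at the base point `o = K`. -/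
abbrev Form : Type _ := LinearMap.BilinForm ℝ (offDiag 𝕜 n k)

variable (𝕜 n k) in
/-- Fields of bilinear forms on `M`. -/
abbrev Field : Type _ := Mat 𝕜 n k → Form 𝕜 n k

variable (𝕜 n k) in
/-- The dimension of `M`. -/
def dimM : ℕ := Module.finrank ℝ (offDiag 𝕜 n k)

variable (𝕜 n k) in
/-- A basis of `𝔭`. The notions defined through it do not depend on its choice. -/
def basisP : Module.Basis (Fin (dimM 𝕜 n k)) ℝ (offDiag 𝕜 n k) :=
  Module.finBasis ℝ (offDiag 𝕜 n k)

/-- The Gram matrix of a bilinear form. -/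
def formMatrix (T : Form 𝕜 n k) : Matrix (Fin (dimM 𝕜 n k)) (Fin (dimM 𝕜 n k)) ℝ :=
  LinearMap.BilinForm.toMatrix (basisP 𝕜 n k) T

/-- The matrix of the operator `A` with `T = g(A ·, ·)`. -/
def opMatrix (g T : Form 𝕜 n k) : Matrix (Fin (dimM 𝕜 n k)) (Fin (dimM 𝕜 n k)) ℝ :=
  (formMatrix g)⁻¹ * formMatrix T

/-- `⟨T, S⟩_g = tr(A B)`, where `T = g(A ·, ·)` and `S = g(B ·, ·)`. -/
def innerForm (g T S : Form 𝕜 n k) : ℝ := (opMatrix g T * opMatrix g S).trace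

/-- The trace of `T` with respect to `g`. -/
def traceForm (g T : Form 𝕜 n k) : ℝ := (opMatrix g T).trace

/-- The determinant of `T` with respect to `g`. -/
def detForm (g T : Form 𝕜 n k) : ℝ := (opMatrix g T).det

/-- `Ad(a)` on `𝔭`, for a unitary block diagonal matrix `a`. -/
def Ad (a : Mat 𝕜 n k) (v : offDiag 𝕜 n k) : offDiag 𝕜 n k :=
  projP (a * (v : Mat 𝕜 n k) * star a)

/-- `exp(-X) · D exp_X (v)`: the velocity of the curve `t ↦ exp(X + t v)` at `t = 0`, translated
back to the identity matrix. -/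
def dexp (X v : Mat 𝕜 n k) : Mat 𝕜 n k :=
  NormedSpace.exp (-X) * deriv (fun t : ℝ => NormedSpace.exp (X + t • v)) 0

/-- The metric `g` of `M` in the chart `X ↦ a exp(X) K` from a neighbourhood of `0` in `𝔭` to a
neighbourhood of `a K` in `M`. -/
def chartMetric (g : Field 𝕜 n k) (a : Mat 𝕜 n k) (X v w : offDiag 𝕜 n k) : ℝ :=
  g (a * NormedSpace.exp (X : Mat 𝕜 n k)) (projP (dexp (X : Mat 𝕜 n k) v))
    (projP (dexp (X : Mat 𝕜 n k) w))

/-- The Ricci tensor of the metric `g` at the point `a K`. -/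
def ricciAt (g : Field 𝕜 n k) (a : Mat 𝕜 n k) : Form 𝕜 n k :=
  Matrix.toBilin (basisP 𝕜 n k)
    (Matrix.of (ricciCoord (chartMetric g a) (basisP 𝕜 n k) 0))

/-- The scalar curvature of the metric `g` at the point `a K`. -/
def scalAt (g : Field 𝕜 n k) (a : Mat 𝕜 n k) : ℝ := traceForm (g a) (ricciAt g a)

/-- A function on `G` is smooth: it is so in the coordinates `s ↦ a exp(s₁ X₁ + ⋯ + s_r X_r)`. -/
def IsSmoothOn {F : Type*} [NormedAddCommGroup F] [NormedSpace ℝ F] (H : Space 𝕜 n k)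
    (f : Mat 𝕜 n k → F) : Prop :=
  ∀ a ∈ H.G, ∀ (r : ℕ) (X : Fin r → Mat 𝕜 n k), (∀ i, X i ∈ H.lie) →
    ContDiff ℝ ∞ fun s : Fin r → ℝ => f (a * NormedSpace.exp (∑ i, s i • X i))

/-- `g` is a smooth Riemannian metric on `M`. -/
structure IsMetric (H : Space 𝕜 n k) (g : Field 𝕜 n k) : Prop where
  symm : ∀ a ∈ H.G, ∀ v w, g a v w = g a w v
  pos : ∀ a ∈ H.G, ∀ v, v ≠ 0 → 0 < g a v v
  equivariant : ∀ a ∈ H.G, ∀ c ∈ H.G, IsBlockDiag c → ∀ v w, g (a * c) v w = g a (Ad c v) (Ad c w)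
  smooth : ∀ v w, IsSmoothOn H fun a => g a v w

/-! ### `G`-invariant metrics, the scalar curvature functional and its second variation -/

/-- `T` is a `G`-invariant symmetric 2-tensor, given by its value at the base point. -/
structure IsInvTensor (H : Space 𝕜 n k) (T : Form 𝕜 n k) : Prop where
  symm : ∀ v w, T v w = T w v
  inv : ∀ c ∈ H.G, IsBlockDiag c → ∀ v w, T (Ad c v) (Ad c w) = T v w

/-- `g` is a `G`-invariant Riemannian metric, given by its value at the base point. -/
structure IsInvMetric (H : Space 𝕜 n k) (g : Form 𝕜 n k) : Prop extends IsInvTensor H g where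
  pos : ∀ v, v ≠ 0 → 0 < g v v

/-- The Ricci tensor, at the base point, of the `G`-invariant metric with value `g` there. -/
def ricci (g : Form 𝕜 n k) : Form 𝕜 n k := ricciAt (fun _ => g) 1

/-- The (constant) scalar curvature of the `G`-invariant metric with value `g` at the base point. -/
def scal (g : Form 𝕜 n k) : ℝ := scalAt (fun _ => g) 1

/-- The `G`-invariant metric `g` is Einstein. -/
def IsEinstein (g : Form 𝕜 n k) : Prop := ∃ ρ : ℝ, ricci g = ρ • g

/-- The standard metric, whose value at the base point is minus the Killing form of `𝔤` on `𝔭`. -/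
def stdMetric (H : Space 𝕜 n k) : Form 𝕜 n k :=
  -((killingForm ℝ H.lie).compl₁₂ (Submodule.inclusion H.offDiag_le)
    (Submodule.inclusion H.offDiag_le))

/-- The `G`-invariant metrics of the same volume as `g`. -/
def unitVolume (H : Space 𝕜 n k) (g : Form 𝕜 n k) : Set (Form 𝕜 n k) :=
  {g' | IsInvMetric H g' ∧ detForm g g' = 1}

/-- `g'` rescaled to the volume of `g`. -/
def rescale (g g' : Form 𝕜 n k) : Form 𝕜 n k :=
  (detForm g g') ^ (-(1 / (dimM 𝕜 n k : ℝ))) • g'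

/-- The Hessian at its critical point `g` of the restriction of `scal` to the manifold of the
`G`-invariant metrics of the same volume as `g`, evaluated at trace-free tensors `T` and `S`. (The
surface `(s, t) ↦ rescale g (g + s T + t S)` lies in that manifold; it passes through `g` with the
velocities `T` and `S`.) -/
def hess (g T S : Form 𝕜 n k) : ℝ :=
  deriv (fun s : ℝ => deriv (fun t : ℝ => scal (rescale g (g + s • T + t • S))) 0) 0

/-- `φ` restricts to an element of `Aut(G/K)`, a smooth automorphism of `G` that takes `K` onto
`K`. -/
structure IsAut (H : Space 𝕜 n k) (φ : Mat 𝕜 n k → Mat 𝕜 n k) : Prop where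
  bij : Set.BijOn φ H.G H.G
  mul : ∀ a ∈ H.G, ∀ b ∈ H.G, φ (a * b) = φ a * φ b
  smooth : ∀ p q, IsSmoothOn H fun a => φ a p q
  isotropy : ∀ a ∈ H.G, IsBlockDiag (φ a) ↔ IsBlockDiag a

/-- The map of the tangent space of `M` at the base point that is induced by `φ ∈ Aut(G/K)`. -/
def autDiff (φ : Mat 𝕜 n k → Mat 𝕜 n k) (v : offDiag 𝕜 n k) : offDiag 𝕜 n k :=
  projP (deriv (fun t : ℝ => φ (NormedSpace.exp (t • (v : Mat 𝕜 n k)))) 0)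

/-- The orbit `Aut(G/K) · g`. -/
def autOrbit (H : Space 𝕜 n k) (g : Form 𝕜 n k) : Set (Form 𝕜 n k) :=
  {g' | ∃ φ, IsAut H φ ∧ ∀ v w, g' v w = g (autDiff φ v) (autDiff φ w)}

/-- The trivial variations of `g`: the tangent space at `g` of the orbit `Aut(G/K) · g`. -/
def trivialVariations (H : Space 𝕜 n k) (g : Form 𝕜 n k) : Submodule ℝ (Form 𝕜 n k) :=
  Submodule.span ℝ {T | ∃ γ : ℝ → Form 𝕜 n k, (∀ t, γ t ∈ autOrbit H g) ∧ γ 0 = g ∧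
    ∀ v w, ContDiff ℝ ∞ (fun t => γ t v w) ∧ T v w = deriv (fun t => γ t v w) 0}

/-- The space `W_g` of the `G`-invariant symmetric 2-tensors that are orthogonal to `g` and to the
trivial variations (which is the space of `G`-invariant TT-tensors, `G` being compact). -/
def W (H : Space 𝕜 n k) (g : Form 𝕜 n k) : Set (Form 𝕜 n k) :=
  {T | IsInvTensor H T ∧ innerForm g T g = 0 ∧ ∀ S ∈ trivialVariations H g, innerForm g T S = 0}

/-- The Einstein metric `g` is `G`-unstable. -/
def IsGUnstable (H : Space 𝕜 n k) (g : Form 𝕜 n k) : Prop :=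
  ∃ T ∈ W H g, 0 < hess g T T

/-- The Einstein metric `g` is `G`-non-degenerate. -/
def IsGNondegenerate (H : Space 𝕜 n k) (g : Form 𝕜 n k) : Prop :=
  ∀ T ∈ W H g, (∀ S ∈ W H g, hess g T S = 0) → T = 0

/-- The coindex of the Einstein metric `g` is `c`: this is the maximal dimension of a subspace of
`W_g` on which the second variation is positive definite. -/
def HasCoindex (H : Space 𝕜 n k) (g : Form 𝕜 n k) (c : ℕ) : Prop :=
  IsGreatest {d : ℕ | ∃ V : Submodule ℝ (Form 𝕜 n k), (V : Set (Form 𝕜 n k)) ⊆ W H g ∧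
    Module.finrank ℝ V = d ∧ ∀ T ∈ V, T ≠ 0 → 0 < hess g T T} c

/-- `(1 - ε) g ≤ g' ≤ (1 + ε) g`. For `ε > 0` these sets form a basis of neighbourhoods of `g`. -/
def Near (g : Form 𝕜 n k) (ε : ℝ) (g' : Form 𝕜 n k) : Prop :=
  ∀ v, |g' v v - g v v| ≤ ε * g v v

/-- `g` is a critical point of `scal` among the `G`-invariant metrics of the same volume. -/
def IsCritical (H : Space 𝕜 n k) (g : Form 𝕜 n k) : Prop :=
  ∀ T, IsInvTensor H T → traceForm g T = 0 →
    HasDerivAt (fun t : ℝ => scal (rescale g (g + t • T))) 0 0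

/-- `g` is a local minimum of `scal` among the `G`-invariant metrics of the same volume. -/
def IsLocMin (H : Space 𝕜 n k) (g : Form 𝕜 n k) : Prop :=
  ∃ ε > 0, ∀ g' ∈ unitVolume H g, Near g ε g' → scal g ≤ scal g'

/-- `g` is a local maximum of `scal` among the `G`-invariant metrics of the same volume. -/
def IsLocMax (H : Space 𝕜 n k) (g : Form 𝕜 n k) : Prop :=
  ∃ ε > 0, ∀ g' ∈ unitVolume H g, Near g ε g' → scal g' ≤ scal g

/-- `g` is a saddle point of `scal` among the `G`-invariant metrics of the same volume. -/
def IsSaddle (H : Space 𝕜 n k) (g : Form 𝕜 n k) : Prop :=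
  IsCritical H g ∧ ¬ IsLocMin H g ∧ ¬ IsLocMax H g

/-- The Einstein metric `g` is `G`-rigid: the `G`-invariant Einstein metrics close to it belong to
`Aut(G/K) · g` up to scaling. -/
def IsGRigid (H : Space 𝕜 n k) (g : Form 𝕜 n k) : Prop :=
  ∃ ε > 0, ∀ g', IsInvMetric H g' → IsEinstein g' → Near g ε g' →
    ∃ c > (0 : ℝ), ∃ g'' ∈ autOrbit H g, g' = c • g''

/-! ### Dynamical instability -/

/-- The Borel measure `μ` is the Haar probability measure of the compact group `G`. -/
def IsHaarProb (H : Space 𝕜 n k) (μ : @MeasureTheory.Measure (Mat 𝕜 n k) (borel _)) : Prop :=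
  letI : MeasurableSpace (Mat 𝕜 n k) := borel _
  μ Set.univ = 1 ∧ μ (H.G : Set (Mat 𝕜 n k))ᶜ = 0 ∧
    ∀ a ∈ H.G, ∀ s : Set (Mat 𝕜 n k), MeasurableSet s → μ ((fun b => a * b) ⁻¹' s) = μ s

/-- The density of the volume of the metric `g` relative to a fixed `G`-invariant volume. -/
def volDensity (g : Field 𝕜 n k) (a : Mat 𝕜 n k) : ℝ := √(formMatrix (g a)).det

/-- `r` is the mean value `∫_M scal(g) dvol_g / ∫_M dvol_g` of the scalar curvature. -/
def IsMeanScal (H : Space 𝕜 n k) (g : Field 𝕜 n k) (r : ℝ) : Prop :=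
  letI : MeasurableSpace (Mat 𝕜 n k) := borel _
  ∀ μ : MeasureTheory.Measure (Mat 𝕜 n k), IsHaarProb H μ →
    r * ∫ a, volDensity g a ∂μ = ∫ a, scalAt g a * volDensity g a ∂μ

/-- `γ` is a smooth solution on `(-∞, 0]` of the (volume-)normalized Ricci flow
`∂g/∂t = -2 Ric(g) + (2 r / dim M) g` on `M`, with `r` the mean scalar curvature of `g`. -/
structure IsNormalizedRicciFlow (H : Space 𝕜 n k) (γ : ℝ → Field 𝕜 n k) : Prop where
  metric : ∀ t ≤ 0, IsMetric H (γ t)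
  smooth : ∀ a ∈ H.G, ∀ (r : ℕ) (X : Fin r → Mat 𝕜 n k), (∀ i, X i ∈ H.lie) → ∀ v w,
    ContDiffOn ℝ ∞ (fun p : ℝ × (Fin r → ℝ) =>
      γ p.1 (a * NormedSpace.exp (∑ i, p.2 i • X i)) v w) (Set.Iic 0 ×ˢ Set.univ)
  flow : ∀ t ≤ 0, ∃ r, IsMeanScal H (γ t) r ∧ ∀ a ∈ H.G, ∀ v w,
    HasDerivWithinAt (fun s => γ s a v w)
      (-2 * ricciAt (γ t) a v w + 2 * r / (dimM 𝕜 n k : ℝ) * γ t a v w) (Set.Iic 0) t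

/-- `a K = b K`, for `a` and `b` in `G`. -/
def SamePoint (a b : Mat 𝕜 n k) : Prop := IsBlockDiag (star a * b)

/-- `F`, defined near `0` in `𝔭`, is a smooth local lift to `G` of the map `a K ↦ (Φ a) K` of `M`
in the chart `X ↦ a exp(X) K`. -/
structure IsLocalLift (H : Space 𝕜 n k) (Φ : Mat 𝕜 n k → Mat 𝕜 n k) (a : Mat 𝕜 n k)
    (F : offDiag 𝕜 n k → Mat 𝕜 n k) : Prop where
  lift : ∀ᶠ X in 𝓝 (0 : offDiag 𝕜 n k),
    F X ∈ H.G ∧ SamePoint (F X) (Φ (a * NormedSpace.exp (X : Mat 𝕜 n k)))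
  smooth : ∀ (r : ℕ) (X : Fin r → offDiag 𝕜 n k) (p q : Fin n × Fin k),
    ContDiffAt ℝ ∞ (fun s : Fin r → ℝ => F (∑ i, s i • X i) p q) 0

/-- `Φ` maps `G` to `G` and induces a smooth map `a K ↦ (Φ a) K` of `M` to itself. -/
structure IsSmoothMap (H : Space 𝕜 n k) (Φ : Mat 𝕜 n k → Mat 𝕜 n k) : Prop where
  mapsTo : ∀ a ∈ H.G, Φ a ∈ H.G
  wellDefined : ∀ a ∈ H.G, ∀ b ∈ H.G, SamePoint a b → SamePoint (Φ a) (Φ b)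
  lifts : ∀ a ∈ H.G, ∃ F, IsLocalLift H Φ a F

/-- `Φ` induces a diffeomorphism of `M`. -/
def IsDiffeo (H : Space 𝕜 n k) (Φ : Mat 𝕜 n k → Mat 𝕜 n k) : Prop :=
  IsSmoothMap H Φ ∧ ∃ Ψ, IsSmoothMap H Ψ ∧
    ∀ a ∈ H.G, SamePoint (Ψ (Φ a)) a ∧ SamePoint (Φ (Ψ a)) a

/-- The differential at `0` of a local lift `F`, applied to `v`. The image of the tangent vector `v`
at `a K` is represented by this element of `𝔭` at the point `F 0` of `G`. -/
def liftDiff (F : offDiag 𝕜 n k → Mat 𝕜 n k) (v : offDiag 𝕜 n k) : offDiag 𝕜 n k :=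
  projP (star (F 0) * deriv (fun t : ℝ => F (t • v)) 0)

/-- `h` is the pullback of `g` by the smooth map of `M` that is induced by `Φ`. -/
def IsPullback (H : Space 𝕜 n k) (Φ : Mat 𝕜 n k → Mat 𝕜 n k) (g h : Field 𝕜 n k) : Prop :=
  ∀ a ∈ H.G, ∀ F, IsLocalLift H Φ a F →
    ∀ v w, h a v w = g (F 0) (liftDiff F v) (liftDiff F w)

/-- Iterated derivatives of a function on `G` along left-invariant vector fields. -/
def leftDeriv : List (Mat 𝕜 n k) → (Mat 𝕜 n k → ℝ) → Mat 𝕜 n k → ℝ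
  | [], f => f
  | X :: L, f => fun a => deriv (fun s : ℝ => leftDeriv L f (a * NormedSpace.exp (s • X))) 0

/-- `h t` converges to `g` in the `C^∞` topology as `t → -∞`. -/
def ConvergesSmoothly (H : Space 𝕜 n k) (h : ℝ → Field 𝕜 n k) (g : Field 𝕜 n k) : Prop :=
  ∀ L : List (Mat 𝕜 n k), (∀ X ∈ L, X ∈ H.lie) → ∀ v w,
    TendstoUniformlyOn (fun t a => leftDeriv L (fun b => h t b v w) a)
      (leftDeriv L fun b => g b v w) Filter.atBot H.G

/-- The metric `g` on `M` is (Ricci flow) dynamically unstable: there is a non-constant normalized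
Ricci flow on `(-∞, 0]` which converges modulo diffeomorphisms to `g` as `t → -∞`. -/
def IsDynamicallyUnstable (H : Space 𝕜 n k) (g : Field 𝕜 n k) : Prop :=
  ∃ γ : ℝ → Field 𝕜 n k, IsNormalizedRicciFlow H γ ∧
    (∃ s ≤ 0, ∃ t ≤ 0, ∃ a ∈ H.G, γ s a ≠ γ t a) ∧
    ∃ (Φ : ℝ → Mat 𝕜 n k → Mat 𝕜 n k) (h : ℝ → Field 𝕜 n k),
      (∀ t ≤ 0, IsDiffeo H (Φ t) ∧ IsPullback H (Φ t) (γ t) (h t)) ∧ ConvergesSmoothly H h g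

/-! ### Summary for a single space -/

/-- The standard metric of the space is a `G`-invariant Einstein metric which is `G`-unstable and
dynamically unstable. -/
structure StdUnstable (H : Space 𝕜 n k) : Prop where
  metric : IsInvMetric H (stdMetric H)
  einstein : IsEinstein (stdMetric H)
  gUnstable : IsGUnstable H (stdMetric H)
  dynamicallyUnstable : IsDynamicallyUnstable H fun _ => stdMetric H

/-- The standard metric is a local minimum of coindex `c`, `G`-non-degenerate and `G`-rigid. -/
def StdLocMin (H : Space 𝕜 n k) (c : ℕ) : Prop :=
  IsLocMin H (stdMetric H) ∧ HasCoindex H (stdMetric H) c ∧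
    IsGNondegenerate H (stdMetric H) ∧ IsGRigid H (stdMetric H)

/-- The standard metric is a saddle point of coindex `c`, `G`-non-degenerate and `G`-rigid. -/
def StdSaddle (H : Space 𝕜 n k) (c : ℕ) : Prop :=
  IsSaddle H (stdMetric H) ∧ HasCoindex H (stdMetric H) c ∧
    IsGNondegenerate H (stdMetric H) ∧ IsGRigid H (stdMetric H)

/-- The standard metric is `G`-degenerate of coindex `c`. -/
def StdDegenerate (H : Space 𝕜 n k) (c : ℕ) : Prop :=
  ¬ IsGNondegenerate H (stdMetric H) ∧ HasCoindex H (stdMetric H) c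

end BlockSpace

end

open BlockSpace

open scoped ContDiff Topology

noncomputable section

namespace BlockSpace

/-! Write 𝔭 as the sum of its blocks 𝔭_ij. The isotropy group contains enough signed permutations
and diagonal matrices of units to force an invariant symmetric form to be a multiple of the standard
one on each block, and different blocks to be orthogonal (`isInvTensor_iff`). So the G-invariant
symmetric 2-tensors are the symmetric arrays x_ij with i ≠ j, and, as elements of G permute the
blocks, the standard metric is a constant array x_ij = c (`exists_std`). The Killing form is
preserved by all automorphisms, hence the orbit of the standard metric under Aut(G/K) is a point,
there are no trivial variations, and W_g is the space of arrays with vanishing sum (`mem_W_iff`).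

The Ricci tensor of the metric x is computed in the exponential chart. `ricciCoord_eq_sum` expresses
it by the 2-jet of the metric, contracted in an orthogonal basis; `ricci_summand` writes each
summand through products of brackets, and `sum_wform_comm` sums these products. The result is
`ricciAt_diagForm`. With δ the real dimension of the scalars, κ = kδ and C = `scalConst`, the scalar
curvature is a positive multiple of C ∑ 1/x_ij - (κ/2) ∑ x_ij/(x_il x_jl). In the logarithmic
coordinates y_ij = log(x_ij/c), normalising the volume means subtracting the mean of y, so the
functional is a finite sum of exponentials of linear functionals (`scal_rescale`) and all its
derivatives are explicit.

At y = 0 the Hessian is (C - κ(3n-4)/2) ∑ y_ij w_ij plus κ times the product of the row sums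
(`expHess_terms`). It has two eigenspaces on W_g: the arrays a_i + a_j with ∑ a_i = 0, of dimension
n-1, and the arrays with vanishing row sums, of dimension n(n-3)/2. Up to a common positive factor
the eigenvalues are `eig₁` = C - κ(n-1) and `eig₂` = C - κ(3n-4)/2. For SU, Sp and SO they equal 2k,
4k+4, k-2 and k(4-n), 2(2+k(4-n)), k(4-n)/2-2. The first is always positive, which gives the
G-instability. The second eigenspace is zero for n = 3; otherwise the sign of the second eigenvalue
decides the type of the critical point, the coindex and the degeneracy. Taylor estimates turn these
signs into statements about nearby metrics. For rigidity, an Einstein metric is a zero of the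
gradient, which is dominated near 0 by the non-degenerate Hessian (`isGRigid_std`).

For the dynamical instability, the metrics with one value on the pairs that contain a fixed block
and another value on the remaining pairs form a family that the flow preserves. At constant volume
it is a curve with parameter θ on which the normalised flow is θ' = f(θ), with f(0) = 0 and f > 0
for θ > 0 because `eig₁` is positive. Separation of variables yields a solution that tends to 0 as t
→ -∞ (`exists_unstable_solution`). -/

/-- The common features of `ℝ`, `ℂ` and `ℍ`: a real part and an orthonormal real basis consisting of
units. -/
class Scalars (𝕜 : Type*) [NormedDivisionRing 𝕜] [NormedAlgebra ℝ 𝕜] [StarRing 𝕜]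
    [StarModule ℝ 𝕜] where
  /-- the real dimension -/
  δ : ℕ
  /-- the real part -/
  re : 𝕜 →ₗ[ℝ] ℝ
  /-- an orthonormal basis -/
  unit : Fin δ → 𝕜
  re_mul_comm : ∀ a b, re (a * b) = re (b * a)
  re_star : ∀ a, re (star a) = re a
  add_star : ∀ a, a + star a = algebraMap ℝ 𝕜 (2 * re a)
  unit_mul_star : ∀ i, unit i * star (unit i) = 1
  re_unit : ∀ i j, re (unit i * star (unit j)) = if i = j then 1 else 0
  sum_re : ∀ a, ∑ i, re (a * star (unit i)) • unit i = a
  sum_unit : ∀ a, ∑ i, unit i * a * unit i = (2 - (δ : ℝ)) • star a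

open Scalars

set_option linter.unusedSectionVars false

/-! ### Weighted inner products of brackets of elements of 𝔭 -/

section Elements

variable {𝕜 : Type*} [NormedDivisionRing 𝕜] [NormedAlgebra ℝ 𝕜] [FiniteDimensional ℝ 𝕜]
  [StarRing 𝕜] [StarModule ℝ 𝕜] [Scalars 𝕜] {n k : ℕ}

lemma star_unit_mul (i : Fin (δ 𝕜)) : star (unit i : 𝕜) * unit i = 1 := by
  have h := unit_mul_star (𝕜 := 𝕜) i
  rw [eq_inv_of_mul_eq_one_right h, inv_mul_cancel₀ (left_ne_zero_of_mul_eq_one h)]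

lemma re_mul_star_comm (a b : 𝕜) : re (a * star b) = re (b * star a) := by
  rw [← re_star, star_mul, star_star]

/-- Parseval's identity for the basis of units; it makes `re (a * star b)` a positive definite inner
product. -/
lemma re_mul_star_self_eq (a : 𝕜) : re (a * star a) = ∑ i, re (a * star (unit i)) ^ 2 := by
  conv_lhs => rw [re_mul_star_comm]; arg 2; arg 1; rw [← sum_re a]
  rw [Finset.sum_mul, map_sum]
  refine Finset.sum_congr rfl fun i _ => ?_
  rw [smul_mul_assoc, map_smul, re_mul_star_comm, smul_eq_mul, sq]

lemma re_mul_star_self_nonneg (a : 𝕜) : 0 ≤ re (a * star a) := by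
  rw [re_mul_star_self_eq]; positivity

lemma re_mul_star_self_pos {a : 𝕜} (ha : a ≠ 0) : 0 < re (a * star a) := by
  refine lt_of_le_of_ne (re_mul_star_self_nonneg a) fun h => ha ?_
  rw [re_mul_star_self_eq] at h
  have h' := (Finset.sum_eq_zero_iff_of_nonneg (fun i _ => sq_nonneg _)).mp h.symm
  rw [← sum_re a]
  refine Finset.sum_eq_zero fun i hi => ?_
  have := h' i hi
  rw [pow_eq_zero_iff two_ne_zero] at this
  rw [this, zero_smul]

variable (𝕜 n k) in
/-- The symmetric form `½ ∑ σ_{ij} re (X_{pq} (Y_{pq})^*)`, the block of `(p, q)` being `(i, j)`. -/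
def wform (σ : Fin n → Fin n → ℝ) : LinearMap.BilinForm ℝ (Mat 𝕜 n k) :=
  LinearMap.mk₂ ℝ (fun X Y => (1 / 2 : ℝ) * ∑ p, ∑ q, σ p.1 q.1 * re (X p q * star (Y p q)))
    (fun X X' Y => by
      simp only [Matrix.add_apply, add_mul, map_add, mul_add, Finset.sum_add_distrib])
    (fun c X Y => by
      simp only [Matrix.smul_apply, smul_mul_assoc, map_smul, smul_eq_mul, Finset.mul_sum]
      exact Finset.sum_congr rfl fun _ _ => Finset.sum_congr rfl fun _ _ => by ring)
    (fun X Y Y' => by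
      simp only [Matrix.add_apply, star_add, map_add, mul_add, Finset.sum_add_distrib])
    (fun c X Y => by
      simp only [Matrix.smul_apply, star_smul, star_trivial, mul_smul_comm, map_smul, smul_eq_mul,
        Finset.mul_sum]
      exact Finset.sum_congr rfl fun _ _ => Finset.sum_congr rfl fun _ _ => by ring)

lemma wform_apply (σ : Fin n → Fin n → ℝ) (X Y : Mat 𝕜 n k) :
    wform 𝕜 n k σ X Y = (1 / 2 : ℝ) * ∑ p, ∑ q, σ p.1 q.1 * re (X p q * star (Y p q)) := rfl

lemma wform_comm (σ : Fin n → Fin n → ℝ) (X Y : Mat 𝕜 n k) :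
    wform 𝕜 n k σ X Y = wform 𝕜 n k σ Y X := by
  simp only [wform_apply, re_mul_star_comm (X _ _)]

lemma wform_congr {σ σ' : Fin n → Fin n → ℝ} {X : Mat 𝕜 n k} (Y : Mat 𝕜 n k)
    (h : ∀ p q, X p q ≠ 0 → σ p.1 q.1 = σ' p.1 q.1) :
    wform 𝕜 n k σ X Y = wform 𝕜 n k σ' X Y := by
  simp only [wform_apply]
  congr 1
  refine Finset.sum_congr rfl fun p _ => Finset.sum_congr rfl fun q _ => ?_
  by_cases hX : X p q = 0
  · simp [hX]
  · rw [h p q hX]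

/-- Multiplication of the blocks by real numbers. -/
def scale (x : Fin n → Fin n → ℝ) (X : Mat 𝕜 n k) : Mat 𝕜 n k :=
  Matrix.of fun p q => x p.1 q.1 • X p q

lemma wform_scale (σ x : Fin n → Fin n → ℝ) (X Y : Mat 𝕜 n k) :
    wform 𝕜 n k σ (scale x X) Y = wform 𝕜 n k (fun i j => x i j * σ i j) X Y := by
  simp only [wform_apply, scale, Matrix.of_apply, smul_mul_assoc, map_smul, smul_eq_mul]
  congr 1
  exact Finset.sum_congr rfl fun _ _ => Finset.sum_congr rfl fun _ _ => by ring

/-- `σ` is symmetric. -/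
def IsSymm (σ : Fin n → Fin n → ℝ) : Prop := ∀ i j, σ i j = σ j i

/-- A bracket of two elements of 𝔭 has the form `A - star A` with `A` their matrix product
(`comm_eq_sub_star`). Transposing the summation indices and using the symmetry of `σ` identifies the
four products in pairs, which absorbs the factor ½. -/
lemma wform_sub_star {σ : Fin n → Fin n → ℝ} (hσ : IsSymm σ) (A B : Mat 𝕜 n k) :
    wform 𝕜 n k σ (A - star A) (B - star B) =
      ∑ p, ∑ q, σ p.1 q.1 * (re (A p q * star (B p q)) - re (A p q * B q p)) := by
  have h1 : ∑ p, ∑ q, σ p.1 q.1 * re (star (A q p) * B q p) =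
      ∑ p, ∑ q, σ p.1 q.1 * re (A p q * star (B p q)) := by
    rw [Finset.sum_comm]
    refine Finset.sum_congr rfl fun p _ => Finset.sum_congr rfl fun q _ => ?_
    rw [hσ, re_mul_comm, re_mul_star_comm]
  have h2 : ∑ p, ∑ q, σ p.1 q.1 * re (star (A q p) * star (B p q)) =
      ∑ p, ∑ q, σ p.1 q.1 * re (A p q * B q p) := by
    rw [Finset.sum_comm]
    refine Finset.sum_congr rfl fun p _ => Finset.sum_congr rfl fun q _ => ?_
    rw [hσ, ← star_mul, re_star, re_mul_comm]
  have h3 : wform 𝕜 n k σ (A - star A) (B - star B) = (1 / 2 : ℝ) *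
      (∑ p, ∑ q, σ p.1 q.1 * re (A p q * star (B p q)) -
        ∑ p, ∑ q, σ p.1 q.1 * re (A p q * B q p) -
        ∑ p, ∑ q, σ p.1 q.1 * re (star (A q p) * star (B p q)) +
        ∑ p, ∑ q, σ p.1 q.1 * re (star (A q p) * B q p)) := by
    simp only [← Finset.sum_sub_distrib, ← Finset.sum_add_distrib, wform_apply]
    congr 1
    refine Finset.sum_congr rfl fun p _ => Finset.sum_congr rfl fun q _ => ?_
    simp only [Matrix.sub_apply, Matrix.star_apply, star_sub, star_star, sub_mul, mul_sub, map_sub]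
    ring
  rw [h3, h1, h2]
  simp only [mul_sub, Finset.sum_sub_distrib]
  ring

/-- The skew-Hermitian matrix with entry `a` at `(r, s)` and vanishing entries except at `(r, s)`
and `(s, r)`. -/
def elem (r s : Fin n × Fin k) (a : 𝕜) : Mat 𝕜 n k :=
  Matrix.of fun p q => if p = r ∧ q = s then a else if p = s ∧ q = r then -star a else 0

lemma elem_mem {r s : Fin n × Fin k} (h : r.1 ≠ s.1) (a : 𝕜) : elem r s a ∈ offDiag 𝕜 n k := by
  have hrs : r ≠ s := fun e => h (by rw [e])
  refine ⟨?_, ?_⟩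
  · ext p q
    simp only [Matrix.star_apply, elem, Matrix.of_apply, Matrix.neg_apply]
    by_cases h1 : p = r ∧ q = s
    · obtain ⟨rfl, rfl⟩ := h1
      simp [hrs]
    · by_cases h2 : p = s ∧ q = r
      · obtain ⟨rfl, rfl⟩ := h2
        simp [hrs.symm]
      · have h1' : ¬ (q = s ∧ p = r) := fun e => h1 ⟨e.2, e.1⟩
        have h2' : ¬ (q = r ∧ p = s) := fun e => h2 ⟨e.2, e.1⟩
        simp [h1, h2, h1', h2']
  · intro i a' b'
    have h1 : ¬ ((i, a') = r ∧ (i, b') = s) := fun e => h (by rw [← e.1, ← e.2])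
    have h2 : ¬ ((i, a') = s ∧ (i, b') = r) := fun e => h (by rw [← e.1, ← e.2])
    simp [elem, h1, h2]

lemma elem_add (r s : Fin n × Fin k) (a b : 𝕜) : elem r s (a + b) = elem r s a + elem r s b := by
  ext p q
  simp only [elem, Matrix.of_apply, Matrix.add_apply, star_add]
  split_ifs <;> simp [add_comm]

lemma elem_smul (r s : Fin n × Fin k) (c : ℝ) (a : 𝕜) : elem r s (c • a) = c • elem r s a := by
  ext p q
  simp only [elem, Matrix.of_apply, Matrix.smul_apply, star_smul, star_trivial]
  split_ifs <;> simp

variable (𝕜 n k) in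
/-- The index set of a basis of `𝔭`. -/
abbrev Idx : Type := {e : (Fin n × Fin k) × (Fin n × Fin k) // e.1.1 < e.2.1} × Fin (δ 𝕜)

variable (𝕜 n k) in
/-- The elements of a basis of `𝔭`. -/
def stdVec (e : Idx 𝕜 n k) : offDiag 𝕜 n k :=
  ⟨elem e.1.1.1 e.1.1.2 (unit e.2), elem_mem e.1.2.ne _⟩

lemma stdVec_apply (e e' : Idx 𝕜 n k) :
    (stdVec 𝕜 n k e : Mat 𝕜 n k) e'.1.1.1 e'.1.1.2 = if e'.1 = e.1 then unit e.2 else 0 := by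
  obtain ⟨⟨⟨r, s⟩, h⟩, u⟩ := e
  obtain ⟨⟨⟨r', s'⟩, h'⟩, u'⟩ := e'
  simp only [stdVec, elem, Matrix.of_apply, Subtype.mk.injEq, Prod.mk.injEq]
  -- Both pairs are ordered by their blocks, so the lower entry of `elem` is never met.
  have : ¬ (r' = s ∧ s' = r) := by
    rintro ⟨rfl, rfl⟩
    exact absurd h (by simpa using h'.le)
  rw [if_neg this]

lemma offDiag_star {v : Mat 𝕜 n k} (hv : v ∈ offDiag 𝕜 n k) (p q : Fin n × Fin k) :
    star (v q p) = -v p q := by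
  have := congrFun (congrFun hv.1 p) q
  simpa using this

lemma offDiag_zero {v : Mat 𝕜 n k} (hv : v ∈ offDiag 𝕜 n k) {p q : Fin n × Fin k}
    (h : p.1 = q.1) : v p q = 0 := by
  obtain ⟨i, a⟩ := p
  obtain ⟨j, b⟩ := q
  obtain rfl : i = j := h
  exact hv.2 i a b

lemma offDiag_ext {v w : offDiag 𝕜 n k}
    (h : ∀ p q : Fin n × Fin k, p.1 < q.1 → (v : Mat 𝕜 n k) p q = (w : Mat 𝕜 n k) p q) : v = w := by
  ext p q
  rcases lt_trichotomy p.1 q.1 with hlt | heq | hgt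
  · exact h p q hlt
  · rw [offDiag_zero v.2 heq, offDiag_zero w.2 heq]
  · rw [← neg_inj, ← offDiag_star v.2, ← offDiag_star w.2, h q p hgt]

variable (𝕜 n k) in
/-- A basis of `𝔭`, orthonormal for `wform 1`. -/
def stdBasis : Module.Basis (Idx 𝕜 n k) ℝ (offDiag 𝕜 n k) :=
  Module.Basis.ofEquivFun
    { toFun := fun v e => re ((v : Mat 𝕜 n k) e.1.1.1 e.1.1.2 * star (unit e.2))
      map_add' := fun v w => by ext e; simp [add_mul]
      map_smul' := fun c v => by ext e; simp
      invFun := fun c => ∑ e, c e • stdVec 𝕜 n k e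
      left_inv := fun v => by
        refine offDiag_ext fun p q hpq => ?_
        rw [Submodule.coe_sum, Matrix.sum_apply, Fintype.sum_prod_type,
          Finset.sum_eq_single (⟨(p, q), hpq⟩ : {e : (Fin n × Fin k) × (Fin n × Fin k) //
            e.1.1 < e.2.1})]
        · conv_rhs => rw [← sum_re ((v : Mat 𝕜 n k) p q)]
          refine Finset.sum_congr rfl fun i _ => ?_
          have := stdVec_apply (⟨⟨(p, q), hpq⟩, i⟩ : Idx 𝕜 n k) (⟨⟨(p, q), hpq⟩, i⟩ : Idx 𝕜 n k)
          simp only [if_true] at this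
          rw [Submodule.coe_smul, Matrix.smul_apply, this]
        · intro e _ he
          refine Finset.sum_eq_zero fun i _ => ?_
          have := stdVec_apply (⟨e, i⟩ : Idx 𝕜 n k) (⟨⟨(p, q), hpq⟩, i⟩ : Idx 𝕜 n k)
          rw [if_neg he.symm] at this
          rw [Submodule.coe_smul, Matrix.smul_apply, this, smul_zero]
        · simp
      right_inv := fun c => by
        ext e
        simp only [Submodule.coe_sum, Matrix.sum_apply, Submodule.coe_smul, Matrix.smul_apply,
          stdVec_apply, Finset.sum_mul, map_sum]
        rw [Finset.sum_eq_single e]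
        · rw [if_pos rfl, smul_mul_assoc, map_smul, re_unit, if_pos rfl, smul_eq_mul, mul_one]
        · intro e' _ he'
          by_cases h : e.1 = e'.1
          · have : e'.2 ≠ e.2 := fun h' => he' (Prod.ext h.symm h')
            rw [if_pos h, smul_mul_assoc, map_smul, re_unit, if_neg this, smul_zero]
          · simp [h]
        · simp }

lemma stdBasis_apply (e : Idx 𝕜 n k) : stdBasis 𝕜 n k e = stdVec 𝕜 n k e := by
  classical
  simp only [stdBasis, Module.Basis.coe_ofEquivFun, LinearEquiv.coe_symm_mk']
  change ∑ e', (Pi.single e (1:ℝ) : Idx 𝕜 n k → ℝ) e' • stdVec 𝕜 n k e' = _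
  rw [Finset.sum_eq_single e] <;> simp +contextual

/-- A form that is determined by its values on the pairs of blocks. -/
lemma sum_pairs (f : Fin n × Fin k → Fin n × Fin k → ℝ) (hf : ∀ r s, r.1 = s.1 → f r s = 0) :
    ∑ e : {e : (Fin n × Fin k) × (Fin n × Fin k) // e.1.1 < e.2.1},
      (f e.1.1 e.1.2 + f e.1.2 e.1.1) = ∑ r, ∑ s, f r s := by
  have h1 : ∀ g : (Fin n × Fin k) × (Fin n × Fin k) → ℝ,
      ∑ e : {e : (Fin n × Fin k) × (Fin n × Fin k) // e.1.1 < e.2.1}, g e.1 =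
        ∑ r, ∑ s, if r.1 < s.1 then g (r, s) else 0 := fun g => by
    rw [← Finset.sum_subtype (Finset.univ.filter fun e : (Fin n × Fin k) × (Fin n × Fin k) =>
      e.1.1 < e.2.1) (by simp), Finset.sum_filter, Fintype.sum_prod_type]
  rw [Finset.sum_add_distrib, h1 fun e => f e.1 e.2, h1 fun e => f e.2 e.1]
  conv_lhs => arg 2; rw [Finset.sum_comm]
  rw [← Finset.sum_add_distrib]
  refine Finset.sum_congr rfl fun r _ => ?_
  rw [← Finset.sum_add_distrib]
  refine Finset.sum_congr rfl fun s _ => ?_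
  rcases lt_trichotomy r.1 s.1 with h | h | h
  · simp [h, h.le.not_gt]
  · simp [h, hf r s h]
  · simp [h, h.le.not_gt]

lemma mul_elem_apply {v : Mat 𝕜 n k} {r s : Fin n × Fin k} (hrs : r ≠ s) (a : 𝕜)
    (p q : Fin n × Fin k) :
    (v * elem r s a) p q = if q = s then v p r * a else if q = r then -(v p s * star a) else 0 := by
  rw [Matrix.mul_apply]
  by_cases h1 : q = s
  · subst h1
    rw [Finset.sum_eq_single r]
    · simp [elem]
    · intro b _ hb
      simp [elem, hb, hrs.symm]
    · simp
  · by_cases h2 : q = r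
    · subst h2
      rw [Finset.sum_eq_single s]
      · simp [elem, h1]
      · intro b _ hb
        simp [elem, hb, h1]
      · simp
    · simp [elem, h1, h2]

/-- The commutator. -/
def comm (X Y : Mat 𝕜 n k) : Mat 𝕜 n k := X * Y - Y * X

lemma comm_eq_sub_star {v w : Mat 𝕜 n k} (hv : v ∈ offDiag 𝕜 n k) (hw : w ∈ offDiag 𝕜 n k) :
    comm v w = v * w - star (v * w) := by
  rw [star_mul, hv.1, hw.1, comm]
  noncomm_ring

/-- Right multiplication by `elem r s a` fills only the columns `r` and `s`, so only these survive
in `wform_sub_star`. The unit `a` cancels in the norms and remains only in the cross terms at the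
diagonal blocks of `r` and `s`, which measure the 𝔨-component of the brackets. -/
lemma wform_comm_elem {σ : Fin n → Fin n → ℝ} (hσ : IsSymm σ) {v w : Mat 𝕜 n k}
    (hv : v ∈ offDiag 𝕜 n k) (hw : w ∈ offDiag 𝕜 n k) {r s : Fin n × Fin k} (h : r.1 ≠ s.1)
    {a : 𝕜} (ha : a * star a = 1) :
    wform 𝕜 n k σ (comm v (elem r s a)) (comm w (elem r s a)) =
      ((∑ p, σ p.1 s.1 * re (v p r * star (w p r))) - σ s.1 s.1 * re (v s r * a * w s r * a)) +
      ((∑ p, σ p.1 r.1 * re (v p s * star (w p s))) -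
        σ r.1 r.1 * re (v r s * star a * w r s * star a)) := by
  have hrs : r ≠ s := fun e => h (by rw [e])
  have ha' : star a * a = 1 := by
    rw [eq_inv_of_mul_eq_one_right ha, inv_mul_cancel₀ (left_ne_zero_of_mul_eq_one ha)]
  rw [comm_eq_sub_star hv (elem_mem h a), comm_eq_sub_star hw (elem_mem h a), wform_sub_star hσ]
  have key : ∀ p, ∑ q, σ p.1 q.1 * (re ((v * elem r s a) p q * star ((w * elem r s a) p q)) -
      re ((v * elem r s a) p q * (w * elem r s a) q p)) =
      (σ p.1 s.1 * re (v p r * star (w p r)) + σ p.1 r.1 * re (v p s * star (w p s))) -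
      ((if p = s then σ s.1 s.1 * re (v s r * a * w s r * a) else 0) +
        (if p = r then σ r.1 r.1 * re (v r s * star a * w r s * star a) else 0)) := by
    intro p
    have hsub : ∀ q ∉ ({s, r} : Finset (Fin n × Fin k)), σ p.1 q.1 *
        (re ((v * elem r s a) p q * star ((w * elem r s a) p q)) -
          re ((v * elem r s a) p q * (w * elem r s a) q p)) = 0 := by
      intro q hq
      simp only [Finset.mem_insert, Finset.mem_singleton, not_or] at hq
      simp [mul_elem_apply hrs, hq.1, hq.2]
    rw [← Finset.sum_subset (Finset.subset_univ {s, r}) fun q _ => hsub q,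
      Finset.sum_pair hrs.symm]
    simp only [mul_elem_apply hrs, if_true, if_neg hrs]
    have e1 : v p r * a * star (w p r * a) = v p r * star (w p r) := by
      rw [star_mul, mul_assoc, ← mul_assoc a, ha, one_mul]
    have e2 : -(v p s * star a) * star (-(w p s * star a)) = v p s * star (w p s) := by
      rw [star_neg, star_mul, star_star, neg_mul_neg, mul_assoc, ← mul_assoc (star a), ha', one_mul]
    rw [e1, e2]
    by_cases h1 : p = s
    · subst h1
      rw [if_pos rfl, if_neg hrs.symm, offDiag_zero hv (p := p) (q := p) rfl]
      simp only [mul_assoc, zero_mul, neg_zero, map_zero, if_true, if_neg hrs.symm]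
      ring
    · by_cases h2 : p = r
      · subst h2
        rw [if_neg h1, if_pos rfl, offDiag_zero hv (p := p) (q := p) rfl]
        simp only [mul_assoc, zero_mul, map_zero, neg_mul_neg, if_true, if_neg h1]
        ring
      · simp only [if_neg h1, if_neg h2, mul_zero, map_zero]
        ring
  rw [Finset.sum_congr rfl fun p _ => key p, Finset.sum_sub_distrib, Finset.sum_add_distrib,
    Finset.sum_add_distrib, Finset.sum_ite_eq', Finset.sum_ite_eq']
  simp only [Finset.mem_univ, if_true]
  ring

variable (𝕜) in
/-- The coefficients in `sum_wform_comm`. -/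
def contr (k : ℕ) (τ σ : Fin n → Fin n → ℝ) (i j : Fin n) : ℝ :=
  k * δ 𝕜 * ∑ l, (τ i l * σ j l + τ j l * σ i l) - (2 - δ 𝕜) * (τ i j * (σ i i + σ j j))

lemma sum_unit_star (a : 𝕜) : ∑ i, star (unit i) * a * star (unit i) = (2 - (δ 𝕜 : ℝ)) • star a := by
  have h := congrArg star (sum_unit (star a))
  rw [star_sum, star_smul, star_trivial (2 - (δ 𝕜 : ℝ)), star_star] at h
  conv_rhs at h => rw [← star_star a]
  rw [star_star] at h
  rw [← h]
  exact Finset.sum_congr rfl fun i _ => by rw [star_mul, star_mul, star_star, mul_assoc]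

lemma sum_blocks (f : Fin n → ℝ) : ∑ p : Fin n × Fin k, f p.1 = k * ∑ l, f l := by
  rw [Fintype.sum_prod_type, Finset.mul_sum]
  simp

lemma sum_symmetrize {N : Fin n × Fin k → Fin n × Fin k → ℝ} (hN : ∀ p q, N p q = N q p)
    (A : Fin n → Fin n → ℝ) :
    ∑ p, ∑ q, (A p.1 q.1 + A q.1 p.1) * N p q = 2 * ∑ p, ∑ q, A p.1 q.1 * N p q := by
  simp only [add_mul, Finset.sum_add_distrib]
  have : ∑ p, ∑ q, A q.1 p.1 * N p q = ∑ p, ∑ q, A p.1 q.1 * N p q := by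
    rw [Finset.sum_comm]
    simp only [hN]
  rw [this, two_mul]

/-- The sum over an orthonormal basis of `𝔭` of the weighted products of the brackets with two
elements of `𝔭`. -/
theorem sum_wform_comm {τ σ : Fin n → Fin n → ℝ} (hτ : IsSymm τ) (hτ0 : ∀ i, τ i i = 0)
    (hσ : IsSymm σ) {v w : Mat 𝕜 n k} (hv : v ∈ offDiag 𝕜 n k) (hw : w ∈ offDiag 𝕜 n k) :
    ∑ e : Idx 𝕜 n k, τ e.1.1.1.1 e.1.1.2.1 *
      wform 𝕜 n k σ (comm v (stdBasis 𝕜 n k e : Mat 𝕜 n k)) (comm w (stdBasis 𝕜 n k e : Mat 𝕜 n k)) =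
    wform 𝕜 n k (contr 𝕜 k τ σ) v w := by
  set N : Fin n × Fin k → Fin n × Fin k → ℝ := fun p q => re (v p q * star (w p q)) with hN
  have hNs : ∀ p q, N p q = N q p := fun p q => by
    simp only [hN]
    rw [← neg_mul_neg, ← star_neg, ← offDiag_star hv, ← offDiag_star hw, star_star, re_mul_comm,
      re_mul_star_comm]
  -- Averaging over the units removes them from the cross terms: `sum_unit` replaces `u * w * u` by
  -- a multiple of `star w`, so the cross terms become norms as well.
  have h1 : ∀ r s : Fin n × Fin k, ∑ i : Fin (δ 𝕜), re (v s r * unit i * w s r * unit i) =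
      (2 - δ 𝕜) * N s r := fun r s => by
    have : ∀ i, v s r * unit i * w s r * unit i = v s r * (unit i * w s r * unit i) := fun i => by
      simp only [mul_assoc]
    simp only [this, ← map_sum, ← Finset.mul_sum, sum_unit]
    rw [mul_smul_comm, map_smul, smul_eq_mul]
  have h2 : ∀ r s : Fin n × Fin k,
      ∑ i : Fin (δ 𝕜), re (v r s * star (unit i) * w r s * star (unit i)) =
      (2 - δ 𝕜) * N r s := fun r s => by
    have : ∀ i, v r s * star (unit i) * w r s * star (unit i) =
        v r s * (star (unit i) * w r s * star (unit i)) := fun i => by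
      simp only [mul_assoc]
    simp only [this, ← map_sum, ← Finset.mul_sum, sum_unit_star]
    rw [mul_smul_comm, map_smul, smul_eq_mul]
  -- This is the share of one of the two columns. The basis vectors belonging to the pair `(r, s)`
  -- contribute `f r s + f s r`, so `sum_pairs` turns the sum over ordered pairs of blocks into a
  -- free double sum.
  set f : Fin n × Fin k → Fin n × Fin k → ℝ := fun r s => τ r.1 s.1 *
    (δ 𝕜 * (∑ p, σ p.1 s.1 * N p r) - (2 - δ 𝕜) * (σ s.1 s.1 * N s r)) with hf
  rw [Fintype.sum_prod_type]
  have h3 : ∀ e : {e : (Fin n × Fin k) × (Fin n × Fin k) // e.1.1 < e.2.1},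
      (∑ i, τ e.1.1.1 e.1.2.1 * wform 𝕜 n k σ (comm v (stdBasis 𝕜 n k (e, i) : Mat 𝕜 n k))
        (comm w (stdBasis 𝕜 n k (e, i) : Mat 𝕜 n k))) = f e.1.1 e.1.2 + f e.1.2 e.1.1 := by
    intro e
    simp only [fun i => stdBasis_apply (𝕜 := 𝕜) (n := n) (k := k) (e, i), stdVec,
      fun i => wform_comm_elem hσ hv hw e.2.ne (unit_mul_star (𝕜 := 𝕜) i), ← Finset.mul_sum, Finset.sum_add_distrib, Finset.sum_sub_distrib, h1, h2,
      Finset.sum_const, Finset.card_univ, Fintype.card_fin, nsmul_eq_mul, hf, hτ e.1.2.1 e.1.1.1]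
    simp only [hN]
    ring
  rw [Finset.sum_congr rfl fun e _ => h3 e, sum_pairs f fun r s h => by simp [hf, h, hτ0]]
  have h4 : ∑ r, ∑ s, f r s = ∑ r, ∑ p, (k * δ 𝕜 * (∑ l, τ r.1 l * σ p.1 l) -
      (2 - δ 𝕜) * (τ r.1 p.1 * σ p.1 p.1)) * N r p := by
    refine Finset.sum_congr rfl fun r _ => ?_
    have e1 : ∑ s : Fin n × Fin k, τ r.1 s.1 * (δ 𝕜 * ∑ p, σ p.1 s.1 * N p r) =
        ∑ p, k * δ 𝕜 * (∑ l, τ r.1 l * σ p.1 l) * N r p := by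
      simp only [Finset.mul_sum]
      rw [Finset.sum_comm]
      refine Finset.sum_congr rfl fun p _ => ?_
      rw [sum_blocks (fun l => τ r.1 l * (δ 𝕜 * (σ p.1 l * N p r))), Finset.sum_mul,
        Finset.mul_sum]
      refine Finset.sum_congr rfl fun l _ => ?_
      rw [hNs p r]
      ring
    simp only [hf]
    simp_rw [mul_sub (τ _ _), sub_mul (_ * Finset.sum _ _), Finset.sum_sub_distrib]
    rw [e1]
    congr 1
    refine Finset.sum_congr rfl fun s _ => ?_
    rw [hNs s r]
    ring
  -- As `N` is symmetric, only the symmetric part of its coefficient matters, and `contr` is the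
  -- coefficient plus its transpose; the resulting factor 2 cancels the ½ in `wform`.
  have h5 := sum_symmetrize hNs fun i j => k * δ 𝕜 * (∑ l, τ i l * σ j l) -
      (2 - δ 𝕜) * (τ i j * σ j j)
  rw [h4, wform_apply]
  have h6 : ∀ p q : Fin n × Fin k, contr 𝕜 k τ σ p.1 q.1 =
      (k * δ 𝕜 * (∑ l, τ p.1 l * σ q.1 l) - (2 - δ 𝕜) * (τ p.1 q.1 * σ q.1 q.1)) +
      (k * δ 𝕜 * (∑ l, τ q.1 l * σ p.1 l) - (2 - δ 𝕜) * (τ q.1 p.1 * σ p.1 p.1)) := by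
    intro p q
    rw [contr, Finset.sum_add_distrib, hτ q.1 p.1]
    ring
  simp only [h6]
  rw [h5]
  ring

end Elements

/-! ### The Ricci tensor at the origin of a chart from the 2-jet of the metric -/

section ChartRicci

variable {E : Type*} [AddCommGroup E] [Module ℝ E] {d : ℕ} {ι : Type*} [Fintype ι] [DecidableEq ι]

open scoped Matrix.Norms.Operator in
lemma hasDerivAt_matrix_inv {G : ℝ → Matrix (Fin d) (Fin d) ℝ} {G' : Matrix (Fin d) (Fin d) ℝ}
    {t : ℝ} (hG : ∀ i j, HasDerivAt (fun s => G s i j) (G' i j) t) (hdet : IsUnit (G t).det)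
    (i j : Fin d) :
    HasDerivAt (fun s => (G s)⁻¹ i j) (-((G t)⁻¹ * G' * (G t)⁻¹) i j) t := by
  have h1 : HasDerivAt G G' t := by
    refine hasDerivAt_pi.mpr fun i => ?_
    exact hasDerivAt_pi.mpr fun j => hG i j
  obtain ⟨u, hu⟩ := (Matrix.isUnit_iff_isUnit_det _).mpr hdet
  have h2 := hasFDerivAt_ringInverse (𝕜 := ℝ) u
  rw [hu] at h2
  have h3 := h2.comp_hasDerivAt t h1
  have h4 : (fun s => (G s)⁻¹) = Ring.inverse ∘ G := by
    ext s; simp [Matrix.nonsing_inv_eq_ringInverse]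
  have h5 : (↑u⁻¹ : Matrix (Fin d) (Fin d) ℝ) = (G t)⁻¹ := by
    rw [← hu, Matrix.coe_units_inv]
  rw [← h4] at h3
  have h6 := hasDerivAt_pi.mp (hasDerivAt_pi.mp h3 i) j
  simpa [h5] using h6

variable (b : Module.Basis (Fin d) ℝ E) (ε : Module.Basis ι ℝ E) {g : LinearMap.BilinForm ℝ E}
  {c : ι → ℝ}

/-- The Gram matrix of a bilinear form in a basis. -/
def gramOf (g : LinearMap.BilinForm ℝ E) : Matrix (Fin d) (Fin d) ℝ :=
  Matrix.of fun i j => g (b i) (b j)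

-- In the basis `ε` the form is diagonal, so its inverse is the tensor ∑ ε_a ⊗ ε_a / c_a, written
-- here in the coordinates of `b`. Contractions that are defined through `b` can therefore be
-- evaluated in the orthogonal basis `ε`.
variable {b} in
lemma gramOf_inv (hg : ∀ a a', g (ε a) (ε a') = if a = a' then c a else 0) (hc : ∀ a, c a ≠ 0) :
    IsUnit (gramOf b g).det ∧
      (gramOf b g)⁻¹ = Matrix.of fun l m => ∑ a, b.repr (ε a) l * b.repr (ε a) m / c a := by
  have key : gramOf b g * (Matrix.of fun l m => ∑ a, b.repr (ε a) l * b.repr (ε a) m / c a) = 1 := by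
    ext i j
    have h1 : ∀ a, ∑ m, g (b i) (b m) * b.repr (ε a) m = c a * ε.repr (b i) a := by
      intro a
      have : ∑ m, g (b i) (b m) * b.repr (ε a) m = g (b i) (∑ m, b.repr (ε a) m • b m) := by
        simp only [map_sum, map_smul, smul_eq_mul, mul_comm]
      rw [this, b.sum_repr]
      conv_lhs => rw [← ε.sum_repr (b i)]
      simp only [map_sum, map_smul, LinearMap.sum_apply, LinearMap.smul_apply, smul_eq_mul, hg,
        mul_ite, mul_zero, Finset.sum_ite_eq', Finset.mem_univ, if_true]
      rw [mul_comm]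
    have h2 : ∑ a, ε.repr (b i) a * b.repr (ε a) j = if i = j then 1 else 0 := by
      have : ∑ a, ε.repr (b i) a * b.repr (ε a) j = b.repr (∑ a, ε.repr (b i) a • ε a) j := by
        simp only [map_sum, map_smul, Finsupp.coe_finsetSum, Finset.sum_apply, Finsupp.smul_apply,
          smul_eq_mul]
      rw [this, ε.sum_repr, b.repr_self, Finsupp.single_apply]
    rw [Matrix.mul_apply, Matrix.one_apply, ← h2]
    simp only [gramOf, Matrix.of_apply, Finset.mul_sum]
    rw [Finset.sum_comm]
    refine Finset.sum_congr rfl fun a _ => ?_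
    rw [eq_comm, ← mul_right_inj' (hc a), ← mul_assoc, ← h1 a, Finset.sum_mul, Finset.mul_sum]
    refine Finset.sum_congr rfl fun m _ => ?_
    field_simp [hc a]
  refine ⟨?_, Matrix.inv_eq_right_inv key⟩
  rw [← Matrix.isUnit_iff_isUnit_det]
  exact IsUnit.of_mul_eq_one _ key

variable {b} in
lemma sum_gramOf_inv (hg : ∀ a a', g (ε a) (ε a') = if a = a' then c a else 0)
    (hc : ∀ a, c a ≠ 0) (β : LinearMap.BilinForm ℝ E) :
    ∑ l, ∑ m, (gramOf b g)⁻¹ l m * β (b l) (b m) = ∑ a, β (ε a) (ε a) / c a := by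
  rw [(gramOf_inv ε hg hc).2]
  have h1 : ∀ a, β (ε a) (ε a) = ∑ l, ∑ m, b.repr (ε a) l * b.repr (ε a) m * β (b l) (b m) := by
    intro a
    conv_lhs => rw [← b.sum_repr (ε a)]
    simp only [map_sum, map_smul, LinearMap.sum_apply, LinearMap.smul_apply, smul_eq_mul,
      Finset.mul_sum]
    rw [Finset.sum_comm]
    exact Finset.sum_congr rfl fun l _ => Finset.sum_congr rfl fun m _ => by ring
  simp only [h1, Matrix.of_apply, Finset.sum_mul, Finset.sum_div]
  conv_rhs => rw [Finset.sum_comm]; arg 2; ext l; rw [Finset.sum_comm]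
  refine Finset.sum_congr rfl fun l _ => Finset.sum_congr rfl fun m _ =>
    Finset.sum_congr rfl fun a _ => by ring

lemma sum_gramOf_inv_repr (hsymm : ∀ v w, g v w = g w v)
    (hdet : IsUnit (gramOf b g).det) (z : E) (l : Fin d) :
    ∑ m, (gramOf b g)⁻¹ l m * g z (b m) = b.repr z l := by
  have h1 : ∀ m, g z (b m) = ((gramOf b g).mulVec (b.repr z)) m := by
    intro m
    conv_lhs => rw [← b.sum_repr z]
    simp only [map_sum, map_smul, LinearMap.sum_apply, LinearMap.smul_apply, smul_eq_mul,
      Matrix.mulVec, dotProduct, gramOf, Matrix.of_apply]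
    refine Finset.sum_congr rfl fun i _ => by rw [hsymm (b m)]; ring
  simp only [h1]
  change ((gramOf b g)⁻¹.mulVec ((gramOf b g).mulVec (b.repr z))) l = _
  rw [Matrix.mulVec_mulVec, Matrix.nonsing_inv_mul _ hdet, Matrix.one_mulVec]

variable {b}

/-- The Ricci tensor at the origin of a metric with given first and second derivatives there. -/
theorem ricciCoord_eq_sum {γ : E → E → E → ℝ} {g1 : E →ₗ[ℝ] LinearMap.BilinForm ℝ E}
    {g2 : E →ₗ[ℝ] E →ₗ[ℝ] LinearMap.BilinForm ℝ E} {Γ : E →ₗ[ℝ] E →ₗ[ℝ] E}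
    (hsymm : ∀ v w, g v w = g w v)
    (hg : ∀ a a', g (ε a) (ε a') = if a = a' then c a else 0) (hc : ∀ a, c a ≠ 0)
    (h0 : ∀ v w, γ 0 v w = g v w)
    (h1 : ∀ z v w, HasDerivAt (fun t : ℝ => γ (t • z) v w) (g1 z v w) 0)
    (h2 : ∀ z y v w, HasDerivAt (fun t : ℝ => deriv (fun s : ℝ => γ (t • z + s • y) v w) 0)
      (g2 z y v w) 0)
    (hΓ : ∀ v w z, 2 * g (Γ v w) z = g1 v w z + g1 w v z - g1 z v w) (i j : Fin d) :
    ricciCoord γ b 0 i j = ∑ a, ((g2 (ε a) (b i) (b j) (ε a) + g2 (ε a) (b j) (b i) (ε a)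
      - g2 (ε a) (ε a) (b i) (b j)) / 2 - g1 (ε a) (ε a) (Γ (b i) (b j))
      - g2 (b j) (b i) (ε a) (ε a) / 2
      + g1 (b j) (ε a) (Γ (b i) (ε a))
      + g (Γ (ε a) (Γ (b i) (b j))) (ε a) - g (Γ (b j) (Γ (b i) (ε a))) (ε a)) / c a := by
  have hdet := (gramOf_inv (b := b) ε hg hc).1
  have hG0 : gram γ b 0 = gramOf b g := by ext i j; simp [gram, gramOf, h0]
  have hpd : ∀ l i j, pd b l (fun y => gram γ b y i j) 0 = g1 (b l) (b i) (b j) := by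
    intro l i j
    simp only [pd, gram, Matrix.of_apply, zero_add]
    exact (h1 _ _ _).deriv
  -- By the Koszul identity `hΓ`, the classical formula is the covector of `Γ (b i) (b j)` with its
  -- index raised.
  have hchr : ∀ l i j, christoffel γ b l i j 0 = b.repr (Γ (b i) (b j)) l := by
    intro l i j
    rw [christoffel, hG0, ← sum_gramOf_inv_repr b hsymm hdet, Finset.mul_sum]
    refine Finset.sum_congr rfl fun m _ => ?_
    rw [hpd, hpd, hpd, ← hΓ]
    ring
  -- The derivative of the inverse Gram matrix is `-G⁻¹ G' G⁻¹`. Applied to the Koszul covector, its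
  -- right factor `G⁻¹` raises the index, which leaves the term with `g1 (b p) (b m) (Γ (b i) (b
  -- j))`.
  have hder : ∀ p l i j, pd b p (christoffel γ b l i j) 0 = ∑ m, (gramOf b g)⁻¹ l m *
      ((g2 (b p) (b i) (b j) (b m) + g2 (b p) (b j) (b i) (b m) - g2 (b p) (b m) (b i) (b j)) / 2
        - g1 (b p) (b m) (Γ (b i) (b j))) := by
    intro p l i j
    have hinv : ∀ m, HasDerivAt (fun t : ℝ => (gram γ b (t • b p))⁻¹ l m)
        (-((gramOf b g)⁻¹ * (gramOf b (g1 (b p))) * (gramOf b g)⁻¹) l m) 0 := by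
      intro m
      have := hasDerivAt_matrix_inv (G := fun t : ℝ => gram γ b (t • b p))
        (G' := gramOf b (g1 (b p))) (t := 0)
        (fun i j => by simpa [gram, gramOf] using h1 (b p) (b i) (b j))
        (by simpa [hG0] using hdet) l m
      simpa [hG0] using this
    have hpd2 : ∀ q m i, HasDerivAt (fun t : ℝ => pd b q (fun y => gram γ b y m i) (t • b p))
        (g2 (b p) (b q) (b m) (b i)) 0 := fun q m i => by
      simpa [pd, gram] using h2 (b p) (b q) (b m) (b i)
    have hsum : HasDerivAt (fun t : ℝ => christoffel γ b l i j (t • b p))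
        ((1 / 2) * ∑ m, (-((gramOf b g)⁻¹ * (gramOf b (g1 (b p))) * (gramOf b g)⁻¹) l m *
          (2 * g (Γ (b i) (b j)) (b m)) + (gramOf b g)⁻¹ l m * (g2 (b p) (b i) (b j) (b m) +
            g2 (b p) (b j) (b i) (b m) - g2 (b p) (b m) (b i) (b j)))) 0 := by
      unfold christoffel
      refine HasDerivAt.const_mul _ (HasDerivAt.fun_sum fun m _ => ?_)
      have h3 := (hinv m).mul (((hpd2 i j m).add (hpd2 j i m)).sub (hpd2 m i j))
      simp only [Pi.add_apply, Pi.sub_apply, zero_smul, hpd, hG0] at h3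
      rw [hΓ]
      exact h3
    simp only [pd, zero_add]
    rw [hsum.deriv, Finset.sum_add_distrib]
    have h3 : ∑ m, -((gramOf b g)⁻¹ * (gramOf b (g1 (b p))) * (gramOf b g)⁻¹) l m *
          (2 * g (Γ (b i) (b j)) (b m)) =
        -2 * ∑ m, (gramOf b g)⁻¹ l m * g1 (b p) (b m) (Γ (b i) (b j)) := by
      have h4 : ∀ m, g1 (b p) (b m) (Γ (b i) (b j)) = ((gramOf b (g1 (b p))).mulVec
          ((gramOf b g)⁻¹.mulVec fun q => g (Γ (b i) (b j)) (b q))) m := by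
        intro m
        have h5 : ((gramOf b g)⁻¹.mulVec fun q => g (Γ (b i) (b j)) (b q)) =
            b.repr (Γ (b i) (b j)) := by
          ext q
          exact sum_gramOf_inv_repr b hsymm hdet _ _
        rw [h5]
        conv_lhs => rw [← b.sum_repr (Γ (b i) (b j))]
        simp only [map_sum, map_smul, smul_eq_mul, Matrix.mulVec, dotProduct, gramOf,
          Matrix.of_apply]
        exact Finset.sum_congr rfl fun _ _ => mul_comm _ _
      have h6 : ∑ m, (gramOf b g)⁻¹ l m * g1 (b p) (b m) (Γ (b i) (b j)) =
          (((gramOf b g)⁻¹ * (gramOf b (g1 (b p))) * (gramOf b g)⁻¹).mulVec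
            fun q => g (Γ (b i) (b j)) (b q)) l := by
        simp only [h4, ← Matrix.mulVec_mulVec]
        rfl
      rw [h6, Matrix.mulVec, dotProduct, Finset.mul_sum]
      refine Finset.sum_congr rfl fun m _ => by ring
    rw [h3]
    simp only [mul_sub, Finset.sum_sub_distrib, Finset.mul_sum, mul_add, Finset.sum_add_distrib,
      ← mul_div_assoc, add_div, sub_div]
    simp only [neg_mul, Finset.sum_neg_distrib, ← Finset.mul_sum, ← Finset.sum_div]
    ring
  -- The quadratic terms in the Christoffel symbols are traces of operators, and the trace may be
  -- taken in `ε`.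
  have htr : ∀ L : E →ₗ[ℝ] E, ∑ l, b.repr (L (b l)) l = ∑ a, g (L (ε a)) (ε a) / c a := by
    intro L
    refine Eq.trans ?_ (sum_gramOf_inv (b := b) ε hg hc (g ∘ₗ L))
    exact Finset.sum_congr rfl fun l _ => (sum_gramOf_inv_repr b hsymm hdet _ _).symm
  have e1 : ∑ l, pd b l (christoffel γ b l i j) 0 = ∑ a, ((g2 (ε a) (b i) (b j) (ε a) +
      g2 (ε a) (b j) (b i) (ε a) - g2 (ε a) (ε a) (b i) (b j)) / 2
      - g1 (ε a) (ε a) (Γ (b i) (b j))) / c a := by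
    have := sum_gramOf_inv (b := b) ε hg hc (LinearMap.mk₂ ℝ (fun l m =>
      (g2 l (b i) (b j) m + g2 l (b j) (b i) m - g2 l m (b i) (b j)) / 2
      - g1 l m (Γ (b i) (b j))) (by intros; simp; ring) (by intros; simp; ring)
        (by intros; simp; ring) (by intros; simp; ring))
    simp only [LinearMap.mk₂_apply] at this
    rw [← this]
    exact Finset.sum_congr rfl fun l _ => hder l l i j
  have e2 : ∑ l, pd b j (christoffel γ b l i l) 0 = ∑ a, ((g2 (b j) (b i) (ε a) (ε a) +
      g2 (b j) (ε a) (b i) (ε a) - g2 (b j) (ε a) (b i) (ε a)) / 2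
      - g1 (b j) (ε a) (Γ (b i) (ε a))) / c a := by
    have := sum_gramOf_inv (b := b) ε hg hc (LinearMap.mk₂ ℝ (fun l m =>
      (g2 (b j) (b i) l m + g2 (b j) l (b i) m - g2 (b j) m (b i) l) / 2
      - g1 (b j) m (Γ (b i) l)) (by intros; simp; ring) (by intros; simp; ring)
        (by intros; simp; ring) (by intros; simp; ring))
    simp only [LinearMap.mk₂_apply] at this
    rw [← this]
    exact Finset.sum_congr rfl fun l _ => hder j l i l
  have e3 : ∑ l, ∑ m, b.repr (Γ (b l) (b m)) l * b.repr (Γ (b i) (b j)) m =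
      ∑ a, g (Γ (ε a) (Γ (b i) (b j))) (ε a) / c a := by
    refine Eq.trans ?_ (htr (Γ.flip (Γ (b i) (b j))))
    refine Finset.sum_congr rfl fun l _ => ?_
    conv_rhs => rw [LinearMap.flip_apply, ← b.sum_repr (Γ (b i) (b j))]
    simp only [map_sum, map_smul, Finsupp.coe_finsetSum, Finset.sum_apply, Finsupp.smul_apply,
      smul_eq_mul, mul_comm]
  have e4 : ∑ l, ∑ m, b.repr (Γ (b j) (b m)) l * b.repr (Γ (b i) (b l)) m =
      ∑ a, g (Γ (b j) (Γ (b i) (ε a))) (ε a) / c a := by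
    refine Eq.trans ?_ (htr ((Γ (b j)).comp (Γ (b i))))
    refine Finset.sum_congr rfl fun l _ => ?_
    conv_rhs => rw [LinearMap.comp_apply, ← b.sum_repr (Γ (b i) (b l))]
    simp only [map_sum, map_smul, Finsupp.coe_finsetSum, Finset.sum_apply, Finsupp.smul_apply,
      smul_eq_mul, mul_comm]
  rw [ricciCoord]
  simp only [hchr, Finset.sum_sub_distrib]
  rw [e1, e2, e3, e4, ← Finset.sum_sub_distrib, ← Finset.sum_sub_distrib,
    ← Finset.sum_add_distrib]
  refine Finset.sum_congr rfl fun a _ => ?_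
  ring

end ChartRicci

/-! ### Derivatives of the exponential map up to third order -/

section ExpDerivatives

open NormedSpace

variable {A : Type*} [NormedRing A] [NormedAlgebra ℝ A] [CompleteSpace A]

lemma contDiff_exp : ContDiff ℝ ω (exp : A → A) :=
  contDiff_iff_contDiffAt.mpr fun x => (exp_analytic (𝕂 := ℝ) x).contDiffAt

lemma contDiff_fderiv_exp : ContDiff ℝ ω (fderiv ℝ (exp : A → A)) :=
  contDiff_exp.fderiv_right le_top

lemma hasFDerivAt_exp (x : A) : HasFDerivAt (exp : A → A) (fderiv ℝ exp x) x :=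
  (contDiff_exp.differentiable (by simp) x).hasFDerivAt

lemma fderiv_exp_zero (y : A) : fderiv ℝ (exp : A → A) 0 y = y := by
  rw [(hasFDerivAt_exp_zero (𝕂 := ℝ) (𝔸 := A)).fderiv]; rfl

lemma expSeries_apply (m : ℕ) (v : Fin m → A) :
    expSeries ℝ A m v = ((m.factorial : ℝ)⁻¹) • (List.ofFn v).prod := by
  simp [expSeries]

/-- The m-th derivative at the centre of a power series is its m-th coefficient summed over all
orders of the arguments; for `exp` that coefficient is the product divided by m!. -/
lemma fderiv_fderiv_exp_zero (y z : A) :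
    fderiv ℝ (fderiv ℝ (exp : A → A)) 0 y z = (1 / 2 : ℝ) • (y * z + z * y) := by
  have h := (exp_hasFPowerSeriesOnBall (𝕂 := ℝ) (𝔸 := A)).iteratedFDeriv_eq_sum_of_completeSpace
    (n := 2) ![y, z]
  have hu : (Finset.univ : Finset (Equiv.Perm (Fin 2))) = {1, Equiv.swap 0 1} := by decide
  rw [iteratedFDeriv_two_apply, hu, Finset.sum_pair (by decide)] at h
  simp only [expSeries_apply, ← smul_add, List.ofFn_succ, List.ofFn_zero, List.prod_cons,
    List.prod_nil] at h
  simpa [Nat.factorial] using h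

lemma fderiv_fderiv_fderiv_exp_zero (x y z : A) :
    fderiv ℝ (fderiv ℝ (fderiv ℝ (exp : A → A))) 0 x y z =
      (1 / 6 : ℝ) • (x * y * z + x * z * y + y * x * z + y * z * x + z * x * y + z * y * x) := by
  have h := (exp_hasFPowerSeriesOnBall (𝕂 := ℝ) (𝔸 := A)).iteratedFDeriv_eq_sum_of_completeSpace
    (n := 3) ![x, y, z]
  have hu : (Finset.univ : Finset (Equiv.Perm (Fin 3))) = {1, Equiv.swap 0 1, Equiv.swap 0 2,
    Equiv.swap 1 2, finRotate 3, (finRotate 3)⁻¹} := by decide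
  rw [hu, Finset.sum_insert (by decide), Finset.sum_insert (by decide),
    Finset.sum_insert (by decide), Finset.sum_insert (by decide), Finset.sum_pair (by decide)] at h
  simp only [expSeries_apply, ← smul_add, List.ofFn_succ, List.ofFn_zero, List.prod_cons,
    List.prod_nil] at h
  have h2 : iteratedFDeriv ℝ 3 (exp : A → A) 0 ![x, y, z] =
      fderiv ℝ (fderiv ℝ (fderiv ℝ (exp : A → A))) 0 x y z := by
    rw [iteratedFDeriv_succ_apply_right, iteratedFDeriv_two_apply]
    rfl
  rw [← h2, h]
  have e1 : (Equiv.swap (1 : Fin 3) 2) 0 = 0 := by decide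
  have e2 : ((finRotate 3)⁻¹ : Equiv.Perm (Fin 3)) 0 = 2 := by decide
  have e3 : ((finRotate 3)⁻¹ : Equiv.Perm (Fin 3)) 1 = 0 := by decide
  have e4 : ((finRotate 3)⁻¹ : Equiv.Perm (Fin 3)) 2 = 1 := by decide
  have e5 : (Equiv.swap (0 : Fin 3) 1) 2 = 2 := by decide
  have e6 : (Equiv.swap (0 : Fin 3) 2) 1 = 1 := by decide
  simp [Nat.factorial, e1, e2, e3, e4, e5, e6, mul_assoc]
  abel

lemma hasDerivAt_exp_comp {c : ℝ → A} {c' : A} {t : ℝ} (hc : HasDerivAt c c' t) :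
    HasDerivAt (fun s => exp (c s)) (fderiv ℝ exp (c t) c') t :=
  (hasFDerivAt_exp (c t)).comp_hasDerivAt t hc

lemma hasDerivAt_clm_comp {F : Type*} [NormedAddCommGroup F] [NormedSpace ℝ F]
    {f : A → A →L[ℝ] F} (hf : ContDiff ℝ ω f) (v : A) {c : ℝ → A} {c' : A} {t : ℝ}
    (hc : HasDerivAt c c' t) : HasDerivAt (fun s => f (c s) v) (fderiv ℝ f (c t) c' v) t :=
  (ContinuousLinearMap.apply ℝ F v).hasFDerivAt.comp_hasDerivAt t
    ((hf.differentiable (by simp) (c t)).hasFDerivAt.comp_hasDerivAt t hc)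

lemma hasDerivAt_line (x y : A) (t : ℝ) : HasDerivAt (fun s : ℝ => x + s • y) y t := by
  simpa using ((hasDerivAt_id t).smul_const y).const_add x

/-- The velocity of a curve of exponentials, translated to the identity. -/
def logDerivExp (x v : A) : A := exp (-x) * fderiv ℝ exp x v

lemma deriv_exp_line (x v : A) : deriv (fun t : ℝ => exp (x + t • v)) 0 = fderiv ℝ exp x v := by
  simpa using (hasDerivAt_exp_comp (hasDerivAt_line x v 0)).deriv

/-- The derivative of `logDerivExp`. -/
def logDerivExpDeriv (x y v : A) : A :=
  -(fderiv ℝ exp (-x) y) * fderiv ℝ exp x v + exp (-x) * fderiv ℝ (fderiv ℝ (exp : A → A)) x y v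

lemma hasDerivAt_logDerivExp (x y v : A) :
    HasDerivAt (fun s : ℝ => logDerivExp (x + s • y) v) (logDerivExpDeriv x y v) 0 := by
  have hl := hasDerivAt_line x y 0
  have := (hasDerivAt_exp_comp hl.fun_neg).mul (hasDerivAt_clm_comp contDiff_fderiv_exp v hl)
  simp only [zero_smul, add_zero, map_neg] at this
  exact this

lemma logDerivExpDeriv_zero (y v : A) : logDerivExpDeriv 0 y v = (-1 / 2 : ℝ) • (y * v - v * y) := by
  rw [logDerivExpDeriv, neg_zero, exp_zero, fderiv_exp_zero, fderiv_exp_zero,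
    fderiv_fderiv_exp_zero, one_mul, neg_mul]
  module

/-- The expansion behind this is exp(-x) D exp_x = (1 - e^{-ad x})/ad x = 1 - ad x/2 + (ad x)²/6 -
…. The quadratic term, polarised in `y` and `z`, gives the value here; the linear one gives
`logDerivExpDeriv_zero`. -/
lemma hasDerivAt_logDerivExpDeriv (z y v : A) :
    HasDerivAt (fun t : ℝ => logDerivExpDeriv (t • z) y v)
      ((1 / 6 : ℝ) • ((z * (y * v - v * y) - (y * v - v * y) * z) +
        (y * (z * v - v * z) - (z * v - v * z) * y))) 0 := by
  have hl : HasDerivAt (fun t : ℝ => t • z) z 0 := by simpa using hasDerivAt_line 0 z 0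
  have h1 := (hasDerivAt_clm_comp contDiff_fderiv_exp y hl.fun_neg).fun_neg
  have h2 := hasDerivAt_clm_comp contDiff_fderiv_exp v hl
  have h3 := hasDerivAt_exp_comp hl.fun_neg
  have h4 := (ContinuousLinearMap.apply ℝ A v).hasFDerivAt.comp_hasDerivAt (0 : ℝ)
    (hasDerivAt_clm_comp (contDiff_fderiv_exp (A := A).fderiv_right (m := ω) le_top) y hl)
  have := (h1.mul h2).add (h3.mul h4)
  refine this.congr_deriv ?_
  simp only [zero_smul, neg_zero, exp_zero, fderiv_exp_zero, fderiv_fderiv_exp_zero, map_neg,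
    ContinuousLinearMap.apply_apply, neg_apply, neg_neg,
    fderiv_fderiv_fderiv_exp_zero, Function.comp_apply, mul_sub, sub_mul, smul_mul_assoc,
    mul_smul_comm, mul_add, add_mul, ← mul_assoc, neg_mul, one_mul]
  module

end ExpDerivatives

/-! ### Diagonal forms on 𝔭 and the 2-jet of an invariant metric -/

section DiagForm

variable {𝕜 : Type*} [NormedDivisionRing 𝕜] [NormedAlgebra ℝ 𝕜] [FiniteDimensional ℝ 𝕜]
  [StarRing 𝕜] [StarModule ℝ 𝕜] [Scalars 𝕜] {n k : ℕ}

lemma projP_apply (X : Mat 𝕜 n k) (p q : Fin n × Fin k) : (projP X : Mat 𝕜 n k) p q =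
    if p.1 = q.1 then 0 else (1 / 2 : ℝ) • (X p q - star (X q p)) := rfl

lemma projP_apply_of_skew {X : Mat 𝕜 n k} (hX : star X = -X) (p q : Fin n × Fin k) :
    (projP X : Mat 𝕜 n k) p q = if p.1 = q.1 then 0 else X p q := by
  have h : star (X q p) = - X p q := by simpa using congrFun (congrFun hX p) q
  rw [projP_apply, h]
  split_ifs
  · rfl
  · rw [sub_neg_eq_add]; module

@[simp] lemma projP_coe (v : offDiag 𝕜 n k) : projP (v : Mat 𝕜 n k) = v := by
  refine offDiag_ext fun p q hpq => ?_
  rw [projP_apply_of_skew v.2.1, if_neg hpq.ne]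

lemma projP_blockDiag {X : Mat 𝕜 n k} (hX : IsBlockDiag X) : projP X = 0 := by
  refine offDiag_ext fun p q hpq => ?_
  rw [projP_apply, if_neg hpq.ne, hX p q hpq.ne, hX q p hpq.ne']
  simp

variable (𝕜 n k) in
/-- The form on `𝔭` that is `x_{ij}` times the standard one on the block `𝔭_{ij}`. -/
def diagForm (x : Fin n → Fin n → ℝ) : Form 𝕜 n k :=
  (wform 𝕜 n k x).compl₁₂ (offDiag 𝕜 n k).subtype (offDiag 𝕜 n k).subtype

lemma diagForm_apply (x : Fin n → Fin n → ℝ) (v w : offDiag 𝕜 n k) :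
    diagForm 𝕜 n k x v w = wform 𝕜 n k x (v : Mat 𝕜 n k) w := rfl

lemma diagForm_comm (x : Fin n → Fin n → ℝ) (v w : offDiag 𝕜 n k) :
    diagForm 𝕜 n k x v w = diagForm 𝕜 n k x w v := wform_comm _ _ _

lemma diagForm_congr {x y : Fin n → Fin n → ℝ} (h : ∀ i j, i ≠ j → x i j = y i j) :
    diagForm 𝕜 n k x = diagForm 𝕜 n k y := by
  ext v w
  exact wform_congr _ fun p q hv => h _ _ fun e => hv (offDiag_zero v.2 e)

lemma wform_projP {x : Fin n → Fin n → ℝ} (hx : ∀ i, x i i = 0) {X : Mat 𝕜 n k} (hX : star X = -X)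
    (Y : Mat 𝕜 n k) : wform 𝕜 n k x (projP X : Mat 𝕜 n k) Y = wform 𝕜 n k x X Y := by
  simp only [wform_apply, projP_apply_of_skew hX]
  congr 1
  refine Finset.sum_congr rfl fun p _ => Finset.sum_congr rfl fun q _ => ?_
  split_ifs with h
  · simp [h, hx]
  · rfl

lemma wform_one_stdVec (x : Fin n → Fin n → ℝ) (hx : IsSymm x) (v : offDiag 𝕜 n k)
    (e : Idx 𝕜 n k) : wform 𝕜 n k x (v : Mat 𝕜 n k) (stdBasis 𝕜 n k e : Mat 𝕜 n k) =
      x e.1.1.1.1 e.1.1.2.1 * re ((v : Mat 𝕜 n k) e.1.1.1 e.1.1.2 * star (unit e.2)) := by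
  obtain ⟨⟨⟨r, s⟩, h⟩, u⟩ := e
  have hrs : r ≠ s := fun e => h.ne (by rw [e])
  simp only [stdBasis_apply, stdVec, wform_apply]
  have key : ∀ p, ∑ q, x p.1 q.1 * re ((v : Mat 𝕜 n k) p q * star (elem r s (unit u : 𝕜) p q)) =
      if p = r ∨ p = s then x r.1 s.1 * re ((v : Mat 𝕜 n k) r s * star (unit u)) else 0 := by
    intro p
    by_cases h1 : p = r
    · subst h1
      rw [Finset.sum_eq_single s]
      · simp [elem]
      · intro q _ hq
        simp [elem, hq, hrs]
      · simp
    · by_cases h2 : p = s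
      · subst h2
        rw [Finset.sum_eq_single r]
        · simp only [elem, Matrix.of_apply, if_neg (fun e => h1 e.1 : ¬ (p = r ∧ r = p)),
            and_self, if_true, or_true, star_neg, star_star, mul_neg]
          rw [hx, ← neg_mul, ← offDiag_star v.2 p r, ← re_star (star _ * _), star_mul, star_star,
            re_mul_comm, re_mul_comm, hx]
        · intro q _ hq
          simp [elem, hq, hrs.symm]
        · simp
      · simp [elem, h1, h2]
  rw [Finset.sum_congr rfl fun p _ => key p, ← Finset.sum_filter, Finset.filter_or,
    Finset.filter_eq', Finset.filter_eq']
  simp only [Finset.mem_univ, if_true]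
  rw [Finset.sum_union (by simpa using hrs), Finset.sum_singleton, Finset.sum_singleton]
  ring

/-- `∑_{p,q} re (A_{pq} B_{qp})` -/
lemma wform_one_eq (X Y : Mat 𝕜 n k) : wform 𝕜 n k (fun _ _ => 1) X Y =
    (1 / 2 : ℝ) * re (X * star Y).trace := by
  simp [wform_apply, Matrix.trace, Matrix.mul_apply, Matrix.star_apply]

lemma re_trace_mul_comm (X Y : Mat 𝕜 n k) : re (X * Y).trace = re (Y * X).trace := by
  simp only [Matrix.trace, Matrix.mul_apply, Matrix.diag, map_sum]
  rw [Finset.sum_comm]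
  simp only [re_mul_comm (X _ _)]

/-- Skewness of ad X for the trace form. Over non-commutative scalars the trace is cyclic only after
taking real parts, which is enough. -/
lemma wform_one_comm {X : Mat 𝕜 n k} (hX : star X = -X) (Y Z : Mat 𝕜 n k) :
    wform 𝕜 n k (fun _ _ => 1) (comm X Y) Z = -wform 𝕜 n k (fun _ _ => 1) Y (comm X Z) := by
  rw [wform_one_eq, wform_one_eq]
  have h : comm X Y * star Z + Y * star (comm X Z) = X * (Y * star Z) - (Y * star Z) * X := by
    simp only [comm, star_sub, star_mul, hX]
    noncomm_ring
  have h2 : re (comm X Y * star Z + Y * star (comm X Z)).trace = 0 := by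
    rw [h, Matrix.trace_sub, map_sub, re_trace_mul_comm, sub_self]
  rw [Matrix.trace_add, map_add] at h2
  linarith

lemma comm_swap (X Y : Mat 𝕜 n k) : comm X Y = -comm Y X := by simp [comm]

lemma comm_self (X : Mat 𝕜 n k) : comm X X = 0 := by simp [comm]

lemma comm_add_left (X X' Y : Mat 𝕜 n k) : comm (X + X') Y = comm X Y + comm X' Y := by
  simp only [comm, add_mul, mul_add]; abel

lemma comm_add_right (X Y Y' : Mat 𝕜 n k) : comm X (Y + Y') = comm X Y + comm X Y' := by
  simp only [comm, add_mul, mul_add]; abel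

lemma comm_smul_left (c : ℝ) (X Y : Mat 𝕜 n k) : comm (c • X) Y = c • comm X Y := by
  simp only [comm, smul_mul_assoc, mul_smul_comm, smul_sub]

lemma comm_smul_right (c : ℝ) (X Y : Mat 𝕜 n k) : comm X (c • Y) = c • comm X Y := by
  simp only [comm, smul_mul_assoc, mul_smul_comm, smul_sub]

lemma star_comm_of_skew {X Y : Mat 𝕜 n k} (hX : star X = -X) (hY : star Y = -Y) :
    star (comm X Y) = -comm X Y := by
  simp only [comm, star_sub, star_mul, hX, hY]; noncomm_ring

/-- The operator `D` with `diagForm x = wform 1 (D ·, ·)`. -/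
def scaleP (x : Fin n → Fin n → ℝ) (hx : IsSymm x) : offDiag 𝕜 n k →ₗ[ℝ] offDiag 𝕜 n k where
  toFun v := ⟨scale x v, by
    refine ⟨?_, fun i a b => by simp [scale, v.2.2 i a b]⟩
    ext p q
    simp only [scale, Matrix.star_apply, Matrix.of_apply, star_smul, star_trivial,
      Matrix.neg_apply, offDiag_star v.2, smul_neg, hx p.1 q.1]⟩
  map_add' v w := by ext p q; simp [scale]
  map_smul' c v := by ext p q; simp [scale, smul_comm c]

lemma wform_scaleP {x : Fin n → Fin n → ℝ} (hx : IsSymm x) (σ : Fin n → Fin n → ℝ)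
    (v : offDiag 𝕜 n k) (Y : Mat 𝕜 n k) :
    wform 𝕜 n k σ (scaleP x hx v : Mat 𝕜 n k) Y = wform 𝕜 n k (fun i j => x i j * σ i j) v Y :=
  wform_scale _ _ _ _

/-- The `𝔭`-component of the commutator. -/
def commP : offDiag 𝕜 n k →ₗ[ℝ] offDiag 𝕜 n k →ₗ[ℝ] offDiag 𝕜 n k :=
  LinearMap.mk₂ ℝ (fun v w => projP (comm (v : Mat 𝕜 n k) w))
    (fun _ _ _ => by rw [Submodule.coe_add, comm_add_left, map_add])
    (fun _ _ _ => by rw [Submodule.coe_smul, comm_smul_left, map_smul])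
    (fun _ _ _ => by rw [Submodule.coe_add, comm_add_right, map_add])
    (fun _ _ _ => by rw [Submodule.coe_smul, comm_smul_right, map_smul])

lemma commP_apply (v w : offDiag 𝕜 n k) : commP v w = projP (comm (v : Mat 𝕜 n k) w) := rfl

/-- The first derivative of the metric in the exponential chart. -/
def metricD1 (g : Form 𝕜 n k) : offDiag 𝕜 n k →ₗ[ℝ] Form 𝕜 n k :=
  LinearMap.mk₂ ℝ (fun z v => (-1 / 2 : ℝ) • (g (commP z v) + (g v) ∘ₗ (commP z)))
  (fun _ _ _ => by ext; simp; ring) (fun _ _ _ => by ext; simp; ring)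
  (fun _ _ _ => by ext; simp; ring) (fun _ _ _ => by ext; simp; ring)

lemma metricD1_apply (g : Form 𝕜 n k) (z v w : offDiag 𝕜 n k) :
    metricD1 g z v w = -1 / 2 * (g (commP z v) w + g v (commP z w)) := rfl

variable (𝕜 n k) in
/-- The commutator as a bilinear map. -/
def commL : Mat 𝕜 n k →ₗ[ℝ] Mat 𝕜 n k →ₗ[ℝ] Mat 𝕜 n k :=
  LinearMap.mk₂ ℝ comm comm_add_left comm_smul_left comm_add_right comm_smul_right

/-- The `𝔭`-component of the symmetrized double commutator. -/
def nestP : offDiag 𝕜 n k →ₗ[ℝ] offDiag 𝕜 n k →ₗ[ℝ] offDiag 𝕜 n k →ₗ[ℝ] offDiag 𝕜 n k :=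
  LinearMap.mk₂ ℝ (fun z y => projP ∘ₗ (commL 𝕜 n k z ∘ₗ commL 𝕜 n k y +
      commL 𝕜 n k y ∘ₗ commL 𝕜 n k z) ∘ₗ (offDiag 𝕜 n k).subtype)
    (fun _ _ _ => by ext1; simp; abel) (fun _ _ _ => by ext1; simp)
    (fun _ _ _ => by ext1; simp; abel) (fun _ _ _ => by ext1; simp)

lemma nestP_apply (z y v : offDiag 𝕜 n k) : nestP z y v =
    projP (comm (z : Mat 𝕜 n k) (comm (y : Mat 𝕜 n k) v) +
      comm (y : Mat 𝕜 n k) (comm (z : Mat 𝕜 n k) v)) := rfl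

/-- The second derivative of the metric in the exponential chart. -/
def metricD2 (g : Form 𝕜 n k) : offDiag 𝕜 n k →ₗ[ℝ] offDiag 𝕜 n k →ₗ[ℝ] Form 𝕜 n k :=
  LinearMap.mk₂ ℝ (fun z y => (1 / 6 : ℝ) • (g.compl₁₂ (nestP z y) LinearMap.id +
      g.compl₁₂ LinearMap.id (nestP z y)) +
      (1 / 4 : ℝ) • (g.compl₁₂ (commP y) (commP z) + g.compl₁₂ (commP z) (commP y)))
    (fun _ _ _ => by ext; simp; ring) (fun _ _ _ => by ext; simp; ring)
    (fun _ _ _ => by ext; simp; ring) (fun _ _ _ => by ext; simp; ring)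

lemma metricD2_apply (g : Form 𝕜 n k) (z y v w : offDiag 𝕜 n k) :
    metricD2 g z y v w = 1 / 6 * (g (nestP z y v) w + g v (nestP z y w)) +
      1 / 4 * (g (commP y v) (commP z w) + g (commP z v) (commP y w)) := rfl

end DiagForm

/-! ### Derivatives of an invariant metric in the exponential chart -/

section Chart

variable {𝕜 : Type*} [NormedDivisionRing 𝕜] [NormedAlgebra ℝ 𝕜] [FiniteDimensional ℝ 𝕜]
  [StarRing 𝕜] [StarModule ℝ 𝕜] [Scalars 𝕜] {n k : ℕ}

open scoped Matrix.Norms.Operator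

lemma dexp_eq (X v : Mat 𝕜 n k) : dexp X v = logDerivExp X v := by
  have : CompleteSpace (Mat 𝕜 n k) := FiniteDimensional.complete ℝ _
  rw [logDerivExp, ← deriv_exp_line]
  rfl

lemma hasDerivAt_bilin {M : Type*} [NormedAddCommGroup M] [NormedSpace ℝ M] [FiniteDimensional ℝ M]
    (B : LinearMap.BilinForm ℝ M) {c c' : ℝ → M} {u u' : M} {t : ℝ} (h : HasDerivAt c u t)
    (h' : HasDerivAt c' u' t) :
    HasDerivAt (fun s => B (c s) (c' s)) (B u (c' t) + B (c t) u') t := by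
  have h1 : HasDerivAt (fun s => B.toContinuousBilinearMap (c s)) (B.toContinuousBilinearMap u) t :=
    B.toContinuousBilinearMap.hasFDerivAt.comp_hasDerivAt t h
  exact h1.clm_apply h'

/-- The metric `g` as a form on all matrices. -/
def extForm (g : Form 𝕜 n k) : LinearMap.BilinForm ℝ (Mat 𝕜 n k) := g.compl₁₂ projP projP

lemma chartMetric_eq (g : Form 𝕜 n k) (a : Mat 𝕜 n k) (X v w : offDiag 𝕜 n k) :
    chartMetric (fun _ => g) a X v w = extForm g (logDerivExp (X : Mat 𝕜 n k) v)
      (logDerivExp (X : Mat 𝕜 n k) w) := by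
  rw [chartMetric, dexp_eq, dexp_eq]
  rfl

lemma chartMetric_zero (g : Form 𝕜 n k) (a : Mat 𝕜 n k) (v w : offDiag 𝕜 n k) :
    chartMetric (fun _ => g) a 0 v w = g v w := by
  have : CompleteSpace (Mat 𝕜 n k) := FiniteDimensional.complete ℝ _
  rw [chartMetric_eq]
  simp [logDerivExp, fderiv_exp_zero, extForm]

lemma hasDerivAt_chartMetric_line (g : Form 𝕜 n k) (a : Mat 𝕜 n k) (x y v w : offDiag 𝕜 n k) :
    HasDerivAt (fun s : ℝ => chartMetric (fun _ => g) a (x + s • y) v w)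
      (extForm g (logDerivExpDeriv (x : Mat 𝕜 n k) y v) (logDerivExp (x : Mat 𝕜 n k) w) +
        extForm g (logDerivExp (x : Mat 𝕜 n k) v) (logDerivExpDeriv (x : Mat 𝕜 n k) y w)) 0 := by
  have : CompleteSpace (Mat 𝕜 n k) := FiniteDimensional.complete ℝ _
  have := hasDerivAt_bilin (extForm g) (hasDerivAt_logDerivExp (x : Mat 𝕜 n k) y v)
    (hasDerivAt_logDerivExp (x : Mat 𝕜 n k) y w)
  simp only [chartMetric_eq]
  simpa using this

lemma hasDerivAt_chartMetric (g : Form 𝕜 n k) (a : Mat 𝕜 n k) (z v w : offDiag 𝕜 n k) :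
    HasDerivAt (fun s : ℝ => chartMetric (fun _ => g) a (s • z) v w) (metricD1 g z v w) 0 := by
  have : CompleteSpace (Mat 𝕜 n k) := FiniteDimensional.complete ℝ _
  have := hasDerivAt_chartMetric_line g a 0 z v w
  simp only [zero_add] at this
  refine this.congr_deriv ?_
  simp only [Submodule.coe_zero, logDerivExpDeriv_zero, extForm, LinearMap.compl₁₂_apply,
    logDerivExp, fderiv_exp_zero, neg_zero, NormedSpace.exp_zero, one_mul, projP_coe, map_smul,
    metricD1_apply, LinearMap.smul_apply, smul_eq_mul]
  change _ * g (projP (comm (z : Mat 𝕜 n k) v)) w + _ * g v (projP (comm (z : Mat 𝕜 n k) w)) = _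
  rw [← commP_apply, ← commP_apply]
  ring

/-- The metric in the chart is a fixed form applied to two copies of `logDerivExp`, so the product
rule applies. The constant 1/6 in `metricD2` comes from the second derivative of one copy, and 1/4
is the square of the constant -1/2 of the first derivatives. -/
lemma hasDerivAt_deriv_chartMetric (g : Form 𝕜 n k) (a : Mat 𝕜 n k) (z y v w : offDiag 𝕜 n k) :
    HasDerivAt (fun t : ℝ => deriv (fun s : ℝ =>
      chartMetric (fun _ => g) a (t • z + s • y) v w) 0) (metricD2 g z y v w) 0 := by
  have : CompleteSpace (Mat 𝕜 n k) := FiniteDimensional.complete ℝ _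
  simp only [fun t : ℝ => (hasDerivAt_chartMetric_line g a (t • z) y v w).deriv]
  have hl : ∀ u : offDiag 𝕜 n k, HasDerivAt (fun t : ℝ => logDerivExp (t • (z : Mat 𝕜 n k)) u)
      (logDerivExpDeriv 0 (z : Mat 𝕜 n k) u) 0 := fun u => by
    have := hasDerivAt_logDerivExp 0 (z : Mat 𝕜 n k) (u : Mat 𝕜 n k)
    simp only [zero_add] at this
    exact this
  have h1 := hasDerivAt_bilin (extForm g)
    (hasDerivAt_logDerivExpDeriv (z : Mat 𝕜 n k) y v) (hl w)
  have h2 := hasDerivAt_bilin (extForm g) (hl v)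
    (hasDerivAt_logDerivExpDeriv (z : Mat 𝕜 n k) y w)
  have h3 := h1.add h2
  simp only [Submodule.coe_smul]
  refine h3.congr_deriv ?_
  simp only [zero_smul, logDerivExpDeriv_zero, extForm, LinearMap.compl₁₂_apply,
    logDerivExp, fderiv_exp_zero, neg_zero, NormedSpace.exp_zero, one_mul, projP_coe, map_smul,
    metricD2_apply, LinearMap.smul_apply, smul_eq_mul, nestP_apply, commP_apply, comm]
  ring

end Chart

/-! ### The Ricci tensor of a diagonal metric -/

section RicciDiag

variable {𝕜 : Type*} [NormedDivisionRing 𝕜] [NormedAlgebra ℝ 𝕜] [FiniteDimensional ℝ 𝕜]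
  [StarRing 𝕜] [StarModule ℝ 𝕜] [Scalars 𝕜] {n k : ℕ}

variable {x : Fin n → Fin n → ℝ} (hx : IsSymm x)

lemma isSymm_inv {x : Fin n → Fin n → ℝ} (hx : IsSymm x) : IsSymm fun i j => (x i j)⁻¹ :=
  fun i j => by simp only [hx i j]

/-- The weight which is `1` off the diagonal blocks. -/
def offWeight (n : ℕ) (i j : Fin n) : ℝ := if i = j then 0 else 1

lemma offWeight_symm : IsSymm (offWeight n) := fun i j => by simp [offWeight, eq_comm]

/-- The Levi-Civita connection of `diagForm x` at the base point. -/
def conn : offDiag 𝕜 n k →ₗ[ℝ] offDiag 𝕜 n k →ₗ[ℝ] offDiag 𝕜 n k :=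
  LinearMap.mk₂ ℝ (fun v w => (1 / 2 : ℝ) • scaleP _ (isSymm_inv hx)
      (commP v (scaleP x hx w) + commP w (scaleP x hx v)))
    (fun _ _ _ => by simp only [map_add, LinearMap.add_apply]; module)
    (fun _ _ _ => by simp only [map_add, map_smul, LinearMap.smul_apply]; module)
    (fun _ _ _ => by simp only [map_add, LinearMap.add_apply]; module)
    (fun _ _ _ => by simp only [map_add, map_smul, LinearMap.smul_apply]; module)

lemma conn_apply (v w : offDiag 𝕜 n k) : conn hx v w = (1 / 2 : ℝ) • scaleP _ (isSymm_inv hx)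
      (commP v (scaleP x hx w) + commP w (scaleP x hx v)) := rfl

/-- Moving the weights into the operator `scaleP` leaves the trace form, for which brackets can be
shifted from one argument to the other. -/
lemma diagForm_eq_scaleP (v w : offDiag 𝕜 n k) :
    diagForm 𝕜 n k x v w = wform 𝕜 n k (fun _ _ => 1) (v : Mat 𝕜 n k) (scaleP x hx w) := by
  rw [wform_comm, wform_scaleP, diagForm_apply, wform_comm]
  simp

lemma skew_comm (v w : offDiag 𝕜 n k) :
    star (comm (v : Mat 𝕜 n k) w) = -comm (v : Mat 𝕜 n k) w := star_comm_of_skew v.2.1 w.2.1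

lemma diagForm_commP (h0 : ∀ i, x i i = 0) (v w z : offDiag 𝕜 n k) :
    diagForm 𝕜 n k x (commP v w) z =
      wform 𝕜 n k (fun _ _ => 1) (comm (v : Mat 𝕜 n k) w) (scaleP x hx z) := by
  rw [commP_apply, diagForm_apply, wform_projP h0 (skew_comm v w), wform_comm _ _ (scaleP x hx z : Mat 𝕜 n k),
    wform_scaleP, wform_comm]
  simp

lemma diagForm_nestP (h0 : ∀ i, x i i = 0) (z y v w : offDiag 𝕜 n k) :
    diagForm 𝕜 n k x (nestP z y v) w =
      -wform 𝕜 n k (fun _ _ => 1) (comm (y : Mat 𝕜 n k) v)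
        (comm (z : Mat 𝕜 n k) (scaleP x hx w)) -
      wform 𝕜 n k (fun _ _ => 1) (comm (z : Mat 𝕜 n k) v)
        (comm (y : Mat 𝕜 n k) (scaleP x hx w)) := by
  have hs : star (comm (z : Mat 𝕜 n k) (comm (y : Mat 𝕜 n k) v) +
      comm (y : Mat 𝕜 n k) (comm (z : Mat 𝕜 n k) v)) = -(comm (z : Mat 𝕜 n k)
        (comm (y : Mat 𝕜 n k) v) + comm (y : Mat 𝕜 n k) (comm (z : Mat 𝕜 n k) v)) := by
    rw [star_add, star_comm_of_skew z.2.1 (skew_comm y v), star_comm_of_skew y.2.1 (skew_comm z v),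
      neg_add]
  have h1 : ∀ X : Mat 𝕜 n k, wform 𝕜 n k x X (w : Mat 𝕜 n k) =
      wform 𝕜 n k (fun _ _ => 1) X (scaleP x hx w) := fun X => by
    rw [wform_comm _ _ (scaleP x hx w : Mat 𝕜 n k), wform_scaleP, wform_comm]
    simp
  rw [nestP_apply, diagForm_apply, wform_projP h0 hs, h1, map_add, LinearMap.add_apply,
    wform_one_comm z.2.1 (comm (y : Mat 𝕜 n k) v), wform_one_comm y.2.1 (comm (z : Mat 𝕜 n k) v)]
  ring

lemma diagForm_commP_commP (h0 : ∀ i, x i i = 0) (v w v' w' : offDiag 𝕜 n k) :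
    diagForm 𝕜 n k x (commP v w) (commP v' w') =
      wform 𝕜 n k x (comm (v : Mat 𝕜 n k) w) (comm (v' : Mat 𝕜 n k) w') := by
  rw [commP_apply, commP_apply, diagForm_apply, wform_projP h0 (skew_comm v w), wform_comm,
    wform_projP h0 (skew_comm v' w'), wform_comm]

lemma metricD1_diagForm (h0 : ∀ i, x i i = 0) (z v w : offDiag 𝕜 n k) :
    metricD1 (diagForm 𝕜 n k x) z v w =
      -1 / 2 * (wform 𝕜 n k (fun _ _ => 1) (comm (z : Mat 𝕜 n k) v) (scaleP x hx w) +
        wform 𝕜 n k (fun _ _ => 1) (comm (z : Mat 𝕜 n k) w) (scaleP x hx v)) := by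
  rw [metricD1_apply, diagForm_comm x v, diagForm_commP hx h0, diagForm_commP hx h0]

lemma scaleP_scaleP_inv (h1 : ∀ i j, i ≠ j → x i j ≠ 0)
    (v : offDiag 𝕜 n k) : scaleP x hx (scaleP _ (isSymm_inv hx) v) = v := by
  refine offDiag_ext fun p q hpq => ?_
  simp [scaleP, scale, smul_smul, mul_inv_cancel₀ (h1 _ _ hpq.ne)]

lemma wform_one_comm' (X Y Z : offDiag 𝕜 n k) :
    wform 𝕜 n k (fun _ _ => 1) (comm (X : Mat 𝕜 n k) Y) (Z : Mat 𝕜 n k) =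
      -wform 𝕜 n k (fun _ _ => 1) (comm (X : Mat 𝕜 n k) Z) (Y : Mat 𝕜 n k) := by
  rw [wform_one_comm X.2.1, wform_comm]

lemma wform_offWeight (Y : Mat 𝕜 n k) (z : offDiag 𝕜 n k) :
    wform 𝕜 n k (offWeight n) Y (z : Mat 𝕜 n k) = wform 𝕜 n k (fun _ _ => 1) Y (z : Mat 𝕜 n k) := by
  rw [wform_comm, wform_comm _ Y]
  refine wform_congr _ fun p q hz => ?_
  rw [offWeight, if_neg fun e => hz (offDiag_zero z.2 e)]

lemma wform_one_projP {X : Mat 𝕜 n k} (hX : star X = -X) (Y : Mat 𝕜 n k) :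
    wform 𝕜 n k (fun _ _ => 1) (projP X : Mat 𝕜 n k) Y = wform 𝕜 n k (offWeight n) X Y := by
  rw [wform_comm, ← wform_offWeight, wform_comm, wform_projP (by simp [offWeight]) hX]

/-- This is the Koszul formula for the 1-jet of the metric. Christoffel symbols of a chart are
symmetric, so `conn` is only the symmetric part of the Levi-Civita connection of a reductive space
and has no term ½[v, w]. -/
lemma two_mul_conn (h0 : ∀ i, x i i = 0) (h1 : ∀ i j, i ≠ j → x i j ≠ 0)
    (v w z : offDiag 𝕜 n k) :
    2 * diagForm 𝕜 n k x (conn hx v w) z =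
      metricD1 (diagForm 𝕜 n k x) v w z + metricD1 (diagForm 𝕜 n k x) w v z -
        metricD1 (diagForm 𝕜 n k x) z v w := by
  have e1 : 2 * diagForm 𝕜 n k x (conn hx v w) z =
      wform 𝕜 n k (fun _ _ => 1) (comm (v : Mat 𝕜 n k) (scaleP x hx w)) (z : Mat 𝕜 n k) +
      wform 𝕜 n k (fun _ _ => 1) (comm (w : Mat 𝕜 n k) (scaleP x hx v)) (z : Mat 𝕜 n k) := by
    rw [diagForm_comm, diagForm_eq_scaleP hx, conn_apply, map_smul, scaleP_scaleP_inv hx h1,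
      Submodule.coe_smul, map_smul, Submodule.coe_add, map_add, commP_apply, commP_apply,
      wform_comm _ (z : Mat 𝕜 n k), wform_comm _ (z : Mat 𝕜 n k), smul_eq_mul]
    rw [wform_one_projP (skew_comm _ _), wform_one_projP (skew_comm _ _),
      wform_offWeight, wform_offWeight]
    ring
  rw [e1, metricD1_diagForm hx h0, metricD1_diagForm hx h0, metricD1_diagForm hx h0,
    wform_one_comm' v (scaleP x hx w) z, wform_one_comm' w (scaleP x hx v) z,
    comm_swap (z : Mat 𝕜 n k) v, comm_swap (z : Mat 𝕜 n k) w, comm_swap (w : Mat 𝕜 n k) v]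
  simp only [map_neg, LinearMap.neg_apply]
  ring

/-- The product of the commutators of `a` and `b` with `e`. -/
def commForm (σ : Fin n → Fin n → ℝ) (e a b : offDiag 𝕜 n k) : ℝ :=
  wform 𝕜 n k σ (comm (a : Mat 𝕜 n k) e) (comm (b : Mat 𝕜 n k) e)

lemma commForm_comm (σ : Fin n → Fin n → ℝ) (e a b : offDiag 𝕜 n k) :
    commForm σ e a b = commForm σ e b a := wform_comm _ _ _

/-- The summand of the Ricci tensor that belongs to a basis vector. -/
lemma ricci_summand (h0 : ∀ i, x i i = 0) (h1 : ∀ i j, i ≠ j → x i j ≠ 0) {e : offDiag 𝕜 n k}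
    {c : ℝ} (hc : scaleP x hx e = c • e) (v w : offDiag 𝕜 n k) :
    (metricD2 (diagForm 𝕜 n k x) e v w e + metricD2 (diagForm 𝕜 n k x) e w v e
      - metricD2 (diagForm 𝕜 n k x) e e v w) / 2
      - metricD1 (diagForm 𝕜 n k x) e e (conn hx v w)
      - metricD2 (diagForm 𝕜 n k x) w v e e / 2
      + metricD1 (diagForm 𝕜 n k x) w e (conn hx v e)
      + diagForm 𝕜 n k x (conn hx e (conn hx v w)) e
      - diagForm 𝕜 n k x (conn hx w (conn hx v e)) e =
    c / 2 * commForm (fun _ _ => 1) e v w +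
      1 / 4 * (commForm (fun _ _ => 1) e v (scaleP x hx w) +
        commForm (fun _ _ => 1) e (scaleP x hx v) w)
      - 3 / 4 * commForm x e v w + c ^ 2 / 4 * commForm (fun i j => (x i j)⁻¹) e v w
      - c / 4 * (commForm (fun i j => (x i j)⁻¹) e (scaleP x hx v) w +
        commForm (fun i j => (x i j)⁻¹) e v (scaleP x hx w))
      + 1 / 4 * commForm (fun i j => (x i j)⁻¹) e (scaleP x hx v) (scaleP x hx w) := by
  set S := fun (σ : Fin n → Fin n → ℝ) (a b : offDiag 𝕜 n k) => commForm (𝕜 := 𝕜) (n := n) (k := k) σ e a b with hS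
  set D := scaleP (𝕜 := 𝕜) (k := k) x hx with hD
  set y := fun i j => (x i j)⁻¹ with hy
  have hSc : ∀ σ a b, S σ a b = S σ b a := fun σ a b => commForm_comm σ e a b
  have hSd : ∀ σ (a b : offDiag 𝕜 n k), wform 𝕜 n k σ (comm (a : Mat 𝕜 n k) e)
    (comm (b : Mat 𝕜 n k) e) = S σ a b := fun σ a b => rfl
  have hs : ∀ a : offDiag 𝕜 n k, comm (e : Mat 𝕜 n k) a = -comm (a : Mat 𝕜 n k) e :=
    fun a => comm_swap _ _
  have t1 : ∀ v w : offDiag 𝕜 n k, metricD2 (diagForm 𝕜 n k x) e v w e =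
      1 / 6 * (c * S (fun _ _ => 1) v w + S (fun _ _ => 1) v (D w)) - 1 / 4 * S x v w := by
    intro v w
    rw [metricD2_apply, diagForm_comm x w, diagForm_nestP hx h0, diagForm_nestP hx h0,
      diagForm_commP_commP h0, diagForm_commP_commP h0, ← hD, hc, Submodule.coe_smul]
    simp only [comm_smul_right, comm_self, hs, smul_zero, map_zero, map_neg, map_smul,
      LinearMap.neg_apply, smul_eq_mul, LinearMap.zero_apply, hSd]
    rw [hSc x v w, hSc (fun _ _ => 1) v w]
    ring
  have t2 : metricD2 (diagForm 𝕜 n k x) e e v w =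
      -(1 / 3) * (S (fun _ _ => 1) v (D w) + S (fun _ _ => 1) (D v) w) + 1 / 2 * S x v w := by
    rw [metricD2_apply, diagForm_comm x v, diagForm_nestP hx h0, diagForm_nestP hx h0,
      diagForm_commP_commP h0]
    simp only [hs, map_neg, LinearMap.neg_apply, hSd, ← hD]
    rw [hSc _ (D v) w]
    ring
  have t3 : metricD2 (diagForm 𝕜 n k x) w v e e =
      -(2 / 3) * c * S (fun _ _ => 1) v w + 1 / 2 * S x v w := by
    rw [metricD2_apply, diagForm_comm x e, diagForm_nestP hx h0,
      diagForm_commP_commP h0, diagForm_commP_commP h0, ← hD, hc, Submodule.coe_smul]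
    simp only [comm_smul_right, map_smul, smul_eq_mul, hSd]
    rw [hSc x w v, hSc (fun _ _ => 1) w v]
    ring
  -- By skewness, [Z, e] is orthogonal to e, and D e is a multiple of e. This kills the first
  -- derivatives in which e occurs twice, and with them the component of `conn hx e Z` along e.
  have h2 : ∀ Z : offDiag 𝕜 n k,
      wform 𝕜 n k (fun _ _ => 1) (comm (Z : Mat 𝕜 n k) e) (e : Mat 𝕜 n k) = 0 := fun Z => by
    have := wform_one_comm' Z e e
    linarith
  have hDe : ∀ X : Mat 𝕜 n k, wform 𝕜 n k (fun _ _ => 1) X (D e : Mat 𝕜 n k) =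
      c * wform 𝕜 n k (fun _ _ => 1) X (e : Mat 𝕜 n k) := fun X => by
    rw [hc, Submodule.coe_smul, map_smul, smul_eq_mul]
  have t4 : ∀ Z, metricD1 (diagForm 𝕜 n k x) e e Z = 0 := fun Z => by
    rw [metricD1_diagForm hx h0, hDe]
    simp [comm_self, hs, h2]
  have t4' : ∀ Z, metricD1 (diagForm 𝕜 n k x) e Z e = 0 := fun Z => by
    rw [metricD1_diagForm hx h0, hDe]
    simp [comm_self, hs, h2]
  have t4'' : ∀ Z, metricD1 (diagForm 𝕜 n k x) Z e e = 0 := fun Z => by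
    rw [metricD1_diagForm hx h0, hDe]
    simp [h2]
  have t5 : ∀ Z, diagForm 𝕜 n k x (conn hx e Z) e = 0 := fun Z => by
    have := two_mul_conn hx h0 h1 e Z e
    rw [t4, t4', t4''] at this
    linarith
  set Z := conn hx v e with hZ
  -- The vector `Z` enters both scaled and unscaled. In D Z the operator cancels the inverse in
  -- `conn` and only the projection to 𝔭 is left, whence the weight `offWeight`; in `Z` itself the
  -- inverse weights `y` remain.
  have hDZ : ∀ a : offDiag 𝕜 n k, wform 𝕜 n k (fun _ _ => 1) (comm (a : Mat 𝕜 n k) e)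
      (D Z : Mat 𝕜 n k) = 1 / 2 * (c * S (offWeight n) a v - S (offWeight n) a (D v)) := by
    intro a
    rw [hZ, conn_apply, map_smul, scaleP_scaleP_inv hx h1, ← hD, hc, map_smul,
      Submodule.coe_smul, map_smul, Submodule.coe_add, map_add, Submodule.coe_smul, map_smul,
      commP_apply, commP_apply, wform_comm, wform_comm _ _ (projP (comm (e : Mat 𝕜 n k) _) : Mat 𝕜 n k),
      wform_one_projP (skew_comm _ _), wform_one_projP (skew_comm _ _), hs]
    simp only [map_neg, LinearMap.neg_apply, hSd, smul_eq_mul]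
    rw [hSc _ v a, hSc _ (D v) a]
    ring
  have hZ' : ∀ a : offDiag 𝕜 n k, wform 𝕜 n k (fun _ _ => 1) (comm (a : Mat 𝕜 n k) e)
      (Z : Mat 𝕜 n k) = 1 / 2 * (c * S y a v - S y a (D v)) := by
    intro a
    have hy0 : ∀ i, y i i = 0 := fun i => by simp [hy, h0]
    have hy1 : (fun i j => y i j * 1) = y := by simp
    rw [hZ, conn_apply, ← hD, hc, map_smul, Submodule.coe_smul, map_smul, wform_comm, wform_scaleP,
      Submodule.coe_add, map_add, Submodule.coe_smul, map_smul, commP_apply, commP_apply, hy1,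
      LinearMap.add_apply, LinearMap.smul_apply,
      wform_projP hy0 (skew_comm _ _), wform_projP hy0 (skew_comm _ _), hs]
    simp only [map_neg, LinearMap.neg_apply, hSd, smul_eq_mul]
    rw [hSc _ v a, hSc _ (D v) a]
    ring
  have t6 : metricD1 (diagForm 𝕜 n k x) w e Z =
      -1 / 4 * (c * S (offWeight n) w v - S (offWeight n) w (D v)) +
        c / 4 * (c * S y w v - S y w (D v)) := by
    rw [metricD1_diagForm hx h0, ← hD, hDZ, hDe, wform_one_comm' w Z e, hZ']
    ring
  have t7 : diagForm 𝕜 n k x (conn hx w Z) e =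
      -1 / 4 * (c * S (offWeight n) w v - S (offWeight n) w (D v)) +
        1 / 4 * (c * S y (D w) v - S y (D w) (D v)) := by
    have h3 := two_mul_conn hx h0 h1 w Z e
    rw [metricD1_diagForm hx h0, metricD1_diagForm hx h0, metricD1_diagForm hx h0, ← hD,
      comm_swap (Z : Mat 𝕜 n k) w, comm_swap (Z : Mat 𝕜 n k) e, hs w] at h3
    simp only [map_neg, LinearMap.neg_apply] at h3
    rw [hDZ, wform_one_comm' e Z (D w), hs (D w)] at h3
    simp only [map_neg, LinearMap.neg_apply] at h3
    rw [hZ'] at h3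
    linarith
  rw [t1, t1, t2, t3, t4, t5, t6, t7]
  rw [hSc (fun _ _ => 1) w v, hSc x w v, hSc y w v, hSc y w (D v), hSc y (D w) v,
    hSc y (D w) (D v), hSc (fun _ _ => 1) w (D v)]
  simp only [hS]
  ring

/-- The coefficients of the Ricci tensor of `diagForm x`. -/
def ricCoef (𝕜 : Type*) [NormedDivisionRing 𝕜] [NormedAlgebra ℝ 𝕜] [StarRing 𝕜]
    [StarModule ℝ 𝕜] [Scalars 𝕜] {n : ℕ} (k : ℕ) (x : Fin n → Fin n → ℝ) (i j : Fin n) : ℝ :=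
  2 * (k * δ 𝕜 - (2 - δ 𝕜)) + k * δ 𝕜 * ∑ l with l ≠ i ∧ l ≠ j,
    (1 + (x i j ^ 2 - x i l ^ 2 - x j l ^ 2) / (2 * x i l * x j l))

/-- The terms with third index `i` or `j` are split off. They are the only ones that involve
diagonal values of `σ`, that is, the 𝔨-components of the brackets. -/
lemma contr_eq {τ σ : Fin n → Fin n → ℝ} (hτ : IsSymm τ) (hτ0 : ∀ i, τ i i = 0) {i j : Fin n}
    (hij : i ≠ j) : contr 𝕜 k τ σ i j = (k * δ 𝕜 - (2 - δ 𝕜)) * (τ i j * (σ i i + σ j j)) +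
      k * δ 𝕜 * ∑ l with l ≠ i ∧ l ≠ j, (τ i l * σ j l + τ j l * σ i l) := by
  have h : ∑ l, (τ i l * σ j l + τ j l * σ i l) = (τ i j * (σ i i + σ j j)) +
      ∑ l with l ≠ i ∧ l ≠ j, (τ i l * σ j l + τ j l * σ i l) := by
    rw [← Finset.sum_filter_add_sum_filter_not Finset.univ (fun l => l ≠ i ∧ l ≠ j), add_comm]
    congr 1
    have : (Finset.univ.filter fun l : Fin n => ¬ (l ≠ i ∧ l ≠ j)) = {i, j} := by
      ext l
      simp only [Finset.mem_filter, Finset.mem_univ, true_and, Finset.mem_insert,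
        Finset.mem_singleton]
      tauto
    rw [this, Finset.sum_pair hij, hτ0, hτ0, hτ j i]
    ring
  rw [contr, h]
  ring

/-- These six sums are what `ricci_summand` produces after summation over the basis. The parts with
third index `i` or `j` combine to the constant term of `ricCoef`, and every other third index
contributes one summand of it. -/
lemma ricCoef_eq (hx : IsSymm x) (h0 : ∀ i, x i i = 0) (h1 : ∀ i j, i ≠ j → x i j ≠ 0) {i j : Fin n}
    (hij : i ≠ j) :
    1 / 2 * contr 𝕜 k (offWeight n) (fun _ _ => 1) i j +
      1 / 2 * x i j * contr 𝕜 k (fun i j => (x i j)⁻¹) (fun _ _ => 1) i j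
      - 3 / 4 * contr 𝕜 k (fun i j => (x i j)⁻¹) x i j
      + 1 / 4 * contr 𝕜 k x (fun i j => (x i j)⁻¹) i j
      - 1 / 2 * x i j * contr 𝕜 k (offWeight n) (fun i j => (x i j)⁻¹) i j
      + 1 / 4 * x i j ^ 2 * contr 𝕜 k (fun i j => (x i j)⁻¹) (fun i j => (x i j)⁻¹) i j =
      ricCoef 𝕜 k x i j := by
  have hy0 : ∀ i, (x i i)⁻¹ = 0 := fun i => by rw [h0, inv_zero]
  have ho : ∀ i, offWeight n i i = 0 := fun i => by simp [offWeight]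
  rw [contr_eq offWeight_symm ho hij, contr_eq (isSymm_inv hx) hy0 hij,
    contr_eq (isSymm_inv hx) hy0 hij, contr_eq hx h0 hij, contr_eq offWeight_symm ho hij,
    contr_eq (isSymm_inv hx) hy0 hij]
  have key : ∑ l with l ≠ i ∧ l ≠ j,
      (1 + (x i j ^ 2 - x i l ^ 2 - x j l ^ 2) / (2 * x i l * x j l)) =
      1 / 2 * (∑ l with l ≠ i ∧ l ≠ j, (offWeight n i l * 1 + offWeight n j l * 1)) +
      1 / 2 * x i j * (∑ l with l ≠ i ∧ l ≠ j, ((x i l)⁻¹ * 1 + (x j l)⁻¹ * 1))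
      - 3 / 4 * (∑ l with l ≠ i ∧ l ≠ j, ((x i l)⁻¹ * x j l + (x j l)⁻¹ * x i l)) +
      1 / 4 * (∑ l with l ≠ i ∧ l ≠ j, (x i l * (x j l)⁻¹ + x j l * (x i l)⁻¹))
      - 1 / 2 * x i j * (∑ l with l ≠ i ∧ l ≠ j,
        (offWeight n i l * (x j l)⁻¹ + offWeight n j l * (x i l)⁻¹)) +
      1 / 4 * x i j ^ 2 * (∑ l with l ≠ i ∧ l ≠ j,
        ((x i l)⁻¹ * (x j l)⁻¹ + (x j l)⁻¹ * (x i l)⁻¹)) := by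
    simp only [Finset.mul_sum, ← Finset.sum_add_distrib, ← Finset.sum_sub_distrib]
    refine Finset.sum_congr rfl fun l hl => ?_
    simp only [Finset.mem_filter, Finset.mem_univ, true_and] at hl
    rw [offWeight, offWeight, if_neg hl.1.symm, if_neg hl.2.symm]
    have := h1 i l hl.1.symm
    have := h1 j l hl.2.symm
    field_simp
    ring
  have ho' : offWeight n i j = 1 := by simp [offWeight, hij]
  rw [ricCoef, key, h0, h0, inv_zero, ho']
  have := h1 i j hij
  field_simp
  ring

lemma scaleP_stdBasis (e : Idx 𝕜 n k) :
    scaleP x hx (stdBasis 𝕜 n k e) = x e.1.1.1.1 e.1.1.2.1 • stdBasis 𝕜 n k e := by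
  refine offDiag_ext fun p q hpq => ?_
  have h := stdVec_apply e (⟨⟨(p, q), hpq⟩, e.2⟩ : Idx 𝕜 n k)
  simp only at h
  simp only [scaleP, LinearMap.coe_mk, AddHom.coe_mk, scale, Matrix.of_apply, stdBasis_apply,
    Submodule.coe_smul, Matrix.smul_apply]
  rw [h]
  split_ifs with h'
  · rw [← h']
  · simp

lemma diagForm_stdBasis (hx : IsSymm x) (e e' : Idx 𝕜 n k) :
    diagForm 𝕜 n k x (stdBasis 𝕜 n k e) (stdBasis 𝕜 n k e') =
      if e = e' then x e.1.1.1.1 e.1.1.2.1 else 0 := by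
  rw [diagForm_apply, wform_one_stdVec x hx, stdBasis_apply, stdVec_apply]
  by_cases h : e = e'
  · subst h
    simp [re_unit]
  · rw [if_neg h]
    by_cases h1 : e'.1 = e.1
    · have h2 : e.2 ≠ e'.2 := fun h' => h (Prod.ext h1.symm h')
      simp [h1, re_unit, h2]
    · simp [h1]

/-- The Ricci tensor of a diagonal metric. -/
theorem ricciAt_diagForm (hx : IsSymm x) (h0 : ∀ i, x i i = 0) (h1 : ∀ i j, i ≠ j → x i j ≠ 0)
    (a : Mat 𝕜 n k) :
    ricciAt (fun _ => diagForm 𝕜 n k x) a = diagForm 𝕜 n k (ricCoef 𝕜 k x) := by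
  have hmat : Matrix.of (ricciCoord (chartMetric (fun _ => diagForm 𝕜 n k x) a)
      (basisP 𝕜 n k) 0) = LinearMap.BilinForm.toMatrix (basisP 𝕜 n k)
        (diagForm 𝕜 n k (ricCoef 𝕜 k x)) := by
    ext i j
    rw [Matrix.of_apply, LinearMap.BilinForm.toMatrix_apply,
      ricciCoord_eq_sum (b := basisP 𝕜 n k) (stdBasis 𝕜 n k) (diagForm_comm x)
        (diagForm_stdBasis hx) (fun e => h1 _ _ e.1.2.ne) (chartMetric_zero _ a)
        (hasDerivAt_chartMetric _ a) (hasDerivAt_deriv_chartMetric _ a) (two_mul_conn hx h0 h1)]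
    set v := basisP 𝕜 n k i
    set w := basisP 𝕜 n k j
    simp only [ricci_summand hx h0 h1 (scaleP_stdBasis hx _)]
    have hy0 : ∀ i, (x i i)⁻¹ = 0 := fun i => by rw [h0, inv_zero]
    have ho : ∀ i, offWeight n i i = 0 := fun i => by simp [offWeight]
    -- Each summand is divided by the value `c` of the metric on the basis vector. The powers c, 1
    -- and c² in `ricci_summand` thereby become the weights `offWeight`, 1/x and x, which play the
    -- role of `τ`.
    have hS : ∀ (τ σ : Fin n → Fin n → ℝ) (a b : offDiag 𝕜 n k), IsSymm τ → (∀ i, τ i i = 0) →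
        IsSymm σ → ∑ e : Idx 𝕜 n k, τ e.1.1.1.1 e.1.1.2.1 * commForm σ (stdBasis 𝕜 n k e) a b =
          wform 𝕜 n k (contr 𝕜 k τ σ) a b := fun τ σ a b hτ hτ0 hσ =>
      sum_wform_comm hτ hτ0 hσ a.2 b.2
    have hyS := isSymm_inv hx
    have hone : IsSymm (fun _ _ : Fin n => (1 : ℝ)) := fun _ _ => rfl
    have e1 := hS _ _ v w offWeight_symm ho hone
    have e2 := hS _ _ v (scaleP x hx w) hyS hy0 hone
    have e3 := hS _ _ (scaleP x hx v) w hyS hy0 hone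
    have e4 := hS _ _ v w hyS hy0 hx
    have e5 := hS _ _ v w hx h0 hyS
    have e6 := hS _ _ (scaleP x hx v) w offWeight_symm ho hyS
    have e7 := hS _ _ v (scaleP x hx w) offWeight_symm ho hyS
    have e8 := hS _ _ (scaleP x hx v) (scaleP x hx w) hyS hy0 hyS
    have hr : ∀ (σ : Fin n → Fin n → ℝ) (u : Mat 𝕜 n k), wform 𝕜 n k σ u (scaleP x hx w) =
        wform 𝕜 n k (fun i j => x i j * σ i j) u w := fun σ u => by
      rw [wform_comm, wform_scaleP, wform_comm]
    rw [hr] at e2 e7 e8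
    rw [wform_scaleP] at e3 e6 e8
    trans 1 / 2 * wform 𝕜 n k (contr 𝕜 k (offWeight n) fun _ _ => 1) v w +
      1 / 4 * (wform 𝕜 n k (fun i j => x i j * contr 𝕜 k (fun i j => (x i j)⁻¹) (fun _ _ => 1) i j) v w +
        wform 𝕜 n k (fun i j => x i j * contr 𝕜 k (fun i j => (x i j)⁻¹) (fun _ _ => 1) i j) v w) -
      3 / 4 * wform 𝕜 n k (contr 𝕜 k (fun i j => (x i j)⁻¹) x) v w +
      1 / 4 * wform 𝕜 n k (contr 𝕜 k x fun i j => (x i j)⁻¹) v w -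
      1 / 4 * (wform 𝕜 n k (fun i j => x i j * contr 𝕜 k (offWeight n) (fun i j => (x i j)⁻¹) i j) v w +
        wform 𝕜 n k (fun i j => x i j * contr 𝕜 k (offWeight n) (fun i j => (x i j)⁻¹) i j) v w) +
      1 / 4 * wform 𝕜 n k (fun i j => x i j * (x i j * contr 𝕜 k (fun i j => (x i j)⁻¹)
        (fun i j => (x i j)⁻¹) i j)) v w
    · rw [← e1, ← e4, ← e5, ← e8]
      nth_rewrite 1 [← e2]
      nth_rewrite 1 [← e3]
      nth_rewrite 1 [← e6]
      rw [← e7]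
      simp only [Finset.mul_sum, ← Finset.sum_add_distrib, ← Finset.sum_sub_distrib]
      refine Finset.sum_congr rfl fun e _ => ?_
      have hc := h1 _ _ e.1.2.ne
      have ho' : offWeight n e.1.1.1.1 e.1.1.2.1 = 1 := by simp [offWeight, e.1.2.ne]
      rw [ho']
      field_simp
    · rw [diagForm_apply]
      simp only [wform_apply, Finset.mul_sum, ← Finset.sum_add_distrib, ← Finset.sum_sub_distrib]
      refine Finset.sum_congr rfl fun p _ => Finset.sum_congr rfl fun q _ => ?_
      by_cases hpq : p.1 = q.1
      · rw [offDiag_zero v.2 hpq]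
        simp
      · rw [← ricCoef_eq hx h0 h1 hpq]
        ring
  rw [ricciAt, hmat]
  exact Matrix.toBilin_toMatrix _ _

end RicciDiag

/-! ### Traces, determinants and scalar curvature of diagonal forms -/

section DiagAlgebra

variable {𝕜 : Type*} [NormedDivisionRing 𝕜] [NormedAlgebra ℝ 𝕜] [FiniteDimensional ℝ 𝕜]
  [StarRing 𝕜] [StarModule ℝ 𝕜] [Scalars 𝕜] {n k : ℕ}

/-- A symmetric matrix with vanishing diagonal. -/
structure IsWeight (x : Fin n → Fin n → ℝ) : Prop where
  symm : IsSymm x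
  diag : ∀ i, x i i = 0

lemma isWeight_offWeight : IsWeight (offWeight n) := ⟨offWeight_symm, fun i => by simp [offWeight]⟩

lemma IsWeight.map {x : Fin n → Fin n → ℝ} (hx : IsWeight x) (f : ℝ → ℝ) (hf : f 0 = 0) :
    IsWeight fun i j => f (x i j) :=
  ⟨fun i j => by rw [hx.symm], fun i => by simp only [hx.diag, hf]⟩

lemma IsWeight.map₂ {x y : Fin n → Fin n → ℝ} (hx : IsWeight x) (hy : IsWeight y) (f : ℝ → ℝ → ℝ)
    (hf : f 0 0 = 0) : IsWeight fun i j => f (x i j) (y i j) :=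
  ⟨fun i j => by simp only [hx.symm i j, hy.symm i j], fun i => by simp only [hx.diag, hy.diag, hf]⟩

variable (𝕜 k) in
/-- The dimension of a block. -/
def blockDim : ℝ := δ 𝕜 * (k : ℝ) ^ 2

/-- Every pair of blocks carries δk² basis vectors; the factor ½ is due to summing over ordered
pairs on the right. -/
lemma sum_idx {f : Fin n → Fin n → ℝ} (hf : IsWeight f) :
    ∑ e : Idx 𝕜 n k, f e.1.1.1.1 e.1.1.2.1 = blockDim 𝕜 k / 2 * ∑ i, ∑ j, f i j := by
  have h := sum_pairs (fun r s : Fin n × Fin k => f r.1 s.1 / 2)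
    fun r s h => by simp only [h, hf.diag, zero_div]
  have h2 : ∑ r : Fin n × Fin k, ∑ s : Fin n × Fin k, f r.1 s.1 / 2 =
      (k : ℝ) ^ 2 / 2 * ∑ i, ∑ j, f i j := by
    simp only [fun i : Fin n => sum_blocks (k := k) fun j => f i j / 2]
    rw [sum_blocks (k := k) fun i => (k : ℝ) * ∑ j, f i j / 2]
    simp only [← Finset.sum_div, ← Finset.mul_sum]
    ring
  rw [Fintype.sum_prod_type]
  simp only [Finset.sum_const, Finset.card_univ, Fintype.card_fin, nsmul_eq_mul, ← Finset.mul_sum]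
  have h3 : ∀ e : {e : (Fin n × Fin k) × (Fin n × Fin k) // e.1.1 < e.2.1}, f e.1.1.1 e.1.2.1 =
      f e.1.1.1 e.1.2.1 / 2 + f e.1.2.1 e.1.1.1 / 2 := fun e => by
    rw [hf.symm e.1.2.1 e.1.1.1]; ring
  rw [Finset.sum_congr rfl fun e _ => h3 e, h, h2, blockDim]
  ring

lemma sum_offWeight : ∑ i, ∑ j, offWeight n i j = (n : ℝ) * (n - 1) := by
  have : ∀ i : Fin n, ∑ j, offWeight n i j = (n : ℝ) - 1 := fun i => by
    have : ∀ j, offWeight n i j = 1 - if i = j then 1 else 0 := fun j => by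
      rw [offWeight]; split_ifs <;> simp
    simp only [this, Finset.sum_sub_distrib]
    simp
  simp only [this, Finset.sum_const, Finset.card_univ, Fintype.card_fin, nsmul_eq_mul]

lemma dimM_eq : (dimM 𝕜 n k : ℝ) = blockDim 𝕜 k / 2 * (n * (n - 1)) := by
  rw [dimM, Module.finrank_eq_card_basis (stdBasis 𝕜 n k), ← sum_offWeight,
    ← sum_idx (𝕜 := 𝕜) (k := k) isWeight_offWeight]
  have : ∀ e : Idx 𝕜 n k, offWeight n e.1.1.1.1 e.1.1.2.1 = 1 := fun e => by
    simp [offWeight, e.1.2.ne]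
  simp [this]

/-- Relative to `diagForm x`, the form `diagForm z` is given by multiplication of the blocks by the
quotients z_ij/x_ij. Traces and determinants can thus be read off in the eigenbasis `stdBasis`. -/
lemma diagForm_eq_compRight {x z : Fin n → Fin n → ℝ} (hx : IsWeight x) (hz : IsWeight z)
    (h1 : ∀ i j, i ≠ j → x i j ≠ 0) :
    diagForm 𝕜 n k z = (diagForm 𝕜 n k x).compRight
      (scaleP _ (hz.map₂ hx (fun a b => a / b) (by simp)).symm) := by
  ext v w
  rw [LinearMap.BilinForm.compRight_apply, diagForm_comm x, diagForm_comm, diagForm_apply,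
    diagForm_apply, wform_scaleP]
  refine wform_congr _ fun p q hv => ?_
  rw [div_mul_cancel₀ _ (h1 _ _ fun e => hv (offDiag_zero w.2 e))]

lemma isUnit_det_formMatrix {x : Fin n → Fin n → ℝ} (hx : IsWeight x)
    (h1 : ∀ i j, i ≠ j → x i j ≠ 0) : IsUnit (formMatrix (diagForm 𝕜 n k x)).det := by
  have hnd : (diagForm 𝕜 n k x).Nondegenerate := by
    rw [LinearMap.BilinForm.nondegenerate_iff_det_ne_zero (stdBasis 𝕜 n k)]
    have : LinearMap.BilinForm.toMatrix (stdBasis 𝕜 n k) (diagForm 𝕜 n k x) =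
        Matrix.diagonal fun e : Idx 𝕜 n k => x e.1.1.1.1 e.1.1.2.1 := by
      ext e e'
      rw [LinearMap.BilinForm.toMatrix_apply, diagForm_stdBasis hx.symm, Matrix.diagonal_apply]
    rw [this, Matrix.det_diagonal]
    exact Finset.prod_ne_zero_iff.mpr fun e _ => h1 _ _ e.1.2.ne
  rw [formMatrix]
  exact ((LinearMap.BilinForm.nondegenerate_iff_det_ne_zero (basisP 𝕜 n k)).mp hnd).isUnit

lemma opMatrix_diagForm {x z : Fin n → Fin n → ℝ} (hx : IsWeight x) (hz : IsWeight z)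
    (h1 : ∀ i j, i ≠ j → x i j ≠ 0) :
    opMatrix (diagForm 𝕜 n k x) (diagForm 𝕜 n k z) =
      LinearMap.toMatrix (basisP 𝕜 n k) (basisP 𝕜 n k)
        (scaleP _ (hz.map₂ hx (fun a b => a / b) (by simp)).symm) := by
  rw [opMatrix]
  conv_lhs => arg 2; rw [diagForm_eq_compRight hx hz h1, formMatrix,
    LinearMap.BilinForm.toMatrix_compRight, ← formMatrix]
  rw [← Matrix.mul_assoc, Matrix.nonsing_inv_mul _ (isUnit_det_formMatrix hx h1), Matrix.one_mul]

lemma toMatrix_scaleP {x : Fin n → Fin n → ℝ} (hx : IsSymm x) :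
    LinearMap.toMatrix (stdBasis 𝕜 n k) (stdBasis 𝕜 n k) (scaleP x hx) =
      Matrix.diagonal fun e : Idx 𝕜 n k => x e.1.1.1.1 e.1.1.2.1 := by
  ext e e'
  rw [LinearMap.toMatrix_apply, scaleP_stdBasis, map_smul, Module.Basis.repr_self,
    Matrix.diagonal_apply]
  by_cases h : e = e'
  · subst h; simp
  · simp [h]

lemma trace_scaleP {x : Fin n → Fin n → ℝ} (hx : IsWeight x) :
    (LinearMap.toMatrix (basisP 𝕜 n k) (basisP 𝕜 n k) (scaleP x hx.symm)).trace =
      blockDim 𝕜 k / 2 * ∑ i, ∑ j, x i j := by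
  rw [← LinearMap.trace_eq_matrix_trace _ (basisP 𝕜 n k),
    LinearMap.trace_eq_matrix_trace _ (stdBasis 𝕜 n k), toMatrix_scaleP, Matrix.trace_diagonal,
    sum_idx hx]

lemma det_scaleP {x : Fin n → Fin n → ℝ} (hx : IsWeight x) (h1 : ∀ i j, i ≠ j → 0 < x i j) :
    (LinearMap.toMatrix (basisP 𝕜 n k) (basisP 𝕜 n k) (scaleP x hx.symm)).det =
      Real.exp (blockDim 𝕜 k / 2 * ∑ i, ∑ j, Real.log (x i j)) := by
  rw [LinearMap.det_toMatrix, ← LinearMap.det_toMatrix (stdBasis 𝕜 n k), toMatrix_scaleP,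
    Matrix.det_diagonal, ← sum_idx (hx.map Real.log Real.log_zero), Real.exp_sum]
  exact Finset.prod_congr rfl fun e _ => (Real.exp_log (h1 _ _ e.1.2.ne)).symm

lemma traceForm_diagForm {x z : Fin n → Fin n → ℝ} (hx : IsWeight x) (hz : IsWeight z)
    (h1 : ∀ i j, i ≠ j → x i j ≠ 0) : traceForm (diagForm 𝕜 n k x) (diagForm 𝕜 n k z) =
      blockDim 𝕜 k / 2 * ∑ i, ∑ j, z i j / x i j := by
  rw [traceForm, opMatrix_diagForm hx hz h1,
    trace_scaleP (hz.map₂ hx (fun a b => a / b) (by simp))]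

lemma detForm_diagForm {x z : Fin n → Fin n → ℝ} (hx : IsWeight x) (hz : IsWeight z)
    (h1 : ∀ i j, i ≠ j → 0 < x i j) (h2 : ∀ i j, i ≠ j → 0 < z i j) :
    detForm (diagForm 𝕜 n k x) (diagForm 𝕜 n k z) =
      Real.exp (blockDim 𝕜 k / 2 * ∑ i, ∑ j, Real.log (z i j / x i j)) := by
  rw [detForm, opMatrix_diagForm hx hz fun i j h => (h1 i j h).ne',
    det_scaleP (hz.map₂ hx (fun a b => a / b) (by simp)) fun i j h => div_pos (h2 i j h) (h1 i j h)]

lemma innerForm_diagForm {x z z' : Fin n → Fin n → ℝ} (hx : IsWeight x) (hz : IsWeight z)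
    (hz' : IsWeight z') (h1 : ∀ i j, i ≠ j → x i j ≠ 0) :
    innerForm (diagForm 𝕜 n k x) (diagForm 𝕜 n k z) (diagForm 𝕜 n k z') =
      blockDim 𝕜 k / 2 * ∑ i, ∑ j, z i j / x i j * (z' i j / x i j) := by
  have ha := hz.map₂ hx (fun a b => a / b) (by simp)
  have hb := hz'.map₂ hx (fun a b => a / b) (by simp)
  have hab := ha.map₂ hb (fun a b => a * b) (by simp)
  rw [innerForm, opMatrix_diagForm hx hz h1, opMatrix_diagForm hx hz' h1,
    ← LinearMap.toMatrix_comp, ← trace_scaleP hab]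
  congr 2
  refine LinearMap.ext fun v => offDiag_ext fun p q _ => ?_
  simp [scaleP, scale, smul_smul]

/-- The Ricci coefficients, made to vanish on the diagonal. -/
lemma isWeight_ricCoef {x : Fin n → Fin n → ℝ} (hx : IsWeight x) :
    IsWeight fun i j => offWeight n i j * ricCoef 𝕜 k x i j := by
  refine ⟨fun i j => ?_, fun i => by simp [offWeight]⟩
  rw [offWeight_symm i j, ricCoef, ricCoef, hx.symm i j]
  congr 3
  refine Finset.sum_congr (by ext; simp [and_comm]) fun l _ => ?_
  ring

lemma scalAt_diagForm {x : Fin n → Fin n → ℝ} (hx : IsWeight x) (h1 : ∀ i j, i ≠ j → x i j ≠ 0)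
    (a : Mat 𝕜 n k) : scalAt (fun _ => diagForm 𝕜 n k x) a =
      blockDim 𝕜 k / 2 * ∑ i, ∑ j, ricCoef 𝕜 k x i j / x i j := by
  rw [scalAt, ricciAt_diagForm hx.symm hx.diag h1,
    diagForm_congr (x := ricCoef 𝕜 k x) (y := fun i j => offWeight n i j * ricCoef 𝕜 k x i j)
      fun i j h => by simp [offWeight, h],
    traceForm_diagForm hx (isWeight_ricCoef hx) h1]
  congr 1
  refine Finset.sum_congr rfl fun i _ => Finset.sum_congr rfl fun j _ => ?_
  by_cases h : i = j
  · subst h; simp [hx.diag]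
  · simp [offWeight, h]

variable (𝕜 n k) in
/-- The constant `C` of the formula `C/2 ∑ 1/x_{ij} - κ/4 ∑ x_{ij}/(x_{il} x_{jl})` for the scalar
curvature. -/
def scalConst : ℝ := 2 * (k * δ 𝕜 - (2 - δ 𝕜)) + k * δ 𝕜 * (n - 2)

lemma card_filter_ne {i j : Fin n} (h : i ≠ j) :
    ((Finset.univ.filter fun l : Fin n => l ≠ i ∧ l ≠ j).card : ℝ) = n - 2 := by
  have h1 : (Finset.univ.filter fun l : Fin n => l ≠ i ∧ l ≠ j) = (Finset.univ \ {i, j}) := by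
    ext; simp
  have h2 := Finset.card_sdiff_add_card_eq_card (Finset.subset_univ ({i, j} : Finset (Fin n)))
  rw [Finset.card_pair h, Finset.card_univ, Fintype.card_fin] at h2
  rw [h1, eq_sub_iff_add_eq]
  exact_mod_cast h2

/-- The conventions x_ii = 0 and a/0 = 0 make all the quotients with coinciding indices vanish, so
the sum may run over every `l` and later relabellings of the indices need no case distinctions. -/
lemma ricCoef_div {x : Fin n → Fin n → ℝ} (hx : IsWeight x) (h1 : ∀ i j, i ≠ j → x i j ≠ 0)
    (i j : Fin n) : ricCoef 𝕜 k x i j / x i j = scalConst 𝕜 n k / x i j +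
      k * δ 𝕜 / 2 * ∑ l, (x i j / (x i l * x j l) - x i l / (x i j * x j l)
        - x j l / (x i j * x i l)) := by
  by_cases h : i = j
  · subst h
    simp only [hx.diag]
    simp
  have h2 : ∑ l, (x i j / (x i l * x j l) - x i l / (x i j * x j l) - x j l / (x i j * x i l)) =
      ∑ l with l ≠ i ∧ l ≠ j,
        (x i j / (x i l * x j l) - x i l / (x i j * x j l) - x j l / (x i j * x i l)) := by
    refine (Finset.sum_subset (Finset.subset_univ _) fun l _ hl => ?_).symm
    simp only [Finset.mem_filter, Finset.mem_univ, true_and, not_and_or, not_not] at hl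
    rcases hl with rfl | rfl
    · simp [hx.diag, hx.symm j l]
    · simp [hx.diag]
  have h3 : ∑ l with l ≠ i ∧ l ≠ j, (1 + (x i j ^ 2 - x i l ^ 2 - x j l ^ 2) / (2 * x i l * x j l)) =
      (n - 2) + x i j / 2 * ∑ l with l ≠ i ∧ l ≠ j,
        (x i j / (x i l * x j l) - x i l / (x i j * x j l) - x j l / (x i j * x i l)) := by
    rw [Finset.sum_add_distrib, Finset.sum_const, nsmul_eq_mul, mul_one, card_filter_ne h,
      Finset.mul_sum]
    congr 1
    refine Finset.sum_congr rfl fun l hl => ?_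
    simp only [Finset.mem_filter, Finset.mem_univ, true_and] at hl
    have := h1 i l hl.1.symm
    have := h1 j l hl.2.symm
    have := h1 i j h
    field_simp
  rw [h2, ricCoef, h3, scalConst]
  have := h1 i j h
  field_simp
  ring

/-- The derivative of the scalar curvature, in logarithmic coordinates. -/
lemma sum_ricCoef_div_mul {x : Fin n → Fin n → ℝ} (hx : IsWeight x)
    (h1 : ∀ i j, i ≠ j → x i j ≠ 0) {w : Fin n → Fin n → ℝ} (hw : IsSymm w) :
    ∑ i, ∑ j, ricCoef 𝕜 k x i j / x i j * w i j =
      scalConst 𝕜 n k * ∑ i, ∑ j, w i j / x i j +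
      k * δ 𝕜 / 2 * ∑ i, ∑ j, ∑ l, x i j / (x i l * x j l) * (w i j - w i l - w j l) := by
  -- Renaming the summation indices puts the same quotient in front of every term and moves the
  -- indices of `w` instead.
  have e1 : ∑ i, ∑ j, ∑ l, x i l / (x i j * x j l) * w i j =
      ∑ i, ∑ j, ∑ l, x i j / (x i l * x j l) * w i l := by
    refine Finset.sum_congr rfl fun i _ => ?_
    rw [Finset.sum_comm]
    refine Finset.sum_congr rfl fun j _ => Finset.sum_congr rfl fun l _ => ?_
    rw [hx.symm l j]
  have e2 : ∑ i, ∑ j, ∑ l, x j l / (x i j * x i l) * w i j =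
      ∑ i, ∑ j, ∑ l, x i j / (x i l * x j l) * w j l := by
    rw [Finset.sum_comm]
    have : ∀ j : Fin n, ∑ i, ∑ l, x j l / (x i j * x i l) * w i j =
        ∑ l, ∑ i, x j l / (x i j * x i l) * w i j := fun j => Finset.sum_comm
    simp only [this]
    rw [Finset.sum_comm]
    refine Finset.sum_congr rfl fun i _ => Finset.sum_congr rfl fun j _ =>
      Finset.sum_congr rfl fun l _ => ?_
    rw [hx.symm j i, hx.symm l j, hx.symm l i, hw l j, mul_comm (x j l)]
  have e3 : ∑ i, ∑ j, ∑ l, x i j / (x i l * x j l) * (w i j - w i l - w j l) =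
      ∑ i, ∑ j, ∑ l, (x i j / (x i l * x j l) - x i l / (x i j * x j l)
        - x j l / (x i j * x i l)) * w i j := by
    simp only [mul_sub, sub_mul, Finset.sum_sub_distrib]
    rw [e1, e2]
  rw [e3]
  simp only [ricCoef_div hx h1, Finset.mul_sum, ← Finset.sum_add_distrib]
  refine Finset.sum_congr rfl fun i _ => Finset.sum_congr rfl fun j _ => ?_
  rw [add_mul, Finset.sum_mul]
  congr 1
  · ring
  · exact Finset.sum_congr rfl fun l _ => by ring

lemma sum_ricCoef_div {x : Fin n → Fin n → ℝ} (hx : IsWeight x)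
    (h1 : ∀ i j, i ≠ j → x i j ≠ 0) :
    ∑ i, ∑ j, ricCoef 𝕜 k x i j / x i j =
      scalConst 𝕜 n k * ∑ i, ∑ j, 1 / x i j
        - k * δ 𝕜 / 2 * ∑ i, ∑ j, ∑ l, x i j / (x i l * x j l) := by
  have := sum_ricCoef_div_mul (𝕜 := 𝕜) (k := k) hx h1 (w := fun _ _ => 1) fun _ _ => rfl
  simp only [mul_one] at this
  rw [this]
  norm_num
  ring

end DiagAlgebra

/-! ### Sums of exponentials of linear functionals -/

section ExpSum

variable {M V : Type*} [Fintype M] [NormedAddCommGroup V] [NormedSpace ℝ V] (a : M → ℝ)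
  (L : M → V →L[ℝ] ℝ)

/-- A linear combination of exponentials of linear functionals. -/
def expSum (y : V) : ℝ := ∑ m, a m * Real.exp (L m y)

/-- The Hessian of `expSum` at the origin. -/
def expHess (y w : V) : ℝ := ∑ m, a m * (L m y * L m w)

lemma abs_exp_sub_quadratic_le {x : ℝ} (hx : |x| ≤ 1) :
    |Real.exp x - (1 + x + x ^ 2 / 2)| ≤ |x| ^ 3 := by
  have h := Real.exp_bound hx (n := 3) (by norm_num)
  simp only [Finset.sum_range_succ, Finset.range_zero, Finset.sum_empty] at h
  norm_num [Nat.factorial] at h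
  refine h.trans ?_
  have : 0 ≤ |x| ^ 3 := by positivity
  linarith

lemma exists_norm_le : ∃ N : ℝ, 1 ≤ N ∧ ∀ m, ‖L m‖ ≤ N :=
  ⟨1 + ∑ m, ‖L m‖, by
    have : 0 ≤ ∑ m, ‖L m‖ := Finset.sum_nonneg fun _ _ => norm_nonneg _
    linarith, fun m => by
    have := Finset.single_le_sum (f := fun m => ‖L m‖) (fun _ _ => norm_nonneg _)
      (Finset.mem_univ m)
    linarith⟩

lemma expSum_taylor : ∃ K r : ℝ, 0 < K ∧ 0 < r ∧ ∀ y, ‖y‖ ≤ r →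
    |expSum a L y - expSum a L 0 - (∑ m, a m * L m y) - expHess a L y y / 2| ≤ K * ‖y‖ ^ 3 := by
  obtain ⟨N, hN, hLN⟩ := exists_norm_le L
  have hN0 : 0 < N := by linarith
  have hS : 0 ≤ ∑ m, |a m| := Finset.sum_nonneg fun _ _ => abs_nonneg _
  -- On the ball of radius 1/N all exponents have absolute value at most 1, as the bound for the
  -- remainder of exp requires. The added 1 only keeps the constant positive.
  refine ⟨(1 + ∑ m, |a m|) * N ^ 3, 1 / N, by positivity, by positivity, fun y hy => ?_⟩
  have hL : ∀ m, |L m y| ≤ N * ‖y‖ := fun m =>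
    ((L m).le_opNorm y).trans (mul_le_mul_of_nonneg_right (hLN m) (norm_nonneg _))
  have hL1 : ∀ m, |L m y| ≤ 1 := fun m => (hL m).trans <| by
    calc N * ‖y‖ ≤ N * (1 / N) := by gcongr
      _ = 1 := by field_simp
  have e : expSum a L y - expSum a L 0 - (∑ m, a m * L m y) - expHess a L y y / 2 =
      ∑ m, a m * (Real.exp (L m y) - (1 + L m y + L m y ^ 2 / 2)) := by
    simp only [expSum, expHess, Finset.sum_div, ← Finset.sum_sub_distrib]
    refine Finset.sum_congr rfl fun m _ => ?_
    simp
    ring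
  rw [e]
  calc _ ≤ ∑ m, |a m| * (N * ‖y‖) ^ 3 := by
        refine (Finset.abs_sum_le_sum_abs _ _).trans (Finset.sum_le_sum fun m _ => ?_)
        rw [abs_mul]
        refine mul_le_mul_of_nonneg_left ((abs_exp_sub_quadratic_le (hL1 m)).trans ?_)
          (abs_nonneg _)
        exact pow_le_pow_left₀ (abs_nonneg _) (hL m) 3
    _ = (∑ m, |a m|) * N ^ 3 * ‖y‖ ^ 3 := by rw [← Finset.sum_mul]; ring
    _ ≤ _ := by
        have : 0 ≤ N ^ 3 * ‖y‖ ^ 3 := by positivity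
        nlinarith

lemma expSum_deriv_taylor : ∃ K r : ℝ, 0 < K ∧ 0 < r ∧ ∀ y w, ‖y‖ ≤ r →
    |(∑ m, a m * (Real.exp (L m y) * L m w)) - (∑ m, a m * L m w) - expHess a L y w| ≤
      K * ‖y‖ ^ 2 * ‖w‖ := by
  obtain ⟨N, hN, hLN⟩ := exists_norm_le L
  have hN0 : 0 < N := by linarith
  have hS : 0 ≤ ∑ m, |a m| := Finset.sum_nonneg fun _ _ => abs_nonneg _
  refine ⟨(1 + ∑ m, |a m|) * N ^ 3, 1 / N, by positivity, by positivity, fun y w hy => ?_⟩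
  have hL : ∀ m v, |L m v| ≤ N * ‖v‖ := fun m v =>
    ((L m).le_opNorm v).trans (mul_le_mul_of_nonneg_right (hLN m) (norm_nonneg _))
  have hL1 : ∀ m, |L m y| ≤ 1 := fun m => (hL m y).trans <| by
    calc N * ‖y‖ ≤ N * (1 / N) := by gcongr
      _ = 1 := by field_simp
  have e : (∑ m, a m * (Real.exp (L m y) * L m w)) - (∑ m, a m * L m w) - expHess a L y w =
      ∑ m, a m * ((Real.exp (L m y) - 1 - L m y) * L m w) := by
    simp only [expHess, ← Finset.sum_sub_distrib]
    exact Finset.sum_congr rfl fun m _ => by ring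
  rw [e]
  calc _ ≤ ∑ m, |a m| * ((N * ‖y‖) ^ 2 * (N * ‖w‖)) := by
        refine (Finset.abs_sum_le_sum_abs _ _).trans (Finset.sum_le_sum fun m _ => ?_)
        rw [abs_mul, abs_mul]
        refine mul_le_mul_of_nonneg_left (mul_le_mul ?_ (hL m w) (abs_nonneg _) (by positivity))
          (abs_nonneg _)
        refine (Real.abs_exp_sub_one_sub_id_le (hL1 m)).trans ?_
        rw [← sq_abs]
        exact pow_le_pow_left₀ (abs_nonneg _) (hL m y) 2
    _ = (∑ m, |a m|) * N ^ 3 * (‖y‖ ^ 2 * ‖w‖) := by rw [← Finset.sum_mul]; ring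
    _ ≤ _ := by
        have : 0 ≤ N ^ 3 * (‖y‖ ^ 2 * ‖w‖) := by positivity
        nlinarith

lemma hasDerivAt_expSum {y : ℝ → V} {y' : V} {t : ℝ} (h : HasDerivAt y y' t) :
    HasDerivAt (fun s => expSum a L (y s)) (∑ m, a m * (Real.exp (L m (y t)) * L m y')) t :=
  HasDerivAt.fun_sum fun m _ => (((L m).hasFDerivAt.comp_hasDerivAt t h).exp).const_mul (a m)

/-- The second derivative along a surface whose second derivative is in the kernel of the first
derivative. -/
lemma deriv_deriv_expSum {y : ℝ → ℝ → V} {T : V} {S : ℝ → V} {Z : V}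
    (h0 : y 0 0 = 0) (hT : HasDerivAt (fun s => y s 0) T 0)
    (hS : ∀ᶠ s in 𝓝 (0 : ℝ), HasDerivAt (y s) (S s) 0) (hZ : HasDerivAt S Z 0)
    (hcrit : ∑ m, a m * L m Z = 0) :
    deriv (fun s => deriv (fun t => expSum a L (y s t)) 0) 0 = expHess a L T (S 0) := by
  have h1 : (fun s => deriv (fun t => expSum a L (y s t)) 0) =ᶠ[𝓝 0]
      fun s => ∑ m, a m * (Real.exp (L m (y s 0)) * L m (S s)) := by
    filter_upwards [hS] with s hs
    exact (hasDerivAt_expSum a L hs).deriv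
  rw [h1.deriv_eq]
  have h2 : HasDerivAt (fun s => ∑ m, a m * (Real.exp (L m (y s 0)) * L m (S s)))
      (∑ m, a m * (Real.exp (L m (y 0 0)) * L m T * L m (S 0) + Real.exp (L m (y 0 0)) * L m Z)) 0 :=
    HasDerivAt.fun_sum fun m _ => (HasDerivAt.mul
      (((L m).hasFDerivAt.comp_hasDerivAt 0 hT).exp)
      ((L m).hasFDerivAt.comp_hasDerivAt 0 hZ)).const_mul (a m)
  rw [h2.deriv, h0]
  simp only [map_zero, Real.exp_zero, one_mul, mul_add, Finset.sum_add_distrib, hcrit, add_zero]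
  rfl

end ExpSum

/-! ### The scalar curvature in logarithmic coordinates and its Hessian -/

section Energy

variable {n : ℕ}

/-- A summation by parts: it collects the coefficient of w_ij in a sum over triples, so that linear
functionals of this shape can be read as gradients. -/
lemma sum_triple (G : Fin n → Fin n → Fin n → ℝ) {w : Fin n → Fin n → ℝ} (hw : IsSymm w) :
    ∑ i, ∑ j, ∑ l, G i j l * (w i j - w i l - w j l) =
      ∑ i, ∑ j, (∑ l, (G i j l - G i l j - G l j i)) * w i j := by
  have e1 : ∑ i, ∑ j, ∑ l, G i l j * w i j = ∑ i, ∑ j, ∑ l, G i j l * w i l := by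
    refine Finset.sum_congr rfl fun i _ => ?_
    rw [Finset.sum_comm]
  have e2 : ∑ i, ∑ j, ∑ l, G l j i * w i j = ∑ i, ∑ j, ∑ l, G i j l * w j l := by
    have : ∀ i : Fin n, ∑ j, ∑ l, G l j i * w i j = ∑ l, ∑ j, G l j i * w i j :=
      fun i => Finset.sum_comm
    simp only [this]
    rw [Finset.sum_comm]
    refine Finset.sum_congr rfl fun i _ => ?_
    rw [Finset.sum_comm]
    exact Finset.sum_congr rfl fun j _ => Finset.sum_congr rfl fun l _ => by rw [hw l j]
  simp only [mul_sub, Finset.sum_sub_distrib, sub_mul, Finset.sum_mul]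
  rw [e1, e2]

/-- The weight of the triples of distinct indices. -/
def triWeight (n : ℕ) (i j l : Fin n) : ℝ := offWeight n i j * offWeight n i l * offWeight n j l

lemma triWeight_swap (i j l : Fin n) : triWeight n j i l = triWeight n i j l := by
  simp only [triWeight, offWeight_symm j i]; ring

lemma triWeight_rotate (i j l : Fin n) : triWeight n l i j = triWeight n i j l := by
  simp only [triWeight, offWeight_symm l i, offWeight_symm l j]; ring

lemma triWeight_reverse (i j l : Fin n) : triWeight n l j i = triWeight n i j l := by
  rw [triWeight_swap, triWeight_rotate, triWeight_rotate]

lemma triWeight_swap_right (i j l : Fin n) : triWeight n i l j = triWeight n i j l := by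
  rw [triWeight_swap, triWeight_rotate]

lemma sum_offWeight_mul (y : Fin n → ℝ) (i : Fin n) :
    ∑ j, offWeight n i j * y j = ∑ j, y j - y i := by
  have : ∀ j, offWeight n i j * y j = y j - if i = j then y j else 0 := fun j => by
    rw [offWeight]; split_ifs <;> simp
  simp [this]

lemma sum_triWeight_mul (y : Fin n → ℝ) (i j : Fin n) :
    ∑ l, triWeight n i j l * y l = offWeight n i j * (∑ l, y l - y i - y j) := by
  have h : ∀ l, triWeight n i j l * y l = offWeight n i j * (y l - (if i = l then y l else 0)
      - if j = l then y l else 0) := fun l => by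
    by_cases h : i = j
    · simp [triWeight, offWeight, h]
    · simp only [triWeight, offWeight, if_neg h]
      split_ifs with h1 h2 <;> simp_all
  simp only [h, ← Finset.mul_sum, Finset.sum_sub_distrib]
  simp

lemma sum_triWeight (i j : Fin n) : ∑ l, triWeight n i j l = offWeight n i j * (n - 2) := by
  have := sum_triWeight_mul (fun _ => 1) i j
  simp only [mul_one] at this
  rw [this]
  simp only [Finset.sum_const, Finset.card_univ, Fintype.card_fin, nsmul_eq_mul]
  ring

lemma offWeight_mul {y : Fin n → Fin n → ℝ} (hy : IsWeight y) (i j : Fin n) :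
    offWeight n i j * y i j = y i j := by
  by_cases h : i = j
  · subst h; simp [hy.diag]
  · simp [offWeight, h]

/-- The coordinates on the tangent space of the metrics of fixed volume. -/
def centered (i j : Fin n) : (Fin n → Fin n → ℝ) →ₗ[ℝ] ℝ where
  toFun y := y i j - (∑ i, ∑ j, offWeight n i j * y i j) / (n * (n - 1))
  map_add' y z := by
    simp only [Pi.add_apply, mul_add, Finset.sum_add_distrib, add_div]
    ring
  map_smul' c y := by
    have : ∀ i j, offWeight n i j * (c • y) i j = c * (offWeight n i j * y i j) := fun i j => by
      simp only [Pi.smul_apply, smul_eq_mul]; ring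
    simp only [this, ← Finset.mul_sum]
    simp only [Pi.smul_apply, smul_eq_mul, RingHom.id_apply]
    ring

lemma centered_of_sum_eq_zero {y : Fin n → Fin n → ℝ} (hy : IsWeight y)
    (h0 : ∑ i, ∑ j, y i j = 0) (i j : Fin n) : centered i j y = y i j := by
  simp only [centered, LinearMap.coe_mk, AddHom.coe_mk, offWeight_mul hy, h0, zero_div, sub_zero]

/-- The indices of the summands of the scalar curvature. -/
abbrev TermIdx (n : ℕ) : Type := (Fin n × Fin n) ⊕ (Fin n × Fin n × Fin n)

/-- The coefficients of the scalar curvature as a sum of exponentials. -/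
def termCoef (A κ : ℝ) : TermIdx n → ℝ :=
  Sum.elim (fun p => A * offWeight n p.1 p.2)
    fun p => -(κ / 2) * triWeight n p.1 p.2.1 p.2.2

/-- The exponents of the scalar curvature as a sum of exponentials. -/
def termExp : TermIdx n → (Fin n → Fin n → ℝ) →L[ℝ] ℝ :=
  Sum.elim (fun p => LinearMap.toContinuousLinearMap (-centered p.1 p.2))
    fun p => LinearMap.toContinuousLinearMap
      (centered p.1 p.2.1 - centered p.1 p.2.2 - centered p.2.1 p.2.2)

lemma sum_terms (A κ : ℝ) (f : TermIdx n → ℝ) :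
    ∑ m, termCoef A κ m * f m = A * ∑ i, ∑ j, offWeight n i j * f (Sum.inl (i, j)) -
      κ / 2 * ∑ i, ∑ j, ∑ l, triWeight n i j l * f (Sum.inr (i, j, l)) := by
  simp only [Fintype.sum_sum_type, Fintype.sum_prod_type, termCoef, Sum.elim_inl, Sum.elim_inr,
    mul_assoc, ← Finset.mul_sum]
  ring

/-- The origin is a critical point by symmetry: all pairs of different indices enter with the same
coefficient, and the `centered` coordinates sum to zero over these pairs. -/
lemma sum_terms_linear (hn : 3 ≤ n) (A κ : ℝ) {v : Fin n → Fin n → ℝ} (hv : IsSymm v) :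
    ∑ m, termCoef A κ m * termExp m v = 0 := by
  have hn' : (3 : ℝ) ≤ n := by exact_mod_cast hn
  have h1 : ∑ i, ∑ j, offWeight n i j * centered i j v = 0 := by
    have e : ∀ i j, offWeight n i j * centered i j v = offWeight n i j * v i j -
        offWeight n i j * ((∑ i, ∑ j, offWeight n i j * v i j) / (n * (n - 1))) :=
      fun i j => by simp only [centered, LinearMap.coe_mk, AddHom.coe_mk]; ring
    simp only [e, Finset.sum_sub_distrib, ← Finset.sum_mul, sum_offWeight]
    have : (n : ℝ) * (n - 1) ≠ 0 := by
      have : (n : ℝ) - 1 ≠ 0 := by linarith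
      positivity
    rw [mul_div_cancel₀ _ this, sub_self]
  have h2 := sum_triple (triWeight n) (w := fun i j => centered i j v)
    fun i j => by simp only [centered, LinearMap.coe_mk, AddHom.coe_mk, hv i j]
  simp only [fun i j l => triWeight_reverse (n := n) i j l, triWeight_swap_right, sub_self, zero_sub, Finset.sum_neg_distrib,
    sum_triWeight] at h2
  rw [sum_terms]
  simp only [termExp, Sum.elim_inl, Sum.elim_inr, LinearMap.coe_toContinuousLinearMap',
    LinearMap.neg_apply, LinearMap.sub_apply, h2]
  have h3 : ∑ i, ∑ j, -(offWeight n i j * ((n : ℝ) - 2)) * centered i j v =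
      -(n - 2) * ∑ i, ∑ j, offWeight n i j * centered i j v := by
    simp only [Finset.mul_sum]
    exact Finset.sum_congr rfl fun i _ => Finset.sum_congr rfl fun j _ => by ring
  rw [h3]
  simp only [mul_neg, Finset.sum_neg_distrib, h1]
  ring

/-- The row sums. -/
def rowSum (y : Fin n → Fin n → ℝ) (i : Fin n) : ℝ := ∑ j, y i j

/-- The weights with vanishing sum. -/
structure IsTraceless (y : Fin n → Fin n → ℝ) : Prop extends IsWeight y where
  sum : ∑ i, ∑ j, y i j = 0

/-- The Hessian of the scalar curvature. -/
lemma expHess_terms (A κ : ℝ) {y w : Fin n → Fin n → ℝ} (hy : IsTraceless y)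
    (hw : IsTraceless w) :
    expHess (termCoef A κ) termExp y w = (A - κ * (3 * n - 4) / 2) * (∑ i, ∑ j, y i j * w i j) +
      κ * ∑ i, rowSum y i * rowSum w i := by
  have h2 := sum_triple (fun i j l => triWeight n i j l * (y i j - y i l - y j l)) hw.symm
  -- There are n-2 third indices, each giving 3 y_ij. Summing the rows of i and j over third indices
  -- only leaves out y_ij once in each, so the full row sums need a correction 2 y_ij; altogether
  -- 3(n-2) + 2 = 3n-4.
  have h3 : ∀ i j, ∑ l, (triWeight n i j l * (y i j - y i l - y j l)
      - triWeight n i l j * (y i l - y i j - y l j) - triWeight n l j i * (y l j - y l i - y j i)) =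
      (3 * n - 4) * y i j - offWeight n i j * rowSum y i - offWeight n i j * rowSum y j := by
    intro i j
    have e : ∀ l, (triWeight n i j l * (y i j - y i l - y j l)
      - triWeight n i l j * (y i l - y i j - y l j) - triWeight n l j i * (y l j - y l i - y j i)) =
      3 * y i j * triWeight n i j l - triWeight n i j l * y i l - triWeight n i j l * y j l := by
      intro l
      rw [triWeight_reverse i j l, triWeight_swap_right i j l, hy.symm l i, hy.symm l j, hy.symm j i]
      ring
    simp only [e, Finset.sum_sub_distrib, ← Finset.mul_sum, sum_triWeight, sum_triWeight_mul]
    rw [hy.diag, hy.diag, hy.symm j i]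
    have := offWeight_mul hy.toIsWeight i j
    simp only [rowSum]
    linear_combination (3 * (n - 2) + 2) * this
  have h4 : ∑ i, ∑ j, ((3 * n - 4) * y i j - offWeight n i j * rowSum y i
      - offWeight n i j * rowSum y j) * w i j =
      (3 * n - 4) * (∑ i, ∑ j, y i j * w i j) - 2 * ∑ i, rowSum y i * rowSum w i := by
    have e : ∀ i j, ((3 * n - 4) * y i j - offWeight n i j * rowSum y i
      - offWeight n i j * rowSum y j) * w i j = (3 * n - 4) * (y i j * w i j) -
        rowSum y i * w i j - rowSum y j * w j i := fun i j => by
      rw [hw.symm j i]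
      linear_combination (-rowSum y i - rowSum y j) * offWeight_mul hw.toIsWeight i j
    simp only [e, Finset.sum_sub_distrib, ← Finset.mul_sum]
    have e2 : ∑ i, ∑ j, rowSum y j * w j i = ∑ i, rowSum y i * rowSum w i := by
      rw [Finset.sum_comm]
      simp only [← Finset.mul_sum, rowSum]
    rw [e2]
    simp only [rowSum]
    ring
  simp only [h3, h4] at h2
  have h5 : ∀ i j, offWeight n i j * (-y i j * -w i j) = y i j * w i j := fun i j => by
    linear_combination w i j * offWeight_mul hy.toIsWeight i j
  rw [expHess, sum_terms]
  simp only [termExp, Sum.elim_inl, Sum.elim_inr, LinearMap.coe_toContinuousLinearMap',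
    LinearMap.neg_apply, LinearMap.sub_apply, centered_of_sum_eq_zero hy.toIsWeight hy.sum,
    centered_of_sum_eq_zero hw.toIsWeight hw.sum, h5]
  simp only [mul_assoc] at h2
  rw [h2]
  ring

/-- The component of a traceless weight in the space of the `a i + a j`. -/
def rowPart (y : Fin n → Fin n → ℝ) (i j : Fin n) : ℝ :=
  offWeight n i j * ((rowSum y i + rowSum y j) / (n - 2))

/-- Summing a_i + a_j over j ≠ i gives (n-1) a_i + (0 - a_i). This factor n-2 is the normalisation
in `rowPart`. -/
lemma isTraceless_add {a : Fin n → ℝ} (ha : ∑ i, a i = 0) :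
    IsTraceless (fun i j => offWeight n i j * (a i + a j)) ∧
      ∀ i, rowSum (fun i j => offWeight n i j * (a i + a j)) i = (n - 2) * a i := by
  have h : ∀ i, rowSum (fun i j => offWeight n i j * (a i + a j)) i = (n - 2) * a i := by
    intro i
    simp only [rowSum, sum_offWeight_mul (fun j => a i + a j), Finset.sum_add_distrib, ha]
    simp
    ring
  refine ⟨⟨⟨fun i j => by rw [offWeight_symm i j, add_comm], fun i => by simp [offWeight]⟩, ?_⟩, h⟩
  change ∑ i, rowSum (fun i j => offWeight n i j * (a i + a j)) i = 0
  simp only [h, ← Finset.mul_sum, ha, mul_zero]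

variable (hn : 3 ≤ n)
include hn

lemma rowPart_spec {y : Fin n → Fin n → ℝ} (hy : IsTraceless y) :
    IsTraceless (rowPart y) ∧ ∀ i, rowSum (rowPart y) i = rowSum y i := by
  have hn' : (3 : ℝ) ≤ n := by exact_mod_cast hn
  have hn2 : (n : ℝ) - 2 ≠ 0 := by linarith
  have h0 : ∑ i, rowSum y i / ((n : ℝ) - 2) = 0 := by
    rw [← Finset.sum_div]
    simp only [rowSum, hy.sum, zero_div]
  have h := isTraceless_add h0
  have e : (fun i j => offWeight n i j * (rowSum y i / ((n : ℝ) - 2) + rowSum y j / (n - 2))) =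
      rowPart y := by
    ext i j
    rw [rowPart, add_div]
  rw [e] at h
  refine ⟨h.1, fun i => ?_⟩
  rw [h.2]
  field_simp

lemma sum_rowPart_mul (y : Fin n → Fin n → ℝ) {w : Fin n → Fin n → ℝ} (hw : IsTraceless w) :
    ∑ i, ∑ j, rowPart y i j * w i j = 2 / (n - 2) * ∑ i, rowSum y i * rowSum w i := by
  have e : ∀ i j, rowPart y i j * w i j = 1 / (n - 2) * (rowSum y i * w i j) +
      1 / (n - 2) * (rowSum y j * w j i) := fun i j => by
    rw [hw.symm j i, rowPart]
    linear_combination ((rowSum y i + rowSum y j) / (n - 2)) * offWeight_mul hw.toIsWeight i j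
  simp only [e, Finset.sum_add_distrib, ← Finset.mul_sum]
  have e2 : ∑ i, ∑ j, rowSum y j * w j i = ∑ i, rowSum y i * rowSum w i := by
    rw [Finset.sum_comm]
    simp only [← Finset.mul_sum, rowSum]
  rw [e2]
  simp only [rowSum]
  ring

/-- On row parts the product of the row sums is (n-2)/2 times the inner product, by
`sum_rowPart_mul`. The eigenvalue is therefore A - κ(3n-4)/2 + κ(n-2)/2 = A - κ(n-1). -/
lemma expHess_rowPart (A κ : ℝ) {y w : Fin n → Fin n → ℝ} (hy : IsTraceless y)
    (hw : IsTraceless w) : expHess (termCoef A κ) termExp y (rowPart w) =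
      (A - κ * (n - 1)) * ∑ i, ∑ j, y i j * rowPart w i j := by
  have hn' : (3 : ℝ) ≤ n := by exact_mod_cast hn
  have hn2 : (n : ℝ) - 2 ≠ 0 := by linarith
  obtain ⟨h1, h2⟩ := rowPart_spec hn hw
  rw [expHess_terms A κ hy h1]
  have h3 := sum_rowPart_mul hn w hy
  simp only [mul_comm (rowPart w _ _), mul_comm (rowSum w _)] at h3
  simp only [h2]
  have h4 : ∑ i, rowSum y i * rowSum w i = (n - 2) / 2 * ∑ i, ∑ j, y i j * rowPart w i j := by
    rw [h3]; field_simp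
  rw [h4]
  ring

lemma isTraceless_sub_rowPart {y : Fin n → Fin n → ℝ} (hy : IsTraceless y) :
    IsTraceless (y - rowPart y) ∧ ∀ i, rowSum (y - rowPart y) i = 0 := by
  obtain ⟨h1, h2⟩ := rowPart_spec hn hy
  have h3 : ∀ i, rowSum (y - rowPart y) i = 0 := fun i => by
    have : rowSum (y - rowPart y) i = rowSum y i - rowSum (rowPart y) i := by
      simp [rowSum]
    rw [this, h2, sub_self]
  refine ⟨⟨⟨fun i j => ?_, fun i => ?_⟩, ?_⟩, h3⟩
  · simp only [Pi.sub_apply, hy.symm i j, h1.symm i j]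
  · simp only [Pi.sub_apply, hy.diag, h1.diag, sub_zero]
  · exact Finset.sum_eq_zero fun i _ => h3 i

omit hn in
lemma expHess_of_rowSum_eq_zero (A κ : ℝ) {y w : Fin n → Fin n → ℝ} (hy : IsTraceless y)
    (hw : IsTraceless w) (h : ∀ i, rowSum w i = 0) : expHess (termCoef A κ) termExp y w =
      (A - κ * (3 * n - 4) / 2) * ∑ i, ∑ j, y i j * w i j := by
  rw [expHess_terms A κ hy hw]
  simp [h]

/-- `rowPart` is the orthogonal projection onto the arrays a_i + a_j: pairing with such an array
depends on the row sums only, and these agree for `y` and `rowPart y`. -/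
lemma sum_mul_rowPart_self {y : Fin n → Fin n → ℝ} (hy : IsTraceless y) :
    ∑ i, ∑ j, y i j * rowPart y i j = ∑ i, ∑ j, rowPart y i j ^ 2 := by
  obtain ⟨h1, h2⟩ := rowPart_spec hn hy
  have h3 := sum_rowPart_mul hn y h1
  have h4 := sum_rowPart_mul hn y hy
  simp only [h2] at h3
  simp only [sq, mul_comm (y _ _)]
  rw [h3, h4]

lemma sum_mul_sub_rowPart {y : Fin n → Fin n → ℝ} (hy : IsTraceless y) :
    ∑ i, ∑ j, y i j * (y - rowPart y) i j = ∑ i, ∑ j, (y - rowPart y) i j ^ 2 := by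
  have h := sum_mul_rowPart_self hn hy
  have e : ∀ i j, (y - rowPart y) i j ^ 2 = y i j * (y - rowPart y) i j - y i j * rowPart y i j +
    rowPart y i j ^ 2 := fun i j => by simp only [Pi.sub_apply]; ring
  simp only [e, Finset.sum_add_distrib, Finset.sum_sub_distrib, h]
  ring

lemma sum_sq_eq {y : Fin n → Fin n → ℝ} (hy : IsTraceless y) :
    ∑ i, ∑ j, y i j ^ 2 = ∑ i, ∑ j, rowPart y i j ^ 2 + ∑ i, ∑ j, (y - rowPart y) i j ^ 2 := by
  rw [← sum_mul_rowPart_self hn hy, ← sum_mul_sub_rowPart hn hy]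
  simp only [← Finset.sum_add_distrib]
  refine Finset.sum_congr rfl fun i _ => Finset.sum_congr rfl fun j _ => ?_
  simp only [Pi.sub_apply]
  ring

omit hn in
lemma sum_sq_eq_zero {y : Fin n → Fin n → ℝ} (h : ∑ i, ∑ j, y i j ^ 2 = 0) : y = 0 := by
  ext i j
  have h1 := (Finset.sum_eq_zero_iff_of_nonneg fun i _ =>
    Finset.sum_nonneg fun j _ => sq_nonneg (y i j)).mp h i (Finset.mem_univ i)
  have h2 := (Finset.sum_eq_zero_iff_of_nonneg fun j _ => sq_nonneg (y i j)).mp h1 j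
    (Finset.mem_univ j)
  exact pow_eq_zero_iff two_ne_zero |>.mp h2

end Energy

/-! ### Recovering the coefficients of a diagonal form -/

section Coefficients

variable {𝕜 : Type*} [NormedDivisionRing 𝕜] [NormedAlgebra ℝ 𝕜] [FiniteDimensional ℝ 𝕜]
  [StarRing 𝕜] [StarModule ℝ 𝕜] [Scalars 𝕜] {n k : ℕ}

variable (𝕜) in
lemma δ_pos : 0 < δ 𝕜 := by
  rcases Nat.eq_zero_or_pos (δ 𝕜) with h | h
  · have h1 := sum_re (1 : 𝕜)
    have : IsEmpty (Fin (δ 𝕜)) := by rw [h]; infer_instance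
    simp at h1
  · exact h

lemma blockDim_pos (hk : 1 ≤ k) : 0 < blockDim 𝕜 k := by
  have := δ_pos 𝕜
  rw [blockDim]
  positivity

variable (𝕜 n k) in
/-- `diagForm` as a linear map. -/
def diagFormL : (Fin n → Fin n → ℝ) →ₗ[ℝ] Form 𝕜 n k where
  toFun := diagForm 𝕜 n k
  map_add' x y := by
    ext v w
    simp only [diagForm_apply, wform_apply, LinearMap.add_apply, Pi.add_apply, add_mul,
      Finset.sum_add_distrib, mul_add]
  map_smul' c x := by
    ext v w
    simp only [diagForm_apply, wform_apply, LinearMap.smul_apply, Pi.smul_apply, smul_eq_mul,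
      RingHom.id_apply, Finset.mul_sum]
    exact Finset.sum_congr rfl fun p _ => Finset.sum_congr rfl fun q _ => by ring

lemma diagFormL_apply (x : Fin n → Fin n → ℝ) : diagFormL 𝕜 n k x = diagForm 𝕜 n k x := rfl

lemma diagForm_mono {x y : Fin n → Fin n → ℝ} (h : ∀ i j, i ≠ j → x i j ≤ y i j)
    (v : offDiag 𝕜 n k) : diagForm 𝕜 n k x v v ≤ diagForm 𝕜 n k y v v := by
  simp only [diagForm_apply, wform_apply]
  refine mul_le_mul_of_nonneg_left (Finset.sum_le_sum fun p _ => Finset.sum_le_sum fun q _ => ?_)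
    (by norm_num)
  by_cases hpq : p.1 = q.1
  · simp [offDiag_zero v.2 hpq]
  · exact mul_le_mul_of_nonneg_right (h _ _ hpq) (re_mul_star_self_nonneg _)

lemma diagForm_pos {x : Fin n → Fin n → ℝ} (h : ∀ i j, i ≠ j → 0 < x i j) {v : offDiag 𝕜 n k}
    (hv : v ≠ 0) : 0 < diagForm 𝕜 n k x v v := by
  have hnn : ∀ p q, 0 ≤ x p.1 q.1 * re ((v : Mat 𝕜 n k) p q * star ((v : Mat 𝕜 n k) p q)) := by
    intro p q
    by_cases hpq : p.1 = q.1
    · simp [offDiag_zero v.2 hpq]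
    · exact mul_nonneg (h _ _ hpq).le (re_mul_star_self_nonneg _)
  have hv' : ∃ p q, (v : Mat 𝕜 n k) p q ≠ 0 := by
    by_contra hcon
    push Not at hcon
    exact hv (by ext p q; simp [hcon])
  obtain ⟨p, q, hpq⟩ := hv'
  have hne : p.1 ≠ q.1 := fun e => hpq (offDiag_zero v.2 e)
  rw [diagForm_apply, wform_apply]
  refine mul_pos (by norm_num) ?_
  refine Finset.sum_pos' (fun p _ => Finset.sum_nonneg fun q _ => hnn p q) ⟨p, Finset.mem_univ _, ?_⟩
  exact Finset.sum_pos' (fun q _ => hnn p q)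
    ⟨q, Finset.mem_univ _, mul_pos (h _ _ hne) (re_mul_star_self_pos hpq)⟩

lemma wform_elem (x : Fin n → Fin n → ℝ) (hx : IsSymm x) {r s : Fin n × Fin k} (h : r.1 ≠ s.1)
    {a : 𝕜} (ha : a * star a = 1) (hr : re (1 : 𝕜) = 1) :
    wform 𝕜 n k x (elem r s a) (elem r s a) = x r.1 s.1 := by
  have hrs : r ≠ s := fun e => h (by rw [e])
  have ha' : star a * a = 1 := by
    rw [eq_inv_of_mul_eq_one_right ha, inv_mul_cancel₀ (left_ne_zero_of_mul_eq_one ha)]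
  rw [wform_apply]
  have key : ∀ p, ∑ q, x p.1 q.1 * re (elem r s a p q * star (elem r s a p q)) =
      (if p = r then x r.1 s.1 else 0) + (if p = s then x r.1 s.1 else 0) := by
    intro p
    have hp : ∀ q, x p.1 q.1 * re (elem r s a p q * star (elem r s a p q)) =
        (if p = r ∧ q = s then x r.1 s.1 else 0) + (if p = s ∧ q = r then x r.1 s.1 else 0) := by
      intro q
      simp only [elem, Matrix.of_apply]
      by_cases h1 : p = r ∧ q = s
      · obtain ⟨rfl, rfl⟩ := h1
        simp [hrs, ha, hr]
      · by_cases h2 : p = s ∧ q = r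
        · obtain ⟨rfl, rfl⟩ := h2
          simp [hrs.symm, ha', hr, hx p.1 q.1]
        · simp [h1, h2]
    simp only [hp, Finset.sum_add_distrib]
    congr 1
    · by_cases h1 : p = r <;> simp [h1]
    · by_cases h1 : p = s <;> simp [h1]
  simp only [key, Finset.sum_add_distrib, Finset.sum_ite_eq', Finset.mem_univ, if_true]
  ring

variable (𝕜) in
lemma re_one : re (1 : 𝕜) = 1 := by
  have h := re_unit (𝕜 := 𝕜) ⟨0, δ_pos 𝕜⟩ ⟨0, δ_pos 𝕜⟩
  rwa [unit_mul_star, if_pos rfl] at h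

lemma diagForm_elem {x : Fin n → Fin n → ℝ} (hx : IsSymm x) {r s : Fin n × Fin k} (h : r.1 ≠ s.1) :
    diagForm 𝕜 n k x ⟨elem r s 1, elem_mem h 1⟩ ⟨elem r s 1, elem_mem h 1⟩ = x r.1 s.1 :=
  wform_elem x hx h (by simp) (re_one 𝕜)

/-- The coefficients of a diagonal form. -/
def coefL (hk : 1 ≤ k) : Form 𝕜 n k →ₗ[ℝ] (Fin n → Fin n → ℝ) where
  toFun T i j := if h : i ≠ j then
    T ⟨elem (i, ⟨0, hk⟩) (j, ⟨0, hk⟩) 1, elem_mem h 1⟩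
      ⟨elem (i, ⟨0, hk⟩) (j, ⟨0, hk⟩) 1, elem_mem h 1⟩ else 0
  map_add' T S := by
    ext i j
    simp only [Pi.add_apply]
    split_ifs <;> simp
  map_smul' c T := by
    ext i j
    simp only [Pi.smul_apply]
    split_ifs <;> simp

lemma coefL_diagForm (hk : 1 ≤ k) {x : Fin n → Fin n → ℝ} (hx : IsWeight x) :
    coefL hk (diagForm 𝕜 n k x) = x := by
  ext i j
  simp only [coefL, LinearMap.coe_mk, AddHom.coe_mk]
  split_ifs with h
  · exact diagForm_elem (r := (i, ⟨0, hk⟩)) (s := (j, ⟨0, hk⟩)) hx.symm h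
  · rw [not_not.mp h, hx.diag]

lemma diagForm_injective (hk : 1 ≤ k) {x y : Fin n → Fin n → ℝ} (hx : IsWeight x) (hy : IsWeight y)
    (h : diagForm 𝕜 n k x = diagForm 𝕜 n k y) : x = y := by
  rw [← coefL_diagForm (𝕜 := 𝕜) hk hx, h, coefL_diagForm hk hy]

lemma pos_of_diagForm_pos (hk : 1 ≤ k) {x : Fin n → Fin n → ℝ} (hx : IsWeight x)
    (h : ∀ v : offDiag 𝕜 n k, v ≠ 0 → 0 < diagForm 𝕜 n k x v v) {i j : Fin n} (hij : i ≠ j) :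
    0 < x i j := by
  have h1 := diagForm_elem (𝕜 := 𝕜) (k := k) hx.symm (r := (i, ⟨0, hk⟩)) (s := (j, ⟨0, hk⟩)) hij
  rw [← h1]
  refine h _ fun e => ?_
  have h2 := congrArg (fun v : offDiag 𝕜 n k => (v : Mat 𝕜 n k) (i, ⟨0, hk⟩) (j, ⟨0, hk⟩)) e
  simp [elem] at h2

lemma near_diagForm (hk : 1 ≤ k) {x y : Fin n → Fin n → ℝ} (hx : IsWeight x) (hy : IsWeight y)
    {ε : ℝ} (h : Near (diagForm 𝕜 n k x) ε (diagForm 𝕜 n k y)) {i j : Fin n} (hij : i ≠ j) :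
    |y i j - x i j| ≤ ε * x i j := by
  have h1 := h ⟨elem (i, ⟨0, hk⟩) (j, ⟨0, hk⟩) 1, elem_mem hij 1⟩
  rwa [diagForm_elem (r := (i, ⟨0, hk⟩)) (s := (j, ⟨0, hk⟩)) hx.symm hij,
    diagForm_elem (r := (i, ⟨0, hk⟩)) (s := (j, ⟨0, hk⟩)) hy.symm hij] at h1

lemma near_of_le {x y : Fin n → Fin n → ℝ} {ε : ℝ} (h : ∀ i j, i ≠ j → |y i j - x i j| ≤ ε * x i j) :
    Near (diagForm 𝕜 n k x) ε (diagForm 𝕜 n k y) := by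
  intro v
  have e1 : diagForm 𝕜 n k y v v - diagForm 𝕜 n k x v v = diagForm 𝕜 n k (y - x) v v := by
    rw [← diagFormL_apply (y - x), map_sub]; rfl
  have e2 : ε * diagForm 𝕜 n k x v v = diagForm 𝕜 n k (ε • x) v v := by
    rw [← diagFormL_apply (ε • x), map_smul]; rfl
  have e3 : -(diagForm 𝕜 n k (ε • x) v v) = diagForm 𝕜 n k (-(ε • x)) v v := by
    rw [← diagFormL_apply (-(ε • x)), map_neg]; rfl
  rw [e1, e2, abs_le, e3]
  exact ⟨diagForm_mono (fun i j hij => (abs_le.mp (h i j hij)).1.trans' (by simp)) v,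
    diagForm_mono (fun i j hij => (abs_le.mp (h i j hij)).2) v⟩

end Coefficients

/-! ### Variations of the volume-normalised scalar curvature -/

section Rescale

variable {𝕜 : Type*} [NormedDivisionRing 𝕜] [NormedAlgebra ℝ 𝕜] [FiniteDimensional ℝ 𝕜]
  [StarRing 𝕜] [StarModule ℝ 𝕜] [Scalars 𝕜] {n k : ℕ}

/-- The weight with the value `c` off the diagonal. -/
def constWeight (n : ℕ) (c : ℝ) (i j : Fin n) : ℝ := c * offWeight n i j

lemma isWeight_constWeight (c : ℝ) : IsWeight (constWeight n c) :=
  isWeight_offWeight.map (fun a => c * a) (by simp)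

lemma constWeight_of_ne (c : ℝ) {i j : Fin n} (h : i ≠ j) : constWeight n c i j = c := by
  simp [constWeight, offWeight, h]

/-- Logarithmic coordinates. -/
def logWeight (c : ℝ) (x : Fin n → Fin n → ℝ) (i j : Fin n) : ℝ := Real.log (x i j / c)

lemma isWeight_logWeight (c : ℝ) {x : Fin n → Fin n → ℝ} (hx : IsWeight x) :
    IsWeight (logWeight c x) := hx.map (fun a => Real.log (a / c)) (by simp)

variable (𝕜 n k) in
/-- The scalar curvature as a sum of exponentials. -/
def energy (y : Fin n → Fin n → ℝ) : ℝ :=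
  expSum (termCoef (scalConst 𝕜 n k) (k * δ 𝕜)) termExp y

lemma log_div_constWeight {c : ℝ} {x : Fin n → Fin n → ℝ} (hx : IsWeight x) (i j : Fin n) :
    Real.log (x i j / constWeight n c i j) = logWeight c x i j := by
  by_cases h : i = j
  · subst h; simp [logWeight, hx.diag]
  · rw [constWeight_of_ne c h, logWeight]

lemma detForm_constWeight {c : ℝ} (hc : 0 < c) {x : Fin n → Fin n → ℝ} (hx : IsWeight x)
    (hp : ∀ i j, i ≠ j → 0 < x i j) :
    detForm (diagForm 𝕜 n k (constWeight n c)) (diagForm 𝕜 n k x) =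
      Real.exp (blockDim 𝕜 k / 2 * ∑ i, ∑ j, logWeight c x i j) := by
  rw [detForm_diagForm (isWeight_constWeight c) hx
    (fun i j h => by rw [constWeight_of_ne c h]; exact hc) hp]
  simp only [log_div_constWeight hx]

lemma smul_diagForm (r : ℝ) (x : Fin n → Fin n → ℝ) :
    r • diagForm 𝕜 n k x = diagForm 𝕜 n k fun i j => r * x i j :=
  ((diagFormL 𝕜 n k).map_smul r x).symm

/-- Rescaling to the volume of the standard metric subtracts from the logarithmic coordinates their
mean, which is what `centered` does. The constraint on the volume is thereby built into the
exponents, and `energy` may be studied without constraint. -/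
lemma scal_rescale (hn : 3 ≤ n) (hk : 1 ≤ k) {c : ℝ} (hc : 0 < c) {x : Fin n → Fin n → ℝ}
    (hx : IsWeight x) (hp : ∀ i j, i ≠ j → 0 < x i j) :
    scal (rescale (diagForm 𝕜 n k (constWeight n c)) (diagForm 𝕜 n k x)) =
      blockDim 𝕜 k / (2 * c) * energy 𝕜 n k (logWeight c x) := by
  have hn' : (3 : ℝ) ≤ n := by exact_mod_cast hn
  have hb := blockDim_pos (𝕜 := 𝕜) hk
  have hnn : (n : ℝ) * (n - 1) ≠ 0 := by
    have : (n : ℝ) - 1 ≠ 0 := by linarith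
    have : (n : ℝ) ≠ 0 := by linarith
    positivity
  have hy := isWeight_logWeight c hx
  set y := logWeight c x with hydef
  set m := (∑ i, ∑ j, y i j) / (n * (n - 1)) with hm
  have hcen : ∀ i j, centered i j y = y i j - m := fun i j => by
    simp only [centered, LinearMap.coe_mk, AddHom.coe_mk, offWeight_mul hy, hm]
  have hr : rescale (diagForm 𝕜 n k (constWeight n c)) (diagForm 𝕜 n k x) =
      diagForm 𝕜 n k fun i j => Real.exp (-m) * x i j := by
    -- The dimension of M is blockDim/2 · n(n-1), so raising the determinant to the power -1/dim M
    -- gives exactly exp(-m), with m the mean.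
    have e : blockDim 𝕜 k / 2 * (∑ i, ∑ j, y i j) *
        -(1 / (blockDim 𝕜 k / 2 * (n * (n - 1)))) = -m := by
      rw [hm]
      field_simp
    rw [rescale, detForm_constWeight hc hx hp, ← Real.exp_mul, smul_diagForm, dimM_eq, ← hydef, e]
  have hx' : IsWeight fun i j => Real.exp (-m) * x i j := hx.map (fun a => Real.exp (-m) * a) (by simp)
  have hp' : ∀ i j, i ≠ j → Real.exp (-m) * x i j ≠ 0 := fun i j h =>
    (mul_pos (Real.exp_pos _) (hp i j h)).ne'
  have hval : ∀ i j, i ≠ j → Real.exp (-m) * x i j = c * Real.exp (centered i j y) := by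
    intro i j h
    rw [hcen, sub_eq_add_neg, Real.exp_add, hydef, logWeight, Real.exp_log (div_pos (hp i j h) hc)]
    field_simp
  rw [hr, scal, scalAt_diagForm hx' hp', sum_ricCoef_div hx' hp', energy, expSum, sum_terms]
  have t1 : ∀ i j, 1 / (Real.exp (-m) * x i j) =
      c⁻¹ * (offWeight n i j * Real.exp (termExp (Sum.inl (i, j)) y)) := by
    intro i j
    by_cases h : i = j
    · subst h; simp [hx.diag, offWeight]
    · rw [hval i j h]
      simp [termExp, offWeight, h, Real.exp_neg, mul_comm]
  have t2 : ∀ i j l, (Real.exp (-m) * x i j) / ((Real.exp (-m) * x i l) * (Real.exp (-m) * x j l)) =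
      c⁻¹ * (triWeight n i j l * Real.exp (termExp (Sum.inr (i, j, l)) y)) := by
    intro i j l
    by_cases h1 : i = j
    · subst h1; simp [hx.diag, triWeight, offWeight]
    by_cases h2 : i = l
    · subst h2; simp [hx.diag, triWeight, offWeight]
    by_cases h3 : j = l
    · subst h3; simp [hx.diag, triWeight, offWeight]
    rw [hval i j h1, hval i l h2, hval j l h3]
    simp only [termExp, Sum.elim_inr, triWeight, offWeight, h1, h2, h3, if_false,
      LinearMap.coe_toContinuousLinearMap', LinearMap.sub_apply, Real.exp_sub]
    field_simp
  simp only [t1, t2, ← Finset.mul_sum]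
  field_simp

lemma scal_of_detForm_eq_one (hn : 3 ≤ n) (hk : 1 ≤ k) {c : ℝ} (hc : 0 < c)
    {x : Fin n → Fin n → ℝ} (hx : IsWeight x) (hp : ∀ i j, i ≠ j → 0 < x i j)
    (h1 : detForm (diagForm 𝕜 n k (constWeight n c)) (diagForm 𝕜 n k x) = 1) :
    scal (diagForm 𝕜 n k x) = blockDim 𝕜 k / (2 * c) * energy 𝕜 n k (logWeight c x) := by
  rw [← scal_rescale hn hk hc hx hp, rescale, h1, Real.one_rpow, one_smul]

lemma logWeight_constWeight (c : ℝ) : logWeight c (constWeight n c) = 0 := by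
  ext i j
  by_cases h : i = j
  · subst h; simp [logWeight, constWeight, offWeight]
  · by_cases hc : c = 0
    · simp [logWeight, hc]
    · simp [logWeight, constWeight_of_ne c h, div_self hc]

lemma hasDerivAt_logWeight {c : ℝ} (hc : 0 < c) {x z : Fin n → Fin n → ℝ} (hx : IsWeight x)
    (hz : IsWeight z) (hp : ∀ i j, i ≠ j → 0 < x i j) :
    HasDerivAt (fun t : ℝ => logWeight c (x + t • z)) (fun i j => z i j / x i j) 0 := by
  refine hasDerivAt_pi.mpr fun i => hasDerivAt_pi.mpr fun j => ?_
  by_cases h : i = j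
  · subst h
    simp only [logWeight, Pi.add_apply, Pi.smul_apply, hx.diag, hz.diag, smul_eq_mul, mul_zero,
      add_zero, zero_div, Real.log_zero]
    exact hasDerivAt_const _ _
  · have h1 : HasDerivAt (fun t : ℝ => (x i j + t * z i j) / c) (z i j / c) 0 := by
      have := (((hasDerivAt_id (0 : ℝ)).mul_const (z i j)).const_add (x i j)).div_const c
      simpa using this
    have hne := (hp i j h).ne'
    have h2 := h1.log (by simp [hne, hc.ne'])
    simp only [zero_mul, add_zero] at h2
    refine h2.congr_deriv ?_
    field_simp

lemma IsWeight.add_smul {x z : Fin n → Fin n → ℝ} (hx : IsWeight x) (hz : IsWeight z) (t : ℝ) :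
    IsWeight (x + t • z) := hx.map₂ hz (fun a b => a + t * b) (by simp)

lemma eventually_pos {x z : Fin n → Fin n → ℝ} (hp : ∀ i j, i ≠ j → 0 < x i j) :
    ∀ᶠ t in 𝓝 (0 : ℝ), ∀ i j, i ≠ j → 0 < (x + t • z) i j := by
  refine Filter.eventually_all.mpr fun i => Filter.eventually_all.mpr fun j => ?_
  by_cases h : i = j
  · simp [h]
  · have h1 : Filter.Tendsto (fun t : ℝ => (x + t • z) i j) (𝓝 0) (𝓝 (x i j)) := by
      have : Continuous fun t : ℝ => x i j + t * z i j := by fun_prop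
      simpa using this.tendsto 0
    filter_upwards [h1.eventually (lt_mem_nhds (hp i j h))] with t ht _ using ht

lemma diagForm_add_smul (x z : Fin n → Fin n → ℝ) (t : ℝ) :
    diagForm 𝕜 n k x + t • diagForm 𝕜 n k z = diagForm 𝕜 n k (x + t • z) := by
  rw [← diagFormL_apply (x + t • z), map_add, map_smul]; rfl

/-- The first variation of the scalar curvature. -/
lemma hasDerivAt_scal (hn : 3 ≤ n) (hk : 1 ≤ k) {c : ℝ} (hc : 0 < c) {z : Fin n → Fin n → ℝ}
    (hz : IsWeight z) :
    HasDerivAt (fun t : ℝ => scal (rescale (diagForm 𝕜 n k (constWeight n c))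
      (diagForm 𝕜 n k (constWeight n c) + t • diagForm 𝕜 n k z))) 0 0 := by
  have hcw := isWeight_constWeight (n := n) c
  have hp : ∀ i j, i ≠ j → 0 < constWeight n c i j := fun i j h => by
    rw [constWeight_of_ne c h]; exact hc
  have h1 := (hasDerivAt_expSum (termCoef (scalConst 𝕜 n k) (k * δ 𝕜)) termExp
    (hasDerivAt_logWeight hc hcw hz hp)).const_mul (blockDim 𝕜 k / (2 * c))
  simp only [zero_smul, add_zero, logWeight_constWeight, map_zero, Real.exp_zero, one_mul] at h1
  rw [sum_terms_linear hn _ _ (hz.map₂ hcw (fun a b => a / b) (by simp)).symm, mul_zero] at h1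
  refine h1.congr_of_eventuallyEq ?_
  filter_upwards [eventually_pos (z := z) hp] with t ht
  rw [diagForm_add_smul, scal_rescale hn hk hc (hcw.add_smul hz t) ht]
  rfl

/-- The second variation of the scalar curvature. -/
lemma hess_diagForm (hn : 3 ≤ n) (hk : 1 ≤ k) {c : ℝ} (hc : 0 < c) {z w : Fin n → Fin n → ℝ}
    (hz : IsWeight z) (hw : IsWeight w) :
    hess (diagForm 𝕜 n k (constWeight n c)) (diagForm 𝕜 n k z) (diagForm 𝕜 n k w) =
      blockDim 𝕜 k / (2 * c ^ 3) *
        expHess (termCoef (scalConst 𝕜 n k) (k * δ 𝕜)) termExp z w := by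
  have hcw := isWeight_constWeight (n := n) c
  have hp : ∀ i j, i ≠ j → 0 < constWeight n c i j := fun i j h => by
    rw [constWeight_of_ne c h]; exact hc
  set y : ℝ → ℝ → Fin n → Fin n → ℝ := fun s t => logWeight c (constWeight n c + s • z + t • w)
    with hy
  have h1 : (fun s : ℝ => deriv (fun t : ℝ => scal (rescale (diagForm 𝕜 n k (constWeight n c))
      (diagForm 𝕜 n k (constWeight n c) + s • diagForm 𝕜 n k z + t • diagForm 𝕜 n k w))) 0)
      =ᶠ[𝓝 0] fun s => blockDim 𝕜 k / (2 * c) * deriv (fun t => energy 𝕜 n k (y s t)) 0 := by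
    filter_upwards [eventually_pos (z := z) hp] with s hs
    rw [← deriv_const_mul_field]
    refine Filter.EventuallyEq.deriv_eq ?_
    filter_upwards [eventually_pos (z := w) hs] with t ht
    rw [diagForm_add_smul, diagForm_add_smul,
      scal_rescale hn hk hc ((hcw.add_smul hz s).add_smul hw t) ht]
  have hdiv : ∀ {x : Fin n → Fin n → ℝ}, IsWeight x → IsWeight fun i j => x i j / c := fun hx =>
    hx.map (fun a => a / c) (by simp)
  have h2 : HasDerivAt (fun s => y s 0) (fun i j => z i j / c) 0 := by
    have := hasDerivAt_logWeight hc hcw hz hp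
    simp only [hy, zero_smul, add_zero]
    refine this.congr_deriv ?_
    ext i j
    by_cases h : i = j
    · subst h; simp [hz.diag]
    · rw [constWeight_of_ne c h]
  have h3 : ∀ᶠ s in 𝓝 (0 : ℝ), HasDerivAt (y s)
      (fun i j => w i j / (constWeight n c + s • z) i j) 0 := by
    filter_upwards [eventually_pos (z := z) hp] with s hs
    exact hasDerivAt_logWeight hc (hcw.add_smul hz s) hw hs
  -- Straight lines of metrics are not straight in logarithmic coordinates. Their mixed second
  -- derivative -wz/c² is symmetric in the indices, so the first derivative of the energy at the
  -- origin annihilates it and only the Hessian remains.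
  have h4 : HasDerivAt (fun s : ℝ => (fun i j => w i j / (constWeight n c + s • z) i j))
      (fun i j => -(w i j * z i j) / c ^ 2) 0 := by
    refine hasDerivAt_pi.mpr fun i => hasDerivAt_pi.mpr fun j => ?_
    by_cases h : i = j
    · subst h
      simp only [hw.diag, zero_div, zero_mul, neg_zero]
      exact hasDerivAt_const _ _
    · have h5 : HasDerivAt (fun s : ℝ => (constWeight n c + s • z) i j) (z i j) 0 := by
        simp only [Pi.add_apply, Pi.smul_apply, smul_eq_mul]
        simpa using ((hasDerivAt_id (0 : ℝ)).mul_const (z i j)).const_add (constWeight n c i j)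
      have h6 := (hasDerivAt_const (0 : ℝ) (w i j)).div h5
        (by simp [constWeight_of_ne c h, hc.ne'])
      refine h6.congr_deriv ?_
      simp [constWeight_of_ne c h]
  have hZ : IsSymm fun i j => -(w i j * z i j) / c ^ 2 := fun i j => by
    simp only [hw.symm i j, hz.symm i j]
  have h5 := deriv_deriv_expSum (termCoef (scalConst 𝕜 n k) (k * δ 𝕜)) termExp
    (y := y) (by simp [hy, logWeight_constWeight]) h2 h3 h4 (sum_terms_linear hn _ _ hZ)
  rw [hess, h1.deriv_eq, deriv_const_mul_field]
  have h6 : deriv (fun s => deriv (fun t => energy 𝕜 n k (y s t)) 0) 0 =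
      expHess (termCoef (scalConst 𝕜 n k) (k * δ 𝕜)) termExp (fun i j => z i j / c)
        (fun i j => w i j / (constWeight n c + (0 : ℝ) • z) i j) := h5
  have h7 : (fun i j => w i j / (constWeight n c + (0 : ℝ) • z) i j) = c⁻¹ • w := by
    ext i j
    by_cases h : i = j
    · subst h; simp [hw.diag]
    · simp [constWeight_of_ne c h, div_eq_inv_mul]
  have h8 : (fun i j => z i j / c) = c⁻¹ • z := by ext i j; simp [div_eq_inv_mul]
  rw [h6, h7, h8, expHess, expHess, Finset.mul_sum, Finset.mul_sum]
  refine Finset.sum_congr rfl fun m _ => ?_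
  simp only [map_smul, smul_eq_mul]
  field_simp

end Rescale

/-! ### Eigenspaces and definiteness of the Hessian -/

section Quadratic

variable {n : ℕ}

lemma norm_sq_le_sum (y : Fin n → Fin n → ℝ) : ‖y‖ ^ 2 ≤ ∑ i, ∑ j, y i j ^ 2 := by
  have h0 : 0 ≤ ∑ i, ∑ j, y i j ^ 2 :=
    Finset.sum_nonneg fun i _ => Finset.sum_nonneg fun j _ => sq_nonneg _
  have h : ‖y‖ ≤ √(∑ i, ∑ j, y i j ^ 2) := by
    refine (pi_norm_le_iff_of_nonneg (Real.sqrt_nonneg _)).mpr fun i =>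
      (pi_norm_le_iff_of_nonneg (Real.sqrt_nonneg _)).mpr fun j => ?_
    refine Real.le_sqrt_of_sq_le ?_
    rw [Real.norm_eq_abs, sq_abs]
    refine (Finset.single_le_sum (f := fun j => y i j ^ 2) (fun j _ => sq_nonneg _)
      (Finset.mem_univ j)).trans ?_
    exact Finset.single_le_sum (f := fun i => ∑ j, y i j ^ 2)
      (fun i _ => Finset.sum_nonneg fun j _ => sq_nonneg _) (Finset.mem_univ i)
  calc ‖y‖ ^ 2 ≤ √(∑ i, ∑ j, y i j ^ 2) ^ 2 := pow_le_pow_left₀ (norm_nonneg _) h 2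
    _ = _ := Real.sq_sqrt h0

/-- For three blocks a traceless weight is determined by its row sums. -/
lemma eq_zero_of_rowSum (hn : n = 3) {y : Fin n → Fin n → ℝ} (hy : IsWeight y)
    (h : ∀ i, rowSum y i = 0) : y = 0 := by
  subst hn
  have h0 := h 0
  have h1 := h 1
  have h2 := h 2
  simp only [rowSum, Fin.sum_univ_three, hy.diag, hy.symm 1 0, hy.symm 2 0, hy.symm 2 1] at h0 h1 h2
  ext i j
  fin_cases i <;> fin_cases j <;>
    simp [hy.diag, hy.symm 1 0, hy.symm 2 0, hy.symm 2 1] <;> linarith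

lemma rowPart_add (hn : 3 ≤ n) {a : Fin n → ℝ} (ha : ∑ i, a i = 0) :
    rowPart (fun i j => offWeight n i j * (a i + a j)) =
      fun i j => offWeight n i j * (a i + a j) := by
  have hn' : (3 : ℝ) ≤ n := by exact_mod_cast hn
  have hn2 : (n : ℝ) - 2 ≠ 0 := by linarith
  ext i j
  rw [rowPart, (isTraceless_add ha).2, (isTraceless_add ha).2]
  field_simp

lemma expHess_self (hn : 3 ≤ n) (A κ : ℝ) {y : Fin n → Fin n → ℝ} (hy : IsTraceless y) :
    expHess (termCoef A κ) termExp y y = (A - κ * (n - 1)) * ∑ i, ∑ j, rowPart y i j ^ 2 +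
      (A - κ * (3 * n - 4) / 2) * ∑ i, ∑ j, (y - rowPart y) i j ^ 2 := by
  obtain ⟨h1, h2⟩ := isTraceless_sub_rowPart hn hy
  have e : expHess (termCoef A κ) termExp y y = expHess (termCoef A κ) termExp y (rowPart y) +
      expHess (termCoef A κ) termExp y (y - rowPart y) := by
    simp only [expHess, map_sub, ← Finset.sum_add_distrib]
    exact Finset.sum_congr rfl fun m _ => by ring
  rw [e, expHess_rowPart hn A κ hy hy, expHess_of_rowSum_eq_zero A κ hy h1 h2,
    sum_mul_rowPart_self hn hy, sum_mul_sub_rowPart hn hy]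

/-- The Hessian is non-degenerate. -/
def HessNondeg (n : ℕ) (A κ : ℝ) : Prop := n = 3 ∨ A - κ * (3 * n - 4) / 2 ≠ 0

/-- The Hessian is positive definite. -/
def HessPos (n : ℕ) (A κ : ℝ) : Prop := n = 3 ∨ 0 < A - κ * (3 * n - 4) / 2

/-- With the absolute value of the second eigenvalue the estimate needs only non-degeneracy; it
serves both rigidity and, when the eigenvalue is positive, local minimality. For n = 3 the second
component vanishes and its eigenvalue is irrelevant. -/
lemma exists_lower_bound (hn : 3 ≤ n) {A κ : ℝ} (h1 : 0 < A - κ * (n - 1))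
    (h2 : HessNondeg n A κ) : ∃ μ : ℝ, 0 < μ ∧ ∀ y : Fin n → Fin n → ℝ, IsTraceless y →
      μ * ∑ i, ∑ j, y i j ^ 2 ≤ (A - κ * (n - 1)) * ∑ i, ∑ j, rowPart y i j ^ 2 +
        |A - κ * (3 * n - 4) / 2| * ∑ i, ∑ j, (y - rowPart y) i j ^ 2 := by
  have hnn : ∀ z : Fin n → Fin n → ℝ, 0 ≤ ∑ i, ∑ j, z i j ^ 2 := fun z =>
    Finset.sum_nonneg fun i _ => Finset.sum_nonneg fun j _ => sq_nonneg _
  rcases h2 with h2 | h2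
  · refine ⟨_, h1, fun y hy => ?_⟩
    obtain ⟨h3, h4⟩ := isTraceless_sub_rowPart hn hy
    rw [sum_sq_eq hn hy, eq_zero_of_rowSum h2 h3.toIsWeight h4]
    simp
  · refine ⟨min (A - κ * (n - 1)) |A - κ * (3 * n - 4) / 2|, lt_min h1 (abs_pos.mpr h2),
      fun y hy => ?_⟩
    rw [sum_sq_eq hn hy, mul_add]
    exact add_le_add (mul_le_mul_of_nonneg_right (min_le_left _ _) (hnn _))
      (mul_le_mul_of_nonneg_right (min_le_right _ _) (hnn _))

lemma exists_lower_bound_expHess (hn : 3 ≤ n) {A κ : ℝ} (h1 : 0 < A - κ * (n - 1))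
    (h2 : HessPos n A κ) : ∃ μ : ℝ, 0 < μ ∧ ∀ y : Fin n → Fin n → ℝ, IsTraceless y →
      μ * ‖y‖ ^ 2 ≤ expHess (termCoef A κ) termExp y y := by
  obtain ⟨μ, hμ, h⟩ := exists_lower_bound hn h1 (h2.imp id ne_of_gt)
  refine ⟨μ, hμ, fun y hy => ?_⟩
  have h3 := h y hy
  have h4 : |A - κ * (3 * n - 4) / 2| * ∑ i, ∑ j, (y - rowPart y) i j ^ 2 =
      (A - κ * (3 * n - 4) / 2) * ∑ i, ∑ j, (y - rowPart y) i j ^ 2 := by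
    rcases h2 with h2 | h2
    · obtain ⟨h5, h6⟩ := isTraceless_sub_rowPart hn hy
      rw [eq_zero_of_rowSum h2 h5.toIsWeight h6]
      simp
    · rw [abs_of_pos h2]
  rw [h4, ← expHess_self hn A κ hy] at h3
  exact (mul_le_mul_of_nonneg_left (norm_sq_le_sum y) hμ.le).trans h3

/-- For at least four blocks there are weights with vanishing row sums. -/
lemma exists_rowSum_eq_zero (hn : 4 ≤ n) :
    ∃ y : Fin n → Fin n → ℝ, IsTraceless y ∧ (∀ i, rowSum y i = 0) ∧ y ≠ 0 := by
  let i0 : Fin n := ⟨0, by omega⟩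
  let i1 : Fin n := ⟨1, by omega⟩
  let i2 : Fin n := ⟨2, by omega⟩
  let i3 : Fin n := ⟨3, by omega⟩
  -- The symmetrised product of `u` and `v` has vanishing row sums because both vectors sum to zero,
  -- and vanishing diagonal because their supports are disjoint. This takes four indices.
  let u : Fin n → ℝ := fun i => (if i = i0 then 1 else 0) - if i = i2 then 1 else 0
  let v : Fin n → ℝ := fun i => (if i = i1 then 1 else 0) - if i = i3 then 1 else 0
  have hu : ∑ i, u i = 0 := by simp [u]
  have hv : ∑ i, v i = 0 := by simp [v]
  have h01 : i0 ≠ i1 := by simp [i0, i1]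
  have h02 : i0 ≠ i2 := by simp [i0, i2]
  have h03 : i0 ≠ i3 := by simp [i0, i3]
  have h12 : i1 ≠ i2 := by simp [i1, i2]
  have h13 : i1 ≠ i3 := by simp [i1, i3]
  have h23 : i2 ≠ i3 := by simp [i2, i3]
  have hrow : ∀ i, rowSum (fun i j => u i * v j + u j * v i) i = 0 := fun i => by
    simp only [rowSum, Finset.sum_add_distrib, ← Finset.mul_sum, ← Finset.sum_mul, hu, hv]
    simp
  refine ⟨fun i j => u i * v j + u j * v i, ⟨⟨fun i j => by ring, fun i => ?_⟩, ?_⟩, hrow, ?_⟩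
  · have : u i * v i = 0 := by
      simp only [u, v]
      by_cases e0 : i = i0
      · simp [e0, h01, h03]
      · by_cases e2 : i = i2
        · simp [e2, h12.symm, h23]
        · simp [e0, e2]
    linarith
  · exact Finset.sum_eq_zero fun i _ => hrow i
  · intro h
    have := congrFun (congrFun h i0) i1
    simp [u, v, h01, h02, h03, h12, h13, h01.symm] at this

lemma exists_rowPart_ne_zero (hn : 3 ≤ n) :
    ∃ y : Fin n → Fin n → ℝ, IsTraceless y ∧ rowPart y = y ∧ y ≠ 0 := by
  let i0 : Fin n := ⟨0, by omega⟩
  let i1 : Fin n := ⟨1, by omega⟩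
  let i2 : Fin n := ⟨2, by omega⟩
  let a : Fin n → ℝ := fun i => (if i = i0 then 1 else 0) - if i = i1 then 1 else 0
  have ha : ∑ i, a i = 0 := by simp [a]
  refine ⟨_, (isTraceless_add ha).1, rowPart_add hn ha, fun h => ?_⟩
  have := congrFun (congrFun h i0) i2
  simp [a, i0, i1, i2, offWeight] at this

end Quadratic

/-! ### Instability, degeneracy and type of the critical point -/

section Stability

variable {𝕜 : Type*} [NormedDivisionRing 𝕜] [NormedAlgebra ℝ 𝕜] [FiniteDimensional ℝ 𝕜]
  [StarRing 𝕜] [StarModule ℝ 𝕜] [Scalars 𝕜] {n k : ℕ}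

/-- The invariant tensors are the diagonal forms, the standard metric is a multiple of the diagonal
form with constant coefficients, and its orbit under the automorphisms is trivial. -/
structure IsDiagonal (H : Space 𝕜 n k) (c : ℝ) : Prop where
  pos : 0 < c
  std : stdMetric H = diagForm 𝕜 n k (constWeight n c)
  inv : ∀ T, IsInvTensor H T ↔ ∃ x, IsWeight x ∧ T = diagForm 𝕜 n k x
  trivial : ∀ S ∈ trivialVariations H (stdMetric H), S = 0
  mem_orbit : stdMetric H ∈ autOrbit H (stdMetric H)

variable (𝕜 n k) in
/-- The eigenvalue of the Hessian on the tensors `a i + a j`, up to a positive factor. -/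
def eig₁ : ℝ := scalConst 𝕜 n k - k * δ 𝕜 * (n - 1)

variable (𝕜 n k) in
/-- The Hessian at the standard metric, up to a positive factor. -/
def hessForm (y w : Fin n → Fin n → ℝ) : ℝ :=
  expHess (termCoef (scalConst 𝕜 n k) (k * δ 𝕜)) termExp y w

variable (𝕜 n k) in
/-- The eigenvalue of the Hessian on the tensors with vanishing row sums, up to the same factor. -/
def eig₂ : ℝ := scalConst 𝕜 n k - k * δ 𝕜 * (3 * n - 4) / 2

variable {H : Space 𝕜 n k} {c : ℝ} (hH : IsDiagonal H c) (hn : 3 ≤ n) (hk : 1 ≤ k)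

include hH

lemma constWeight_pos {i j : Fin n} (h : i ≠ j) : 0 < constWeight n c i j := by
  rw [constWeight_of_ne c h]; exact hH.pos

lemma isInvMetric_diagForm {x : Fin n → Fin n → ℝ} (hx : IsWeight x)
    (hp : ∀ i j, i ≠ j → 0 < x i j) : IsInvMetric H (diagForm 𝕜 n k x) :=
  { (hH.inv _).mpr ⟨x, hx, rfl⟩ with pos := fun _ hv => diagForm_pos hp hv }

include hk in
lemma exists_of_isInvMetric {g : Form 𝕜 n k} (hg : IsInvMetric H g) :
    ∃ x, IsWeight x ∧ (∀ i j, i ≠ j → 0 < x i j) ∧ g = diagForm 𝕜 n k x := by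
  obtain ⟨x, hx, rfl⟩ := (hH.inv g).mp hg.toIsInvTensor
  exact ⟨x, hx, fun i j h => pos_of_diagForm_pos hk hx hg.pos h, rfl⟩

lemma isInvMetric_std : IsInvMetric H (stdMetric H) := by
  rw [hH.std]
  exact isInvMetric_diagForm hH (isWeight_constWeight c) fun i j h => constWeight_pos hH h

lemma isEinstein_std : IsEinstein (stdMetric H) := by
  have hc := hH.pos
  -- For equal weights each of the n-2 third indices contributes 1 - ½ to `ricCoef`.
  refine ⟨(2 * (k * δ 𝕜 - (2 - δ 𝕜)) + k * δ 𝕜 * ((n - 2) / 2)) / c, ?_⟩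
  rw [hH.std, ricci, ricciAt_diagForm (isWeight_constWeight c).symm (isWeight_constWeight c).diag
    fun i j h => (constWeight_pos hH h).ne', smul_diagForm]
  refine diagForm_congr fun i j h => ?_
  rw [ricCoef, constWeight_of_ne c h, div_mul_cancel₀ _ hc.ne']
  congr 2
  rw [← card_filter_ne h, div_eq_mul_inv, ← nsmul_eq_mul, ← Finset.sum_const]
  refine Finset.sum_congr rfl fun l hl => ?_
  simp only [Finset.mem_filter, Finset.mem_univ, true_and] at hl
  rw [constWeight_of_ne c hl.1.symm, constWeight_of_ne c hl.2.symm]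
  field_simp
  norm_num

include hn hk in
lemma isCritical_std : IsCritical H (stdMetric H) := by
  intro T hT _
  obtain ⟨z, hz, rfl⟩ := (hH.inv T).mp hT
  rw [hH.std]
  exact hasDerivAt_scal hn hk hH.pos hz

lemma innerForm_std {z : Fin n → Fin n → ℝ} (hz : IsWeight z) :
    innerForm (stdMetric H) (diagForm 𝕜 n k z) (stdMetric H) =
      blockDim 𝕜 k / (2 * c) * ∑ i, ∑ j, z i j := by
  have hc := hH.pos
  rw [hH.std, innerForm_diagForm (isWeight_constWeight c) hz (isWeight_constWeight c)
    fun i j h => (constWeight_pos hH h).ne']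
  have : ∀ i j, z i j / constWeight n c i j * (constWeight n c i j / constWeight n c i j) =
      c⁻¹ * z i j := fun i j => by
    by_cases h : i = j
    · subst h; simp [hz.diag]
    · rw [constWeight_of_ne c h]; field_simp
  simp only [this, ← Finset.mul_sum]
  field_simp

-- Since the trivial variations vanish, orthogonality to them is no condition, and orthogonality to
-- the metric, which has constant coefficients, says that the sum of the coefficients is zero.
include hk in
lemma mem_W_iff (T : Form 𝕜 n k) :
    T ∈ W H (stdMetric H) ↔ ∃ y, IsTraceless y ∧ T = diagForm 𝕜 n k y := by
  have hc := hH.pos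
  have hb := blockDim_pos (𝕜 := 𝕜) hk
  constructor
  · rintro ⟨h1, h2, -⟩
    obtain ⟨y, hy, rfl⟩ := (hH.inv T).mp h1
    rw [innerForm_std hH hy] at h2
    have : blockDim 𝕜 k / (2 * c) ≠ 0 := by positivity
    exact ⟨y, ⟨hy, (mul_eq_zero.mp h2).resolve_left this⟩, rfl⟩
  · rintro ⟨y, hy, rfl⟩
    refine ⟨(hH.inv _).mpr ⟨y, hy.toIsWeight, rfl⟩, ?_, fun S hS => ?_⟩
    · rw [innerForm_std hH hy.toIsWeight, hy.sum, mul_zero]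
    · rw [hH.trivial S hS]
      simp [innerForm, opMatrix, formMatrix]

include hn hk in
lemma hess_std {y w : Fin n → Fin n → ℝ} (hy : IsWeight y) (hw : IsWeight w) :
    hess (stdMetric H) (diagForm 𝕜 n k y) (diagForm 𝕜 n k w) =
      blockDim 𝕜 k / (2 * c ^ 3) * hessForm 𝕜 n k y w := by
  rw [hH.std, hess_diagForm hn hk hH.pos hy hw, hessForm]

include hk in
lemma hessFactor_pos : 0 < blockDim 𝕜 k / (2 * c ^ 3) := by
  have hc := hH.pos
  have hb := blockDim_pos (𝕜 := 𝕜) hk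
  positivity

include hn hk in
lemma isGUnstable_std (h1 : 0 < eig₁ 𝕜 n k) : IsGUnstable H (stdMetric H) := by
  obtain ⟨y, hy, hry, hy0⟩ := exists_rowPart_ne_zero hn
  refine ⟨diagForm 𝕜 n k y, (mem_W_iff hH hk _).mpr ⟨y, hy, rfl⟩, ?_⟩
  rw [hess_std hH hn hk hy.toIsWeight hy.toIsWeight, hessForm]
  refine mul_pos (hessFactor_pos hH hk) ?_
  conv => rhs; arg 4; rw [← hry]
  rw [expHess_rowPart hn _ _ hy hy, sum_mul_rowPart_self hn hy, hry]
  refine mul_pos h1 ?_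
  refine lt_of_le_of_ne (Finset.sum_nonneg fun i _ => Finset.sum_nonneg fun j _ => sq_nonneg _)
    fun h => hy0 (sum_sq_eq_zero h.symm)

-- A null vector is tested against its own two spectral components, so the eigenvalue times the
-- squared norm vanishes for each of them. The lower bound then forces it to be zero.
include hn hk in
lemma isGNondegenerate_std (h1 : 0 < eig₁ 𝕜 n k)
    (h2 : HessNondeg n (scalConst 𝕜 n k) (k * δ 𝕜)) : IsGNondegenerate H (stdMetric H) := by
  intro T hT h
  obtain ⟨y, hy, rfl⟩ := (mem_W_iff hH hk T).mp hT
  have hz : ∀ w, IsTraceless w → hessForm 𝕜 n k y w = 0 := fun w hw => by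
    have := h _ ((mem_W_iff hH hk _).mpr ⟨w, hw, rfl⟩)
    rw [hess_std hH hn hk hy.toIsWeight hw.toIsWeight] at this
    exact (mul_eq_zero.mp this).resolve_left (hessFactor_pos hH hk).ne'
  have h3 := hz _ (rowPart_spec hn hy).1
  obtain ⟨h5, h6⟩ := isTraceless_sub_rowPart hn hy
  have h4 := hz _ h5
  rw [hessForm, expHess_rowPart hn _ _ hy hy, sum_mul_rowPart_self hn hy] at h3
  rw [hessForm, expHess_of_rowSum_eq_zero _ _ hy h5 h6, sum_mul_sub_rowPart hn hy] at h4
  obtain ⟨μ, hμ, hb⟩ := exists_lower_bound hn h1 h2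
  have h7 := hb y hy
  have h8 : |scalConst 𝕜 n k - k * δ 𝕜 * (3 * n - 4) / 2| *
      ∑ i, ∑ j, (y - rowPart y) i j ^ 2 = 0 := by
    rcases mul_eq_zero.mp h4 with h | h
    · rw [h]; simp
    · rw [h, mul_zero]
  rw [h3, h8, add_zero] at h7
  have h9 : ∑ i, ∑ j, y i j ^ 2 = 0 := by
    refine le_antisymm ?_ (Finset.sum_nonneg fun i _ => Finset.sum_nonneg fun j _ => sq_nonneg _)
    by_contra hcon
    push Not at hcon
    exact absurd h7 (not_le.mpr (mul_pos hμ hcon))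
  rw [sum_sq_eq_zero h9]
  exact (diagFormL 𝕜 n k).map_zero

include hn hk in
lemma not_isGNondegenerate_std (hn4 : 4 ≤ n) (h2 : eig₂ 𝕜 n k = 0) :
    ¬ IsGNondegenerate H (stdMetric H) := by
  intro h
  obtain ⟨y, hy, hry, hy0⟩ := exists_rowSum_eq_zero hn4
  refine hy0 (diagForm_injective (𝕜 := 𝕜) hk hy.toIsWeight (y := 0) ⟨fun _ _ => rfl, fun _ => rfl⟩ ?_)
  rw [h _ ((mem_W_iff hH hk _).mpr ⟨y, hy, rfl⟩)]
  · exact (diagFormL 𝕜 n k).map_zero.symm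
  · intro S hS
    obtain ⟨w, hw, rfl⟩ := (mem_W_iff hH hk S).mp hS
    rw [hess_std hH hn hk hy.toIsWeight hw.toIsWeight]
    have : hessForm 𝕜 n k y w = hessForm 𝕜 n k w y := by
      simp only [hessForm, expHess, mul_comm (termExp _ y)]
    rw [this, hessForm, expHess_of_rowSum_eq_zero _ _ hw hy hry]
    rw [eig₂] at h2
    rw [h2]
    simp

omit hH in
lemma abs_log_le {c u ε : ℝ} (hc : 0 < c) (hε : ε ≤ 1 / 2) (h : |u - c| ≤ ε * c) :
    |Real.log (u / c)| ≤ 2 * ε := by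
  have h1 : |u / c - 1| ≤ ε := by
    rw [div_sub_one hc.ne', abs_div, abs_of_pos hc, div_le_iff₀ hc]
    exact h
  obtain ⟨h2, h3⟩ := abs_le.mp h1
  have hε0 : 0 ≤ ε := (abs_nonneg _).trans h1
  have h4 : 0 < u / c := by linarith
  rw [abs_le]
  constructor
  · have h5 := Real.one_sub_inv_le_log_of_pos h4
    refine le_trans ?_ h5
    -- Since (1 + 2ε)(1 - ε) = 1 + ε(1 - 2ε), this is where ε ≤ ½ is needed.
    have h6 : (u / c)⁻¹ ≤ 1 + 2 * ε := by
      rw [inv_le_comm₀ h4 (by linarith), inv_le_iff_one_le_mul₀ (by linarith)]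
      nlinarith
    linarith
  · have h5 := Real.log_le_sub_one_of_pos h4
    linarith

include hk in
lemma norm_logWeight_le {x : Fin n → Fin n → ℝ} (hx : IsWeight x) {ε : ℝ} (hε0 : 0 ≤ ε)
    (hε : ε ≤ 1 / 2) (h : Near (stdMetric H) ε (diagForm 𝕜 n k x)) : ‖logWeight c x‖ ≤ 2 * ε := by
  rw [hH.std] at h
  have h0 : 0 ≤ 2 * ε := by linarith
  refine (pi_norm_le_iff_of_nonneg h0).mpr fun i => (pi_norm_le_iff_of_nonneg h0).mpr fun j => ?_
  by_cases hij : i = j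
  · subst hij; simpa [logWeight, hx.diag] using hε0
  · have h1 := near_diagForm hk (isWeight_constWeight c) hx h hij
    rw [constWeight_of_ne c hij] at h1
    exact abs_log_le hH.pos hε h1

include hk in
lemma detForm_std_eq_one_iff {x : Fin n → Fin n → ℝ} (hx : IsWeight x)
    (hp : ∀ i j, i ≠ j → 0 < x i j) :
    detForm (stdMetric H) (diagForm 𝕜 n k x) = 1 ↔ IsTraceless (logWeight c x) := by
  have hb := blockDim_pos (𝕜 := 𝕜) hk
  rw [hH.std, detForm_constWeight hH.pos hx hp, Real.exp_eq_one_iff]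
  constructor
  · intro h
    exact ⟨isWeight_logWeight c hx, (mul_eq_zero.mp h).resolve_left (by positivity)⟩
  · intro h
    rw [h.sum, mul_zero]

include hn hk in
lemma scal_std : scal (stdMetric H) = blockDim 𝕜 k / (2 * c) * energy 𝕜 n k 0 := by
  have hw := isWeight_constWeight (n := n) c
  have hp : ∀ i j, i ≠ j → 0 < constWeight n c i j := fun i j h => constWeight_pos hH h
  have h := (detForm_std_eq_one_iff hH hk hw hp).mpr
    ⟨isWeight_logWeight c hw, by simp [logWeight_constWeight]⟩
  rw [hH.std] at h ⊢
  rw [scal_of_detForm_eq_one hn hk hH.pos hw hp h, logWeight_constWeight]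

include hn hk in
lemma isLocMin_std (h1 : 0 < eig₁ 𝕜 n k) (h2 : HessPos n (scalConst 𝕜 n k) (k * δ 𝕜)) :
    IsLocMin H (stdMetric H) := by
  have hc := hH.pos
  have hb := blockDim_pos (𝕜 := 𝕜) hk
  obtain ⟨μ, hμ, hq⟩ := exists_lower_bound_expHess hn h1 h2
  obtain ⟨K, r, hK, hr, hT⟩ := expSum_taylor (termCoef (n := n) (scalConst 𝕜 n k) (k * δ 𝕜)) termExp
  -- The logarithmic coordinates satisfy ‖y‖ ≤ 2ε. The bound r/2 keeps them in the range of the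
  -- Taylor estimate, and μ/(4K) makes the cubic remainder at most μ/2 · ‖y‖², which half of the
  -- Hessian compensates.
  have hε : 0 < min (1 / 2) (min (r / 2) (μ / (4 * K))) := by positivity
  refine ⟨_, hε, fun g' hg' hnear => ?_⟩
  obtain ⟨hg1, hg2⟩ := hg'
  obtain ⟨x, hx, hp, rfl⟩ := exists_of_isInvMetric hH hk hg1
  have hy := (detForm_std_eq_one_iff hH hk hx hp).mp hg2
  have hny := norm_logWeight_le hH hk hx hε.le (min_le_left _ _) hnear
  rw [scal_std hH hn hk]
  rw [hH.std] at hg2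
  rw [scal_of_detForm_eq_one hn hk hc hx hp hg2]
  refine mul_le_mul_of_nonneg_left ?_ (by positivity)
  set y := logWeight c x
  have e1 : ‖y‖ ≤ r := hny.trans <| by
    have := (min_le_right (1 / 2) (min (r / 2) (μ / (4 * K)))).trans (min_le_left _ _)
    linarith
  have e2 : K * ‖y‖ ≤ μ / 2 := by
    have := (min_le_right (1 / 2) (min (r / 2) (μ / (4 * K)))).trans (min_le_right _ _)
    calc K * ‖y‖ ≤ K * (2 * (μ / (4 * K))) := by
          refine mul_le_mul_of_nonneg_left ?_ hK.le
          linarith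
      _ = μ / 2 := by field_simp; norm_num
  have e3 := hT y e1
  rw [sum_terms_linear hn _ _ hy.symm, sub_zero] at e3
  have e4 := hq y hy
  have e5 : K * ‖y‖ ^ 3 ≤ μ / 2 * ‖y‖ ^ 2 := by
    calc K * ‖y‖ ^ 3 = (K * ‖y‖) * ‖y‖ ^ 2 := by ring
      _ ≤ _ := mul_le_mul_of_nonneg_right e2 (by positivity)
  have e6 := (abs_le.mp e3).1
  simp only [energy]
  linarith

/-- The metric with logarithmic coordinates `y`. -/
def expWeight (c : ℝ) (y : Fin n → Fin n → ℝ) (i j : Fin n) : ℝ :=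
  offWeight n i j * (c * Real.exp (y i j))

include hn hk in
/-- There are metrics close to the standard one whose scalar curvature differs in the direction
that the Hessian predicts. -/
lemma exists_near_of_hessForm {σ : ℝ} (hσ : |σ| = 1) {y : Fin n → Fin n → ℝ} (hy : IsTraceless y)
    (h : 0 < σ * hessForm 𝕜 n k y y) {ε : ℝ} (hε : 0 < ε) :
    ∃ g' ∈ unitVolume H (stdMetric H), Near (stdMetric H) ε g' ∧
      0 < σ * (scal g' - scal (stdMetric H)) := by
  have hc := hH.pos
  have hb := blockDim_pos (𝕜 := 𝕜) hk
  obtain ⟨K, r, hK, hr, hT⟩ := expSum_taylor (termCoef (n := n) (scalConst 𝕜 n k) (k * δ 𝕜)) termExp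
  set q := σ * hessForm 𝕜 n k y y with hq
  have c1 : ∀ᶠ t in 𝓝[>] (0 : ℝ), ‖t • y‖ ≤ r := by
    have : Filter.Tendsto (fun t : ℝ => ‖t • y‖) (𝓝 0) (𝓝 0) := by
      have hcont : Continuous fun t : ℝ => ‖t • y‖ := by fun_prop
      simpa using hcont.tendsto 0
    filter_upwards [(this.mono_left nhdsWithin_le_nhds).eventually (gt_mem_nhds hr)] with t ht
      using le_of_lt ht
  have c2 : ∀ᶠ t in 𝓝[>] (0 : ℝ), t * (K * ‖y‖ ^ 3) < q / 2 := by
    have : Filter.Tendsto (fun t : ℝ => t * (K * ‖y‖ ^ 3)) (𝓝 0) (𝓝 0) := by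
      have hcont : Continuous fun t : ℝ => t * (K * ‖y‖ ^ 3) := by fun_prop
      simpa using hcont.tendsto 0
    exact (this.mono_left nhdsWithin_le_nhds).eventually (gt_mem_nhds (by positivity))
  have c3 : ∀ᶠ t in 𝓝[>] (0 : ℝ), ∀ i j, |Real.exp (t * y i j) - 1| < ε := by
    refine Filter.eventually_all.mpr fun i => Filter.eventually_all.mpr fun j => ?_
    have : Filter.Tendsto (fun t : ℝ => |Real.exp (t * y i j) - 1|) (𝓝 0) (𝓝 0) := by
      have hcont : Continuous fun t : ℝ => |Real.exp (t * y i j) - 1| := by fun_prop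
      simpa using hcont.tendsto 0
    exact (this.mono_left nhdsWithin_le_nhds).eventually (gt_mem_nhds hε)
  -- Along the ray t y the quadratic term is t² q/2, and the second condition keeps the cubic
  -- remainder strictly below it. The factor `σ` = ±1 treats increase and decrease at once.
  obtain ⟨t, ht1, ht2, ht3, ht0⟩ := (c1.and (c2.and (c3.and self_mem_nhdsWithin))).exists
  have hty : IsTraceless (t • y) := ⟨hy.toIsWeight.map (fun a => t * a) (by simp), by
    simp only [Pi.smul_apply, smul_eq_mul, ← Finset.mul_sum, hy.sum, mul_zero]⟩
  have hx : IsWeight (expWeight c (t • y)) :=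
    isWeight_offWeight.map₂ hty.toIsWeight (fun a b => a * (c * Real.exp b)) (by simp)
  have hxv : ∀ i j, i ≠ j → expWeight c (t • y) i j = c * Real.exp (t * y i j) := fun i j hij => by
    simp [expWeight, offWeight, hij]
  have hp : ∀ i j, i ≠ j → 0 < expWeight c (t • y) i j := fun i j hij => by
    rw [hxv i j hij]; positivity
  have hlog : logWeight c (expWeight c (t • y)) = t • y := by
    ext i j
    by_cases hij : i = j
    · subst hij; simp [logWeight, hx.diag, hy.diag]
    · rw [logWeight, hxv i j hij, mul_div_cancel_left₀ _ hc.ne', Real.log_exp]; rfl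
  have hdet := (detForm_std_eq_one_iff hH hk hx hp).mpr (by rw [hlog]; exact hty)
  refine ⟨diagForm 𝕜 n k (expWeight c (t • y)), ⟨isInvMetric_diagForm hH hx hp, hdet⟩, ?_, ?_⟩
  · rw [hH.std]
    refine near_of_le fun i j hij => ?_
    rw [hxv i j hij, constWeight_of_ne c hij]
    have e : c * Real.exp (t * y i j) - c = c * (Real.exp (t * y i j) - 1) := by ring
    rw [e, abs_mul, abs_of_pos hc, mul_comm ε]
    exact mul_le_mul_of_nonneg_left (ht3 i j).le hc.le
  · rw [scal_std hH hn hk]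
    rw [hH.std] at hdet
    rw [scal_of_detForm_eq_one hn hk hc hx hp hdet, hlog]
    have e3 := hT (t • y) ht1
    rw [sum_terms_linear hn _ _ hty.symm, sub_zero] at e3
    have e4 : expHess (termCoef (scalConst 𝕜 n k) (k * δ 𝕜)) termExp (t • y) (t • y) =
        t ^ 2 * hessForm 𝕜 n k y y := by
      simp only [hessForm, expHess, map_smul, smul_eq_mul, Finset.mul_sum]
      exact Finset.sum_congr rfl fun m _ => by ring
    rw [e4, norm_smul, Real.norm_eq_abs, abs_of_pos ht0] at e3
    have e5 : |σ * (energy 𝕜 n k (t • y) - energy 𝕜 n k 0) - t ^ 2 * q / 2| ≤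
        K * (t * ‖y‖) ^ 3 := by
      have : σ * (energy 𝕜 n k (t • y) - energy 𝕜 n k 0) - t ^ 2 * q / 2 =
          σ * (energy 𝕜 n k (t • y) - energy 𝕜 n k 0 - t ^ 2 * hessForm 𝕜 n k y y / 2) := by
        rw [hq]; ring
      rw [this, abs_mul, hσ, one_mul]
      exact e3
    have e6 := (abs_le.mp e5).1
    have e7 : K * (t * ‖y‖) ^ 3 = t ^ 2 * (t * (K * ‖y‖ ^ 3)) := by ring
    have e8 : t ^ 2 * (t * (K * ‖y‖ ^ 3)) < t ^ 2 * (q / 2) :=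
      mul_lt_mul_of_pos_left ht2 (by positivity)
    have e9 : 0 < σ * (energy 𝕜 n k (t • y) - energy 𝕜 n k 0) := by linarith
    rw [← mul_sub]
    have : 0 < blockDim 𝕜 k / (2 * c) := by positivity
    nlinarith

include hn hk in
lemma isSaddle_std (hn4 : 4 ≤ n) (h1 : 0 < eig₁ 𝕜 n k) (h2 : eig₂ 𝕜 n k < 0) :
    IsSaddle H (stdMetric H) := by
  refine ⟨isCritical_std hH hn hk, ?_, ?_⟩
  · rintro ⟨ε, hε, h⟩
    obtain ⟨y, hy, hry, hy0⟩ := exists_rowSum_eq_zero hn4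
    obtain ⟨g', hg', hnear, hlt⟩ := exists_near_of_hessForm hH hn hk (σ := -1) (by simp) hy
      (by
        rw [hessForm, expHess_of_rowSum_eq_zero _ _ hy hy hry]
        have h3 : 0 < ∑ i, ∑ j, y i j * y i j := by
          simp only [← sq]
          exact lt_of_le_of_ne (Finset.sum_nonneg fun i _ => Finset.sum_nonneg fun j _ =>
            sq_nonneg _) fun h => hy0 (sum_sq_eq_zero h.symm)
        rw [eig₂] at h2
        nlinarith) hε
    have := h g' hg' hnear
    linarith
  · rintro ⟨ε, hε, h⟩
    obtain ⟨y, hy, hry, hy0⟩ := exists_rowPart_ne_zero hn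
    obtain ⟨g', hg', hnear, hlt⟩ := exists_near_of_hessForm hH hn hk (σ := 1) (by simp) hy
      (by
        rw [hessForm]
        conv => rhs; arg 2; arg 4; rw [← hry]
        rw [expHess_rowPart hn _ _ hy hy, sum_mul_rowPart_self hn hy, hry, one_mul]
        refine mul_pos h1 ?_
        exact lt_of_le_of_ne (Finset.sum_nonneg fun i _ => Finset.sum_nonneg fun j _ =>
            sq_nonneg _) fun h => hy0 (sum_sq_eq_zero h.symm)) hε
    have := h g' hg' hnear
    linarith

end Stability

/-! ### Rigidity in the non-degenerate case -/

section Rigidity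

variable {𝕜 : Type*} [NormedDivisionRing 𝕜] [NormedAlgebra ℝ 𝕜] [FiniteDimensional ℝ 𝕜]
  [StarRing 𝕜] [StarModule ℝ 𝕜] [Scalars 𝕜] {n k : ℕ}

/-- Einstein metrics are critical points of the energy. -/
lemma sum_termExp_eq_zero {c ρ m : ℝ} (hc : 0 < c) {x y : Fin n → Fin n → ℝ} (hx : IsWeight x)
    (hp : ∀ i j, i ≠ j → 0 < x i j) (hE : ∀ i j, i ≠ j → ricCoef 𝕜 k x i j = ρ * x i j)
    (hy : IsTraceless y) (hxy : ∀ i j, i ≠ j → x i j = c * Real.exp m * Real.exp (y i j))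
    {w : Fin n → Fin n → ℝ} (hw : IsTraceless w) :
    ∑ t, termCoef (scalConst 𝕜 n k) (k * δ 𝕜) t * (Real.exp (termExp t y) * termExp t w) = 0 := by
  have h := sum_ricCoef_div_mul (𝕜 := 𝕜) (k := k) hx (fun i j h => (hp i j h).ne') hw.symm
  have h0 : ∑ i, ∑ j, ricCoef 𝕜 k x i j / x i j * w i j = 0 := by
    have e : ∀ i j, ricCoef 𝕜 k x i j / x i j * w i j = ρ * w i j := fun i j => by
      by_cases hij : i = j
      · subst hij; simp [hw.diag]
      · rw [hE i j hij, mul_div_cancel_right₀ _ (hp i j hij).ne']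
    simp only [e, ← Finset.mul_sum, hw.sum, mul_zero]
  rw [h0] at h
  -- The first variation is homogeneous of degree -1 in the metric, so the common scale appears as
  -- an overall factor C⁻¹ and can be divided out.
  set C := c * Real.exp m with hC
  have hCpos : 0 < C := by positivity
  rw [sum_terms]
  simp only [termExp, Sum.elim_inl, Sum.elim_inr, LinearMap.coe_toContinuousLinearMap',
    LinearMap.neg_apply, LinearMap.sub_apply, centered_of_sum_eq_zero hy.toIsWeight hy.sum,
    centered_of_sum_eq_zero hw.toIsWeight hw.sum]
  have t1 : ∀ i j, w i j / x i j = C⁻¹ * -(offWeight n i j * (Real.exp (-y i j) * -w i j)) := by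
    intro i j
    by_cases hij : i = j
    · subst hij; simp [hw.diag]
    · rw [hxy i j hij, Real.exp_neg, offWeight, if_neg hij]
      field_simp
  have t2 : ∀ i j l, x i j / (x i l * x j l) * (w i j - w i l - w j l) =
      C⁻¹ * (triWeight n i j l * (Real.exp (y i j - y i l - y j l) * (w i j - w i l - w j l))) := by
    intro i j l
    by_cases h1 : i = j
    · subst h1; simp [hx.diag, triWeight, offWeight]
    by_cases h2 : i = l
    · subst h2; simp [hx.diag, triWeight, offWeight]
    by_cases h3 : j = l
    · subst h3; simp [hx.diag, triWeight, offWeight]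
    rw [hxy i j h1, hxy i l h2, hxy j l h3]
    simp only [triWeight, offWeight, h1, h2, h3, if_false, Real.exp_sub]
    field_simp
  simp only [t1, t2, ← Finset.mul_sum] at h
  simp only [Finset.sum_neg_distrib] at h
  have h2 : C⁻¹ * (scalConst 𝕜 n k * -(∑ i, ∑ j, offWeight n i j * (Real.exp (-y i j) * -w i j)) +
      k * δ 𝕜 / 2 * ∑ i, ∑ j, ∑ l, triWeight n i j l * (Real.exp (y i j - y i l - y j l) *
        (w i j - w i l - w j l))) = 0 := by rw [h]; ring
  have h3 := (mul_eq_zero.mp h2).resolve_left (by positivity)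
  linarith

variable {H : Space 𝕜 n k} {c : ℝ} (hH : IsDiagonal H c) (hn : 3 ≤ n) (hk : 1 ≤ k)

include hH hn hk

/-- After removal of its scale, a nearby Einstein metric is a zero y of the gradient of the energy
on traceless arrays. The gradient is Hess(y, ·) up to an error of order ‖y‖². Testing with the two
spectral components of y bounds μ ∑ y_ij² by 2K‖y‖ · ∑ y_ij², hence for small y by μ/2 · ∑ y_ij²,
and so y = 0. -/
lemma isGRigid_std (h1 : 0 < eig₁ 𝕜 n k) (h2 : HessNondeg n (scalConst 𝕜 n k) (k * δ 𝕜)) :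
    IsGRigid H (stdMetric H) := by
  have hc := hH.pos
  have hn' : (3 : ℝ) ≤ n := by exact_mod_cast hn
  obtain ⟨μ, hμ, hq⟩ := exists_lower_bound hn h1 h2
  obtain ⟨K, r, hK, hr, hT⟩ :=
    expSum_deriv_taylor (termCoef (n := n) (scalConst 𝕜 n k) (k * δ 𝕜)) termExp
  obtain ⟨N, hN, hNle⟩ := exists_norm_le fun p : Fin n × Fin n =>
    LinearMap.toContinuousLinearMap (centered p.1 p.2)
  have hN0 : 0 < N := by linarith
  -- `N` bounds the operators that pass from logarithmic coordinates to centred ones, so ‖y‖ ≤ 2Nε.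
  -- The last two bounds give ‖y‖ ≤ r and 2K‖y‖ ≤ μ/2.
  set ε := min (1 / 2) (min (r / (2 * N)) (μ / (8 * K * N))) with hεdef
  have hε : 0 < ε := by positivity
  refine ⟨ε, hε, fun g' hg' hE hnear => ?_⟩
  obtain ⟨x, hx, hp, rfl⟩ := exists_of_isInvMetric hH hk hg'
  have hnz := norm_logWeight_le hH hk hx hε.le (min_le_left _ _) hnear
  set z := logWeight c x with hz
  have hzw : IsWeight z := isWeight_logWeight c hx
  set m := (∑ i, ∑ j, z i j) / (n * (n - 1)) with hm
  set y : Fin n → Fin n → ℝ := fun i j => z i j - m * offWeight n i j with hydef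
  have hyw : IsWeight y := hzw.map₂ isWeight_offWeight (fun a b => a - m * b) (by simp)
  have hy : IsTraceless y := ⟨hyw, by
    simp only [hydef, Finset.sum_sub_distrib, ← Finset.mul_sum, sum_offWeight, hm]
    have h1 : (n : ℝ) - 1 ≠ 0 := by linarith
    have h2 : (n : ℝ) ≠ 0 := by linarith
    field_simp
    simp⟩
  have hcen : ∀ i j, i ≠ j → y i j = centered i j z := fun i j hij => by
    simp only [hydef, centered, LinearMap.coe_mk, AddHom.coe_mk, offWeight_mul hzw, hm]
    simp [offWeight, hij]
  have hny : ‖y‖ ≤ N * (2 * ε) := by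
    have h0 : 0 ≤ N * (2 * ε) := by positivity
    refine (pi_norm_le_iff_of_nonneg h0).mpr fun i => (pi_norm_le_iff_of_nonneg h0).mpr fun j => ?_
    by_cases hij : i = j
    · subst hij; simpa [hyw.diag] using h0
    · rw [hcen i j hij]
      refine ((LinearMap.toContinuousLinearMap (centered i j)).le_opNorm z).trans ?_
      exact mul_le_mul (hNle (i, j)) hnz (norm_nonneg _) hN0.le
  have hxz : ∀ i j, i ≠ j → x i j = c * Real.exp (z i j) := fun i j hij => by
    rw [hz, logWeight, Real.exp_log (div_pos (hp i j hij) hc)]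
    field_simp
  have hxy : ∀ i j, i ≠ j → x i j = c * Real.exp m * Real.exp (y i j) := fun i j hij => by
    rw [hxz i j hij, mul_assoc, ← Real.exp_add]
    simp [hydef, offWeight, hij]
  obtain ⟨ρ, hρ⟩ := hE
  rw [ricci, ricciAt_diagForm hx.symm hx.diag fun i j h => (hp i j h).ne', smul_diagForm,
    diagForm_congr (x := ricCoef 𝕜 k x) (y := fun i j => offWeight n i j * ricCoef 𝕜 k x i j)
      fun i j h => by simp [offWeight, h]] at hρ
  have hρ' := diagForm_injective hk (isWeight_ricCoef hx)
    (hx.map (fun a => ρ * a) (by simp)) hρ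
  have hE' : ∀ i j, i ≠ j → ricCoef 𝕜 k x i j = ρ * x i j := fun i j h => by
    have := congrFun (congrFun hρ' i) j
    simpa [offWeight, h] using this
  have e1 : ‖y‖ ≤ r := hny.trans <| by
    have : ε ≤ r / (2 * N) := (min_le_right _ _).trans (min_le_left _ _)
    calc N * (2 * ε) ≤ N * (2 * (r / (2 * N))) := by gcongr
      _ = r := by field_simp
  have e2 : 2 * K * ‖y‖ ≤ μ / 2 := by
    have : ε ≤ μ / (8 * K * N) := (min_le_right _ _).trans (min_le_right _ _)
    calc 2 * K * ‖y‖ ≤ 2 * K * (N * (2 * (μ / (8 * K * N)))) := by gcongr; exact hny.trans (by gcongr)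
      _ = μ / 2 := by field_simp; norm_num
  have key : ∀ w, IsTraceless w → |hessForm 𝕜 n k y w| ≤ K * ‖y‖ ^ 2 * ‖w‖ := fun w hw => by
    have h := hT y w e1
    rw [sum_termExp_eq_zero hc hx hp hE' hy hxy hw, sum_terms_linear hn _ _ hw.symm] at h
    simpa [hessForm] using h
  obtain ⟨h5, h6⟩ := isTraceless_sub_rowPart hn hy
  have k1 := key _ (rowPart_spec hn hy).1
  have k2 := key _ h5
  rw [hessForm, expHess_rowPart hn _ _ hy hy, sum_mul_rowPart_self hn hy, abs_mul] at k1
  rw [hessForm, expHess_of_rowSum_eq_zero _ _ hy h5 h6, sum_mul_sub_rowPart hn hy, abs_mul] at k2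
  have hnn : ∀ z : Fin n → Fin n → ℝ, 0 ≤ ∑ i, ∑ j, z i j ^ 2 := fun z =>
    Finset.sum_nonneg fun i _ => Finset.sum_nonneg fun j _ => sq_nonneg _
  set Q := ∑ i, ∑ j, y i j ^ 2 with hQ
  have hsum := sum_sq_eq hn hy
  rw [abs_of_pos (show 0 < scalConst 𝕜 n k - k * δ 𝕜 * (n - 1) from h1), abs_of_nonneg (hnn _)] at k1
  rw [abs_of_nonneg (hnn (y - rowPart y))] at k2
  have k3 := hq y hy
  have n1 : ‖rowPart y‖ ≤ √Q := Real.le_sqrt_of_sq_le ((norm_sq_le_sum _).trans (by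
    linarith [hnn (y - rowPart y)]))
  have n2 : ‖y - rowPart y‖ ≤ √Q := Real.le_sqrt_of_sq_le ((norm_sq_le_sum _).trans (by
    linarith [hnn (rowPart y)]))
  have n3 : ‖y‖ ≤ √Q := Real.le_sqrt_of_sq_le (norm_sq_le_sum _)
  have k4 : μ * Q ≤ μ / 2 * Q := by
    have hs : √Q * √Q = Q := Real.mul_self_sqrt (hnn y)
    calc μ * Q ≤ K * ‖y‖ ^ 2 * ‖rowPart y‖ + K * ‖y‖ ^ 2 * ‖y - rowPart y‖ := k3.trans (add_le_add k1 k2)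
      _ ≤ K * ‖y‖ ^ 2 * √Q + K * ‖y‖ ^ 2 * √Q := by gcongr
      _ = 2 * K * ‖y‖ * (‖y‖ * √Q) := by ring
      _ ≤ μ / 2 * (√Q * √Q) := by gcongr
      _ = μ / 2 * Q := by rw [hs]
  have hQ0 : Q = 0 := by nlinarith [hnn y]
  have hy0 := sum_sq_eq_zero hQ0
  refine ⟨Real.exp m, Real.exp_pos _, stdMetric H, hH.mem_orbit, ?_⟩
  rw [hH.std, smul_diagForm]
  refine diagForm_congr fun i j hij => ?_
  rw [hxy i j hij, hy0, constWeight_of_ne c hij]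
  simp [mul_comm]

end Rigidity

/-! ### Dimension counts and the coindex -/

section Coindex

variable {𝕜 : Type*} [NormedDivisionRing 𝕜] [NormedAlgebra ℝ 𝕜] [FiniteDimensional ℝ 𝕜]
  [StarRing 𝕜] [StarModule ℝ 𝕜] [Scalars 𝕜] {n k : ℕ}

lemma finrank_map_of_injOn {V V' : Type*} [AddCommMonoid V] [Module ℝ V] [AddCommMonoid V']
    [Module ℝ V'] {f : V →ₗ[ℝ] V'} {p : Submodule ℝ V}
    (h : ∀ v ∈ p, ∀ w ∈ p, f v = f w → v = w) :
    Module.finrank ℝ (p.map f) = Module.finrank ℝ p := by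
  rw [← LinearMap.range_domRestrict]
  exact (LinearEquiv.ofInjective (f.domRestrict p) fun a b hab =>
    Subtype.ext (h a a.2 b b.2 hab)).finrank_eq.symm

variable (n) in
/-- The vectors with vanishing sum. -/
def sumZero : Submodule ℝ (Fin n → ℝ) where
  carrier := {a | ∑ i, a i = 0}
  add_mem' := by
    intro a b ha hb
    simp only [Set.mem_ofPred_eq, Pi.add_apply, Finset.sum_add_distrib] at *
    rw [ha, hb, add_zero]
  zero_mem' := by simp
  smul_mem' := by
    intro c a ha
    simp only [Set.mem_ofPred_eq, Pi.smul_apply, smul_eq_mul, ← Finset.mul_sum] at *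
    rw [ha, mul_zero]

lemma finrank_sumZero (hn : 1 ≤ n) : Module.finrank ℝ (sumZero n) = n - 1 := by
  let f : (Fin n → ℝ) →ₗ[ℝ] ℝ := ∑ i, LinearMap.proj i
  have hf : f ≠ 0 := fun h => by
    have := LinearMap.congr_fun h (Pi.single ⟨0, hn⟩ 1)
    simp [f] at this
  have hker : LinearMap.ker f = sumZero n := by
    ext a
    simp [f, sumZero]
  have := Module.Dual.finrank_ker_add_one_of_ne_zero hf
  rw [hker, Module.finrank_fin_fun] at this
  omega

variable (n) in
/-- The space of traceless weights. -/
def tracelessSpace : Submodule ℝ (Fin n → Fin n → ℝ) where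
  carrier := {y | IsTraceless y}
  add_mem' := by
    intro y z hy hz
    refine ⟨hy.toIsWeight.map₂ hz.toIsWeight (fun a b => a + b) (by simp), ?_⟩
    simp only [Pi.add_apply, Finset.sum_add_distrib, hy.sum, hz.sum, add_zero]
  zero_mem' := ⟨⟨fun _ _ => rfl, fun _ => rfl⟩, by simp⟩
  smul_mem' := by
    intro c y hy
    refine ⟨hy.toIsWeight.map (fun a => c * a) (by simp), ?_⟩
    simp only [Pi.smul_apply, smul_eq_mul, ← Finset.mul_sum, hy.sum, mul_zero]

lemma mem_tracelessSpace {y : Fin n → Fin n → ℝ} : y ∈ tracelessSpace n ↔ IsTraceless y := Iff.rfl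

/-- The pairs of different indices. -/
abbrev Pairs (n : ℕ) : Type := {p : Fin n × Fin n // p.1 < p.2}

/-- The weight with given values on the pairs. -/
def ofPairs : (Pairs n → ℝ) →ₗ[ℝ] (Fin n → Fin n → ℝ) where
  toFun f i j := if h : i < j then f ⟨(i, j), h⟩ else if h : j < i then f ⟨(j, i), h⟩ else 0
  map_add' f g := by
    ext i j
    simp only [Pi.add_apply]
    split_ifs <;> simp
  map_smul' c f := by
    ext i j
    simp only [Pi.smul_apply]
    split_ifs <;> simp

lemma isWeight_ofPairs (f : Pairs n → ℝ) : IsWeight (ofPairs f) := by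
  refine ⟨fun i j => ?_, fun i => by simp [ofPairs]⟩
  simp only [ofPairs, LinearMap.coe_mk, AddHom.coe_mk]
  rcases lt_trichotomy i j with h | h | h
  · simp [h, h.not_gt]
  · subst h; rfl
  · simp [h, h.not_gt]

lemma ofPairs_restrict {y : Fin n → Fin n → ℝ} (hy : IsWeight y) :
    ofPairs (fun p : Pairs n => y p.1.1 p.1.2) = y := by
  ext i j
  simp only [ofPairs, LinearMap.coe_mk, AddHom.coe_mk]
  rcases lt_trichotomy i j with h | h | h
  · simp [h]
  · subst h; simp [hy.diag]
  · simp [h, h.not_gt, hy.symm i j]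

lemma ofPairs_injective : Function.Injective (ofPairs (n := n)) := by
  intro f g h
  ext ⟨⟨i, j⟩, hij⟩
  have := congrFun (congrFun h i) j
  have hij' : i < j := hij
  simpa [ofPairs, hij'] using this

/-- A weight is determined by free values on the pairs i < j, and vanishing of the total sum is a
single non-trivial linear condition. -/
lemma finrank_tracelessSpace (hn : 2 ≤ n) :
    Module.finrank ℝ (tracelessSpace n) + 1 = Fintype.card (Pairs n) := by
  let f : (Pairs n → ℝ) →ₗ[ℝ] ℝ := (∑ i, ∑ j, LinearMap.proj j ∘ₗ LinearMap.proj i) ∘ₗ ofPairs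
  have hfa : ∀ g, f g = ∑ i, ∑ j, ofPairs g i j := fun g => by simp [f]
  have hf : f ≠ 0 := fun h => by
    have h1 := LinearMap.congr_fun h (fun _ => 1)
    rw [hfa] at h1
    have h2 : ofPairs (n := n) (fun _ => 1) = offWeight n := by
      ext i j
      simp only [ofPairs, LinearMap.coe_mk, AddHom.coe_mk, offWeight]
      rcases lt_trichotomy i j with h | h | h
      · simp [h, h.ne]
      · simp [h]
      · simp [h, h.ne']
    rw [h2, sum_offWeight] at h1
    have h3 : (2 : ℝ) ≤ n := by exact_mod_cast hn
    have h4 : (0 : ℝ) < n * (n - 1) := mul_pos (by linarith) (by linarith)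
    simp only [LinearMap.zero_apply] at h1
    linarith
  have hker : (LinearMap.ker f).map ofPairs = tracelessSpace n := by
    ext y
    rw [Submodule.mem_map, mem_tracelessSpace]
    constructor
    · rintro ⟨g, hg, rfl⟩
      rw [LinearMap.mem_ker, hfa] at hg
      exact ⟨isWeight_ofPairs g, hg⟩
    · intro hy
      refine ⟨fun p => y p.1.1 p.1.2, ?_, ofPairs_restrict hy.toIsWeight⟩
      rw [LinearMap.mem_ker, hfa, ofPairs_restrict hy.toIsWeight, hy.sum]
  have := Module.Dual.finrank_ker_add_one_of_ne_zero hf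
  rw [Module.finrank_fintype_fun_eq_card] at this
  rw [← hker, ← this]
  congr 1
  exact finrank_map_of_injOn fun y _ z _ h => ofPairs_injective h

variable {H : Space 𝕜 n k} {c : ℝ} (hH : IsDiagonal H c) (hn : 3 ≤ n) (hk : 1 ≤ k)

include hH hn hk

lemma hess_std_pos_iff {y : Fin n → Fin n → ℝ} (hy : IsTraceless y) :
    0 < hess (stdMetric H) (diagForm 𝕜 n k y) (diagForm 𝕜 n k y) ↔ 0 < hessForm 𝕜 n k y y := by
  rw [hess_std hH hn hk hy.toIsWeight hy.toIsWeight,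
    mul_pos_iff_of_pos_left (hessFactor_pos hH hk)]

/-- The coindex, if the Hessian is positive definite. -/
lemma hasCoindex_of_hessPos (h1 : 0 < eig₁ 𝕜 n k)
    (h2 : HessPos n (scalConst 𝕜 n k) (k * δ 𝕜)) {d : ℕ} (hd : d + 1 = Fintype.card (Pairs n)) :
    HasCoindex H (stdMetric H) d := by
  have hinj : ∀ y ∈ tracelessSpace n, ∀ z ∈ tracelessSpace n,
      diagFormL 𝕜 n k y = diagFormL 𝕜 n k z → y = z := fun y hy z hz h =>
    diagForm_injective (𝕜 := 𝕜) hk hy.toIsWeight hz.toIsWeight h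
  have hfr : Module.finrank ℝ ((tracelessSpace n).map (diagFormL 𝕜 n k)) = d := by
    have h3 := finrank_map_of_injOn (f := diagFormL 𝕜 n k) (p := tracelessSpace n) hinj
    have h4 := finrank_tracelessSpace (n := n) (by omega)
    omega
  have hmem : ∀ T, T ∈ (tracelessSpace n).map (diagFormL 𝕜 n k) ↔ T ∈ W H (stdMetric H) := fun T => by
    rw [mem_W_iff hH hk]
    constructor
    · rintro ⟨y, hy, rfl⟩; exact ⟨y, hy, rfl⟩
    · rintro ⟨y, hy, rfl⟩; exact ⟨y, hy, rfl⟩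
  refine ⟨⟨_, fun T hT => (hmem T).mp hT, hfr, ?_⟩, ?_⟩
  · rintro T ⟨y, hy, rfl⟩ hT
    refine (hess_std_pos_iff hH hn hk hy).mpr ?_
    obtain ⟨μ, hμ, hq⟩ := exists_lower_bound_expHess hn h1 h2
    refine lt_of_lt_of_le ?_ (hq y hy)
    have : y ≠ 0 := fun h => hT (by rw [h, map_zero])
    have := norm_pos_iff.mpr this
    positivity
  · rintro d' ⟨V, hV, rfl, -⟩
    rw [← hfr]
    exact Submodule.finrank_mono fun T hT => (hmem T).mpr (hV hT)

/-- The coindex, if the Hessian is not positive on the tensors with vanishing row sums. -/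
lemma hasCoindex_of_eig₂_nonpos (h1 : 0 < eig₁ 𝕜 n k) (h2 : n = 3 ∨ eig₂ 𝕜 n k ≤ 0) :
    HasCoindex H (stdMetric H) (n - 1) := by
  have hn' : (3 : ℝ) ≤ n := by exact_mod_cast hn
  have hn2 : (n : ℝ) - 2 ≠ 0 := by linarith
  -- The eigenspace of arrays a_i + a_j with ∑ a_i = 0 realises the coindex.
  let Ψ : (Fin n → ℝ) →ₗ[ℝ] (Fin n → Fin n → ℝ) :=
    { toFun := fun a i j => offWeight n i j * (a i + a j)
      map_add' := fun a b => by ext i j; simp only [Pi.add_apply]; ring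
      map_smul' := fun r a => by
        ext i j; simp only [Pi.smul_apply, smul_eq_mul, RingHom.id_apply]; ring }
  have hΨ : ∀ a ∈ sumZero n, IsTraceless (Ψ a) := fun a ha => (isTraceless_add ha).1
  have hΨ0 : ∀ a ∈ sumZero n, ∀ b ∈ sumZero n, Ψ a = Ψ b → a = b := fun a ha b hb h => by
    ext i
    have h4 : rowSum (Ψ a) i = rowSum (Ψ b) i := by rw [h]
    have h5 : ((n : ℝ) - 2) * a i = (n - 2) * b i :=
      ((isTraceless_add ha).2 i).symm.trans (h4.trans ((isTraceless_add hb).2 i))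
    exact mul_left_cancel₀ hn2 h5
  have hfr : Module.finrank ℝ ((sumZero n).map (diagFormL 𝕜 n k ∘ₗ Ψ)) = n - 1 := by
    rw [← finrank_sumZero (n := n) (by omega)]
    exact finrank_map_of_injOn (f := diagFormL 𝕜 n k ∘ₗ Ψ) (p := sumZero n)
      fun a ha b hb h4 => hΨ0 a ha b hb
        (diagForm_injective (𝕜 := 𝕜) hk (hΨ a ha).toIsWeight (hΨ b hb).toIsWeight h4)
  refine ⟨⟨_, ?_, hfr, ?_⟩, ?_⟩
  · rintro T ⟨a, ha, rfl⟩
    exact (mem_W_iff hH hk _).mpr ⟨_, hΨ a ha, rfl⟩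
  · rintro T ⟨a, ha, rfl⟩ hT
    refine (hess_std_pos_iff hH hn hk (hΨ a ha)).mpr ?_
    have hrow : rowPart (Ψ a) = Ψ a := rowPart_add hn ha
    have hne : Ψ a ≠ 0 := fun h => hT (by rw [LinearMap.comp_apply, h, map_zero])
    rw [hessForm]
    conv => rhs; arg 4; rw [← hrow]
    rw [expHess_rowPart hn _ _ (hΨ a ha) (hΨ a ha), sum_mul_rowPart_self hn (hΨ a ha), hrow]
    refine mul_pos h1 ?_
    exact lt_of_le_of_ne (Finset.sum_nonneg fun i _ => Finset.sum_nonneg fun j _ =>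
      sq_nonneg _) fun h => hne (sum_sq_eq_zero h.symm)
  -- For the upper bound, a space on which the Hessian is positive meets the arrays with vanishing
  -- row sums only in 0. Taking row sums is therefore injective on it, with values in the
  -- (n-1)-dimensional space `sumZero n`.
  · rintro d' ⟨V, hV, rfl, hpos⟩
    rw [← finrank_sumZero (n := n) (by omega)]
    let R : (Fin n → Fin n → ℝ) →ₗ[ℝ] (Fin n → ℝ) :=
      { toFun := rowSum
        map_add' := fun y z => by ext i; simp [rowSum, Finset.sum_add_distrib]
        map_smul' := fun r y => by ext i; simp [rowSum, Finset.mul_sum] }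
    have hmem : ∀ T ∈ V, (R ∘ₗ coefL hk) T ∈ sumZero n := fun T hT => by
      obtain ⟨y, hy, rfl⟩ := (mem_W_iff hH hk T).mp (hV hT)
      rw [LinearMap.comp_apply, coefL_diagForm hk hy.toIsWeight]
      exact hy.sum
    have hinj0 : ∀ T ∈ V, (R ∘ₗ coefL hk) T = 0 → T = 0 := by
      intro T hT h3
      obtain ⟨y, hy, rfl⟩ := (mem_W_iff hH hk T).mp (hV hT)
      rw [LinearMap.comp_apply, coefL_diagForm hk hy.toIsWeight] at h3
      have h4 : ∀ i, rowSum y i = 0 := fun i => congrFun h3 i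
      by_contra hne
      have h5 := (hess_std_pos_iff hH hn hk hy).mp (hpos _ hT hne)
      rcases h2 with h2 | h2
      · refine hne ?_
        rw [eq_zero_of_rowSum h2 hy.toIsWeight h4]
        exact (diagFormL 𝕜 n k).map_zero
      · rw [hessForm, expHess_of_rowSum_eq_zero _ _ hy hy h4] at h5
        have h6 : 0 ≤ ∑ i, ∑ j, y i j * y i j :=
          Finset.sum_nonneg fun i _ => Finset.sum_nonneg fun j _ => mul_self_nonneg _
        rw [eig₂] at h2
        nlinarith
    have hinj : ∀ T ∈ V, ∀ S ∈ V, (R ∘ₗ coefL hk) T = (R ∘ₗ coefL hk) S → T = S :=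
      fun T hT S hS h => by
        have h3 := hinj0 _ (V.add_mem hT (V.smul_mem (-1) hS))
          (by rw [map_add, map_smul, h]; module)
        ext v w
        have h4 := LinearMap.congr_fun (LinearMap.congr_fun h3 v) w
        simp only [LinearMap.add_apply, LinearMap.smul_apply, smul_eq_mul,
          LinearMap.zero_apply] at h4
        linarith
    rw [← finrank_map_of_injOn (f := R ∘ₗ coefL hk) (p := V) hinj]
    refine Submodule.finrank_mono ?_
    rintro _ ⟨T, hT, rfl⟩
    exact hmem T hT

end Coindex

/-! ### Backward solutions of a scalar autonomous equation -/

section Ode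

/-- A backward solution of an autonomous equation that emanates from the unstable zero `0`. -/
lemma exists_unstable_solution {f : ℝ → ℝ} (hf : ContDiff ℝ ∞ f) (hpos : ∀ θ, 0 < θ → 0 < f θ)
    {M : ℝ} (hM : 0 < M) (hfM : ∀ θ, 0 < θ → θ ≤ 1 → f θ ≤ M * θ) :
    ∃ θ : ℝ → ℝ, (∀ t ≤ 0, ContDiffAt ℝ ∞ θ t) ∧ (∀ t ≤ 0, HasDerivAt θ (f (θ t)) t) ∧
      (∀ t ≤ 0, 0 < θ t) ∧ Filter.Tendsto θ Filter.atBot (𝓝 0) := by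
  -- In the variable w = log θ the equation is w' = 1/m(w). Separation of variables gives the time
  -- T(w) = ∫ m at which w is reached, and the solution is the inverse function of T; the logarithm
  -- also keeps θ positive.
  set m : ℝ → ℝ := fun w => Real.exp w / f (Real.exp w) with hm
  have hm0 : ∀ w, 0 < m w := fun w => div_pos (Real.exp_pos w) (hpos _ (Real.exp_pos w))
  have hms : ContDiff ℝ ∞ m := Real.contDiff_exp.div (hf.comp Real.contDiff_exp)
    fun w => (hpos _ (Real.exp_pos w)).ne'
  have hmc : Continuous m := hms.continuous
  set T : ℝ → ℝ := fun w => ∫ s in (0 : ℝ)..w, m s with hT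
  have hTd : ∀ w, HasDerivAt T (m w) w := fun w =>
    intervalIntegral.integral_hasDerivAt_right (hmc.intervalIntegrable _ _)
      (hmc.stronglyMeasurableAtFilter _ _) hmc.continuousAt
  have hTs : ContDiff ℝ ∞ T := by
    rw [contDiff_infty_iff_deriv]
    refine ⟨fun w => (hTd w).differentiableAt, ?_⟩
    have : deriv T = m := funext fun w => (hTd w).deriv
    rw [this]
    exact hms
  have hTmono : StrictMono T := strictMono_of_deriv_pos fun w => by rw [(hTd w).deriv]; exact hm0 w
  have hTopen : IsOpenMap T := by
    refine isOpenMap_iff_nhds_le.mpr fun w => ?_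
    have hs : HasStrictDerivAt T (m w) w := by
      have := hTs.contDiffAt.hasStrictDerivAt (x := w) (by simp)
      rwa [(hTd w).deriv] at this
    exact (hs.map_nhds_eq (hm0 w).ne').ge
  have hemb : Topology.IsOpenEmbedding T :=
    .of_continuous_injective_isOpenMap hTs.continuous hTmono.injective hTopen
  set e := hemb.toOpenPartialHomeomorph T with he
  -- The linear bound f(θ) ≤ Mθ means m ≥ 1/M, so T tends to -∞ with w: the zero is not reached in
  -- finite time, and every t ≤ 0 is in the range of T.
  have hle : ∀ w ≤ 0, T w ≤ w / M := by
    intro w hw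
    have h1 : ∫ s in w..(0 : ℝ), (1 / M : ℝ) ≤ ∫ s in w..(0 : ℝ), m s := by
      refine intervalIntegral.integral_mono_on hw (by simp) (hmc.intervalIntegrable _ _) fun s hs => ?_
      have h2 := hfM _ (Real.exp_pos s) (Real.exp_le_one_iff.mpr hs.2)
      rw [hm, div_le_div_iff₀ hM (hpos _ (Real.exp_pos s))]
      linarith
    rw [intervalIntegral.integral_const, smul_eq_mul] at h1
    have h2 : T w = -∫ s in w..(0 : ℝ), m s := intervalIntegral.integral_symm w 0
    rw [h2]
    have h3 : (0 - w) * (1 / M) = -(w / M) := by ring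
    linarith
  have hT0 : T 0 = 0 := by simp [hT]
  have hrange : ∀ t ≤ 0, t ∈ Set.range T := by
    intro t ht
    refine mem_range_of_exists_le_of_exists_ge hTs.continuous ⟨t * M, ?_⟩ ⟨0, by rw [hT0]; exact ht⟩
    refine (hle _ (mul_nonpos_of_nonpos_of_nonneg ht hM.le)).trans ?_
    rw [mul_div_cancel_right₀ _ hM.ne']
  have htarget : ∀ t ≤ 0, t ∈ e.target := fun t ht => by
    rw [he, hemb.toOpenPartialHomeomorph_target]; exact hrange t ht
  have hright : ∀ t ≤ 0, T (e.symm t) = t := fun t ht => e.right_inv (htarget t ht)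
  have hcoe : (e : ℝ → ℝ) = T := rfl
  refine ⟨fun t => Real.exp (e.symm t), fun t ht => ?_, fun t ht => ?_, fun t _ => Real.exp_pos _, ?_⟩
  · exact (e.contDiffAt_symm_deriv (hm0 _).ne' (htarget t ht) (hTd _) hTs.contDiffAt).exp
  · have h1 := (e.hasDerivAt_symm (htarget t ht) (hm0 _).ne' (hTd _)).exp
    refine h1.congr_deriv ?_
    have h2 := (hpos _ (Real.exp_pos (e.symm t))).ne'
    rw [hm]
    field_simp
  · refine Real.tendsto_exp_atBot.comp ?_
    rw [Filter.tendsto_atBot]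
    intro b
    filter_upwards [Filter.eventually_le_atBot (min 0 (T b))] with t ht
    have h1 := hright t (ht.trans (min_le_left _ _))
    rw [← hTmono.le_iff_le, h1]
    exact ht.trans (min_le_right _ _)

end Ode

/-! ### Ricci curvature of a two-parameter family of metrics -/

section TwoWeight

variable {𝕜 : Type*} [NormedDivisionRing 𝕜] [NormedAlgebra ℝ 𝕜] [FiniteDimensional ℝ 𝕜]
  [StarRing 𝕜] [StarModule ℝ 𝕜] [Scalars 𝕜] {n k : ℕ}

/-- The weight with the value `A` on the pairs that contain `i₀` and `B` on the other ones. -/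
def twoWeight (i₀ : Fin n) (A B : ℝ) (i j : Fin n) : ℝ :=
  offWeight n i j * (B + (A - B) * ((if i = i₀ then 1 else 0) + if j = i₀ then 1 else 0))

variable (i₀ : Fin n) (A B : ℝ)

lemma isWeight_twoWeight : IsWeight (twoWeight i₀ A B) :=
  ⟨fun i j => by simp only [twoWeight, offWeight_symm i j, add_comm], fun i => by
    simp [twoWeight, offWeight]⟩

lemma twoWeight_left {j : Fin n} (h : i₀ ≠ j) : twoWeight i₀ A B i₀ j = A := by
  simp [twoWeight, offWeight, h, h.symm]

lemma twoWeight_right {i : Fin n} (h : i ≠ i₀) : twoWeight i₀ A B i i₀ = A := by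
  simp [twoWeight, offWeight, h]

lemma twoWeight_other {i j : Fin n} (hi : i ≠ i₀) (hj : j ≠ i₀) (h : i ≠ j) :
    twoWeight i₀ A B i j = B := by simp [twoWeight, offWeight, hi, hj, h]

lemma eq_twoWeight {x : Fin n → Fin n → ℝ} (hx : IsWeight x) (h1 : ∀ j, j ≠ i₀ → x i₀ j = A)
    (h2 : ∀ i j, i ≠ i₀ → j ≠ i₀ → i ≠ j → x i j = B) : x = twoWeight i₀ A B := by
  ext i j
  by_cases h : i = j
  · subst h; rw [hx.diag, (isWeight_twoWeight i₀ A B).diag]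
  by_cases hi : i = i₀
  · subst hi; rw [h1 j (Ne.symm h), twoWeight_left _ _ _ h]
  by_cases hj : j = i₀
  · subst hj; rw [hx.symm, h1 i hi, twoWeight_right _ _ _ hi]
  rw [h2 i j hi hj h, twoWeight_other _ _ _ hi hj h]

lemma sum_twoWeight : ∑ i, ∑ j, twoWeight i₀ A B i j =
    2 * (n - 1) * A + (n - 1) * (n - 2) * B := by
  have h : ∀ i, ∑ j, twoWeight i₀ A B i j = (n - 1) * (B + (A - B) * if i = i₀ then 1 else 0) +
      (A - B) * (1 - if i = i₀ then 1 else 0) := fun i => by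
    simp only [twoWeight]
    rw [sum_offWeight_mul]
    simp only [Finset.sum_add_distrib, ← Finset.mul_sum, Finset.sum_const, Finset.card_univ,
      Fintype.card_fin, nsmul_eq_mul, Finset.sum_ite_eq', Finset.mem_univ, if_true]
    ring
  simp only [h, Finset.sum_add_distrib, ← Finset.mul_sum, Finset.sum_sub_distrib, Finset.sum_const,
    Finset.card_univ, Fintype.card_fin, nsmul_eq_mul, Finset.sum_ite_eq', Finset.mem_univ, if_true]
  ring

variable (𝕜 k) in
/-- The constant term of the Ricci tensor. -/
def ricConst : ℝ := 2 * (k * δ 𝕜 - (2 - δ 𝕜))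

variable {A B}

/-- The family is invariant under permutations of the indices other than i₀, hence so is its Ricci
tensor. For a pair with i₀ all n-2 third indices meet the values A and B. For another pair the n-3
third indices different from i₀ give ½ each, and i₀ itself gives B²/(2A²). -/
lemma ricCoef_twoWeight (hA : A ≠ 0) (hB : B ≠ 0) :
    (fun i j => offWeight n i j * ricCoef 𝕜 k (twoWeight i₀ A B) i j) =
      twoWeight i₀ (ricConst 𝕜 k + k * δ 𝕜 * ((n - 2) * (1 - B / (2 * A))))
        (ricConst 𝕜 k + k * δ 𝕜 * ((n - 3) / 2 + B ^ 2 / (2 * A ^ 2))) := by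
  refine eq_twoWeight _ _ _ (isWeight_ricCoef (isWeight_twoWeight _ _ _)) (fun j hj => ?_)
    fun i j hi hj hij => ?_
  · have e : ((n : ℝ) - 2) * (1 - B / (2 * A)) = ∑ l with l ≠ i₀ ∧ l ≠ j, (1 - B / (2 * A)) := by
      rw [← card_filter_ne hj.symm, Finset.sum_const, nsmul_eq_mul]
    rw [offWeight, if_neg hj.symm, one_mul, ricCoef, ricConst, e]
    congr 2
    refine Finset.sum_congr rfl fun l hl => ?_
    simp only [Finset.mem_filter, Finset.mem_univ, true_and] at hl
    rw [twoWeight_left _ _ _ hj.symm, twoWeight_left _ _ _ hl.1.symm,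
      twoWeight_other _ _ _ hj hl.1 hl.2.symm]
    field_simp
    ring
  · have hmem : i₀ ∈ Finset.univ.filter fun l : Fin n => l ≠ i ∧ l ≠ j := by
      simp [hi.symm, hj.symm]
    have h : ∀ l ∈ Finset.univ.filter fun l : Fin n => l ≠ i ∧ l ≠ j,
        (1 + (twoWeight i₀ A B i j ^ 2 - twoWeight i₀ A B i l ^ 2 - twoWeight i₀ A B j l ^ 2) /
          (2 * twoWeight i₀ A B i l * twoWeight i₀ A B j l)) =
        1 / 2 + if l = i₀ then B ^ 2 / (2 * A ^ 2) - 1 / 2 else 0 := fun l hl => by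
      simp only [Finset.mem_filter, Finset.mem_univ, true_and] at hl
      rw [twoWeight_other _ _ _ hi hj hij]
      by_cases hl0 : l = i₀
      · subst hl0
        rw [twoWeight_right _ _ _ hi, twoWeight_right _ _ _ hj, if_pos rfl]
        field_simp
        ring
      · rw [twoWeight_other _ _ _ hi hl0 hl.1.symm, twoWeight_other _ _ _ hj hl0 hl.2.symm,
          if_neg hl0]
        field_simp
        ring
    rw [offWeight, if_neg hij, one_mul, ricCoef, ricConst, Finset.sum_congr rfl h,
      Finset.sum_add_distrib, Finset.sum_ite_eq', if_pos hmem, Finset.sum_const, nsmul_eq_mul,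
      card_filter_ne hij]
    ring

end TwoWeight

/-! ### The ancient solution of the normalised Ricci flow -/

section Flow

variable {𝕜 : Type*} [NormedDivisionRing 𝕜] [NormedAlgebra ℝ 𝕜] [FiniteDimensional ℝ 𝕜]
  [StarRing 𝕜] [StarModule ℝ 𝕜] [Scalars 𝕜] {n k : ℕ}

/-- `G` is a group of unitary matrices that contains the exponentials of the elements of `𝔤`. -/
structure IsUnitaryGroup (H : Space 𝕜 n k) : Prop where
  star_mul_self : ∀ a ∈ H.G, star a * a = 1
  star_mem : ∀ a ∈ H.G, star a ∈ H.G
  exp_mem : ∀ X ∈ H.lie, NormedSpace.exp X ∈ H.G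

lemma diagForm_twoWeight (i₀ : Fin n) (A B : ℝ) (v w : offDiag 𝕜 n k) :
    diagForm 𝕜 n k (twoWeight i₀ A B) v w = A * diagForm 𝕜 n k (twoWeight i₀ 1 0) v w +
      B * diagForm 𝕜 n k (twoWeight i₀ 0 1) v w := by
  have h : twoWeight i₀ A B = A • twoWeight i₀ 1 0 + B • twoWeight i₀ 0 1 := by
    ext i j
    simp only [twoWeight, Pi.add_apply, Pi.smul_apply, smul_eq_mul]
    ring
  rw [h, ← diagFormL_apply, map_add, map_smul, map_smul]
  rfl

variable (𝕜 n k) in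
/-- The velocity of the Ricci flow in the family of metrics with two parameters. -/
def flowField (c θ : ℝ) : ℝ :=
  2 / (n * c) * Real.exp (2 * θ) * (1 - Real.exp (-(n * θ))) *
    (ricConst 𝕜 k + k * δ 𝕜 * ((n - 3) / 2) - k * δ 𝕜 * ((n - 1) / 2) * Real.exp (-(n * θ)))

/-- On A = c e^{(n-2)θ}, B = c e^{-2θ} the volume is constant: n-1 pairs carry A, (n-1)(n-2)/2 carry
B, and (n-1)(n-2) - 2 · (n-1)(n-2)/2 = 0. The right-hand side is the velocity of θ under the flow.
With u = B/A = e^{-nθ} the difference of Ricci eigenvalues has the factor 1 - u, which exhibits the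
zero at θ = 0. -/
lemma flowField_eq (hn : 3 ≤ n) {c : ℝ} (hc : 0 < c) (θ : ℝ) :
    flowField 𝕜 n k c θ = 2 / n *
      ((ricConst 𝕜 k + k * δ 𝕜 * ((n - 3) / 2 + (c * Real.exp (-2 * θ)) ^ 2 /
          (2 * (c * Real.exp ((n - 2) * θ)) ^ 2))) / (c * Real.exp (-2 * θ)) -
        (ricConst 𝕜 k + k * δ 𝕜 * ((n - 2) * (1 - (c * Real.exp (-2 * θ)) /
          (2 * (c * Real.exp ((n - 2) * θ)))))) / (c * Real.exp ((n - 2) * θ))) := by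
  have h1 : Real.exp ((n - 2) * θ) = (Real.exp (-(n * θ)))⁻¹ * (Real.exp (2 * θ))⁻¹ := by
    rw [← Real.exp_neg, ← Real.exp_neg, ← Real.exp_add]
    congr 1
    ring
  have h2 : Real.exp (-2 * θ) = (Real.exp (2 * θ))⁻¹ := by
    rw [← Real.exp_neg]
    congr 1
    ring
  rw [flowField, h1, h2]
  have hu := Real.exp_pos (-(n * θ))
  have he := Real.exp_pos (2 * θ)
  set u := Real.exp (-(n * θ))
  set e := Real.exp (2 * θ)
  have hn0 : (n : ℝ) ≠ 0 := by
    have : (3 : ℝ) ≤ n := by exact_mod_cast hn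
    linarith
  field_simp
  ring

lemma contDiff_flowField (c : ℝ) : ContDiff ℝ ∞ (flowField 𝕜 n k c) := by
  unfold flowField
  fun_prop

lemma ricConst_sub : ricConst 𝕜 k - k * δ 𝕜 = eig₁ 𝕜 n k := by
  rw [ricConst, eig₁, scalConst]; ring

/-- The last factor of `flowField` increases with θ and equals `ricConst` - kδ = `eig₁` at θ = 0, so
it is positive for θ > 0, as is 1 - e^{-nθ}. -/
lemma flowField_pos (hn : 3 ≤ n) {c : ℝ} (hc : 0 < c) (h1 : 0 < eig₁ 𝕜 n k) {θ : ℝ} (hθ : 0 < θ) :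
    0 < flowField 𝕜 n k c θ := by
  have hn' : (3 : ℝ) ≤ n := by exact_mod_cast hn
  have hκ : 0 ≤ (k : ℝ) * δ 𝕜 := by positivity
  have hu : Real.exp (-(n * θ)) < 1 := (Real.exp_lt_exp.mpr (by nlinarith)).trans_eq Real.exp_zero
  have h2 := ricConst_sub (𝕜 := 𝕜) (n := n) (k := k)
  have h3 : k * δ 𝕜 * (((n : ℝ) - 1) / 2) * Real.exp (-(n * θ)) ≤ k * δ 𝕜 * ((n - 1) / 2) * 1 :=
    mul_le_mul_of_nonneg_left hu.le (mul_nonneg hκ (by linarith))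
  rw [flowField]
  have h4 : 0 < 1 - Real.exp (-(n * θ)) := by linarith
  have h5 : 0 < ricConst 𝕜 k + k * δ 𝕜 * (((n : ℝ) - 3) / 2) -
      k * δ 𝕜 * ((n - 1) / 2) * Real.exp (-(n * θ)) := by linarith
  positivity

lemma exists_flowField_le (hn : 3 ≤ n) {c : ℝ} (hc : 0 < c) (h1 : 0 < eig₁ 𝕜 n k) :
    ∃ M : ℝ, 0 < M ∧ ∀ θ, 0 < θ → θ ≤ 1 → flowField 𝕜 n k c θ ≤ M * θ := by
  have hn' : (3 : ℝ) ≤ n := by exact_mod_cast hn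
  have hκ : 0 ≤ (k : ℝ) * δ 𝕜 := by positivity
  have h2 := ricConst_sub (𝕜 := 𝕜) (n := n) (k := k)
  have hA : 0 < ricConst 𝕜 k + k * δ 𝕜 * (((n : ℝ) - 3) / 2) := by
    have : 0 ≤ k * δ 𝕜 * (((n : ℝ) - 3) / 2) := mul_nonneg hκ (by linarith)
    linarith
  -- The constant comes from e^{2θ} ≤ e² on [0, 1], from 1 - e^{-nθ} ≤ nθ and from dropping the
  -- subtracted term of the last factor.
  refine ⟨2 / (n * c) * Real.exp 2 * n * (ricConst 𝕜 k + k * δ 𝕜 * (((n : ℝ) - 3) / 2)),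
    by positivity, fun θ hθ hθ1 => ?_⟩
  have hu := Real.add_one_le_exp (-(n * θ))
  have hu0 := Real.exp_pos (-(n * θ))
  have hu1 : Real.exp (-(n * θ)) < 1 := (Real.exp_lt_exp.mpr (by nlinarith)).trans_eq Real.exp_zero
  have h3 : 0 ≤ k * δ 𝕜 * (((n : ℝ) - 1) / 2) * Real.exp (-(n * θ)) :=
    mul_nonneg (mul_nonneg hκ (by linarith)) hu0.le
  have h4 : k * δ 𝕜 * (((n : ℝ) - 1) / 2) * Real.exp (-(n * θ)) ≤ k * δ 𝕜 * ((n - 1) / 2) * 1 :=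
    mul_le_mul_of_nonneg_left hu1.le (mul_nonneg hκ (by linarith))
  rw [flowField]
  calc _ ≤ 2 / (n * c) * Real.exp 2 * (n * θ) *
        (ricConst 𝕜 k + k * δ 𝕜 * (((n : ℝ) - 3) / 2)) := by
        refine mul_le_mul (mul_le_mul (mul_le_mul_of_nonneg_left (Real.exp_le_exp.mpr (by linarith))
          (by positivity)) (by linarith) (by linarith) (by positivity)) (by linarith) (by linarith)
          (by positivity)
    _ = _ := by ring

variable {H : Space 𝕜 n k} {c : ℝ} (hH : IsDiagonal H c) (hU : IsUnitaryGroup H)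

/-- An invariant metric, as a field. -/
lemma isMetric_const {g : Form 𝕜 n k} (hg : IsInvMetric H g) : IsMetric H fun _ => g where
  symm _ _ := hg.symm
  pos _ _ := hg.pos
  equivariant _ _ c hc hb v w := (hg.inv c hc hb v w).symm
  smooth _ _ _ _ _ _ _ := contDiff_const

lemma leftDeriv_const (L : List (Mat 𝕜 n k)) (r : ℝ) :
    leftDeriv L (fun _ => r) = fun _ => if L = [] then r else 0 := by
  induction L with
  | nil => rfl
  | cons X L ih =>
    funext a
    rw [leftDeriv, ih]
    simp

/-- An invariant field is a constant function on G, so all its derivatives of positive order vanish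
and smooth convergence is convergence of the value. -/
lemma convergesSmoothly_const {g : ℝ → Form 𝕜 n k} {g₀ : Form 𝕜 n k}
    (h : ∀ v w, Filter.Tendsto (fun t => g t v w) Filter.atBot (𝓝 (g₀ v w))) :
    ConvergesSmoothly H (fun t _ => g t) fun _ => g₀ := by
  intro L _ v w
  simp only [leftDeriv_const]
  by_cases hL : L = []
  · simp only [hL, if_true]
    rw [Metric.tendstoUniformlyOn_iff]
    intro ε hε
    filter_upwards [Metric.tendsto_nhds.mp (h v w) ε hε] with t ht a _
    rw [dist_comm]
    exact ht
  · simp only [hL, if_false]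
    rw [Metric.tendstoUniformlyOn_iff]
    intro ε hε
    filter_upwards with t a _
    simpa using hε

lemma isMeanScal_const {g : Form 𝕜 n k} {r : ℝ} (h : ∀ a, scalAt (fun _ => g) a = r) :
    IsMeanScal H (fun _ => g) r := by
  intro μ _
  simp only [h]
  rw [MeasureTheory.integral_const_mul]

lemma isBlockDiag_one : IsBlockDiag (1 : Mat 𝕜 n k) := fun p q h =>
  Matrix.one_apply_ne fun e => h (by rw [e])

lemma IsBlockDiag.star {X : Mat 𝕜 n k} (hX : IsBlockDiag X) : IsBlockDiag (star X) :=
  fun p q h => by rw [Matrix.star_apply, hX q p h.symm, star_zero]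

lemma IsBlockDiag.mul {X Y : Mat 𝕜 n k} (hX : IsBlockDiag X) (hY : IsBlockDiag Y) :
    IsBlockDiag (X * Y) := fun p q h => by
  rw [Matrix.mul_apply]
  refine Finset.sum_eq_zero fun r _ => ?_
  by_cases hr : p.1 = r.1
  · rw [hY r q (hr ▸ h), mul_zero]
  · rw [hX p r hr, zero_mul]

variable (𝕜 n k) in
/-- An entry of a matrix, as a linear map. -/
def entryL (p q : Fin n × Fin k) : Mat 𝕜 n k →ₗ[ℝ] 𝕜 where
  toFun A := A p q
  map_add' _ _ := rfl
  map_smul' _ _ := rfl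

include hU

lemma IsUnitaryGroup.mul_star_self {a : Mat 𝕜 n k} (ha : a ∈ H.G) : a * star a = 1 := by
  have := hU.star_mul_self _ (hU.star_mem _ ha)
  rwa [star_star] at this

lemma isSmoothMap_id : IsSmoothMap H id where
  mapsTo _ h := h
  wellDefined _ _ _ _ h := h
  lifts a ha := by
    have : CompleteSpace (Mat 𝕜 n k) := FiniteDimensional.complete ℝ _
    refine ⟨fun X => a * NormedSpace.exp (X : Mat 𝕜 n k), .of_forall fun X => ?_, ?_⟩
    · have hm := H.G.mul_mem ha (hU.exp_mem _ (H.offDiag_le X.2))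
      refine ⟨hm, ?_⟩
      rw [SamePoint, id, hU.star_mul_self _ hm]
      exact isBlockDiag_one
    · intro r X p q
      open scoped Matrix.Norms.Operator in
      have h1 : ContDiff ℝ ∞ fun s : Fin r → ℝ => a * NormedSpace.exp
          ((∑ i, s i • X i : offDiag 𝕜 n k) : Mat 𝕜 n k) := by
        have h2 : ContDiff ℝ ∞ (NormedSpace.exp : Mat 𝕜 n k → Mat 𝕜 n k) :=
          contDiff_exp.of_le (by exact_mod_cast le_top)
        refine contDiff_const.mul (h2.comp ?_)
        simp only [Submodule.coe_sum, Submodule.coe_smul]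
        fun_prop
      open scoped Matrix.Norms.Operator in
      exact ((LinearMap.toContinuousLinearMap (entryL 𝕜 n k p q)).contDiff.comp h1).contDiffAt

lemma isDiffeo_id : IsDiffeo H id :=
  ⟨isSmoothMap_id hU, id, isSmoothMap_id hU, fun a ha => by
    have : IsBlockDiag (star a * a) := by rw [hU.star_mul_self _ ha]; exact isBlockDiag_one
    exact ⟨this, this⟩⟩

lemma star_exp_of_mem {X : Mat 𝕜 n k} (hX : X ∈ H.lie) :
    star (NormedSpace.exp X) = NormedSpace.exp (-X) := by
  open scoped Matrix.Norms.Operator in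
  have : CompleteSpace (Mat 𝕜 n k) := FiniteDimensional.complete ℝ _
  open scoped Matrix.Norms.Operator in
  let _ : NormedAlgebra ℚ (Mat 𝕜 n k) := NormedAlgebra.restrictScalars ℚ ℝ _
  refine left_inv_eq_right_inv (hU.star_mul_self _ (hU.exp_mem X hX)) ?_
  open scoped Matrix.Norms.Operator in
  have h := NormedSpace.exp_add_of_commute (𝔸 := Mat 𝕜 n k) (x := X) (y := -X)
    (Commute.neg_right (Commute.refl X))
  rw [add_neg_cancel, NormedSpace.exp_zero] at h
  exact h.symm

open scoped Matrix.Norms.Operator in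
omit hU in
lemma hasDerivAt_exp_smul (X : Mat 𝕜 n k) :
    HasDerivAt (fun t : ℝ => NormedSpace.exp (t • X)) X 0 := by
  have : CompleteSpace (Mat 𝕜 n k) := FiniteDimensional.complete ℝ _
  have h := hasDerivAt_exp_smul_const (𝕂 := ℝ) X (0 : ℝ)
  simp only [zero_smul, NormedSpace.exp_zero, one_mul] at h
  exact h

open scoped Matrix.Norms.Operator in
omit hU in
lemma differentiableAt_of_entries {f : ℝ → Mat 𝕜 n k} {t : ℝ}
    (h : ∀ p q, DifferentiableAt ℝ (fun s => f s p q) t) : DifferentiableAt ℝ f t := by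
  have e : f = fun s => ∑ p, ∑ q, Matrix.singleLinearMap ℝ p q (f s p q) := by
    funext s
    exact Matrix.matrix_eq_sum_single (f s)
  rw [e]
  exact DifferentiableAt.fun_sum fun p _ => DifferentiableAt.fun_sum fun q _ =>
    (LinearMap.toContinuousLinearMap (Matrix.singleLinearMap ℝ p q :
      𝕜 →ₗ[ℝ] Mat 𝕜 n k)).differentiableAt.comp t (h p q)

open scoped Matrix.Norms.Operator in
omit hU in
lemma isBlockDiag_deriv {f : ℝ → Mat 𝕜 n k} {D : Mat 𝕜 n k} {t : ℝ} (h : HasDerivAt f D t)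
    (hf : ∀ᶠ s in 𝓝 t, IsBlockDiag (f s)) : IsBlockDiag D := by
  intro p q hpq
  have h1 := (LinearMap.toContinuousLinearMap (entryL 𝕜 n k p q)).hasFDerivAt.comp_hasDerivAt t h
  have h2 : HasDerivAt (fun s => (LinearMap.toContinuousLinearMap (entryL 𝕜 n k p q)) (f s)) 0 t := by
    refine (hasDerivAt_const t (0 : 𝕜)).congr_of_eventuallyEq ?_
    filter_upwards [hf] with s hs using hs p q hpq
  exact h1.unique h2

/-- The differential of a local lift of the identity is given by the isotropy representation. -/
lemma liftDiff_eq {a : Mat 𝕜 n k} (ha : a ∈ H.G) {F : offDiag 𝕜 n k → Mat 𝕜 n k}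
    (hF : IsLocalLift H id a F) (v : offDiag 𝕜 n k) : liftDiff F v = Ad (star (F 0) * a) v := by
  open scoped Matrix.Norms.Operator in
  have : CompleteSpace (Mat 𝕜 n k) := FiniteDimensional.complete ℝ _
  obtain ⟨h0, h0'⟩ := hF.lift.self_of_nhds
  have hb0 : IsBlockDiag (star (F 0) * a) := by
    have : star (F 0) * (a * NormedSpace.exp ((0 : offDiag 𝕜 n k) : Mat 𝕜 n k)) =
        star (F 0) * a := by
      rw [Submodule.coe_zero, NormedSpace.exp_zero, mul_one]
    rw [← this]
    exact h0'
  have htend : Filter.Tendsto (fun t : ℝ => t • v) (𝓝 0) (𝓝 0) := by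
    have hcont : Continuous fun t : ℝ => t • v := by fun_prop
    simpa using hcont.tendsto 0
  have hdiff : DifferentiableAt ℝ (fun t : ℝ => F (t • v)) 0 := by
    refine differentiableAt_of_entries fun p q => ?_
    have h1 := hF.smooth 1 (fun _ => v) p q
    have h2 : ContDiffAt ℝ ∞ (fun t : ℝ => (fun _ : Fin 1 => t)) 0 :=
      (contDiff_pi.mpr fun _ => contDiff_id).contDiffAt
    have h3 := ContDiffAt.comp (0 : ℝ) (f := fun t : ℝ => (fun _ : Fin 1 => t))
      (g := fun s : Fin 1 → ℝ => F (∑ i, s i • v) p q) h1 h2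
    have h4 := h3.differentiableAt (by simp)
    simpa [Function.comp_def] using h4
  set D := deriv (fun t : ℝ => F (t • v)) 0 with hD
  have hFD : HasDerivAt (fun t : ℝ => F (t • v)) D 0 := hdiff.hasDerivAt
  have hE : HasDerivAt (fun t : ℝ => NormedSpace.exp (t • -(v : Mat 𝕜 n k))) (-(v : Mat 𝕜 n k)) 0 :=
    hasDerivAt_exp_smul _
  have hC := hE.mul (hFD.const_mul (star a))
  -- Since F(tv) and a exp(tv) represent the same point of M, the product exp(-tv) a* F(tv) is block
  -- diagonal for small t, and so is its derivative.
  have hblock : IsBlockDiag (-(v : Mat 𝕜 n k) * (star a * F 0) + star a * D) := by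
    have h1 := isBlockDiag_deriv hC (by
      filter_upwards [htend.eventually hF.lift] with t ht
      have h2 := ht.2.star
      rw [star_mul, star_star, id, star_mul, star_exp_of_mem hU (H.offDiag_le (t • v).2)] at h2
      rw [Submodule.coe_smul, ← smul_neg, mul_assoc] at h2
      exact h2)
    simpa using h1
  set C := -(v : Mat 𝕜 n k) * (star a * F 0) + star a * D with hCdef
  -- Inserting a a* = 1 splits the velocity into the conjugate of v by F(0)* a and a block diagonal
  -- remainder, which `projP` removes.
  have hDeq : star (F 0) * D = (star (F 0) * a) * v * star (star (F 0) * a) +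
      (star (F 0) * a) * C := by
    have h1 : a * star a = 1 := hU.mul_star_self ha
    calc star (F 0) * D = star (F 0) * (a * star a) * D := by rw [h1, mul_one]
      _ = _ := by rw [hCdef, star_mul, star_star]; noncomm_ring
  have h5 : liftDiff F v = projP (star (F 0) * D) := rfl
  rw [h5, hDeq, map_add, projP_blockDiag (hb0.mul hblock), add_zero]
  rfl

/-- The definition quantifies over all local lifts. Two lifts of the identity differ by elements of
K, whose effect on tangent vectors is the isotropy representation, under which the form is
invariant. -/
lemma isPullback_id {g : Form 𝕜 n k} (hg : IsInvTensor H g) :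
    IsPullback H id (fun _ => g) fun _ => g := by
  intro a ha F hF v w
  obtain ⟨h0, h0'⟩ := hF.lift.self_of_nhds
  have hb0 : IsBlockDiag (star (F 0) * a) := by
    have : star (F 0) * (a * NormedSpace.exp ((0 : offDiag 𝕜 n k) : Mat 𝕜 n k)) =
        star (F 0) * a := by
      rw [Submodule.coe_zero, NormedSpace.exp_zero, mul_one]
    rw [← this]
    exact h0'
  rw [liftDiff_eq hU ha hF, liftDiff_eq hU ha hF]
  exact (hg.inv _ (H.G.mul_mem (hU.star_mem _ h0) ha) hb0 v w).symm

include hH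

/-- The solution of θ' = `flowField` is inserted into the two-parameter family. No diffeomorphisms
are needed: all metrics are G-invariant, and their two coefficients converge to c as θ → 0. -/
theorem isDynamicallyUnstable_std (hn : 3 ≤ n) (hk : 1 ≤ k) (h1 : 0 < eig₁ 𝕜 n k) :
    IsDynamicallyUnstable H fun _ => stdMetric H := by
  have hc := hH.pos
  have hn' : (3 : ℝ) ≤ n := by exact_mod_cast hn
  let i₀ : Fin n := ⟨0, by omega⟩
  obtain ⟨M, hM, hfM⟩ := exists_flowField_le (𝕜 := 𝕜) (k := k) hn hc h1
  obtain ⟨θ, hθs, hθd, hθ0, hθt⟩ := exists_unstable_solution (contDiff_flowField (𝕜 := 𝕜) (n := n)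
    (k := k) c) (fun θ hθ => flowField_pos hn hc h1 hθ) hM hfM
  set A : ℝ → ℝ := fun s => c * Real.exp ((n - 2) * s) with hA
  set B : ℝ → ℝ := fun s => c * Real.exp (-2 * s) with hB
  have hA0 : ∀ s, 0 < A s := fun s => mul_pos hc (Real.exp_pos _)
  have hB0 : ∀ s, 0 < B s := fun s => mul_pos hc (Real.exp_pos _)
  have hAs : ContDiff ℝ ∞ A := by rw [hA]; fun_prop
  have hBs : ContDiff ℝ ∞ B := by rw [hB]; fun_prop
  have hAd : ∀ s, HasDerivAt A ((n - 2) * A s) s := fun s => by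
    have := (((hasDerivAt_id s).const_mul ((n : ℝ) - 2)).exp).const_mul c
    refine this.congr_deriv ?_
    simp only [hA, id]
    ring
  have hBd : ∀ s, HasDerivAt B (-2 * B s) s := fun s => by
    have := (((hasDerivAt_id s).const_mul (-2 : ℝ)).exp).const_mul c
    refine this.congr_deriv ?_
    simp only [hB, id]
    ring
  set g : ℝ → Form 𝕜 n k := fun t => diagForm 𝕜 n k (twoWeight i₀ (A (θ t)) (B (θ t))) with hg
  have hgv : ∀ t v w, g t v w = A (θ t) * diagForm 𝕜 n k (twoWeight i₀ 1 0) v w +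
      B (θ t) * diagForm 𝕜 n k (twoWeight i₀ 0 1) v w := fun t v w => diagForm_twoWeight _ _ _ _ _
  have hpos : ∀ s i j, i ≠ j → 0 < twoWeight i₀ (A s) (B s) i j := fun s i j hij => by
    by_cases hi : i = i₀
    · subst hi; rw [twoWeight_left _ _ _ hij]; exact hA0 s
    by_cases hj : j = i₀
    · subst hj; rw [twoWeight_right _ _ _ hij]; exact hA0 s
    rw [twoWeight_other _ _ _ hi hj hij]; exact hB0 s
  have hinv : ∀ t, IsInvMetric H (g t) := fun t =>
    isInvMetric_diagForm hH (isWeight_twoWeight _ _ _) (hpos _)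
  have hsmooth : ∀ v w t, t ≤ 0 → ContDiffAt ℝ ∞ (fun t => g t v w) t := fun v w t ht => by
    simp only [hgv]
    exact ((hAs.contDiffAt.comp t (hθs t ht)).mul contDiffAt_const).add
      ((hBs.contDiffAt.comp t (hθs t ht)).mul contDiffAt_const)
  have hderiv : ∀ v w t, t ≤ 0 → HasDerivAt (fun t => g t v w)
      (flowField 𝕜 n k c (θ t) * ((n - 2) * A (θ t) * diagForm 𝕜 n k (twoWeight i₀ 1 0) v w -
        2 * B (θ t) * diagForm 𝕜 n k (twoWeight i₀ 0 1) v w)) t := fun v w t ht => by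
    simp only [hgv]
    have := (((hAd (θ t)).comp t (hθd t ht)).mul_const
      (diagForm 𝕜 n k (twoWeight i₀ 1 0) v w)).add
      (((hBd (θ t)).comp t (hθd t ht)).mul_const (diagForm 𝕜 n k (twoWeight i₀ 0 1) v w))
    refine this.congr_deriv ?_
    ring
  refine ⟨fun t _ => g t, ⟨fun t _ => isMetric_const (hinv t), ?_, ?_⟩, ?_, fun _ => id,
    fun t _ => g t, fun t _ => ⟨isDiffeo_id hU, isPullback_id hU (hinv t).toIsInvTensor⟩,
    convergesSmoothly_const fun v w => ?_⟩
  · intro a _ r X _ v w p hp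
    exact ((hsmooth v w p.1 hp.1).comp p contDiffAt_fst).contDiffWithinAt
  · intro t ht
    set s := θ t
    set RA := ricConst 𝕜 k + k * δ 𝕜 * ((n - 2) * (1 - B s / (2 * A s))) with hRA
    set RB := ricConst 𝕜 k + k * δ 𝕜 * ((n - 3) / 2 + B s ^ 2 / (2 * A s ^ 2)) with hRB
    have hric := ricCoef_twoWeight (𝕜 := 𝕜) (k := k) i₀ (hA0 s).ne' (hB0 s).ne'
    have hdim := dimM_eq (𝕜 := 𝕜) (n := n) (k := k)
    have hb := blockDim_pos (𝕜 := 𝕜) hk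
    have hscal : ∀ a, scalAt (fun _ => g t) a = blockDim 𝕜 k / 2 *
        (2 * (n - 1) * (RA / A s) + (n - 1) * (n - 2) * (RB / B s)) := fun a => by
      rw [scalAt_diagForm (isWeight_twoWeight _ _ _) fun i j h => (hpos s i j h).ne',
        ← sum_twoWeight i₀]
      congr 1
      refine Finset.sum_congr rfl fun i _ => Finset.sum_congr rfl fun j _ => ?_
      by_cases hij : i = j
      · subst hij
        rw [(isWeight_twoWeight _ _ _).diag, (isWeight_twoWeight _ _ _).diag, div_zero]
      have h2 : ricCoef 𝕜 k (twoWeight i₀ (A s) (B s)) i j = twoWeight i₀ RA RB i j := by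
        rw [← hric]; simp [offWeight, hij]
      rw [h2]
      by_cases hi : i = i₀
      · subst hi; simp only [twoWeight_left _ _ _ hij]
      by_cases hj : j = i₀
      · subst hj; simp only [twoWeight_right _ _ _ hij]
      simp only [twoWeight_other _ _ _ hi hj hij]
    refine ⟨_, isMeanScal_const hscal, fun a _ v w => ?_⟩
    refine (hderiv v w t ht).hasDerivWithinAt.congr_deriv ?_
    have hr : ricciAt (fun _ => g t) a v w = RA * diagForm 𝕜 n k (twoWeight i₀ 1 0) v w +
        RB * diagForm 𝕜 n k (twoWeight i₀ 0 1) v w := by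
      rw [ricciAt_diagForm (isWeight_twoWeight _ _ _).symm (isWeight_twoWeight _ _ _).diag
        fun i j h => (hpos s i j h).ne', ← diagForm_twoWeight, ← hric]
      congr 2
      exact diagForm_congr fun i j h => by simp [offWeight, h]
    have hf : flowField 𝕜 n k c s = 2 / n * (RB / B s - RA / A s) := flowField_eq hn hc s
    rw [hr, hgv, hf, hdim]
    have e1 := (hA0 s).ne'
    have e2 := (hB0 s).ne'
    have e3 : (n : ℝ) ≠ 0 := by linarith
    have e4 : (n : ℝ) - 1 ≠ 0 := by linarith
    generalize RA = RA, RB = RB, diagForm 𝕜 n k (twoWeight i₀ 1 0) v w = U,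
      diagForm 𝕜 n k (twoWeight i₀ 0 1) v w = V
    field_simp
    ring
  -- A constant solution would agree with its limit at t → -∞, which forces e^{-2θ(0)} = 1, whereas
  -- θ(0) > 0.
  · by_contra hcon
    push Not at hcon
    have h3 : ∀ t ≤ 0, B (θ t) = B (θ 0) := fun t ht => by
      have h4 := hcon t ht 0 le_rfl 1 H.G.one_mem
      have h5 := diagForm_injective hk (isWeight_twoWeight _ _ _) (isWeight_twoWeight _ _ _) h4
      have h6 := congrFun (congrFun h5 ⟨1, by omega⟩) ⟨2, by omega⟩
      rwa [twoWeight_other _ _ _ (by simp [i₀]) (by simp [i₀]) (by simp),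
        twoWeight_other _ _ _ (by simp [i₀]) (by simp [i₀]) (by simp)] at h6
    have h4 : Filter.Tendsto (fun t => B (θ t)) Filter.atBot (𝓝 c) := by
      have := (hBs.continuous.tendsto 0).comp hθt
      simpa [hB, Function.comp_def] using this
    have h5 : Filter.Tendsto (fun t => B (θ t)) Filter.atBot (𝓝 (B (θ 0))) :=
      tendsto_const_nhds.congr' (by
        filter_upwards [Filter.eventually_le_atBot 0] with t ht using (h3 t ht).symm)
    have h6 := tendsto_nhds_unique h4 h5
    have h7 : Real.exp (-2 * θ 0) = 1 := by
      have : c * Real.exp (-2 * θ 0) = c * 1 := by rw [mul_one]; exact h6.symm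
      exact mul_left_cancel₀ hc.ne' this
    rw [Real.exp_eq_one_iff] at h7
    have := hθ0 0 le_rfl
    linarith
  · have hlim : stdMetric H = diagForm 𝕜 n k (twoWeight i₀ c c) := by
      rw [hH.std]
      refine diagForm_congr fun i j h => ?_
      simp [constWeight_of_ne c h, twoWeight, offWeight, h]
    simp only [hgv, hlim]
    rw [diagForm_twoWeight i₀ c c]
    have h3 := (hAs.continuous.tendsto 0).comp hθt
    have h4 := (hBs.continuous.tendsto 0).comp hθt
    have e3 : A 0 = c := by simp [hA]
    have e4 : B 0 = c := by simp [hB]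
    rw [e3] at h3
    rw [e4] at h4
    exact (h3.mul_const _).add (h4.mul_const _)

end Flow

/-! ### Invariant tensors: averaging over monomial matrices -/

section Monomial

variable {𝕜 : Type*} [NormedDivisionRing 𝕜] [NormedAlgebra ℝ 𝕜] [FiniteDimensional ℝ 𝕜]
  [StarRing 𝕜] [StarModule ℝ 𝕜] [Scalars 𝕜] {n k : ℕ}

/-- The monomial matrix with the entries `ε p` at the positions `(p, σ p)`. -/
def monomial (σ : Equiv.Perm (Fin n × Fin k)) (ε : Fin n × Fin k → 𝕜) : Mat 𝕜 n k :=
  Matrix.of fun p q => if q = σ p then ε p else 0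

/-- The diagonal entries `w` at `p`, `w^*` at `q`, and `1` elsewhere. -/
def phase (p q : Fin n × Fin k) (w : 𝕜) : Fin n × Fin k → 𝕜 :=
  Function.update (Function.update 1 p w) q (star w)

/-- The entry `-1` at `p`, and `1` elsewhere. -/
def signAt (𝕜 : Type*) [NormedDivisionRing 𝕜] (p : Fin n × Fin k) : Fin n × Fin k → 𝕜 :=
  Function.update 1 p (-1)

lemma monomial_mul_apply (σ : Equiv.Perm (Fin n × Fin k)) (ε : Fin n × Fin k → 𝕜) (X : Mat 𝕜 n k)
    (p q : Fin n × Fin k) : (monomial σ ε * X) p q = ε p * X (σ p) q := by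
  rw [Matrix.mul_apply, Finset.sum_eq_single (σ p)]
  · simp [monomial]
  · intro r _ hr
    simp [monomial, hr]
  · simp

lemma monomial_conj_apply (σ : Equiv.Perm (Fin n × Fin k)) (ε : Fin n × Fin k → 𝕜) (X : Mat 𝕜 n k)
    (p q : Fin n × Fin k) :
    (monomial σ ε * X * star (monomial σ ε)) p q = ε p * X (σ p) (σ q) * star (ε q) := by
  rw [Matrix.mul_apply, Finset.sum_eq_single (σ q)]
  · rw [monomial_mul_apply]
    simp [monomial, Matrix.star_apply]
  · intro r _ hr
    simp [monomial, Matrix.star_apply, hr]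
  · simp

lemma monomial_mul_star (σ : Equiv.Perm (Fin n × Fin k)) {ε : Fin n × Fin k → 𝕜}
    (hε : ∀ p, ε p * star (ε p) = 1) : monomial σ ε * star (monomial σ ε) = 1 := by
  have h := monomial_conj_apply σ ε (1 : Mat 𝕜 n k)
  rw [mul_one] at h
  ext p q
  rw [h]
  by_cases hpq : p = q
  · subst hpq; simp [hε]
  · rw [Matrix.one_apply_ne hpq, Matrix.one_apply_ne fun e => hpq (σ.injective e)]
    simp

lemma elem_conj (σ : Equiv.Perm (Fin n × Fin k)) (ε : Fin n × Fin k → 𝕜) (r s : Fin n × Fin k)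
    (a : 𝕜) : monomial σ ε * elem r s a * star (monomial σ ε) =
      elem (σ.symm r) (σ.symm s) (ε (σ.symm r) * a * star (ε (σ.symm s))) := by
  ext p q
  rw [monomial_conj_apply]
  simp only [elem, Matrix.of_apply, Equiv.eq_symm_apply]
  by_cases h1 : σ p = r ∧ σ q = s
  · obtain ⟨rfl, rfl⟩ := h1
    simp
  · by_cases h2 : σ p = s ∧ σ q = r
    · obtain ⟨rfl, rfl⟩ := h2
      rw [if_neg h1, if_pos ⟨rfl, rfl⟩, if_neg h1, if_pos ⟨rfl, rfl⟩]
      simp [mul_assoc]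
    · rw [if_neg h1, if_neg h2, if_neg h1, if_neg h2]
      simp

lemma isBlockDiag_monomial {σ : Equiv.Perm (Fin n × Fin k)} (hσ : ∀ p, (σ p).1 = p.1)
    (ε : Fin n × Fin k → 𝕜) : IsBlockDiag (monomial σ ε) := by
  intro p q h
  have : q ≠ σ p := fun e => h (by rw [e, hσ])
  simp [monomial, this]

/-- Conjugation by a block diagonal matrix keeps the diagonal blocks zero, so the projection in `Ad`
does nothing. -/
lemma coe_Ad {c : Mat 𝕜 n k} (hc : IsBlockDiag c) (v : offDiag 𝕜 n k) :
    (Ad c v : Mat 𝕜 n k) = c * v * star c := by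
  have h : c * (v : Mat 𝕜 n k) * star c ∈ offDiag 𝕜 n k := by
    refine ⟨by rw [star_mul, star_mul, star_star, v.2.1]; noncomm_ring, fun i a b => ?_⟩
    rw [Matrix.mul_apply]
    refine Finset.sum_eq_zero fun q _ => ?_
    by_cases hq : i = q.1
    · rw [Matrix.mul_apply, Finset.sum_eq_zero, zero_mul]
      intro r _
      by_cases hr : i = r.1
      · rw [offDiag_zero v.2 (hr.symm.trans hq), mul_zero]
      · rw [hc _ _ hr, zero_mul]
    · rw [Matrix.star_apply, hc _ _ hq, star_zero, mul_zero]
  have := projP_coe (⟨_, h⟩ : offDiag 𝕜 n k)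
  rw [Ad, this]

/-- `elem r s a` as an element of `𝔭`. -/
def elemP (r s : Fin n × Fin k) (h : r.1 ≠ s.1) (a : 𝕜) : offDiag 𝕜 n k := ⟨elem r s a, elem_mem h a⟩

lemma stdVec_eq (e : Idx 𝕜 n k) : stdVec 𝕜 n k e = elemP e.1.1.1 e.1.1.2 e.1.2.ne (unit e.2) := rfl

lemma elemP_add {r s : Fin n × Fin k} (h : r.1 ≠ s.1) (a b : 𝕜) :
    elemP r s h (a + b) = elemP r s h a + elemP r s h b := Subtype.ext (elem_add r s a b)

lemma elemP_smul {r s : Fin n × Fin k} (h : r.1 ≠ s.1) (c : ℝ) (a : 𝕜) :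
    elemP r s h (c • a) = c • elemP r s h a := Subtype.ext (elem_smul r s c a)

lemma elemP_neg {r s : Fin n × Fin k} (h : r.1 ≠ s.1) (a : 𝕜) :
    elemP r s h (-a) = -elemP r s h a := by
  ext p q
  simp only [elemP, elem, Matrix.of_apply, Submodule.coe_neg, Matrix.neg_apply, star_neg]
  split_ifs <;> simp

lemma elemP_swap {r s : Fin n × Fin k} (h : r.1 ≠ s.1) (a : 𝕜) :
    elemP s r h.symm a = -elemP r s h (star a) := by
  ext p q
  simp only [elemP, elem, Matrix.of_apply, Submodule.coe_neg, Matrix.neg_apply, star_star]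
  by_cases h1 : p = r ∧ q = s
  · have h2 : ¬ (p = s ∧ q = r) := fun e => h (by rw [← h1.1, ← e.1])
    rw [if_neg h2, if_pos h1, if_pos h1]
  · rw [if_neg h1, if_neg h1]
    split_ifs <;> simp

/-- `elemP r s` as a linear map. -/
def elemL (r s : Fin n × Fin k) (h : r.1 ≠ s.1) : 𝕜 →ₗ[ℝ] offDiag 𝕜 n k where
  toFun := elemP r s h
  map_add' := elemP_add h
  map_smul' := elemP_smul h

/-- A group of unitary matrices that contains sufficiently many monomial matrices, and its Lie
algebra. -/
structure IsRich (H : Space 𝕜 n k) : Prop extends IsUnitaryGroup H where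
  lie_skew : ∀ X ∈ H.lie, star X = -X
  conj_lie : ∀ c : Mat 𝕜 n k, star c * c = 1 → c * star c = 1 → ∀ X ∈ H.lie, c * X * star c ∈ H.lie
  tangent : ∀ Y : Mat 𝕜 n k, (∀ t : ℝ, NormedSpace.exp (t • Y) ∈ H.G) → Y ∈ H.lie
  phase_mem : ∀ p q, p ≠ q → ∀ w : 𝕜, w * star w = 1 → monomial (Equiv.refl _) (phase p q w) ∈ H.G
  swap_mem : ∀ p q, p ≠ q → monomial (Equiv.swap p q) (signAt 𝕜 p) ∈ H.G
  size : δ 𝕜 ≠ 1 ∨ 5 ≤ n * k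

variable {H : Space 𝕜 n k} {T : Form 𝕜 n k}

lemma IsInvTensor.monomial (hT : IsInvTensor H T) {σ : Equiv.Perm (Fin n × Fin k)}
    {ε : Fin n × Fin k → 𝕜} (hσ : ∀ p, (σ p).1 = p.1) (hm : monomial σ ε ∈ H.G)
    {r s r' s' : Fin n × Fin k} (h : r.1 ≠ s.1) (h' : r'.1 ≠ s'.1)
    (h1 : (σ.symm r).1 ≠ (σ.symm s).1) (h1' : (σ.symm r').1 ≠ (σ.symm s').1) (a b : 𝕜) :
    T (elemP (σ.symm r) (σ.symm s) h1 (ε (σ.symm r) * a * star (ε (σ.symm s))))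
      (elemP (σ.symm r') (σ.symm s') h1' (ε (σ.symm r') * b * star (ε (σ.symm s')))) =
    T (elemP r s h a) (elemP r' s' h' b) := by
  have hb := isBlockDiag_monomial hσ ε
  have key : ∀ (r s : Fin n × Fin k) (h : r.1 ≠ s.1) (h1 : (σ.symm r).1 ≠ (σ.symm s).1) (a : 𝕜),
      elemP (σ.symm r) (σ.symm s) h1 (ε (σ.symm r) * a * star (ε (σ.symm s))) =
        Ad (BlockSpace.monomial σ ε) (elemP r s h a) := fun r s h h1 a => by
    ext1
    rw [coe_Ad hb]
    exact (elem_conj σ ε r s a).symm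
  rw [key r s h, key r' s' h', hT.inv _ hm hb]

lemma apply_one_swap (T : Form 𝕜 n k) {r s : Fin n × Fin k} (h : r.1 ≠ s.1) :
    T (elemP s r h.symm 1) (elemP s r h.symm 1) = T (elemP r s h 1) (elemP r s h 1) := by
  rw [elemP_swap h]
  simp

section Phase

variable {p q : Fin n × Fin k}

lemma phase_right (w : 𝕜) : phase p q w q = star w := by simp [phase]

lemma phase_left (h : p ≠ q) (w : 𝕜) : phase p q w p = w := by
  simp [phase, Function.update_of_ne h]

lemma phase_other {r : Fin n × Fin k} (h : r ≠ p) (h' : r ≠ q) (w : 𝕜) : phase p q w r = 1 := by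
  simp [phase, Function.update_of_ne h, Function.update_of_ne h']

variable (hR : IsRich H)

include hR

lemma IsInvTensor.phase (hT : IsInvTensor H T) (hpq : p ≠ q) {w : 𝕜} (hw : w * star w = 1)
    {r s r' s' : Fin n × Fin k} (h : r.1 ≠ s.1) (h' : r'.1 ≠ s'.1) (a b : 𝕜) :
    T (elemP r s h (phase p q w r * a * star (phase p q w s)))
      (elemP r' s' h' (phase p q w r' * b * star (phase p q w s'))) =
    T (elemP r s h a) (elemP r' s' h' b) :=
  hT.monomial (σ := Equiv.refl _) (fun _ => rfl) (hR.phase_mem p q hpq w hw) h h' h h' a b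

/-- Different root spaces are orthogonal. -/
lemma orthogonal_of_ne (hT : IsInvTensor H T) {r s r' s' : Fin n × Fin k} (h : r.1 < s.1)
    (h' : r'.1 < s'.1) (hne : ¬ (r = r' ∧ s = s')) (a b : 𝕜) :
    T (elemP r s h.ne a) (elemP r' s' h'.ne b) = 0 := by
  have hrs : r ≠ s := fun e => h.ne (by rw [e])
  have hrs' : r' ≠ s' := fun e => h'.ne (by rw [e])
  -- The sign -1 at both r and s fixes the vectors of the pair (r, s) and reverses those of a pair
  -- that shares exactly one index with it.
  have hsq : (-1 : 𝕜) * star (-1) = 1 := by simp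
  have hm := hT.phase hR hrs hsq h.ne h'.ne a b
  rw [phase_left hrs, phase_right] at hm
  by_cases hr1 : r' = r
  · have h1 : s' ≠ s := fun e => hne ⟨hr1.symm, e.symm⟩
    have h2 : s' ≠ r := fun e => hrs' (hr1.trans e.symm)
    subst hr1
    rw [phase_left hrs, phase_other h2 h1] at hm
    simp [elemP_neg] at hm
    linarith
  by_cases hr2 : r' = s
  · have h1 : s' ≠ s := fun e => hrs' (hr2.trans e.symm)
    have h2 : s' ≠ r := fun e => by rw [hr2, e] at h'; exact absurd h h'.not_gt
    subst hr2
    rw [phase_right, phase_other h2 h1] at hm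
    simp [elemP_neg] at hm
    linarith
  rw [phase_other hr1 hr2] at hm
  by_cases hs1 : s' = r
  · subst hs1
    rw [phase_left hrs] at hm
    simp [elemP_neg] at hm
    linarith
  by_cases hs2 : s' = s
  · subst hs2
    rw [phase_right] at hm
    simp [elemP_neg] at hm
    linarith
  -- From here on the two pairs are disjoint. Over ℝ a fifth index t is needed, so that signs at r
  -- and t reverse the first vector alone. Otherwise there are enough units to act on the first
  -- vector only.
  by_cases hδ : δ 𝕜 = 1
  · have h5 : 5 ≤ n * k := hR.size.resolve_left (by simpa using hδ)
    obtain ⟨t, ht⟩ : ∃ t, t ∉ ({r, s, r', s'} : Finset (Fin n × Fin k)) := by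
      by_contra hcon
      push Not at hcon
      have h1 : (Finset.univ : Finset (Fin n × Fin k)).card ≤
          ({r, s, r', s'} : Finset (Fin n × Fin k)).card :=
        Finset.card_le_card fun t _ => hcon t
      have h2 := Finset.card_le_four (a := r) (b := s) (c := r') (d := s')
      simp at h1
      omega
    simp only [Finset.mem_insert, Finset.mem_singleton, not_or] at ht
    obtain ⟨ht1, ht2, ht3, ht4⟩ := ht
    have hm2 := hT.phase hR (Ne.symm ht1) hsq h.ne h'.ne a b
    rw [phase_left (Ne.symm ht1), phase_other hrs.symm (Ne.symm ht2),
      phase_other hr1 (Ne.symm ht3), phase_other hs1 (Ne.symm ht4)] at hm2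
    simp [elemP_neg] at hm2
    linarith
  -- The phase u at r and u* at s sends the entry a to u a u. Summing the invariance over all units
  -- u and using `sum_unit` compares the values at a and at its conjugate.
  · have hstep : ∀ a, ((2 - (δ 𝕜 : ℝ)) * T (elemP r s h.ne (star a)) (elemP r' s' h'.ne b) =
        δ 𝕜 * T (elemP r s h.ne a) (elemP r' s' h'.ne b)) := fun a => by
      have h1 : ∀ i : Fin (δ 𝕜), T (elemL r s h.ne (unit i * a * unit i)) (elemP r' s' h'.ne b) =
          T (elemP r s h.ne a) (elemP r' s' h'.ne b) := fun i => by
        have := hT.phase hR hrs (unit_mul_star (𝕜 := 𝕜) i) h.ne h'.ne a b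
        rw [phase_left hrs, phase_right, phase_other hr1 hr2, phase_other hs1 hs2] at this
        rw [star_star, star_one, one_mul, mul_one] at this
        exact this
      have h2 := Finset.sum_congr rfl fun i (_ : i ∈ Finset.univ) => h1 i
      rw [← LinearMap.sum_apply, ← map_sum, ← map_sum, sum_unit, map_smul, map_smul,
        LinearMap.smul_apply, Finset.sum_const, Finset.card_univ, Fintype.card_fin, smul_eq_mul,
        nsmul_eq_mul] at h2
      exact h2
    have e1 := hstep a
    have e2 := hstep (star a)
    rw [star_star] at e2
    set x := T (elemP r s h.ne a) (elemP r' s' h'.ne b)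
    set y := T (elemP r s h.ne (star a)) (elemP r' s' h'.ne b)
    -- The relation applied twice gives δ² x = (2-δ)² x, that is, 4(δ-1) x = 0.
    have e3 : ((δ 𝕜 : ℝ) - 1) * x = 0 := by
      linear_combination (1 / 4 : ℝ) * (-(2 - (δ 𝕜 : ℝ)) * e2 - (δ 𝕜 : ℝ) * e1)
    rcases mul_eq_zero.mp e3 with e4 | e4
    · exact absurd (by exact_mod_cast sub_eq_zero.mp e4) hδ
    · exact e4

/-- On a root space the invariant forms are the multiples of the standard one. -/
lemma apply_unit (hT : IsInvTensor H T) (hn : 3 ≤ n) (hk : 1 ≤ k) {r s : Fin n × Fin k}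
    (h : r.1 ≠ s.1) (i j : Fin (δ 𝕜)) :
    T (elemP r s h (unit i)) (elemP r s h (unit j)) =
      if i = j then T (elemP r s h 1) (elemP r s h 1) else 0 := by
  -- A third block takes up the compensating phase w*, so that the single phase w at r acts as left
  -- multiplication by w.
  obtain ⟨l, hl1, hl2⟩ : ∃ l : Fin n, l ≠ r.1 ∧ l ≠ s.1 := by
    by_contra hcon
    push Not at hcon
    have h1 : (Finset.univ : Finset (Fin n)).card ≤ ({r.1, s.1} : Finset (Fin n)).card :=
      Finset.card_le_card fun t _ => by
        by_cases h : t = r.1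
        · simp [h]
        · simp [hcon t h]
    have h2 := Finset.card_le_two (a := r.1) (b := s.1)
    simp at h1
    omega
  set q : Fin n × Fin k := (l, ⟨0, hk⟩)
  have hqr : r ≠ q := fun e => hl1 (by rw [e])
  have hqs : s ≠ q := fun e => hl2 (by rw [e])
  have hrs : s ≠ r := fun e => h (by rw [e])
  have hstep : ∀ w : 𝕜, w * star w = 1 → ∀ a b,
      T (elemP r s h (w * a)) (elemP r s h (w * b)) = T (elemP r s h a) (elemP r s h b) := by
    intro w hw a b
    have := hT.phase hR hqr hw h h a b
    rw [phase_left hqr, phase_other hrs hqs] at this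
    simpa using this
  by_cases hij : i = j
  · subst hij
    have := hstep (unit i) (unit_mul_star i) 1 1
    rw [if_pos rfl, ← this, mul_one]
  · rw [if_neg hij]
    have h0 : unit i * star (unit j) + unit j * star (unit i) = (0 : 𝕜) := by
      have := add_star (unit i * star (unit j) : 𝕜)
      rwa [re_unit, if_neg hij, mul_zero, map_zero, star_mul, star_star] at this
    have hw : (unit j * star (unit i)) * star (unit j * star (unit i)) = (1 : 𝕜) := by
      rw [star_mul, star_star, mul_assoc, ← mul_assoc (star (unit i)), star_unit_mul, one_mul,
        unit_mul_star]
    -- Left multiplication by u_j u_i* rotates the pair (u_i, u_j) to (u_j, -u_i), so invariance and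
    -- symmetry give T(u_i, u_j) = -T(u_i, u_j).
    have h1 := hstep _ hw (unit i) (unit j)
    have e1 : unit j * star (unit i) * unit i = (unit j : 𝕜) := by
      rw [mul_assoc, star_unit_mul, mul_one]
    have e2 : unit j * star (unit i) * unit j = -(unit i : 𝕜) := by
      rw [← neg_eq_of_add_eq_zero_right h0, neg_mul, mul_assoc, star_unit_mul, mul_one]
    rw [e1, e2, elemP_neg, map_neg, hT.symm] at h1
    linarith

/-- A signed transposition inside one block belongs to K and moves the row r to r'. Hence the value
depends only on the blocks. -/
lemma apply_one_of_fst_eq (hT : IsInvTensor H T) {r s r' : Fin n × Fin k} (h : r.1 ≠ s.1)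
    (hr : r'.1 = r.1) :
    T (elemP r' s (hr ▸ h) 1) (elemP r' s (hr ▸ h) 1) = T (elemP r s h 1) (elemP r s h 1) := by
  by_cases he : r = r'
  · subst he; rfl
  have h1 : (Equiv.swap r r').symm r = r' := by simp
  have hsr : s ≠ r := fun e => h (by rw [e])
  have hsr' : s ≠ r' := fun e => h (by rw [e, hr])
  have h2 : (Equiv.swap r r').symm s = s := by
    rw [Equiv.symm_swap, Equiv.swap_apply_of_ne_of_ne hsr hsr']
  have h3 : ∀ p, (Equiv.swap r r' p).1 = p.1 := fun p => by
    rw [Equiv.swap_apply_def]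
    split_ifs with e1 e2
    · rw [e1, hr]
    · rw [e2, hr]
    · rfl
  have := hT.monomial h3 (hR.swap_mem r r' he) h h (by rw [h1, h2, hr]; exact h)
    (by rw [h1, h2, hr]; exact h) 1 1
  simp only [h1, h2] at this
  rw [← this]
  simp [signAt, Function.update_of_ne hsr, Function.update_of_ne (Ne.symm he)]

end Phase

section Classification

variable (hR : IsRich H)

lemma scale_mul_left {c : Mat 𝕜 n k} (hc : IsBlockDiag c) (x : Fin n → Fin n → ℝ) (X : Mat 𝕜 n k) :
    scale x (c * X) = c * scale x X := by
  ext p q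
  simp only [scale, Matrix.of_apply, Matrix.mul_apply, Finset.smul_sum]
  refine Finset.sum_congr rfl fun r _ => ?_
  by_cases h : p.1 = r.1
  · rw [h, mul_smul_comm]
  · rw [hc p r h]; simp

lemma scale_mul_right {c : Mat 𝕜 n k} (hc : IsBlockDiag c) (x : Fin n → Fin n → ℝ) (X : Mat 𝕜 n k) :
    scale x (X * c) = scale x X * c := by
  ext p q
  simp only [scale, Matrix.of_apply, Matrix.mul_apply, Finset.smul_sum]
  refine Finset.sum_congr rfl fun r _ => ?_
  by_cases h : r.1 = q.1
  · rw [h, smul_mul_assoc]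
  · rw [hc r q h]; simp

lemma wform_one_conj {c : Mat 𝕜 n k} (hc : star c * c = 1) (X Y : Mat 𝕜 n k) :
    wform 𝕜 n k (fun _ _ => 1) (c * X * star c) (c * Y * star c) =
      wform 𝕜 n k (fun _ _ => 1) X Y := by
  rw [wform_one_eq, wform_one_eq, star_mul, star_mul, star_star]
  have e : c * X * star c * (c * (star Y * star c)) = c * (X * star Y * star c) := by
    calc _ = c * X * (star c * c) * (star Y * star c) := by noncomm_ring
      _ = _ := by rw [hc]; noncomm_ring
  rw [e, re_trace_mul_comm]
  have e2 : X * star Y * star c * c = X * star Y := by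
    rw [mul_assoc, hc, mul_one]
  rw [e2]

include hR

/-- Scaling of blocks commutes with block diagonal conjugation, which reduces the claim to the
invariance of the trace form under unitary conjugation. -/
lemma isInvTensor_diagForm (x : Fin n → Fin n → ℝ) :
    IsInvTensor H (diagForm 𝕜 n k x) where
  symm := diagForm_comm x
  inv c hc hb v w := by
    have e : ∀ X Y : Mat 𝕜 n k, wform 𝕜 n k x X Y = wform 𝕜 n k (fun _ _ => 1) (scale x X) Y :=
      fun X Y => by rw [wform_scale]; simp
    rw [diagForm_apply, diagForm_apply, coe_Ad hb, coe_Ad hb, e, e,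
      scale_mul_right hb.star, scale_mul_left hb, wform_one_conj (hR.star_mul_self c hc)]

/-- The invariant symmetric 2-tensors are the block diagonal ones. -/
lemma isInvTensor_iff (hn : 3 ≤ n) (hk : 1 ≤ k) (T : Form 𝕜 n k) :
    IsInvTensor H T ↔ ∃ x, IsWeight x ∧ T = diagForm 𝕜 n k x := by
  refine ⟨fun hT => ?_, ?_⟩
  · set x : Fin n → Fin n → ℝ := fun i j => if h : i = j then 0 else
      T (elemP (i, ⟨0, hk⟩) (j, ⟨0, hk⟩) h 1) (elemP (i, ⟨0, hk⟩) (j, ⟨0, hk⟩) h 1) with hxdef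
    have hx : IsWeight x := by
      refine ⟨fun i j => ?_, fun i => by simp [x]⟩
      simp only [x]
      by_cases h : i = j
      · subst h; rfl
      · rw [dif_neg h, dif_neg (Ne.symm h)]
        exact apply_one_swap T (r := (j, ⟨0, hk⟩)) (s := (i, ⟨0, hk⟩)) (Ne.symm h)
    have hT1 : ∀ {r s : Fin n × Fin k} (h : r.1 ≠ s.1),
        T (elemP r s h 1) (elemP r s h 1) = x r.1 s.1 := by
      intro r s h
      rw [hxdef]
      simp only [dif_neg h]
      rw [← apply_one_of_fst_eq hR hT (r := r) (r' := (r.1, ⟨0, hk⟩)) h rfl,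
        ← apply_one_swap T (r := (r.1, ⟨0, hk⟩)) h,
        ← apply_one_of_fst_eq hR hT (r := s) (s := (r.1, ⟨0, hk⟩)) (r' := (s.1, ⟨0, hk⟩)) h.symm rfl]
      exact apply_one_swap T (r := (r.1, ⟨0, hk⟩)) (s := (s.1, ⟨0, hk⟩)) h
    refine ⟨x, hx, ?_⟩
    refine (stdBasis 𝕜 n k).ext fun e => (stdBasis 𝕜 n k).ext fun e' => ?_
    rw [diagForm_apply, wform_one_stdVec x hx.symm, stdBasis_apply, stdBasis_apply, stdVec_apply]
    rw [stdVec_eq, stdVec_eq]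
    by_cases hee : e'.1 = e.1
    · obtain ⟨e1, i⟩ := e
      obtain ⟨e2, j⟩ := e'
      obtain rfl : e2 = e1 := hee
      rw [if_pos rfl, re_unit, apply_unit hR hT hn hk, hT1]
      split_ifs <;> simp
    · rw [if_neg hee, zero_mul, map_zero, mul_zero]
      exact orthogonal_of_ne hR hT e.1.2 e'.1.2 (fun h => hee (Subtype.ext (Prod.ext h.1.symm h.2.symm))) _ _
  · rintro ⟨x, -, rfl⟩
    exact isInvTensor_diagForm hR x

end Classification

end Monomial

attribute [local instance] LieRing.ofAssociativeRing

/-! ### Squares of skew-symmetric operators -/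

section Trace

variable {V : Type*} [AddCommGroup V] [Module ℝ V] [FiniteDimensional ℝ V]

/-- The trace of the square of a skew-symmetric operator. -/
lemma exists_trace_sq {B : LinearMap.BilinForm ℝ V} (hB : ∀ x y, B x y = B y x)
    (hpos : ∀ x, x ≠ 0 → 0 < B x x) {A : V →ₗ[ℝ] V} (hA : ∀ x y, B (A x) y = -B x (A y)) :
    LinearMap.trace ℝ V (A ∘ₗ A) ≤ 0 ∧ (LinearMap.trace ℝ V (A ∘ₗ A) = 0 → A = 0) := by
  obtain ⟨b, hb⟩ := LinearMap.BilinForm.exists_orthogonal_basis (B := B) ⟨fun x y => hB x y⟩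
  have hb0 : ∀ i, 0 < B (b i) (b i) := fun i => hpos _ (b.ne_zero i)
  have hrepr : ∀ x i, b.repr x i = B x (b i) / B (b i) (b i) := fun x i => by
    rw [eq_div_iff (hb0 i).ne']
    conv_rhs => rw [← b.sum_repr x]
    rw [map_sum, LinearMap.sum_apply, Finset.sum_eq_single i]
    · simp
    · intro j _ hj
      have : B (b j) (b i) = 0 := hb hj
      simp [this]
    · simp
  have htr : LinearMap.trace ℝ V (A ∘ₗ A) = -∑ i, B (A (b i)) (A (b i)) / B (b i) (b i) := by
    rw [LinearMap.trace_eq_matrix_trace ℝ b, Matrix.trace, ← Finset.sum_neg_distrib]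
    refine Finset.sum_congr rfl fun i _ => ?_
    rw [Matrix.diag_apply, LinearMap.toMatrix_apply, hrepr, LinearMap.comp_apply, hA, neg_div]
  have hnn : ∀ i, 0 ≤ B (A (b i)) (A (b i)) / B (b i) (b i) := fun i => by
    refine div_nonneg ?_ (hb0 i).le
    by_cases h : A (b i) = 0
    · simp [h]
    · exact (hpos _ h).le
  rw [htr]
  refine ⟨neg_nonpos.mpr (Finset.sum_nonneg fun i _ => hnn i), fun h => b.ext fun i => ?_⟩
  have h1 := (Finset.sum_eq_zero_iff_of_nonneg fun i _ => hnn i).mp (neg_eq_zero.mp h) i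
    (Finset.mem_univ i)
  by_contra h2
  exact (div_pos (hpos _ h2) (hb0 i)).ne' h1

end Trace

/-! ### The Killing form and the standard metric -/

section Killing

variable {𝕜 : Type*} [NormedDivisionRing 𝕜] [NormedAlgebra ℝ 𝕜] [FiniteDimensional ℝ 𝕜]
  [StarRing 𝕜] [StarModule ℝ 𝕜] [Scalars 𝕜] {n k : ℕ} {H : Space 𝕜 n k}

lemma coe_lie (X Y : H.lie) : ((⁅X, Y⁆ : H.lie) : Mat 𝕜 n k) = comm (X : Mat 𝕜 n k) Y := rfl

lemma stdMetric_apply (v w : offDiag 𝕜 n k) : stdMetric H v w =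
    -killingForm ℝ H.lie (Submodule.inclusion H.offDiag_le v) (Submodule.inclusion H.offDiag_le w) :=
  rfl

lemma wform_one_self_pos {X : Mat 𝕜 n k} (hX : X ≠ 0) : 0 < wform 𝕜 n k (fun _ _ => 1) X X := by
  obtain ⟨p, q, hpq⟩ : ∃ p q, X p q ≠ 0 := by
    by_contra hcon
    push Not at hcon
    exact hX (Matrix.ext hcon)
  rw [wform_apply]
  have h1 : ∀ p, 0 ≤ ∑ q, 1 * re (X p q * star (X p q)) := fun p =>
    Finset.sum_nonneg fun q _ => by rw [one_mul]; exact re_mul_star_self_nonneg _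
  have h2 : 0 < ∑ p, ∑ q, 1 * re (X p q * star (X p q)) :=
    Finset.sum_pos' (fun p _ => h1 p) ⟨p, Finset.mem_univ p, Finset.sum_pos'
      (fun q _ => by rw [one_mul]; exact re_mul_star_self_nonneg _)
      ⟨q, Finset.mem_univ q, by rw [one_mul]; exact re_mul_star_self_pos hpq⟩⟩
  linarith

variable (hR : IsRich H)

include hR

/-- The Killing form is negative semidefinite, and its null vectors are central. -/
lemma killingForm_self (X : H.lie) :
    killingForm ℝ H.lie X X ≤ 0 ∧ (killingForm ℝ H.lie X X = 0 → LieAlgebra.ad ℝ H.lie X = 0) := by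
  rw [killingForm_apply_apply]
  have : FiniteDimensional ℝ H.lie :=
    inferInstanceAs (FiniteDimensional ℝ H.lie.toSubmodule)
  refine exists_trace_sq (B := (wform 𝕜 n k fun _ _ => 1).compl₁₂ H.lie.toSubmodule.subtype
    H.lie.toSubmodule.subtype) (fun Y Z => wform_comm (fun _ _ => 1) (Y : Mat 𝕜 n k) (Z : Mat 𝕜 n k))
    (fun Y hY => wform_one_self_pos fun h => hY (Subtype.ext h)) fun Y Z => ?_
  exact wform_one_comm (hR.lie_skew X X.2) _ _

lemma killingForm_eq_zero {X : H.lie} (h : killingForm ℝ H.lie X X = 0) (Y : H.lie) :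
    killingForm ℝ H.lie X Y = 0 := by
  rw [killingForm_apply_apply, (killingForm_self hR X).2 h, LinearMap.zero_comp, map_zero]

/-- Conjugation by a unitary matrix. -/
def conjEquiv (c : Mat 𝕜 n k) (h1 : star c * c = 1) (h2 : c * star c = 1) : H.lie ≃ₗ⁅ℝ⁆ H.lie where
  toFun X := ⟨c * X * star c, hR.conj_lie c h1 h2 X X.2⟩
  invFun X := ⟨star c * X * c, by
    have := hR.conj_lie (star c) (by rwa [star_star]) (by rwa [star_star]) X X.2
    rwa [star_star] at this⟩
  map_add' X Y := by
    ext1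
    simp [mul_add, add_mul]
  map_smul' r X := by
    ext1
    simp
  map_lie' {X Y} := by
    ext1
    simp only [coe_lie, comm]
    have e : ∀ A B : Mat 𝕜 n k, c * A * star c * (c * B * star c) = c * (A * B) * star c :=
      fun A B => by
        calc _ = c * A * (star c * c) * B * star c := by noncomm_ring
          _ = _ := by rw [h1]; noncomm_ring
    rw [e, e]
    noncomm_ring
  left_inv X := by
    ext1
    calc star c * (c * (X : Mat 𝕜 n k) * star c) * c = (star c * c) * X * (star c * c) := by
          noncomm_ring
      _ = X := by rw [h1, one_mul, mul_one]
  right_inv X := by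
    ext1
    calc c * (star c * (X : Mat 𝕜 n k) * c) * star c = (c * star c) * X * (c * star c) := by
          noncomm_ring
      _ = X := by rw [h2, one_mul, mul_one]

lemma killingForm_conj {c : Mat 𝕜 n k} (h1 : star c * c = 1) (h2 : c * star c = 1)
    {X Y X' Y' : H.lie} (hX : (X' : Mat 𝕜 n k) = c * X * star c)
    (hY : (Y' : Mat 𝕜 n k) = c * Y * star c) :
    killingForm ℝ H.lie X' Y' = killingForm ℝ H.lie X Y := by
  have e1 : X' = conjEquiv hR c h1 h2 X := Subtype.ext hX
  have e2 : Y' = conjEquiv hR c h1 h2 Y := Subtype.ext hY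
  rw [e1, e2, LieAlgebra.killingForm_of_equiv_apply]

lemma isInvTensor_std : IsInvTensor H (stdMetric H) where
  symm v w := by rw [stdMetric_apply, stdMetric_apply, LieModule.traceForm_comm]
  inv c hc hb v w := by
    rw [stdMetric_apply, stdMetric_apply]
    congr 1
    exact killingForm_conj hR (hR.star_mul_self c hc) (hR.mul_star_self hc) (coe_Ad hb v)
      (coe_Ad hb w)

/-- The decomposition `𝔤 = 𝔨 ⊕ 𝔭` is orthogonal for the Killing form. -/
lemma killingForm_blockDiag {X : H.lie} (hX : IsBlockDiag (X : Mat 𝕜 n k)) (v : offDiag 𝕜 n k) :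
    killingForm ℝ H.lie X (Submodule.inclusion H.offDiag_le v) = 0 := by
  suffices h : (killingForm ℝ H.lie X) ∘ₗ (Submodule.inclusion H.offDiag_le) = 0 from
    LinearMap.congr_fun h v
  refine (stdBasis 𝕜 n k).ext fun e => ?_
  rw [stdBasis_apply, stdVec_eq, LinearMap.comp_apply, LinearMap.zero_apply]
  obtain ⟨⟨⟨r, s⟩, h⟩, u⟩ := e
  simp only
  -- Changing the sign of one block fixes every block diagonal X and reverses the given vector of 𝔭.
  -- This matrix need not lie in G; being unitary, it still acts on the Lie algebra by
  -- automorphisms.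
  set ε : Fin n × Fin k → 𝕜 := fun p => if p.1 = r.1 then -1 else 1 with hε
  have h2 : monomial (Equiv.refl _) ε * star (monomial (Equiv.refl _) ε) = 1 :=
    monomial_mul_star _ fun p => by simp only [hε]; split_ifs <;> simp
  have h1 : star (monomial (Equiv.refl _) ε) = monomial (Equiv.refl (Fin n × Fin k)) ε := by
    ext p q
    simp only [monomial, Matrix.star_apply, Matrix.of_apply, Equiv.refl_apply]
    by_cases hpq : p = q
    · subst hpq
      simp only [hε, if_true]
      split_ifs <;> simp
    · simp [hpq, Ne.symm hpq]
  have h3 := killingForm_conj hR (c := monomial (Equiv.refl _) ε) (X := X) (X' := X)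
    (Y := Submodule.inclusion H.offDiag_le (elemP r s h.ne (unit u)))
    (Y' := -Submodule.inclusion H.offDiag_le (elemP r s h.ne (unit u)))
    (by rw [h1]; rwa [h1] at h2) h2 (by
      ext p q
      rw [monomial_conj_apply]
      by_cases hpq : p.1 = q.1
      · simp only [Equiv.refl_apply, hε, hpq]
        split_ifs <;> simp
      · simp [hX p q hpq]) (by
      have hsr : ¬ s.1 = r.1 := h.ne'
      change -elem r s (unit u) = _ * elem r s (unit u) * _
      rw [elem_conj, Equiv.refl_symm, Equiv.refl_apply, Equiv.refl_apply]
      simp only [hε, if_true, if_neg hsr, star_one, mul_one, neg_mul, one_mul]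
      rw [← neg_one_smul ℝ (unit u : 𝕜), elem_smul, neg_one_smul])
  rw [map_neg] at h3
  linarith

/-- The standard metric is a multiple of the trace form. -/
theorem exists_std (hn : 3 ≤ n) (hk : 1 ≤ k) :
    ∃ c : ℝ, 0 < c ∧ stdMetric H = diagForm 𝕜 n k (constWeight n c) := by
  obtain ⟨x, hx, hT⟩ := (isInvTensor_iff hR hn hk _).mp (isInvTensor_std hR)
  set a₀ : Fin k := ⟨0, hk⟩
  have hval : ∀ i j (h : i ≠ j), stdMetric H (elemP (i, a₀) (j, a₀) h 1)
      (elemP (i, a₀) (j, a₀) h 1) = x i j := fun i j h => by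
    rw [hT]
    exact diagForm_elem hx.symm (r := (i, a₀)) (s := (j, a₀)) h
  have hne : ∀ {i j : Fin n}, i ≠ j → (i, a₀) ≠ (j, a₀) := fun h e => h (congrArg Prod.fst e)
  -- A signed transposition of rows in different blocks lies in G but not in K. Its conjugation
  -- preserves the Killing form and carries a vector of one block of 𝔭 to another block.
  have hstep : ∀ i i' j : Fin n, i ≠ j → i' ≠ j → x i j = x i' j := by
    intro i i' j h h'
    by_cases hii : i = i'
    · rw [hii]
    rw [← hval i j h, ← hval i' j h', stdMetric_apply, stdMetric_apply]
    congr 1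
    have hm := hR.swap_mem (i', a₀) (i, a₀) (hne (Ne.symm hii))
    refine killingForm_conj hR (hR.star_mul_self _ hm) (hR.mul_star_self hm) ?_ ?_ <;>
    · change elem _ _ (1 : 𝕜) = _ * elem _ _ 1 * _
      rw [elem_conj, Equiv.symm_swap, Equiv.swap_apply_left,
        Equiv.swap_apply_of_ne_of_ne (hne (Ne.symm h')) (hne (Ne.symm h))]
      simp [signAt, Function.update_of_ne (hne hii), Function.update_of_ne (hne (Ne.symm h'))]
  let i₀ : Fin n := ⟨0, by omega⟩
  let i₁ : Fin n := ⟨1, by omega⟩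
  let i₂ : Fin n := ⟨2, by omega⟩
  have h01 : i₀ ≠ i₁ := by simp [i₀, i₁]
  have hall : ∀ i j, i ≠ j → x i j = x i₀ i₁ := by
    intro i j h
    by_cases hj : j = i₀
    · rw [hj, hstep i i₁ i₀ (hj ▸ h) h01.symm, hx.symm]
    · rw [hstep i i₀ j h (Ne.symm hj), hx.symm, hstep j i₁ i₀ hj h01.symm, hx.symm]
  refine ⟨x i₀ i₁, ?_, ?_⟩
  · rw [← hval i₀ i₁ h01, stdMetric_apply]
    set X : H.lie := Submodule.inclusion H.offDiag_le (elemP (i₀, a₀) (i₁, a₀) h01 1)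
    -- A null vector of the Killing form would be central, but the bracket of X with a vector of the
    -- block (i₁, i₂) has a non-zero entry in the block (i₀, i₂).
    refine neg_pos.mpr (lt_of_le_of_ne (killingForm_self hR X).1 fun h0 => ?_)
    have h12 : i₁ ≠ i₂ := by simp [i₁, i₂]
    have h02 : i₀ ≠ i₂ := by simp [i₀, i₂]
    set Y : H.lie := Submodule.inclusion H.offDiag_le (elemP (i₁, a₀) (i₂, a₀) h12 1)
    have h2 : ⁅X, Y⁆ = 0 := LinearMap.congr_fun ((killingForm_self hR X).2 h0) Y
    have h3 : comm (elem (i₀, a₀) (i₁, a₀) (1 : 𝕜)) (elem (i₁, a₀) (i₂, a₀) 1) = 0 :=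
      congrArg Subtype.val h2
    have h4 := congrFun (congrFun h3 (i₀, a₀)) (i₂, a₀)
    rw [comm, Matrix.sub_apply, mul_elem_apply (hne h12), mul_elem_apply (hne h01), if_pos rfl,
      if_neg (hne h12.symm), if_neg (hne h02.symm)] at h4
    simp [elem] at h4
  · rw [hT]
    exact diagForm_congr fun i j h => by rw [hall i j h, constWeight_of_ne _ h]

end Killing

/-! ### Automorphisms of G/K and their action on the standard metric -/

section Automorphism

variable {𝕜 : Type*} [NormedDivisionRing 𝕜] [NormedAlgebra ℝ 𝕜] [FiniteDimensional ℝ 𝕜]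
  [StarRing 𝕜] [StarModule ℝ 𝕜] [Scalars 𝕜] {n k : ℕ} {H : Space 𝕜 n k}

section Exp

open scoped Matrix.Norms.Operator

lemma hasDerivAt_entry {f : ℝ → Mat 𝕜 n k} {D : Mat 𝕜 n k} {t : ℝ} (h : HasDerivAt f D t)
    (p q : Fin n × Fin k) : HasDerivAt (fun s => f s p q) (D p q) t :=
  (LinearMap.toContinuousLinearMap (entryL 𝕜 n k p q)).hasFDerivAt.comp_hasDerivAt t h

lemma hasDerivAt_mul_const {f : ℝ → Mat 𝕜 n k} {D : Mat 𝕜 n k} {t : ℝ} (h : HasDerivAt f D t)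
    (A B : Mat 𝕜 n k) : HasDerivAt (fun s => A * f s * B) (A * D * B) t :=
  (h.const_mul A).mul_const B

lemma hasDerivAt_exp_conj (X Y : Mat 𝕜 n k) :
    HasDerivAt (fun t : ℝ => NormedSpace.exp (t • X) * Y * NormedSpace.exp (t • -X)) (comm X Y) 0 := by
  have h := ((hasDerivAt_exp_smul X).mul_const Y).mul (hasDerivAt_exp_smul (-X))
  simp only [zero_smul, NormedSpace.exp_zero, one_mul, mul_one, mul_neg] at h
  rw [comm, sub_eq_add_neg]
  exact h

lemma hasDerivAt_linearMap (L : Mat 𝕜 n k →ₗ[ℝ] Mat 𝕜 n k) {f : ℝ → Mat 𝕜 n k} {D : Mat 𝕜 n k}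
    {t : ℝ} (h : HasDerivAt f D t) : HasDerivAt (fun s => L (f s)) (L D) t :=
  (LinearMap.toContinuousLinearMap L).hasFDerivAt.comp_hasDerivAt t h

lemma hasDerivAt_unique {f g : ℝ → Mat 𝕜 n k} {D D' : Mat 𝕜 n k} {t : ℝ} (hf : HasDerivAt f D t)
    (hg : HasDerivAt g D' t) (h : ∀ s, f s = g s) : D = D' :=
  hf.unique (hg.congr_of_eventuallyEq (.of_forall h))

lemma deriv_exp_smul (X : Mat 𝕜 n k) : deriv (fun t : ℝ => NormedSpace.exp (t • X)) 0 = X :=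
  (hasDerivAt_exp_smul X).deriv

lemma hasDerivAt_one (t : ℝ) : HasDerivAt (fun _ : ℝ => (1 : Mat 𝕜 n k)) 0 t := hasDerivAt_const _ _

lemma exp_add_smul (X : Mat 𝕜 n k) (s t : ℝ) :
    NormedSpace.exp ((s + t) • X) = NormedSpace.exp (s • X) * NormedSpace.exp (t • X) := by
  have : CompleteSpace (Mat 𝕜 n k) := FiniteDimensional.complete ℝ _
  let _ : NormedAlgebra ℚ (Mat 𝕜 n k) := NormedAlgebra.restrictScalars ℚ ℝ _
  have h := NormedSpace.exp_add_of_commute (𝔸 := Mat 𝕜 n k) (x := s • X) (y := t • X)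
    (((Commute.refl X).smul_left s).smul_right t)
  rw [← add_smul] at h
  exact h

lemma exp_smul_neg_mul (X : Mat 𝕜 n k) (t : ℝ) :
    NormedSpace.exp (t • -X) * NormedSpace.exp (t • X) = 1 := by
  rw [smul_neg, ← neg_smul, ← exp_add_smul, neg_add_cancel, zero_smul, NormedSpace.exp_zero]

lemma exp_conj_of_mul_eq_one {c c' : Mat 𝕜 n k} (h : c * c' = 1) (h' : c' * c = 1) (X : Mat 𝕜 n k) :
    NormedSpace.exp (c * X * c') = c * NormedSpace.exp X * c' := by
  have : CompleteSpace (Mat 𝕜 n k) := FiniteDimensional.complete ℝ _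
  let _ : NormedAlgebra ℚ (Mat 𝕜 n k) := NormedAlgebra.restrictScalars ℚ ℝ _
  exact NormedSpace.exp_units_conj (𝔸 := Mat 𝕜 n k) ⟨c, c', h, h'⟩ X

/-- A differentiable one-parameter group is generated by its velocity. -/
lemma eq_exp_of_hom {γ : ℝ → Mat 𝕜 n k} {Z : Mat 𝕜 n k} (h0 : γ 0 = 1)
    (hadd : ∀ s t, γ (s + t) = γ s * γ t) (hd : HasDerivAt γ Z 0) (t : ℝ) :
    γ t = NormedSpace.exp (t • Z) := by
  have : CompleteSpace (Mat 𝕜 n k) := FiniteDimensional.complete ℝ _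
  have hγ : ∀ t, HasDerivAt γ (γ t * Z) t := fun t => by
    have h1 : HasDerivAt (fun s => γ (s - t)) Z t := by
      have h2 : HasDerivAt γ Z (t - t) := by rwa [sub_self]
      exact h2.comp_sub_const t t
    refine (h1.const_mul (γ t)).congr_of_eventuallyEq (.of_forall fun s => ?_)
    change γ s = γ t * γ (s - t)
    rw [← hadd, add_sub_cancel]
  have hc : ∀ t, HasDerivAt (fun t : ℝ => γ t * NormedSpace.exp (t • -Z)) 0 t := fun t => by
    have h1 := (hγ t).mul (hasDerivAt_exp_smul_const' (𝕂 := ℝ) (-Z) t)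
    refine h1.congr_deriv ?_
    simp [mul_assoc]
  have h1 := is_const_of_deriv_eq_zero (fun t => (hc t).differentiableAt) (fun t => (hc t).deriv) t 0
  simp only [h0, zero_smul, NormedSpace.exp_zero, mul_one] at h1
  calc γ t = γ t * (NormedSpace.exp (t • -Z) * NormedSpace.exp (t • Z)) := by
        rw [exp_smul_neg_mul, mul_one]
    _ = _ := by rw [← mul_assoc, h1, one_mul]

/-- Block diagonal matrices are the commutant of the diagonal matrix whose entries are the block
numbers; these are real, hence central scalars. A commutant is closed under exp. -/
lemma IsBlockDiag.exp {X : Mat 𝕜 n k} (hX : IsBlockDiag X) : IsBlockDiag (NormedSpace.exp X) := by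
  have : CompleteSpace (Mat 𝕜 n k) := FiniteDimensional.complete ℝ _
  have : T2Space (Mat 𝕜 n k) := inferInstance
  have key : ∀ Y : Mat 𝕜 n k, IsBlockDiag Y ↔
      Commute (Matrix.diagonal fun p : Fin n × Fin k => algebraMap ℝ 𝕜 (p.1 : ℕ)) Y := by
    intro Y
    have h : ∀ p q, (algebraMap ℝ 𝕜 (p.1 : ℕ) * Y p q = Y p q * algebraMap ℝ 𝕜 (q.1 : ℕ)) ↔
        (p.1 ≠ q.1 → Y p q = 0) := fun p q => by
      rw [← Algebra.commutes, ← Algebra.smul_def, ← Algebra.smul_def, ← sub_eq_zero (b := _ • _),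
        ← sub_smul, smul_eq_zero, sub_eq_zero, Nat.cast_inj, Fin.val_inj, or_iff_not_imp_left]
    rw [Commute, SemiconjBy, ← Matrix.ext_iff, IsBlockDiag]
    refine forall_congr' fun p => forall_congr' fun q => ?_
    rw [Matrix.diagonal_mul, Matrix.mul_diagonal, h]
  rw [key] at hX ⊢
  exact hX.exp_right

end Exp

/-- The differential at the identity of a map between groups of matrices. -/
def autLie (φ : Mat 𝕜 n k → Mat 𝕜 n k) (X : Mat 𝕜 n k) : Mat 𝕜 n k :=
  deriv (fun t : ℝ => φ (NormedSpace.exp (t • X))) 0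

variable {φ : Mat 𝕜 n k → Mat 𝕜 n k} (hR : IsRich H) (hφ : IsAut H φ)

section

include hφ

/-- Smoothness in the coordinates exp(∑ s_i X_i) provides one Fréchet derivative for all directions
in the span of the X_i. This is the source of the linearity of `autLie`. -/
lemma IsAut.hasFDerivAt {r : ℕ} (X : Fin r → Mat 𝕜 n k) (hX : ∀ i, X i ∈ H.lie)
    (p q : Fin n × Fin k) : ∃ L : (Fin r → ℝ) →L[ℝ] 𝕜, ∀ c : Fin r → ℝ,
      HasDerivAt (fun t : ℝ => φ (NormedSpace.exp (t • ∑ i, c i • X i)) p q) (L c) 0 := by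
  have h1 := hφ.smooth p q 1 H.G.one_mem r X hX
  have h2 := (h1.differentiable (by simp) 0).hasFDerivAt
  refine ⟨fderiv ℝ (fun s : Fin r → ℝ => φ (1 * NormedSpace.exp (∑ i, s i • X i)) p q) 0,
    fun c => ?_⟩
  have h3 : HasDerivAt (fun t : ℝ => t • c) c 0 := by
    simpa using (hasDerivAt_id (0 : ℝ)).smul_const c
  have h4 := HasFDerivAt.comp_hasDerivAt (𝕜 := ℝ) (0 : ℝ) (f := fun t : ℝ => t • c)
    (by rw [zero_smul]; exact h2) h3
  refine h4.congr_of_eventuallyEq (.of_forall fun t => ?_)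
  simp [Finset.smul_sum, mul_smul]

lemma IsAut.hasDerivAt {X : Mat 𝕜 n k} (hX : X ∈ H.lie) :
    HasDerivAt (fun t : ℝ => φ (NormedSpace.exp (t • X))) (autLie φ X) 0 := by
  open scoped Matrix.Norms.Operator in
  refine DifferentiableAt.hasDerivAt (differentiableAt_of_entries fun p q => ?_)
  obtain ⟨L, hL⟩ := hφ.hasFDerivAt (fun _ : Fin 1 => X) (fun _ => hX) p q
  have := (hL 1).differentiableAt
  simpa using this

lemma IsAut.autLie_sum {r : ℕ} (X : Fin r → Mat 𝕜 n k) (hX : ∀ i, X i ∈ H.lie) (c : Fin r → ℝ) :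
    autLie φ (∑ i, c i • X i) = ∑ i, c i • autLie φ (X i) := by
  ext p q
  obtain ⟨L, hL⟩ := hφ.hasFDerivAt X hX p q
  have h1 : ∀ c : Fin r → ℝ, autLie φ (∑ i, c i • X i) p q = L c := fun c =>
    (hasDerivAt_entry (hφ.hasDerivAt (H.lie.toSubmodule.sum_mem fun i _ =>
      H.lie.toSubmodule.smul_mem (c i) (hX i))) p q).unique (hL c)
  have h2 : ∀ i, autLie φ (X i) p q = L (Pi.single i 1) := fun i => by
    rw [← h1]
    congr 2
    simp [Pi.single_apply]
  rw [h1, Matrix.sum_apply]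
  simp only [Matrix.smul_apply, h2, ← map_smul, ← map_sum]
  congr 1
  ext i
  simp [Pi.single_apply]

/-- The differential of an automorphism, as a linear map. -/
def IsAut.lieMap : H.lie →ₗ[ℝ] Mat 𝕜 n k where
  toFun X := autLie φ X
  map_add' X Y := by
    have := hφ.autLie_sum ![(X : Mat 𝕜 n k), Y] (by simp [Fin.forall_fin_two]) ![1, 1]
    simpa [Fin.sum_univ_two] using this
  map_smul' r X := by
    have := hφ.autLie_sum ![(X : Mat 𝕜 n k)] (by simp) ![r]
    simpa using this

include hR

lemma IsAut.map_one : φ 1 = 1 := by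
  have h1 := hφ.mul 1 H.G.one_mem 1 H.G.one_mem
  rw [mul_one] at h1
  have h2 := hR.star_mul_self _ (hφ.bij.mapsTo H.G.one_mem)
  calc φ 1 = star (φ 1) * φ 1 * φ 1 := by rw [h2, one_mul]
    _ = star (φ 1) * φ 1 := by rw [mul_assoc, ← h1]
    _ = 1 := h2

lemma IsAut.map_exp {X : Mat 𝕜 n k} (hX : X ∈ H.lie) (t : ℝ) :
    φ (NormedSpace.exp (t • X)) = NormedSpace.exp (t • autLie φ X) := by
  have hmem : ∀ t : ℝ, NormedSpace.exp (t • X) ∈ H.G := fun t =>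
    hR.exp_mem _ (H.lie.toSubmodule.smul_mem t hX)
  refine eq_exp_of_hom (γ := fun t => φ (NormedSpace.exp (t • X))) ?_ (fun s t => ?_)
    (hφ.hasDerivAt hX) t
  · simp only [zero_smul, NormedSpace.exp_zero, hφ.map_one hR]
  · simp only [exp_add_smul, hφ.mul _ (hmem s) _ (hmem t)]

lemma IsAut.autLie_mem {X : Mat 𝕜 n k} (hX : X ∈ H.lie) : autLie φ X ∈ H.lie :=
  hR.tangent _ fun t => by
    rw [← hφ.map_exp hR hX]
    exact hφ.bij.mapsTo (hR.exp_mem _ (H.lie.toSubmodule.smul_mem t hX))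

lemma IsAut.autLie_conj {c X : Mat 𝕜 n k} (hc : c ∈ H.G) (hX : X ∈ H.lie) :
    autLie φ (c * X * star c) = φ c * autLie φ X * star (φ c) := by
  have h1 := hR.star_mul_self c hc
  have h2 := hR.mul_star_self hc
  have hs : φ (star c) = star (φ c) := by
    refine (left_inv_eq_right_inv (hR.star_mul_self _ (hφ.bij.mapsTo hc)) ?_).symm
    rw [← hφ.mul _ hc _ (hR.star_mem c hc), h2, hφ.map_one hR]
  have h3 := hasDerivAt_mul_const (hφ.hasDerivAt hX) (φ c) (star (φ c))
  refine hasDerivAt_unique (hφ.hasDerivAt (hR.conj_lie c h1 h2 X hX)) h3 fun t => ?_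
  have hm := hR.exp_mem _ (H.lie.toSubmodule.smul_mem t hX)
  have e : t • (c * X * star c) = c * (t • X) * star c := by
    rw [mul_smul_comm, smul_mul_assoc]
  change φ (NormedSpace.exp (t • (c * X * star c))) = _
  rw [e, exp_conj_of_mul_eq_one h2 h1, hφ.mul _ (H.G.mul_mem hc hm) _ (hR.star_mem c hc),
    hφ.mul _ hc _ hm, hs]

/-- Differentiating φ'(Ad(exp tX) Y) = Ad(φ(exp tX)) φ'(Y) at t = 0. The extension `L` of the
differential to all matrices lets the derivative pass through it. -/
lemma IsAut.autLie_comm {X Y : Mat 𝕜 n k} (hX : X ∈ H.lie) (hY : Y ∈ H.lie) :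
    autLie φ (comm X Y) = comm (autLie φ X) (autLie φ Y) := by
  obtain ⟨L, hL⟩ := LinearMap.exists_extend (p := H.lie.toSubmodule) hφ.lieMap
  have hL' : ∀ Z (hZ : Z ∈ H.lie), L Z = autLie φ Z := fun Z hZ => LinearMap.congr_fun hL ⟨Z, hZ⟩
  have hst : ∀ Z (hZ : Z ∈ H.lie) (t : ℝ), star (NormedSpace.exp (t • Z)) =
      NormedSpace.exp (t • -Z) := fun Z hZ t => by
    rw [star_exp_of_mem hR.toIsUnitaryGroup (H.lie.toSubmodule.smul_mem t hZ), smul_neg]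
  have hXY : comm X Y ∈ H.lie := H.lie.lie_mem hX hY
  rw [← hL' _ hXY]
  refine hasDerivAt_unique (hasDerivAt_linearMap L (hasDerivAt_exp_conj X Y))
    (hasDerivAt_exp_conj (autLie φ X) (autLie φ Y)) fun t => ?_
  have hm := hR.exp_mem _ (H.lie.toSubmodule.smul_mem t hX)
  rw [← hst X hX, hL' _ (hR.conj_lie _ (hR.star_mul_self _ hm) (hR.mul_star_self hm) Y hY),
    hφ.autLie_conj hR hm hY, hφ.map_exp hR hX, hst _ (hφ.autLie_mem hR hX)]

lemma IsAut.autLie_eq_zero {X : Mat 𝕜 n k} (hX : X ∈ H.lie) (h : autLie φ X = 0) : X = 0 := by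
  refine hasDerivAt_unique (hasDerivAt_exp_smul X) (hasDerivAt_one 0) fun t => ?_
  refine hφ.bij.injOn (hR.exp_mem _ (H.lie.toSubmodule.smul_mem t hX)) H.G.one_mem ?_
  rw [hφ.map_exp hR hX, h, smul_zero, NormedSpace.exp_zero, hφ.map_one hR]

/-- The differential of an automorphism, as an automorphism of the Lie algebra. -/
lemma IsAut.exists_lieEquiv : ∃ e : H.lie ≃ₗ⁅ℝ⁆ H.lie, ∀ X, (e X : Mat 𝕜 n k) = autLie φ X := by
  have : FiniteDimensional ℝ H.lie :=
    inferInstanceAs (FiniteDimensional ℝ H.lie.toSubmodule)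
  let f : H.lie →ₗ⁅ℝ⁆ H.lie :=
    { hφ.lieMap.codRestrict H.lie.toSubmodule fun X => hφ.autLie_mem hR X.2 with
      map_lie' := fun {X Y} => Subtype.ext (hφ.autLie_comm hR X.2 Y.2) }
  have hinj : Function.Injective f := by
    refine (injective_iff_map_eq_zero f).mpr fun X hX => Subtype.ext ?_
    exact hφ.autLie_eq_zero hR X.2 (congrArg Subtype.val hX)
  have hsurj : Function.Surjective f :=
    LinearMap.injective_iff_surjective (f := (f : H.lie →ₗ[ℝ] H.lie)).mp hinj
  exact ⟨LieEquiv.ofBijective f ⟨hinj, hsurj⟩, fun X => rfl⟩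

lemma IsAut.isBlockDiag_autLie {X : Mat 𝕜 n k} (hX : X ∈ H.lie) :
    IsBlockDiag (autLie φ X) ↔ IsBlockDiag X := by
  have hm : ∀ t : ℝ, NormedSpace.exp (t • X) ∈ H.G := fun t =>
    hR.exp_mem _ (H.lie.toSubmodule.smul_mem t hX)
  have hs : ∀ {Y : Mat 𝕜 n k}, IsBlockDiag Y → ∀ t : ℝ, IsBlockDiag (t • Y) := fun hY t p q hpq => by
    rw [Matrix.smul_apply, hY p q hpq, smul_zero]
  refine ⟨fun h => isBlockDiag_deriv (hasDerivAt_exp_smul X) (.of_forall fun t => ?_),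
    fun h => isBlockDiag_deriv (hφ.hasDerivAt hX) (.of_forall fun t => ?_)⟩
  · rw [← hφ.isotropy _ (hm t), hφ.map_exp hR hX]
    exact (hs h t).exp
  · rw [hφ.isotropy _ (hm t)]
    exact (hs h t).exp

/-- The standard metric is invariant under the automorphisms. -/
lemma IsAut.stdMetric_autDiff (v w : offDiag 𝕜 n k) :
    stdMetric H (autDiff φ v) (autDiff φ w) = stdMetric H v w := by
  obtain ⟨e, he⟩ := hφ.exists_lieEquiv hR
  set ι : offDiag 𝕜 n k → H.lie := fun v => Submodule.inclusion H.offDiag_le v with hι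
  have hdec : ∀ v : offDiag 𝕜 n k, ∃ Y : H.lie, IsBlockDiag (Y : Mat 𝕜 n k) ∧
      e (ι v) = ι (autDiff φ v) + Y := fun v => by
    refine ⟨e (ι v) - ι (autDiff φ v), fun p q hpq => ?_, by abel⟩
    have h1 : ((e (ι v) - ι (autDiff φ v) : H.lie) : Mat 𝕜 n k) =
        (e (ι v) : Mat 𝕜 n k) - projP (e (ι v) : Mat 𝕜 n k) := by
      conv_rhs => arg 2; rw [he]
      rfl
    rw [h1, Matrix.sub_apply, projP_apply_of_skew (hR.lie_skew _ (e (ι v)).2), if_neg hpq, sub_self]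
  have horth : ∀ v : offDiag 𝕜 n k, ∀ Z : H.lie, IsBlockDiag (Z : Mat 𝕜 n k) →
      killingForm ℝ H.lie Z (e (ι v)) = 0 := fun v Z hZ => by
    obtain ⟨X, rfl⟩ : ∃ X, e X = Z := e.surjective Z
    rw [LieAlgebra.killingForm_of_equiv_apply]
    refine killingForm_blockDiag hR ?_ v
    rwa [he, hφ.isBlockDiag_autLie hR X.2] at hZ
  obtain ⟨Y, hY, hvY⟩ := hdec v
  obtain ⟨Z, hZ, hwZ⟩ := hdec w
  -- `autDiff` drops the 𝔨-component Y of the image of v. The automorphism preserves 𝔨, so that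
  -- image is orthogonal to 𝔨, whence Y is a null vector; by semidefiniteness it is orthogonal to
  -- everything and dropping it changes nothing.
  have hY0 : ∀ X, killingForm ℝ H.lie Y X = 0 := by
    refine killingForm_eq_zero hR ?_
    have h1 := horth v Y hY
    rwa [hvY, map_add, killingForm_blockDiag hR hY, zero_add] at h1
  have hZ0 : ∀ X, killingForm ℝ H.lie Z X = 0 := by
    refine killingForm_eq_zero hR ?_
    have h1 := horth w Z hZ
    rwa [hwZ, map_add, killingForm_blockDiag hR hZ, zero_add] at h1
  have h2 := LieAlgebra.killingForm_of_equiv_apply (R := ℝ) e (ι v) (ι w)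
  rw [stdMetric_apply, stdMetric_apply]
  change -killingForm ℝ H.lie (ι (autDiff φ v)) (ι (autDiff φ w)) = -killingForm ℝ H.lie (ι v) (ι w)
  rw [← h2, hvY, hwZ, map_add (killingForm ℝ H.lie), LinearMap.add_apply, hY0, add_zero, map_add,
    LieModule.traceForm_comm ℝ H.lie H.lie _ Z, hZ0, add_zero]

end

include hR

lemma eq_of_mem_autOrbit {g : Form 𝕜 n k} (hg : g ∈ autOrbit H (stdMetric H)) : g = stdMetric H := by
  obtain ⟨φ, hφ, h⟩ := hg
  ext v w
  rw [h, hφ.stdMetric_autDiff hR]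

omit hR in
lemma isAut_id : IsAut H id where
  bij := Set.bijOn_id _
  mul _ _ _ _ := rfl
  smooth p q a _ r X _ := by
    have : CompleteSpace (Mat 𝕜 n k) := FiniteDimensional.complete ℝ _
    open scoped Matrix.Norms.Operator in
    have h1 : ContDiff ℝ ∞ fun s : Fin r → ℝ => a * NormedSpace.exp (∑ i, s i • X i) := by
      have h2 : ContDiff ℝ ∞ (NormedSpace.exp : Mat 𝕜 n k → Mat 𝕜 n k) :=
        contDiff_exp.of_le (by exact_mod_cast le_top)
      refine contDiff_const.mul (h2.comp ?_)
      fun_prop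
    open scoped Matrix.Norms.Operator in
    exact (LinearMap.toContinuousLinearMap (entryL 𝕜 n k p q)).contDiff.comp h1
  isotropy _ _ := Iff.rfl

omit hR in
lemma mem_autOrbit_self (g : Form 𝕜 n k) : g ∈ autOrbit H g := by
  refine ⟨id, isAut_id, fun v w => ?_⟩
  have h : ∀ v : offDiag 𝕜 n k, autDiff id v = v := fun v => by
    have : autDiff id v = projP (v : Mat 𝕜 n k) :=
      congrArg projP (deriv_exp_smul (v : Mat 𝕜 n k))
    rw [this, projP_coe]
  rw [h, h]

/-- The orbit of the standard metric is a single point, so every curve in it is constant. -/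
lemma trivialVariations_std : ∀ S ∈ trivialVariations H (stdMetric H), S = 0 := by
  intro S hS
  have : trivialVariations H (stdMetric H) ≤ ⊥ := by
    refine Submodule.span_le.mpr ?_
    rintro T ⟨γ, h1, -, h3⟩
    have h4 : T = 0 := by
      ext v w
      rw [(h3 v w).2]
      simp only [fun t => eq_of_mem_autOrbit hR (h1 t)]
      simp
    exact h4
  exact this hS

/-- The structure of the invariant tensors on a homogeneous space with sufficiently many monomial
matrices. -/
theorem exists_isDiagonal (hn : 3 ≤ n) (hk : 1 ≤ k) : ∃ c, IsDiagonal H c := by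
  obtain ⟨c, hc, h⟩ := exists_std hR hn hk
  exact ⟨c, hc, h, isInvTensor_iff hR hn hk, trivialVariations_std hR, mem_autOrbit_self _⟩

end Automorphism

/-! ### Real numbers, complex numbers and quaternions -/

section Instances

instance : Scalars ℝ where
  δ := 1
  re := LinearMap.id
  unit _ := 1
  re_mul_comm a b := mul_comm a b
  re_star _ := rfl
  add_star a := by simp [two_mul]
  unit_mul_star _ := by simp
  re_unit i j := by simp [Subsingleton.elim i j]
  sum_re a := by simp
  sum_unit a := by norm_num

instance : Scalars ℂ where
  δ := 2
  re := Complex.reLm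
  unit := ![1, Complex.I]
  re_mul_comm a b := by rw [mul_comm]
  re_star _ := by simp
  add_star a := by
    apply Complex.ext <;> simp [two_mul]
  unit_mul_star i := by fin_cases i <;> simp
  re_unit i j := by fin_cases i <;> fin_cases j <;> simp
  sum_re a := by apply Complex.ext <;> simp [Fin.sum_univ_two]
  sum_unit a := by apply Complex.ext <;> simp [Fin.sum_univ_two]

/-- The real part of a quaternion, as a linear map. -/
def quatRe : Quaternion ℝ →ₗ[ℝ] ℝ where
  toFun a := a.re
  map_add' _ _ := rfl
  map_smul' _ _ := rfl

lemma quatRe_apply (a : Quaternion ℝ) : quatRe a = a.re := rfl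

/-- The quaternions `1, i, j, k`. -/
def quatUnit (i : Fin 4) : Quaternion ℝ :=
  ⟨if i = 0 then 1 else 0, if i = 1 then 1 else 0, if i = 2 then 1 else 0, if i = 3 then 1 else 0⟩

lemma re_quatUnit (i : Fin 4) : (quatUnit i).re = if i = 0 then 1 else 0 := rfl

lemma imI_quatUnit (i : Fin 4) : (quatUnit i).imI = if i = 1 then 1 else 0 := rfl

lemma imJ_quatUnit (i : Fin 4) : (quatUnit i).imJ = if i = 2 then 1 else 0 := rfl

lemma imK_quatUnit (i : Fin 4) : (quatUnit i).imK = if i = 3 then 1 else 0 := rfl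

instance : Scalars (Quaternion ℝ) where
  δ := 4
  re := quatRe
  unit := quatUnit
  re_mul_comm a b := by
    rw [quatRe_apply, quatRe_apply, Quaternion.re_mul, Quaternion.re_mul]
    ring
  re_star a := Quaternion.re_star a
  add_star a := by
    rw [quatRe_apply]
    exact Quaternion.self_add_star' a
  unit_mul_star i := by
    fin_cases i <;> apply Quaternion.ext <;>
      simp [re_quatUnit, imI_quatUnit, imJ_quatUnit, imK_quatUnit] <;> rfl
  re_unit i j := by
    rw [quatRe_apply, Quaternion.re_mul]
    fin_cases i <;> fin_cases j <;>
      simp [re_quatUnit, imI_quatUnit, imJ_quatUnit, imK_quatUnit]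
  sum_re a := by
    simp only [quatRe_apply, Quaternion.re_mul, Fin.sum_univ_four]
    apply Quaternion.ext <;> simp [re_quatUnit, imI_quatUnit, imJ_quatUnit, imK_quatUnit]
  sum_unit a := by
    simp only [Fin.sum_univ_four]
    apply Quaternion.ext <;> simp [re_quatUnit, imI_quatUnit, imJ_quatUnit, imK_quatUnit] <;> ring

end Instances

/-! ### Unitary matrices and exponentials -/

section Unitary

variable {𝕜 : Type*} [NormedDivisionRing 𝕜] [NormedAlgebra ℝ 𝕜] [FiniteDimensional ℝ 𝕜]
  [StarRing 𝕜] [StarModule ℝ 𝕜] [Scalars 𝕜] {n k : ℕ}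

lemma star_mul_monomial (σ : Equiv.Perm (Fin n × Fin k)) {ε : Fin n × Fin k → 𝕜}
    (hε : ∀ p, star (ε p) * ε p = 1) : star (monomial σ ε) * monomial σ ε = 1 := by
  ext p q
  rw [Matrix.mul_apply, Finset.sum_eq_single (σ.symm p)]
  · by_cases h : p = q
    · subst h
      simp [monomial, Matrix.star_apply, hε]
    · simp [monomial, Matrix.star_apply, Matrix.one_apply_ne h, Ne.symm h]
  · intro r _ hr
    have : p ≠ σ r := fun e => hr (by rw [e, Equiv.symm_apply_apply])
    simp [monomial, Matrix.star_apply, this]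
  · simp

lemma monomial_mem_unitary (σ : Equiv.Perm (Fin n × Fin k)) {ε : Fin n × Fin k → 𝕜}
    (hε : ∀ p, ε p * star (ε p) = 1) : monomial σ ε ∈ unitary (Mat 𝕜 n k) :=
  ⟨star_mul_monomial σ fun p => by
    rw [eq_inv_of_mul_eq_one_right (hε p), inv_mul_cancel₀ (left_ne_zero_of_mul_eq_one (hε p))],
    monomial_mul_star σ hε⟩

lemma phase_mul_star {p q : Fin n × Fin k} {w : 𝕜} (hw : w * star w = 1) (r : Fin n × Fin k) :
    phase p q w r * star (phase p q w r) = 1 := by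
  by_cases hq : r = q
  · subst hq
    rw [phase_right, star_star, eq_inv_of_mul_eq_one_right hw,
      inv_mul_cancel₀ (left_ne_zero_of_mul_eq_one hw)]
  by_cases hp : r = p
  · subst hp
    rw [phase_left hq, hw]
  rw [phase_other hp hq, star_one, mul_one]

lemma signAt_mul_star (p r : Fin n × Fin k) : signAt 𝕜 p r * star (signAt 𝕜 p r) = 1 := by
  by_cases hp : r = p
  · subst hp; simp [signAt]
  · simp [signAt, Function.update_of_ne hp]

lemma star_conj_skew {X : Mat 𝕜 n k} (hX : star X = -X) (c : Mat 𝕜 n k) :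
    star (c * X * star c) = -(c * X * star c) := by
  rw [star_mul, star_mul, star_star, hX]
  noncomm_ring

variable [ContinuousStar 𝕜]

lemma star_exp (X : Mat 𝕜 n k) : star (NormedSpace.exp X) = NormedSpace.exp (star X) :=
  (Matrix.exp_conjTranspose X).symm

lemma exp_mem_unitary {X : Mat 𝕜 n k} (hX : star X = -X) :
    NormedSpace.exp X ∈ unitary (Mat 𝕜 n k) := by
  have h1 := exp_smul_neg_mul X 1
  have h2 := exp_smul_neg_mul (-X) 1
  rw [one_smul, one_smul] at h1
  rw [one_smul, one_smul, neg_neg] at h2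
  exact ⟨by rw [star_exp, hX, h1], by rw [star_exp, hX, h2]⟩

open scoped Matrix.Norms.Operator in
lemma skew_of_exp_mem_unitary {Y : Mat 𝕜 n k}
    (h : ∀ t : ℝ, NormedSpace.exp (t • Y) ∈ unitary (Mat 𝕜 n k)) : star Y = -Y := by
  have h1 := (hasDerivAt_exp_smul (star Y)).mul (hasDerivAt_exp_smul Y)
  simp only [zero_smul, NormedSpace.exp_zero, one_mul, mul_one] at h1
  refine eq_neg_of_add_eq_zero_left (hasDerivAt_unique h1 (hasDerivAt_one 0) fun t => ?_)
  have h2 := (h t).1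
  rw [star_exp, star_smul, star_trivial] at h2
  exact h2

end Unitary

/-! ### Determinants of monomial matrices and of exponentials -/

section Determinant

variable {R : Type*} [NormedField R] {n k : ℕ}

lemma det_monomial (σ : Equiv.Perm (Fin n × Fin k)) (ε : Fin n × Fin k → R) :
    (monomial σ ε).det = (∏ p, ε p) * (Equiv.Perm.sign σ : ℤ) := by
  have h : monomial σ ε = Matrix.diagonal ε * σ.permMatrix R := by
    ext p q
    rw [Matrix.diagonal_mul]
    simp [monomial, Equiv.Perm.permMatrix, PEquiv.toMatrix_apply, eq_comm]
  rw [h, Matrix.det_mul, Matrix.det_diagonal, Matrix.det_permutation]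

/-- The entry -1 compensates the sign of the transposition, so these matrices are available in the
special groups too. -/
lemma det_swap_signAt {p q : Fin n × Fin k} (h : p ≠ q) :
    (monomial (Equiv.swap p q) (signAt R p)).det = 1 := by
  rw [det_monomial, Equiv.Perm.sign_swap h, signAt, Finset.prod_update_of_mem (Finset.mem_univ p)]
  simp

lemma det_phase [StarRing R] {p q : Fin n × Fin k} (h : p ≠ q) {w : R} (hw : w * star w = 1) :
    (monomial (Equiv.refl _) (phase p q w)).det = 1 := by
  rw [det_monomial, phase, Finset.prod_update_of_mem (Finset.mem_univ q),
    Finset.prod_update_of_mem (by simpa using h)]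
  simp [mul_comm, hw]

/-- The determinant of the exponential of a skew-Hermitian matrix. -/
lemma det_exp_of_skew {X : Mat ℂ n k} (hX : star X = -X) :
    (NormedSpace.exp X).det = Complex.exp X.trace := by
  have hA : ((-Complex.I) • X).IsHermitian := by
    rw [Matrix.IsHermitian, Matrix.conjTranspose_smul]
    have : X.conjTranspose = -X := hX
    rw [this]
    simp
  set A := (-Complex.I) • X with hAdef
  set U : Mat ℂ n k := hA.eigenvectorUnitary.1
  have hU1 : U * star U = 1 := Unitary.coe_mul_star_self _
  have hU2 : star U * U = 1 := Unitary.coe_star_mul_self _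
  set d : Fin n × Fin k → ℂ := fun p => Complex.I * hA.eigenvalues p with hd
  have hXd : X = U * Matrix.diagonal d * star U := by
    have h1 := hA.spectral_theorem
    rw [Unitary.conjStarAlgAut_apply] at h1
    have h2 : X = Complex.I • A := by rw [hAdef, smul_smul]; simp
    have h3 : Matrix.diagonal d =
        Complex.I • Matrix.diagonal (RCLike.ofReal ∘ hA.eigenvalues : Fin n × Fin k → ℂ) := by
      rw [← Matrix.diagonal_smul]
      rfl
    rw [h2, h3, mul_smul_comm, smul_mul_assoc]
    congr 1
  have hdet : ∀ B : Mat ℂ n k, (U * B * star U).det = B.det := fun B => by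
    rw [Matrix.det_mul_right_comm, hU1, one_mul]
  have htr : ∀ B : Mat ℂ n k, (U * B * star U).trace = B.trace := fun B => by
    rw [Matrix.trace_mul_comm, ← mul_assoc, hU2, one_mul]
  rw [hXd, exp_conj_of_mul_eq_one hU1 hU2, hdet, htr, Matrix.exp_diagonal, Matrix.det_diagonal,
    Matrix.trace_diagonal, Complex.exp_sum]
  refine Finset.prod_congr rfl fun p _ => ?_
  rw [Pi.coe_exp, Complex.exp_eq_exp_ℂ]

end Determinant

/-! ### The three families of spaces -/

section Spaces

variable {n k : ℕ}

lemma isRich_spSpace : IsRich (spSpace n k) where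
  star_mul_self _ ha := ha.1
  star_mem _ ha := Unitary.star_mem ha
  exp_mem _ hX := exp_mem_unitary hX
  lie_skew _ hX := hX
  conj_lie c _ _ _ hX := star_conj_skew hX c
  tangent _ h := skew_of_exp_mem_unitary h
  phase_mem _ _ _ _ hw := monomial_mem_unitary _ (phase_mul_star hw)
  swap_mem p q _ := monomial_mem_unitary _ (signAt_mul_star p)
  size := Or.inl (by decide)

lemma det_star_of_mem {R : Type*} [CommRing R] [StarRing R] {N : Type*} [Fintype N] [DecidableEq N]
    {a : Matrix N N R} (h : a.det = 1) : (star a).det = 1 := by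
  rw [Matrix.star_eq_conjTranspose, Matrix.det_conjTranspose, h, star_one]

open scoped Matrix.Norms.Operator in
lemma trace_eq_zero_of_det_exp {Y : Mat ℂ n k} (hY : star Y = -Y)
    (h : ∀ t : ℝ, (NormedSpace.exp (t • Y)).det = 1) : Y.trace = 0 := by
  have h1 : HasDerivAt (fun t : ℝ => Complex.exp ((t : ℂ) * Y.trace)) Y.trace 0 := by
    have := (((hasDerivAt_id (0 : ℝ)).ofReal_comp).mul_const Y.trace).cexp
    simpa using this
  refine h1.unique ((hasDerivAt_const (0 : ℝ) (1 : ℂ)).congr_of_eventuallyEq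
    (.of_forall fun t => ?_))
  have h2 := det_exp_of_skew ((skewLie ℂ n k).smul_mem t hY)
  rw [h, Matrix.trace_smul] at h2
  simpa using h2.symm

lemma isRich_suSpace : IsRich (suSpace n k) where
  star_mul_self _ ha := ha.1.1
  star_mem _ ha := ⟨Unitary.star_mem ha.1, det_star_of_mem ha.2⟩
  exp_mem X hX := ⟨exp_mem_unitary hX.1, by
    have h : X.trace = 0 := hX.2
    exact (det_exp_of_skew hX.1).trans (by rw [h, Complex.exp_zero])⟩
  lie_skew _ hX := hX.1
  conj_lie c h1 _ X hX := ⟨star_conj_skew hX.1 c, by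
    have h : X.trace = 0 := hX.2
    rw [Matrix.trace_mul_comm, ← mul_assoc, h1, one_mul, h]⟩
  tangent Y h := by
    have h1 : star Y = -Y := skew_of_exp_mem_unitary fun t => (h t).1
    exact ⟨h1, trace_eq_zero_of_det_exp h1 fun t => (h t).2⟩
  phase_mem _ _ h _ hw := ⟨monomial_mem_unitary _ (phase_mul_star hw), det_phase h hw⟩
  swap_mem p q h := ⟨monomial_mem_unitary _ (signAt_mul_star p), det_swap_signAt h⟩
  size := Or.inl (by decide)

/-- The exponential of X is the square of an orthogonal matrix, so its determinant is the square of
±1. -/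
lemma det_exp_of_skew_real {X : Mat ℝ n k} (hX : star X = -X) : (NormedSpace.exp X).det = 1 := by
  have h1 : NormedSpace.exp X = NormedSpace.exp ((1 / 2 : ℝ) • X) * NormedSpace.exp ((1 / 2 : ℝ) • X) := by
    rw [← exp_add_smul]
    norm_num
  have h2 := (exp_mem_unitary ((skewLie ℝ n k).smul_mem (1 / 2 : ℝ) hX)).1
  have h3 := congrArg Matrix.det h2
  rw [Matrix.det_mul, Matrix.star_eq_conjTranspose, Matrix.det_conjTranspose, Matrix.det_one,
    star_trivial] at h3
  rw [h1, Matrix.det_mul, h3]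

lemma isRich_soSpace (h : 5 ≤ n * k) : IsRich (soSpace n k) where
  star_mul_self _ ha := ha.1.1
  star_mem _ ha := ⟨Unitary.star_mem ha.1, det_star_of_mem ha.2⟩
  exp_mem _ hX := ⟨exp_mem_unitary hX, det_exp_of_skew_real hX⟩
  lie_skew _ hX := hX
  conj_lie c _ _ _ hX := star_conj_skew hX c
  tangent _ h := skew_of_exp_mem_unitary fun t => (h t).1
  phase_mem _ _ h _ hw := ⟨monomial_mem_unitary _ (phase_mul_star hw), det_phase h hw⟩
  swap_mem p _ h := ⟨monomial_mem_unitary _ (signAt_mul_star p), det_swap_signAt h⟩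
  size := Or.inr h

end Spaces

/-! ### From the signs of the eigenvalues to the type of the metric -/

section Summary

variable {𝕜 : Type*} [NormedDivisionRing 𝕜] [NormedAlgebra ℝ 𝕜] [FiniteDimensional ℝ 𝕜]
  [StarRing 𝕜] [StarModule ℝ 𝕜] [Scalars 𝕜] {n k : ℕ} {H : Space 𝕜 n k} (hR : IsRich H)
  (hn : 3 ≤ n) (hk : 1 ≤ k) (h1 : 0 < eig₁ 𝕜 n k)

include hR hn hk h1

lemma stdUnstable_of_isRich : StdUnstable H := by
  obtain ⟨c, hH⟩ := exists_isDiagonal hR hn hk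
  exact ⟨isInvMetric_std hH, isEinstein_std hH, isGUnstable_std hH hn hk h1,
    isDynamicallyUnstable_std hH hR.toIsUnitaryGroup hn hk h1⟩

lemma stdLocMin_of_eq_three (hn3 : n = 3) : StdLocMin H 2 := by
  obtain ⟨c, hH⟩ := exists_isDiagonal hR hn hk
  have hc := hasCoindex_of_eig₂_nonpos hH hn hk h1 (Or.inl hn3)
  rw [show n - 1 = 2 by omega] at hc
  exact ⟨isLocMin_std hH hn hk h1 (Or.inl hn3), hc,
    isGNondegenerate_std hH hn hk h1 (Or.inl hn3), isGRigid_std hH hn hk h1 (Or.inl hn3)⟩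

lemma stdLocMin_of_eig₂_pos (h2 : 0 < eig₂ 𝕜 n k) {d : ℕ} (hd : d + 1 = Fintype.card (Pairs n)) :
    StdLocMin H d := by
  obtain ⟨c, hH⟩ := exists_isDiagonal hR hn hk
  exact ⟨isLocMin_std hH hn hk h1 (Or.inr h2), hasCoindex_of_hessPos hH hn hk h1 (Or.inr h2) hd,
    isGNondegenerate_std hH hn hk h1 (Or.inr h2.ne'), isGRigid_std hH hn hk h1 (Or.inr h2.ne')⟩

lemma stdSaddle_of_eig₂_neg (hn4 : 4 ≤ n) (h2 : eig₂ 𝕜 n k < 0) : StdSaddle H (n - 1) := by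
  obtain ⟨c, hH⟩ := exists_isDiagonal hR hn hk
  exact ⟨isSaddle_std hH hn hk hn4 h1 h2, hasCoindex_of_eig₂_nonpos hH hn hk h1 (Or.inr h2.le),
    isGNondegenerate_std hH hn hk h1 (Or.inr h2.ne), isGRigid_std hH hn hk h1 (Or.inr h2.ne)⟩

lemma stdDegenerate_of_eig₂_eq_zero (hn4 : 4 ≤ n) (h2 : eig₂ 𝕜 n k = 0) :
    StdDegenerate H (n - 1) := by
  obtain ⟨c, hH⟩ := exists_isDiagonal hR hn hk
  exact ⟨not_isGNondegenerate_std hH hn hk hn4 h2,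
    hasCoindex_of_eig₂_nonpos hH hn hk h1 (Or.inr h2.le)⟩

end Summary

/-! ### The two Hessian eigenvalues for each family -/

section Eigenvalues

variable {n k : ℕ}

lemma eig₁_complex : eig₁ ℂ n k = 2 * k := by
  have : (δ ℂ : ℝ) = 2 := by norm_num [δ]
  rw [eig₁, scalConst, this]; ring

lemma eig₂_complex : eig₂ ℂ n k = k * (4 - n) := by
  have : (δ ℂ : ℝ) = 2 := by norm_num [δ]
  rw [eig₂, scalConst, this]; ring

lemma eig₁_quaternion : eig₁ (Quaternion ℝ) n k = 4 * k + 4 := by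
  have : (δ (Quaternion ℝ) : ℝ) = 4 := by norm_num [δ]
  rw [eig₁, scalConst, this]; ring

lemma eig₂_quaternion : eig₂ (Quaternion ℝ) n k = 2 * (2 + k * (4 - n)) := by
  have : (δ (Quaternion ℝ) : ℝ) = 4 := by norm_num [δ]
  rw [eig₂, scalConst, this]; ring

lemma eig₁_real : eig₁ ℝ n k = k - 2 := by
  have : (δ ℝ : ℝ) = 1 := by norm_num [δ]
  rw [eig₁, scalConst, this]; ring

lemma eig₂_real : eig₂ ℝ n k = k * (4 - n) / 2 - 2 := by
  have : (δ ℝ : ℝ) = 1 := by norm_num [δ]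
  rw [eig₂, scalConst, this]; ring

end Eigenvalues

end BlockSpace

end

/-! ### The classification -/

open BlockSpace

theorem proposition6p1 (n k : ℕ) (hn : 3 ≤ n) (hk : 1 ≤ k) :
    (StdUnstable (suSpace n k) ∧
      (n = 3 → StdLocMin (suSpace n k) 2) ∧
      (n = 4 → StdDegenerate (suSpace n k) 3) ∧
      (5 ≤ n → StdSaddle (suSpace n k) (n - 1))) ∧
    (StdUnstable (spSpace n k) ∧
      (n = 3 → StdLocMin (spSpace n k) 2) ∧
      (n = 4 → StdLocMin (spSpace n k) 5) ∧
      (n = 5 → k = 1 → StdLocMin (spSpace n k) 9) ∧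
      (n = 5 → k = 2 → StdDegenerate (spSpace n k) 4) ∧
      (n = 6 → k = 1 → StdDegenerate (spSpace n k) 5) ∧
      (5 ≤ n → (n, k) ≠ (5, 1) → (n, k) ≠ (5, 2) → (n, k) ≠ (6, 1) →
        StdSaddle (spSpace n k) (n - 1))) ∧
    (3 ≤ k → StdUnstable (soSpace n k) ∧
      (n = 3 → StdLocMin (soSpace n k) 2) ∧
      (4 ≤ n → StdSaddle (soSpace n k) (n - 1))) := by
  have hk0 : (1 : ℝ) ≤ k := by exact_mod_cast hk
  have hsu : 0 < eig₁ ℂ n k := by rw [eig₁_complex]; positivity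
  have hsp : 0 < eig₁ (Quaternion ℝ) n k := by rw [eig₁_quaternion]; positivity
  refine ⟨⟨stdUnstable_of_isRich isRich_suSpace hn hk hsu,
    stdLocMin_of_eq_three isRich_suSpace hn hk hsu, ?_, fun h => ?_⟩,
    ⟨stdUnstable_of_isRich isRich_spSpace hn hk hsp,
      stdLocMin_of_eq_three isRich_spSpace hn hk hsp, ?_, ?_, ?_, ?_, fun h h51 h52 h61 => ?_⟩,
    fun hk3 => ?_⟩
  · rintro rfl
    exact stdDegenerate_of_eig₂_eq_zero isRich_suSpace hn hk hsu le_rfl (by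
      rw [eig₂_complex]; norm_num)
  · refine stdSaddle_of_eig₂_neg isRich_suSpace hn hk hsu (by omega) ?_
    have h' : (5 : ℝ) ≤ n := by exact_mod_cast h
    rw [eig₂_complex]
    nlinarith
  · rintro rfl
    -- For n = 4 the second eigenvalue is 4, independently of k. The coindex is then the full
    -- dimension of W_g, one less than the number of pairs.
    exact stdLocMin_of_eig₂_pos isRich_spSpace hn hk hsp (by rw [eig₂_quaternion]; norm_num)
      (by decide)
  · rintro rfl rfl
    exact stdLocMin_of_eig₂_pos isRich_spSpace hn hk hsp (by rw [eig₂_quaternion]; norm_num)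
      (by decide)
  · rintro rfl rfl
    exact stdDegenerate_of_eig₂_eq_zero isRich_spSpace hn hk hsp (by norm_num)
      (by rw [eig₂_quaternion]; norm_num)
  · rintro rfl rfl
    exact stdDegenerate_of_eig₂_eq_zero isRich_spSpace hn hk hsp (by norm_num)
      (by rw [eig₂_quaternion]; norm_num)
  · refine stdSaddle_of_eig₂_neg isRich_spSpace hn hk hsp (by omega) ?_
    rw [eig₂_quaternion]
    -- The second eigenvalue is negative exactly when k(n-4) > 2. For n ≥ 5 the product is at most 2
    -- only for the three excluded pairs (n, k).
    have h3 : 3 ≤ k * (n - 4) := by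
      obtain ⟨m, rfl⟩ := Nat.exists_eq_add_of_le h
      have hm : 5 + m - 4 = m + 1 := by omega
      rw [hm]
      simp only [ne_eq, Prod.mk.injEq, not_and] at h51 h52 h61
      rcases Nat.lt_or_ge k 3 with hk3 | hk3
      · interval_cases k <;> omega
      · nlinarith
    have h4 : (3 : ℝ) ≤ k * (n - 4) := by
      have : ((k * (n - 4) : ℕ) : ℝ) = k * (n - 4) := by
        rw [Nat.cast_mul, Nat.cast_sub (by omega), Nat.cast_ofNat]
      rw [← this]
      exact_mod_cast h3
    linarith
  · have hk3' : (3 : ℝ) ≤ k := by exact_mod_cast hk3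
    have hso : 0 < eig₁ ℝ n k := by rw [eig₁_real]; linarith
    -- The hypothesis k ≥ 3 makes `eig₁` = k - 2 positive; together with n ≥ 3 it also supplies the
    -- fifth index needed over ℝ.
    have hR : IsRich (soSpace n k) := isRich_soSpace (by nlinarith)
    refine ⟨stdUnstable_of_isRich hR hn hk hso, stdLocMin_of_eq_three hR hn hk hso, fun h => ?_⟩
    refine stdSaddle_of_eig₂_neg hR hn hk hso h ?_
    have h' : (4 : ℝ) ≤ n := by exact_mod_cast h
    rw [eig₂_real]
    nlinarith
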